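/- Let $b$ be a non-degenerate symmetric complex bilinear form on $\mathbb C^n=\mathbb R^{2n}$, let $\langle\ ,\ \rangle=\operatorname{Im} b$ (a real inner product of signature $(n,n)$), let $G=SO_0(n,n)$ be the identity component of the orthogonal group of $\langle\ ,\ \rangle$, and let $H=SO(n,\mathbb C)$ be the group of complex linear maps of determinant $1$ preserving $b$. Orient $\mathbb R^{2n}$ so that $(z_1,\dots,z_n,iz_1,\dots,iz_n)$ is positive for every complex basis $(z_j)$, and let $IGr^{+}(n,\mathbb R^{(n,n)})$ and $IGr^{-}(n,\mathbb R^{(n,n)})$ be the sets of self-dual, respectively anti-self-dual, $n$-dimensional real subspaces of $\mathbb C^n$ which are isotropic for $\langle\ ,\ \rangle$; self-duality refers to the Hodge star of $\langle\ ,\ \rangle$ on $\Lambda^n\mathbb R^{2n}$. Let $r,s,k\ge 0$ with $n-r-s=2k$, and let $\mathcal O=\mathcal O_{(r,s)}$ be the set of all $n$-dimensional real subspaces $V\subset\mathbb C^n$ which are isotropic for $\langle\ ,\ \rangle$ and for which $\operatorname{Re}(b)|_V$ has signature $(r,s)$. Then $\mathcal O$ is non-empty and contained in $IGr^{\pm}(n,\mathbb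 R^{(n,n)})$ with sign $(-1)^{n-s}$, and it is a single $H$-orbit if $r+s>0$ (for $r=s=0$ all claims below refer to the set $\mathcal O$). Moreover: (1) $IGr^\pm(n,\mathbb R^{(n,n)})$ (with that sign) and $\mathcal O$ are embedded submanifolds of the Grassmannian of $n$-dimensional real subspaces of $\mathbb R^{2n}$, and $\mathcal O$ has codimension $k^2$ in $IGr^\pm(n,\mathbb R^{(n,n)})$. The set $IGr(k,\mathbb C^n)$ of complex $k$-dimensional subspaces of $\mathbb C^n$ which are isotropic for $b$ is an embedded submanifold of the Grassmannian of real $2k$-dimensional subspaces of $\mathbb R^{2n}$, and there is an $H$-equivariant surjective submersion $p:\mathcal O\to IGr(k,\mathbb C^n)$. For each $W\in IGr(k,\mathbb C^n)$ the fibre $p^{-1}(W)$ is an embedded submanifold which is isomorphic to $SO(n-2k,\mathbb C)/SO(r,s)$: there are a diffeomorphism $f:SO(n-2k,\mathbb C)/SO(r,s)\to p^{-1}(W)$ and a surjective homomorphism $\pi$ from the stabilizer $H_W$ of $W$ in $H$ to $SO(n-2k,\mathbb C)$ such that $f(\pi(h)x)=h\cdot f(x)$ for all $h\in H_W$ and all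 $x$. Here $SO(n-2k,\mathbb C)$ is realized as the special orthogonal group of the complex bilinear form $\operatorname{diag}(1,\dots,1,-1,\dots,-1)$ with $r$ entries $1$ and $s$ entries $-1$, and $SO(r,s)$ is its subgroup of real matrices. (2) Let $V_0$ be an $n$-dimensional real subspace of $\mathbb C^n$ and $g\in G$ with $V:=gV_0\in\mathcal O$. Let $P$ be the stabilizer of $V_0$ in $G$, let $H_{\mathcal O}=g^{-1}Hg$, and let $\mathfrak g,\mathfrak p,\mathfrak h_{\mathcal O}$ be the Lie algebras of $G,P,H_{\mathcal O}$. Then there are a surjective homomorphism $\rho:H_{\mathcal O}\cap P\to GL(k,\mathbb C)$ and a real linear isomorphism $\Phi$ from the infinitesimal transversal $(\mathfrak g/\mathfrak p)/(\mathfrak h_{\mathcal O}/(\mathfrak h_{\mathcal O}\cap\mathfrak p))$ onto the space of Hermitian $k\times k$-matrices such that $$\Phi(h\cdot T)=\rho(h)\,\Phi(T)\,\rho(h)^*$$ for all $h\in H_{\mathcal O}\cap P$ and all $T$, where $h$ acts on the transversal by the representation induced by the adjoint action. The homomorphism $\rho$ is natural in the following sense: with $W=V\cap iV$ and $W^{\perp}$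 its orthocomplement for $b$, there is a complex basis of $\mathbb C^n/W^{\perp}$ in which $\rho(h)$ is, for all $h$, the matrix of the map induced by $ghg^{-1}$. -/

import Mathlib

open Set Manifold
open scoped ContDiff Topology Manifold

noncomputable section

namespace SplitGrassmannian

/-! ### Real Grassmannians as smooth manifolds -/

section Grassmannian

/-- The real Grassmannian of `d`-dimensional, `c`-codimensional linear subspaces of `E`. -/
@[ext]
structure Gr (d c : ℕ) (E : Type*) [AddCommGroup E] [Module ℝ E] where
  /-- the underlying subspace -/
  toSubmodule : Submodule ℝ E
  finrank_eq : Module.finrank ℝ toSubmodule = d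
  finrank_quotient_eq : Module.finrank ℝ (E ⧸ toSubmodule) = c

/-- The model space of the charts: linear maps `ℝᵈ → ℝᶜ`. -/
abbrev GrModel (d c : ℕ) : Type := (Fin d → ℝ) →L[ℝ] (Fin c → ℝ)

variable {d c : ℕ} {E : Type*} [AddCommGroup E] [Module ℝ E]

/-- The graph of a linear map `ℝᵈ → ℝᶜ`, moved to `E` by a linear isomorphism. -/
def graphIn (e : ((Fin d → ℝ) × (Fin c → ℝ)) ≃ₗ[ℝ] E) (φ : GrModel d c) : Submodule ℝ E :=
  (LinearMap.graph φ.toLinearMap).map e.toLinearMap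

theorem mem_graphIn (e : ((Fin d → ℝ) × (Fin c → ℝ)) ≃ₗ[ℝ] E) (φ : GrModel d c) (v : E) :
    v ∈ graphIn e φ ↔ ∃ x, e (x, φ x) = v := by
  simp only [graphIn, Submodule.mem_map, LinearMap.mem_graph_iff]
  constructor
  · rintro ⟨⟨x, y⟩, h, rfl⟩
    exact ⟨x, by simpa using congrArg (fun t => e (x, t)) h.symm⟩
  · rintro ⟨x, rfl⟩
    exact ⟨(x, φ x), rfl, rfl⟩

/-- The linear parametrization of the graph by its first component. -/
def graphEquiv (e : ((Fin d → ℝ) × (Fin c → ℝ)) ≃ₗ[ℝ] E) (φ : GrModel d c) :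
    (Fin d → ℝ) ≃ₗ[ℝ] graphIn e φ :=
  LinearEquiv.ofBijective
    (LinearMap.codRestrict (graphIn e φ)
      (e.toLinearMap ∘ₗ (LinearMap.prod LinearMap.id φ.toLinearMap))
      (fun x => (mem_graphIn e φ _).2 ⟨x, rfl⟩))
    ⟨fun x y h => by
        have h' : e (x, φ x) = e (y, φ y) := congrArg Subtype.val h
        exact congrArg Prod.fst (e.injective h'),
      fun ⟨v, hv⟩ => by
        obtain ⟨x, rfl⟩ := (mem_graphIn e φ v).1 hv
        exact ⟨x, rfl⟩⟩

/-- The graph of a linear map as a point of the Grassmannian. -/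
def graphPoint (e : ((Fin d → ℝ) × (Fin c → ℝ)) ≃ₗ[ℝ] E) (φ : GrModel d c) : Gr d c E where
  toSubmodule := graphIn e φ
  finrank_eq := by simpa using (graphEquiv e φ).finrank_eq.symm
  finrank_quotient_eq := by
    have h1 := (graphEquiv e φ).finrank_eq
    have h2 := e.finrank_eq
    have : FiniteDimensional ℝ E := e.finiteDimensional
    have h3 := Submodule.finrank_quotient_add_finrank (graphIn e φ)
    simp at h1 h2
    omega

theorem graphPoint_injective (e : ((Fin d → ℝ) × (Fin c → ℝ)) ≃ₗ[ℝ] E) :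
    Function.Injective (graphPoint e) := by
  intro φ ψ h
  ext1 x
  have hm : e (x, φ x) ∈ graphIn e ψ := by
    have h' : graphIn e φ = graphIn e ψ := congrArg Gr.toSubmodule h
    rw [← h']
    exact (mem_graphIn e φ _).2 ⟨x, rfl⟩
  obtain ⟨y, hy⟩ := (mem_graphIn e ψ _).1 hm
  have := e.injective hy
  simp only [Prod.mk.injEq] at this
  obtain ⟨rfl, h2⟩ := this
  exact h2.symm

/-- The affine chart of the Grassmannian attached to a splitting `e : ℝᵈ × ℝᶜ ≃ E`: its domain
consists of the subspaces complementary to `e ({0} × ℝᶜ)`, and it maps such a subspace to the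
linear map whose graph it is. -/
def graphChart (e : ((Fin d → ℝ) × (Fin c → ℝ)) ≃ₗ[ℝ] E) : PartialEquiv (Gr d c E) (GrModel d c) where
  toFun := Function.invFun (graphPoint e)
  invFun := graphPoint e
  source := range (graphPoint e)
  target := univ
  map_source' := fun _ _ => mem_univ _
  map_target' := fun φ _ => mem_range_self φ
  left_inv' := by
    rintro _ ⟨φ, rfl⟩
    rw [Function.leftInverse_invFun (graphPoint_injective e) φ]
  right_inv' := fun φ _ => Function.leftInverse_invFun (graphPoint_injective e) φ

theorem graphChart_graphPoint (e : ((Fin d → ℝ) × (Fin c → ℝ)) ≃ₗ[ℝ] E) (φ : GrModel d c) :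
    graphChart e (graphPoint e φ) = φ :=
  Function.leftInverse_invFun (graphPoint_injective e) φ

section Transition

variable (T : ((Fin d → ℝ) × (Fin c → ℝ)) →L[ℝ] ((Fin d → ℝ) × (Fin c → ℝ)))

/-- First component of a change of splitting, restricted to a graph. -/
def transFst (φ : GrModel d c) : (Fin d → ℝ) →L[ℝ] (Fin d → ℝ) :=
  (ContinuousLinearMap.fst ℝ _ _ ∘L T) ∘L ((ContinuousLinearMap.id ℝ _).prod φ)

/-- Second component of a change of splitting, restricted to a graph. -/
def transSnd (φ : GrModel d c) : (Fin d → ℝ) →L[ℝ] (Fin c → ℝ) :=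
  (ContinuousLinearMap.snd ℝ _ _ ∘L T) ∘L ((ContinuousLinearMap.id ℝ _).prod φ)

theorem transFst_apply (φ : GrModel d c) (x : Fin d → ℝ) : transFst T φ x = (T (x, φ x)).1 := rfl

theorem transSnd_apply (φ : GrModel d c) (x : Fin d → ℝ) : transSnd T φ x = (T (x, φ x)).2 := rfl

theorem contDiff_idProd : ContDiff ℝ ∞
    (fun φ : GrModel d c => (ContinuousLinearMap.id ℝ (Fin d → ℝ)).prod φ) :=
  ((ContinuousLinearMap.prodₗᵢ ℝ :
    (((Fin d → ℝ) →L[ℝ] (Fin d → ℝ)) × ((Fin d → ℝ) →L[ℝ] (Fin c → ℝ))) ≃ₗᵢ[ℝ] _).contDiff).comp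
      (contDiff_const.prodMk contDiff_id)

theorem contDiff_transFst : ContDiff ℝ ∞ (transFst T) :=
  contDiff_const.clm_comp contDiff_idProd

theorem contDiff_transSnd : ContDiff ℝ ∞ (transSnd T) :=
  contDiff_const.clm_comp contDiff_idProd

end Transition

/-- The change of splitting as a continuous linear map. -/
def transCLM (e e' : ((Fin d → ℝ) × (Fin c → ℝ)) ≃ₗ[ℝ] E) :
    ((Fin d → ℝ) × (Fin c → ℝ)) →L[ℝ] ((Fin d → ℝ) × (Fin c → ℝ)) :=
  LinearMap.toContinuousLinearMap (e.trans e'.symm).toLinearMap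

theorem transCLM_apply (e e' : ((Fin d → ℝ) × (Fin c → ℝ)) ≃ₗ[ℝ] E) (p) :
    transCLM e e' p = e'.symm (e p) := rfl

theorem graphPoint_eq_iff (e e' : ((Fin d → ℝ) × (Fin c → ℝ)) ≃ₗ[ℝ] E) (φ ψ : GrModel d c) :
    graphPoint e φ = graphPoint e' ψ ↔
      ∀ x, transSnd (transCLM e e') φ x = ψ (transFst (transCLM e e') φ x) := by
  constructor
  · intro h x
    have hm : e (x, φ x) ∈ graphIn e' ψ := by
      have h' : graphIn e φ = graphIn e' ψ := congrArg Gr.toSubmodule h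
      rw [← h']
      exact (mem_graphIn e φ _).2 ⟨x, rfl⟩
    obtain ⟨y, hy⟩ := (mem_graphIn e' ψ _).1 hm
    rw [transFst_apply, transSnd_apply, transCLM_apply, ← hy, e'.symm_apply_apply]
  · intro h
    have hle : graphIn e φ ≤ graphIn e' ψ := by
      intro v hv
      obtain ⟨x, rfl⟩ := (mem_graphIn e φ v).1 hv
      refine (mem_graphIn e' ψ _).2 ⟨transFst (transCLM e e') φ x, ?_⟩
      rw [← h x, transFst_apply, transSnd_apply, transCLM_apply]
      simp
    have : FiniteDimensional ℝ E := e.finiteDimensional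
    have heq := Submodule.eq_of_le_of_finrank_eq hle
      ((graphPoint e φ).finrank_eq.trans (graphPoint e' ψ).finrank_eq.symm)
    exact Gr.ext heq

theorem isUnit_transFst_of_eq (e e' : ((Fin d → ℝ) × (Fin c → ℝ)) ≃ₗ[ℝ] E) (φ ψ : GrModel d c)
    (h : graphPoint e φ = graphPoint e' ψ) : IsUnit (transFst (transCLM e e') φ) := by
  have h' := (graphPoint_eq_iff e e' φ ψ).1 h
  have hinj : Function.Injective (transFst (transCLM e e') φ) := by
    rw [injective_iff_map_eq_zero]
    intro x hx
    have h2 := h' x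
    rw [hx, map_zero] at h2
    have h3 : transCLM e e' (x, φ x) = 0 := Prod.ext hx h2
    rw [transCLM_apply] at h3
    have h4 : (x, φ x) = 0 := by simpa using h3
    exact congrArg Prod.fst h4
  have hb : Function.Bijective (transFst (transCLM e e') φ).toLinearMap :=
    ⟨hinj, LinearMap.injective_iff_surjective.1 hinj⟩
  let L := (LinearEquiv.ofBijective _ hb).toContinuousLinearEquiv
  exact ⟨ContinuousLinearEquiv.toUnit L, rfl⟩

theorem graphChart_trans_source (e e' : ((Fin d → ℝ) × (Fin c → ℝ)) ≃ₗ[ℝ] E) :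
    ((graphChart e).symm.trans (graphChart e')).source =
      {φ | IsUnit (transFst (transCLM e e') φ)} := by
  ext φ
  have : φ ∈ ((graphChart e).symm.trans (graphChart e')).source ↔
      ∃ ψ, graphPoint e' ψ = graphPoint e φ := by
    simp [PartialEquiv.trans_source, graphChart]
  rw [this, mem_ofPred_eq]
  constructor
  · rintro ⟨ψ, h⟩
    exact isUnit_transFst_of_eq e e' φ ψ h.symm
  · intro hu
    refine ⟨transSnd (transCLM e e') φ ∘L Ring.inverse (transFst (transCLM e e') φ), ?_⟩
    refine ((graphPoint_eq_iff e e' φ _).2 fun x => ?_).symm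
    have h1 : Ring.inverse (transFst (transCLM e e') φ) * transFst (transCLM e e') φ = 1 :=
      Ring.inverse_mul_cancel _ hu
    have h2 := congrArg (fun L => L x) h1
    simp only [mul_apply_eq_comp, one_apply_eq_self] at h2
    simp [h2]

theorem graphChart_trans_apply (e e' : ((Fin d → ℝ) × (Fin c → ℝ)) ≃ₗ[ℝ] E) (φ : GrModel d c)
    (hu : IsUnit (transFst (transCLM e e') φ)) :
    graphChart e' (graphPoint e φ) =
      transSnd (transCLM e e') φ ∘L Ring.inverse (transFst (transCLM e e') φ) := by
  have h : graphPoint e φ = graphPoint e'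
      (transSnd (transCLM e e') φ ∘L Ring.inverse (transFst (transCLM e e') φ)) := by
    refine (graphPoint_eq_iff e e' φ _).2 fun x => ?_
    have h1 : Ring.inverse (transFst (transCLM e e') φ) * transFst (transCLM e e') φ = 1 :=
      Ring.inverse_mul_cancel _ hu
    have h2 := congrArg (fun L => L x) h1
    simp only [mul_apply_eq_comp, one_apply_eq_self] at h2
    simp [h2]
  rw [h, graphChart_graphPoint]

theorem contDiffOn_graphChart_trans (e e' : ((Fin d → ℝ) × (Fin c → ℝ)) ≃ₗ[ℝ] E) :
    ContDiffOn ℝ ∞ (fun φ => graphChart e' (graphPoint e φ))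
      {φ | IsUnit (transFst (transCLM e e') φ)} := by
  have h : ContDiffOn ℝ ∞ (fun φ => transSnd (transCLM e e') φ ∘L
      Ring.inverse (transFst (transCLM e e') φ)) {φ | IsUnit (transFst (transCLM e e') φ)} := by
    intro φ hφ
    refine ContDiffAt.contDiffWithinAt ?_
    refine (contDiff_transSnd _).contDiffAt.clm_comp ?_
    obtain ⟨u, hu⟩ := hφ
    have h1 : ContDiffAt ℝ ∞ Ring.inverse (transFst (transCLM e e') φ) := by
      rw [← hu]
      exact contDiffAt_ringInverse ℝ u
    exact h1.comp φ (contDiff_transFst _).contDiffAt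
  exact h.congr fun φ hφ => graphChart_trans_apply e e' φ hφ

theorem isOpen_transFst (e e' : ((Fin d → ℝ) × (Fin c → ℝ)) ≃ₗ[ℝ] E) :
    IsOpen {φ : GrModel d c | IsUnit (transFst (transCLM e e') φ)} :=
  Units.isOpen.preimage (contDiff_transFst (transCLM e e')).continuous

theorem exists_splitting [FiniteDimensional ℝ E] (V : Gr d c E) :
    ∃ e : ((Fin d → ℝ) × (Fin c → ℝ)) ≃ₗ[ℝ] E, graphPoint e 0 = V := by
  obtain ⟨W, hW⟩ := Submodule.exists_isCompl V.toSubmodule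
  have hWc : Module.finrank ℝ W = c := by
    rw [← V.finrank_quotient_eq]
    exact (Submodule.quotientEquivOfIsCompl _ _ hW).finrank_eq.symm
  let e1 : (Fin d → ℝ) ≃ₗ[ℝ] V.toSubmodule :=
    LinearEquiv.ofFinrankEq _ _ (by simp [V.finrank_eq])
  let e2 : (Fin c → ℝ) ≃ₗ[ℝ] W := LinearEquiv.ofFinrankEq _ _ (by simp [hWc])
  refine ⟨(e1.prodCongr e2).trans (Submodule.prodEquivOfIsCompl _ _ hW), Gr.ext ?_⟩
  ext v
  change v ∈ graphIn _ _ ↔ _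
  rw [mem_graphIn]
  constructor
  · rintro ⟨x, rfl⟩
    simp
  · intro hv
    exact ⟨e1.symm ⟨v, hv⟩, by simp⟩

/-- The atlas of all graph charts. -/
def grCore (d c : ℕ) (E : Type*) [AddCommGroup E] [Module ℝ E] [FiniteDimensional ℝ E] :
    ChartedSpaceCore (GrModel d c) (Gr d c E) where
  atlas := range graphChart
  chartAt V := graphChart (exists_splitting V).choose
  mem_chart_source V := ⟨0, (exists_splitting V).choose_spec⟩
  chart_mem_atlas V := mem_range_self _
  open_source := by
    rintro _ _ ⟨e, rfl⟩ ⟨e', rfl⟩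
    rw [graphChart_trans_source]
    exact isOpen_transFst e e'
  continuousOn_toFun := by
    rintro _ _ ⟨e, rfl⟩ ⟨e', rfl⟩
    rw [graphChart_trans_source]
    exact (contDiffOn_graphChart_trans e e').continuousOn

instance [FiniteDimensional ℝ E] : TopologicalSpace (Gr d c E) :=
  (grCore d c E).toTopologicalSpace

instance [FiniteDimensional ℝ E] : ChartedSpace (GrModel d c) (Gr d c E) :=
  (grCore d c E).toChartedSpace

instance [FiniteDimensional ℝ E] : IsManifold 𝓘(ℝ, GrModel d c) ∞ (Gr d c E) := by
  apply isManifold_of_contDiffOn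
  intro f f' hf hf'
  have key : ∀ f ∈ atlas (GrModel d c) (Gr d c E),
      ∃ e : ((Fin d → ℝ) × (Fin c → ℝ)) ≃ₗ[ℝ] E, f.toPartialEquiv = graphChart e := by
    intro f hf
    have hf' : f ∈ ⋃ (e : PartialEquiv (Gr d c E) (GrModel d c)) (he : e ∈ (grCore d c E).atlas),
      {(grCore d c E).openPartialHomeomorph e he} := hf
    simp only [mem_iUnion, mem_singleton_iff] at hf'
    obtain ⟨e, ⟨e', rfl⟩, rfl⟩ := hf'
    exact ⟨e', rfl⟩
  obtain ⟨e, he⟩ := key f hf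
  obtain ⟨e', he'⟩ := key f' hf'
  have hsrc : (f.symm ≫ₕ f').source = {φ | IsUnit (transFst (transCLM e e') φ)} := by
    rw [← graphChart_trans_source e e', ← he, ← he']
    rfl
  have hfun : (f.symm ≫ₕ f' : GrModel d c → GrModel d c)
      = fun φ => graphChart e' (graphPoint e φ) := by
    funext φ
    change f'.toPartialEquiv (f.toPartialEquiv.symm φ) = _
    rw [he, he']
    rfl
  have h := contDiffOn_graphChart_trans e e'
  rw [← hsrc, ← hfun] at h
  simpa using h

end Grassmannian

/-- The action of invertible linear maps on the Grassmannian: `u • V = u(V)`. -/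
instance {d c : ℕ} {E : Type*} [NormedAddCommGroup E] [NormedSpace ℝ E] :
    MulAction (E →L[ℝ] E)ˣ (Gr d c E) where
  smul u V :=
    { toSubmodule := V.toSubmodule.map (ContinuousLinearEquiv.ofUnit u).toLinearEquiv.toLinearMap
      finrank_eq := by rw [LinearEquiv.finrank_map_eq, V.finrank_eq]
      finrank_quotient_eq := by
        exact (Submodule.Quotient.equiv _ _ (ContinuousLinearEquiv.ofUnit u).toLinearEquiv
          rfl).finrank_eq.symm.trans V.finrank_quotient_eq }
  one_smul V := Gr.ext (by
    ext v
    exact ⟨fun ⟨w, hw, h⟩ => h ▸ hw, fun hv => ⟨v, hv, rfl⟩⟩)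
  mul_smul u u' V := Gr.ext (by
    ext v
    constructor
    · rintro ⟨w, hw, rfl⟩
      exact ⟨(u' : E →L[ℝ] E) w, ⟨w, hw, rfl⟩, rfl⟩
    · rintro ⟨_, ⟨w, hw, rfl⟩, rfl⟩
      exact ⟨w, hw, rfl⟩)

theorem mem_smul_iff {d c : ℕ} {E : Type*} [NormedAddCommGroup E] [NormedSpace ℝ E]
    (u : (E →L[ℝ] E)ˣ) (V : Gr d c E) (v : E) :
    v ∈ (u • V).toSubmodule ↔ ∃ w ∈ V.toSubmodule, (u : E →L[ℝ] E) w = v := Iff.rfl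

/-! ### Embedded submanifolds -/

/-- A smooth manifold structure of dimension `d` on `S` for which `ι : S → M` is a smooth embedding
(it exhibits the image of `ι` as an embedded submanifold of `M`, and is unique up to
diffeomorphism over the identity of `S`). -/
structure SmoothStructure (B : Type*) {M S : Type*} [NormedAddCommGroup B] [NormedSpace ℝ B]
    [TopologicalSpace M] [ChartedSpace B M] [TopologicalSpace S] (ι : S → M) (d : ℕ) where
  /-- the charts -/
  charts : ChartedSpace (EuclideanSpace ℝ (Fin d)) S
  isManifold : IsManifold 𝓘(ℝ, EuclideanSpace ℝ (Fin d)) ∞ S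
  isSmoothEmbedding :
    IsSmoothEmbedding 𝓘(ℝ, EuclideanSpace ℝ (Fin d)) 𝓘(ℝ, B) ∞ ι

/-- An embedded submanifold structure of dimension `d` on a subset of a manifold. -/
abbrev EmbeddedSubmanifold (B : Type*) {M : Type*} [NormedAddCommGroup B] [NormedSpace ℝ B]
    [TopologicalSpace M] [ChartedSpace B M] (S : Set M) (d : ℕ) :=
  SmoothStructure B (Subtype.val : S → M) d

/-- `f` is a (smooth) submersion with respect to the given smooth structures. -/
def SmoothStructure.Submersion {B M S B' M' S' : Type*} [NormedAddCommGroup B] [NormedSpace ℝ B]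
    [TopologicalSpace M] [ChartedSpace B M] [TopologicalSpace S]
    [NormedAddCommGroup B'] [NormedSpace ℝ B']
    [TopologicalSpace M'] [ChartedSpace B' M'] [TopologicalSpace S'] {ι : S → M} {ι' : S' → M'}
    {d d' : ℕ} (X : SmoothStructure B ι d) (Y : SmoothStructure B' ι' d') (f : S → S') : Prop :=
  letI := X.charts
  letI := Y.charts
  IsSubmersion 𝓘(ℝ, EuclideanSpace ℝ (Fin d)) 𝓘(ℝ, EuclideanSpace ℝ (Fin d')) ∞ f

/-! ### The forms and the groups -/

/-- `ℂⁿ`, also viewed as `ℝ²ⁿ` with the complex structure `J` given by multiplication by `i`. -/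
def CVec (n : ℕ) : Type := Fin n → ℂ

instance (n : ℕ) : NormedAddCommGroup (CVec n) := inferInstanceAs (NormedAddCommGroup (Fin n → ℂ))

instance (n : ℕ) : NormedSpace ℂ (CVec n) := inferInstanceAs (NormedSpace ℂ (Fin n → ℂ))

instance (n : ℕ) : FiniteDimensional ℂ (CVec n) :=
  inferInstanceAs (FiniteDimensional ℂ (Fin n → ℂ))

/-- The standard basis of `ℂⁿ`. -/
def stdVec {n : ℕ} (i : Fin n) : CVec n := Pi.single i (1 : ℂ)

section Forms

variable {n : ℕ} (b : LinearMap.BilinForm ℂ (CVec n))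

/-- The real part of `b`. -/
def reForm : LinearMap.BilinForm ℝ (CVec n) :=
  LinearMap.mk₂ ℝ (fun v w => (b v w).re) (by simp) (by simp) (by simp) (by simp)

/-- The imaginary part of `b`, a real inner product of signature `(n, n)` if `b` is symmetric and
non-degenerate. -/
def imForm : LinearMap.BilinForm ℝ (CVec n) :=
  LinearMap.mk₂ ℝ (fun v w => (b v w).im) (by simp) (by simp) (by simp) (by simp)

/-- The group of invertible real linear maps of `ℂⁿ = ℝ²ⁿ`. -/
abbrev GLR (n : ℕ) : Type := (CVec n →L[ℝ] CVec n)ˣ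

/-- The full orthogonal group `O(n, n)` of the imaginary part of `b`. -/
def orthIm : Subgroup (GLR n) where
  carrier := {u | ∀ v w, imForm b (u.1 v) (u.1 w) = imForm b v w}
  one_mem' := fun _ _ => rfl
  mul_mem' := fun {u u'} hu hu' v w => (hu _ _).trans (hu' v w)
  inv_mem' := fun {u} hu v w => by
    have h (z : CVec n) : u.1 (u⁻¹.1 z) = z := congrArg (fun L => L z) u.mul_inv
    rw [← hu, h, h]

/-- `G = SO₀(n, n)`: the identity component of the orthogonal group of the imaginary part. -/
def groupG : Subgroup (GLR n) :=
  (Subgroup.connectedComponentOfOne (orthIm b)).map (orthIm b).subtype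

/-- `H = SO(n, ℂ)`: complex linear maps of complex determinant `1` preserving `b`. -/
def groupH : Subgroup (GLR n) where
  carrier := {u | ∃ A : CVec n →ₗ[ℂ] CVec n,
    (∀ z, A z = u.1 z) ∧ (∀ z w, b (A z) (A w) = b z w) ∧ LinearMap.det A = 1}
  one_mem' := ⟨LinearMap.id, fun _ => rfl, fun _ _ => rfl, LinearMap.det_id⟩
  mul_mem' := by
    rintro u u' ⟨A, hA, hb, hd⟩ ⟨A', hA', hb', hd'⟩
    refine ⟨A ∘ₗ A', fun z => ?_, fun z w => ?_, ?_⟩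
    · rw [LinearMap.comp_apply, hA', hA]; rfl
    · rw [LinearMap.comp_apply, LinearMap.comp_apply, hb, hb']
    · rw [LinearMap.det_comp, hd, hd', one_mul]
  inv_mem' := by
    rintro u ⟨A, hA, hb, hd⟩
    have h (z : CVec n) : u.1 (u⁻¹.1 z) = z := congrArg (fun L => L z) u.mul_inv
    have hu : IsUnit (LinearMap.det A) := hd ▸ isUnit_one
    let e := LinearMap.equivOfDetNeZero A (by rw [hd]; exact one_ne_zero)
    have he (z : CVec n) : e z = A z := rfl
    have hs (z : CVec n) : e.symm z = u⁻¹.1 z := by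
      rw [LinearEquiv.symm_apply_eq, he, hA, h]
    refine ⟨e.symm.toLinearMap, hs, fun z w => ?_, ?_⟩
    · rw [← hb, ← he, ← he]; simp
    · have h1 : LinearMap.det (e.toLinearMap) * LinearMap.det (e.symm.toLinearMap) = 1 :=
        LinearEquiv.det_mul_det_symm e
      have h2 : e.toLinearMap = A := rfl
      rwa [h2, hd, one_mul] at h1

/-- The volume form of the inner product `imForm b` on `ℂⁿ = ℝ²ⁿ`, for the orientation in which
`(z₁, …, zₙ, i z₁, …, i zₙ)` is positive for every complex basis `z`: the real determinant in the
standard basis `(e₁, …, eₙ, i e₁, …, i eₙ)`, normalized by the factor `|det (b (eᵢ, eⱼ))|`, which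
is the square root of the absolute value of the Gram determinant of `imForm b` in that basis. -/
def volForm (x : Fin n ⊕ Fin n → CVec n) : ℝ :=
  ‖(Matrix.of fun i j : Fin n => b (stdVec i) (stdVec j)).det‖ *
    (Matrix.of fun i j : Fin n ⊕ Fin n =>
      Sum.elim (fun a => (x j a).re) (fun a => (x j a).im) i).det

/-- The Hodge star acts by `ε` on the line `Λⁿ V`: `*β = ε β` for `β = v₁ ∧ … ∧ vₙ` with `vⱼ ∈ V`.
Since `α ∧ *β = ⟨α, β⟩ vol`, this says `ε (α ∧ β) = ⟨α, β⟩ vol` for all decomposable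
`α = w₁ ∧ … ∧ wₙ`, where `⟨α, β⟩` is the determinant of the mutual inner products. Self-duality is
`ε = 1`, anti-self-duality is `ε = -1`. -/
def IsDual (ε : ℝ) (V : Submodule ℝ (CVec n)) : Prop :=
  ∀ (w v : Fin n → CVec n), (∀ j, v j ∈ V) →
    ε * volForm b (Sum.elim w v) = (Matrix.of fun i j : Fin n => imForm b (w i) (v j)).det

/-- `IGr^±(n, ℝ^{(n,n)})` (with `ε = ±1`): the maximal isotropic subspaces for the imaginary part of
`b` which are self-dual, respectively anti-self-dual. -/
def igr (ε : ℝ) : Set (Gr n n (CVec n)) :=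
  {V | (∀ v ∈ V.toSubmodule, ∀ w ∈ V.toSubmodule, imForm b v w = 0) ∧ IsDual b ε V.toSubmodule}

/-- `𝒪_(r,s)`: the maximal isotropic subspaces for the imaginary part of `b` on which the real part
of `b` has signature `(r, s)`. -/
def orb (r s : ℕ) : Set (Gr n n (CVec n)) :=
  {V | (∀ v ∈ V.toSubmodule, ∀ w ∈ V.toSubmodule, imForm b v w = 0) ∧
    sigPos ((reForm b).toQuadraticMap.restrict V.toSubmodule) = r ∧
    sigNeg ((reForm b).toQuadraticMap.restrict V.toSubmodule) = s}

/-- `IGr(k, ℂⁿ)`: the complex `k`-dimensional subspaces of `ℂⁿ` which are isotropic for `b`, as a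
subset of the Grassmannian of real `2k`-dimensional subspaces. -/
def cIgr (k : ℕ) : Set (Gr (2 * k) (2 * (n - k)) (CVec n)) :=
  {U | ∃ W : Submodule ℂ (CVec n), W.restrictScalars ℝ = U.toSubmodule ∧
    Module.finrank ℂ W = k ∧ ∀ z ∈ W, ∀ w ∈ W, b z w = 0}

end Forms

/-! ### The homogeneous space `SO(r + s, ℂ) / SO(r, s)` -/

/-- `SO(r + s, ℂ)`, realized as the special orthogonal group of the non-degenerate complex bilinear
form with matrix `diag(1, …, 1, -1, …, -1)` on `ℂ^{r+s}`. -/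
def complexSO (r s : ℕ) : Subgroup (GL (Fin r ⊕ Fin s) ℂ) where
  carrier := {A | (A.1).transpose * LieAlgebra.Orthogonal.indefiniteDiagonal (Fin r) (Fin s) ℂ * A.1
      = LieAlgebra.Orthogonal.indefiniteDiagonal (Fin r) (Fin s) ℂ ∧ A.1.det = 1}
  one_mem' := by simp
  mul_mem' := by
    rintro A B ⟨hA, hA'⟩ ⟨hB, hB'⟩
    refine ⟨?_, by simp [hA', hB']⟩
    rw [Units.val_mul, Matrix.transpose_mul]
    calc _ = B.1.transpose * (A.1.transpose *
          LieAlgebra.Orthogonal.indefiniteDiagonal (Fin r) (Fin s) ℂ * A.1) * B.1 := by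
            simp only [Matrix.mul_assoc]
      _ = _ := by rw [hA, hB]
  inv_mem' := by
    rintro A ⟨hA, hA'⟩
    have h1 : A.1 * A⁻¹.1 = 1 := A.mul_inv
    have h2 : (A⁻¹.1).transpose * A.1.transpose = 1 := by
      rw [← Matrix.transpose_mul, h1, Matrix.transpose_one]
    refine ⟨?_, ?_⟩
    · calc _ = (A⁻¹.1).transpose * (A.1.transpose *
          LieAlgebra.Orthogonal.indefiniteDiagonal (Fin r) (Fin s) ℂ * A.1) * A⁻¹.1 := by rw [hA]
        _ = ((A⁻¹.1).transpose * A.1.transpose) *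
          LieAlgebra.Orthogonal.indefiniteDiagonal (Fin r) (Fin s) ℂ * (A.1 * A⁻¹.1) := by
            simp only [Matrix.mul_assoc]
        _ = _ := by rw [h1, h2, Matrix.one_mul, Matrix.mul_one]
    · have h3 := congrArg Matrix.det h1
      rwa [Matrix.det_mul, hA', one_mul, Matrix.det_one] at h3

/-- `SO(r, s)`: the subgroup of real matrices in `complexSO r s`. -/
def realSO (r s : ℕ) : Subgroup (complexSO r s) :=
  ((Matrix.GeneralLinearGroup.map (n := Fin r ⊕ Fin s) (starRingEnd ℂ)).eqLocus
    (MonoidHom.id _)).subgroupOf (complexSO r s)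

/-- The matrix entries of an element of `complexSO r s`. -/
def complexSOEntries (r s : ℕ) (A : complexSO r s) : Fin r ⊕ Fin s → Fin r ⊕ Fin s → ℂ :=
  fun i j => A.1.1 i j

/-! ### The infinitesimal transversal -/

section Transversal

variable {n : ℕ} (b : LinearMap.BilinForm ℂ (CVec n))

/-- The Lie algebra `𝔤 = 𝔰𝔬(n, n)` of `G`. -/
def algG : Submodule ℝ (CVec n →L[ℝ] CVec n) where
  carrier := {X | ∀ v w, imForm b (X v) w + imForm b v (X w) = 0}
  zero_mem' := by simp
  add_mem' := by
    intro X Y hX hY v w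
    have h1 := hX v w
    have h2 := hY v w
    simp only [add_apply, map_add, LinearMap.add_apply]
    linarith
  smul_mem' := by
    intro t X hX v w
    have h1 := hX v w
    simp only [smul_apply, map_smul, LinearMap.smul_apply, smul_eq_mul]
    linear_combination t * h1

/-- The Lie algebra `𝔥 = 𝔰𝔬(n, ℂ)` of `H`: the complex linear maps which are skew for `b`. -/
def algH : Submodule ℝ (CVec n →L[ℝ] CVec n) where
  carrier := {X | (∀ z, X (Complex.I • z) = Complex.I • X z) ∧ ∀ z w, b (X z) w + b z (X w) = 0}
  zero_mem' := by simp
  add_mem' := by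
    rintro X Y ⟨hX, hX'⟩ ⟨hY, hY'⟩
    refine ⟨fun z => ?_, fun z w => ?_⟩
    · simp only [add_apply, hX, hY, smul_add]
    · simp only [add_apply, map_add, LinearMap.add_apply]
      linear_combination hX' z w + hY' z w
  smul_mem' := by
    rintro t X ⟨hX, hX'⟩
    refine ⟨fun z => ?_, fun z w => ?_⟩
    · simp only [smul_apply, hX]
      rw [smul_comm]
    · have h (z : CVec n) : (t • X) z = (t : ℂ) • X z := by
        exact (Complex.coe_smul t (X z)).symm
      rw [h, h, map_smul, map_smul, LinearMap.smul_apply, smul_eq_mul, smul_eq_mul]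
      linear_combination (t : ℂ) * hX' z w

/-- The Lie algebra `𝔭` of the stabilizer of `V` in `G`. -/
def algP (V : Gr n n (CVec n)) : Submodule ℝ (CVec n →L[ℝ] CVec n) :=
  algG b ⊓
  { carrier := {X | ∀ v ∈ V.toSubmodule, X v ∈ V.toSubmodule}
    zero_mem' := fun _ _ => V.toSubmodule.zero_mem
    add_mem' := fun hX hY v hv => V.toSubmodule.add_mem (hX v hv) (hY v hv)
    smul_mem' := fun t _ hX v hv => V.toSubmodule.smul_mem t (hX v hv) }

/-- The parabolic subgroup `P ⊂ G`, the stabilizer of `V` in `G`. -/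
def groupP (V : Gr n n (CVec n)) : Subgroup (GLR n) :=
  groupG b ⊓ MulAction.stabilizer (GLR n) V

/-- The adjoint action `X ↦ u X u⁻¹`. -/
def conjEnd (u : GLR n) :
    (CVec n →L[ℝ] CVec n) →ₗ[ℝ] (CVec n →L[ℝ] CVec n) where
  toFun X := u.1 * X * u⁻¹.1
  map_add' X Y := by rw [mul_add, add_mul]
  map_smul' t X := by rw [mul_smul_comm, smul_mul_assoc, RingHom.id_apply]

theorem conjEnd_one (X : CVec n →L[ℝ] CVec n) : conjEnd (1 : GLR n) X = X := by
  simp [conjEnd]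

theorem conjEnd_mul (u u' : GLR n) (X : CVec n →L[ℝ] CVec n) :
    conjEnd (u * u') X = conjEnd u (conjEnd u' X) := by
  simp [conjEnd, mul_assoc]

/-- The conjugate subgroup `H_𝒪 = g⁻¹ H g`. -/
def conjH (g : GLR n) : Subgroup (GLR n) := (groupH b).map (MulAut.conj g⁻¹).toMonoidHom

/-- The Lie algebra `𝔥_𝒪 = Ad(g⁻¹)(𝔥)` of `H_𝒪`. -/
def algConjH (g : GLR n) : Submodule ℝ (CVec n →L[ℝ] CVec n) :=
  (algH b).map (conjEnd g⁻¹)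

theorem conjEnd_mem_algG {u : GLR n} (hu : u ∈ groupG b) {X} (hX : X ∈ algG b) :
    conjEnd u X ∈ algG b := by
  obtain ⟨⟨u', hu'⟩, -, rfl⟩ := hu
  intro v w
  have h (z : CVec n) : u'.1 (u'⁻¹.1 z) = z := congrArg (fun L => L z) u'.mul_inv
  have h1 := hX (u'⁻¹.1 v) (u'⁻¹.1 w)
  rw [← hu', ← hu' (u'⁻¹.1 v), h, h] at h1
  exact h1

theorem conjEnd_mem_algP {V : Gr n n (CVec n)} {u : GLR n} (hu : u ∈ groupP b V) {X}
    (hX : X ∈ algP b V) : conjEnd u X ∈ algP b V := by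
  refine ⟨conjEnd_mem_algG b hu.1 hX.1, fun v hv => ?_⟩
  have hs : u • V = V := hu.2
  have hv' : v ∈ (u • V).toSubmodule := by rw [hs]; exact hv
  obtain ⟨w, hw, rfl⟩ := (mem_smul_iff u V v).1 hv'
  have h : u⁻¹.1 (u.1 w) = w := congrArg (fun L => L w) u.inv_mul
  have h2 : conjEnd u X (u.1 w) = u.1 (X w) := by
    change u.1 (X (u⁻¹.1 (u.1 w))) = _
    rw [h]
  rw [h2, ← hs]
  exact (mem_smul_iff u V _).2 ⟨X w, hX.2 w hw, rfl⟩

theorem conjEnd_mem_algH {u : GLR n} (hu : u ∈ groupH b) {X} (hX : X ∈ algH b) :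
    conjEnd u X ∈ algH b := by
  obtain ⟨A, hA, hb, -⟩ := id hu
  obtain ⟨B, hB, -, -⟩ := (groupH b).inv_mem hu
  have h (z : CVec n) : u.1 (u⁻¹.1 z) = z := congrArg (fun L => L z) u.mul_inv
  refine ⟨fun z => ?_, fun z w => ?_⟩
  · change u.1 (X (u⁻¹.1 _)) = Complex.I • u.1 (X (u⁻¹.1 z))
    rw [← hB, ← hB, map_smul, hX.1, ← hA, ← hA, map_smul]
  · have h1 := hX.2 (u⁻¹.1 z) (u⁻¹.1 w)
    rw [← hb, ← hb (u⁻¹.1 z), hA, hA, hA, hA, h, h] at h1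
    exact h1

theorem conjEnd_mem_algConjH {g u : GLR n} (hu : u ∈ conjH b g) {X} (hX : X ∈ algConjH b g) :
    conjEnd u X ∈ algConjH b g := by
  obtain ⟨a, ha, rfl⟩ := hu
  obtain ⟨Y, hY, rfl⟩ := hX
  refine ⟨conjEnd a Y, conjEnd_mem_algH b ha hY, ?_⟩
  rw [← conjEnd_mul, ← conjEnd_mul]
  congr 1
  simp

/-- `𝔤/𝔭`. -/
abbrev QuotGP (V : Gr n n (CVec n)) : Type := algG b ⧸ (algP b V).submoduleOf (algG b)

/-- The image of `𝔥_𝒪 / (𝔥_𝒪 ∩ 𝔭)` in `𝔤/𝔭`. -/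
def imageH (V : Gr n n (CVec n)) (g : GLR n) : Submodule ℝ (QuotGP b V) :=
  ((algConjH b g).submoduleOf (algG b)).map (Submodule.mkQ _)

/-- The infinitesimal transversal `(𝔤/𝔭) / (𝔥_𝒪 / (𝔥_𝒪 ∩ 𝔭))`. -/
abbrev Transversal (V : Gr n n (CVec n)) (g : GLR n) : Type := QuotGP b V ⧸ imageH b V g

/-- The adjoint action on `𝔤`. -/
def adG {V : Gr n n (CVec n)} {g : GLR n} (u : ↥(conjH b g ⊓ groupP b V)) :
    algG b →ₗ[ℝ] algG b :=
  (conjEnd u.1).restrict fun _ hX => conjEnd_mem_algG b u.2.2.1 hX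

/-- The induced action on `𝔤/𝔭`. -/
def adGP {V : Gr n n (CVec n)} {g : GLR n} (u : ↥(conjH b g ⊓ groupP b V)) :
    QuotGP b V →ₗ[ℝ] QuotGP b V :=
  Submodule.mapQ _ _ (adG b u) fun X hX => conjEnd_mem_algP b u.2.2 (X := X.1) hX

/-- The natural representation of `H_𝒪 ∩ P` on the infinitesimal transversal, induced by the
adjoint action on `𝔤`. -/
def transversalRep (V : Gr n n (CVec n)) (g : GLR n) :
    Representation ℝ ↥(conjH b g ⊓ groupP b V) (Transversal b V g) where
  toFun u := Submodule.mapQ _ _ (adGP b u) (by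
    rintro _ ⟨X, hX, rfl⟩
    exact ⟨adG b u X, conjEnd_mem_algConjH b u.2.1 (X := X.1) hX, rfl⟩)
  map_one' := by
    ext X
    change Submodule.Quotient.mk (Submodule.Quotient.mk _) = Submodule.Quotient.mk
      (Submodule.Quotient.mk _)
    exact congrArg (fun Z : algG b => (Submodule.Quotient.mk (Submodule.Quotient.mk Z) :
      Transversal b V g)) (Subtype.ext (conjEnd_one X.1))
  map_mul' u u' := by
    ext X
    change Submodule.Quotient.mk (Submodule.Quotient.mk _) = Submodule.Quotient.mk
      (Submodule.Quotient.mk _)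
    exact congrArg (fun Z : algG b => (Submodule.Quotient.mk (Submodule.Quotient.mk Z) :
      Transversal b V g)) (Subtype.ext (conjEnd_mul u.1 u'.1 X.1))

end Transversal

/-- The standard representation of `GL(k, ℂ)` on the real vector space of Hermitian
`k × k`-matrices, `A · M = A M A*`. -/
def hermRep (k : ℕ) :
    Representation ℝ (GL (Fin k) ℂ) (selfAdjoint (Matrix (Fin k) (Fin k) ℂ)) where
  toFun A :=
    { toFun := fun M => ⟨A.1 * M.1 * A.1.conjTranspose, by
        have hM : M.1.conjTranspose = M.1 := M.2
        change (A.1 * M.1 * A.1.conjTranspose).conjTranspose = _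
        rw [Matrix.conjTranspose_mul, Matrix.conjTranspose_mul, Matrix.conjTranspose_conjTranspose,
          hM, Matrix.mul_assoc]⟩
      map_add' := fun M N => Subtype.ext (by simp [Matrix.mul_add, Matrix.add_mul])
      map_smul' := fun t M => Subtype.ext (by simp) }
  map_one' := by ext M : 2; simp
  map_mul' A B := by
    ext M : 2
    simp [Matrix.conjTranspose_mul, Matrix.mul_assoc]

end SplitGrassmannian

end

noncomputable section

namespace SplitGrassmannian

/-! ### Submanifolds from slice charts, and a criterion for submersions -/

section Groupoid

variable {E : Type*} [NormedAddCommGroup E] [NormedSpace ℝ E]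

/-! Everything is read off in one normal form. Over ℂ the form `b` is isometric to the form on ℂᵏ ×
ℂ^{r+s} × ℂᵏ for which the outer factors are isotropic and dual to each other and the middle one
carries `diag(1, …, 1, -1, …, -1)`; such an isometry is a `Frame`. If V lies in 𝒪, then V is its own
orthocomplement for Im b, and since Re b(v, w) = Im b(iv, w), the radical of Re b on V is W = V ∩
iV. So W is complex isotropic of dimension k, and a basis of W together with an orthogonal family of
type (r, s) in V extends to a frame in which V is ℂᵏ × ℝ^{r+s} × 0
(`exists_frame_of_mem_orb_of_basis`). Two frames differ by an isometry of `b`; a reflection of the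
middle factor corrects its determinant if r + s > 0, whence transitivity (`orbit_eq_orb`).
Self-duality can be tested on a single pair of dual bases (`isDual_iff`), which a frame supplies;
this gives the sign (`orb_subset_igr`).

A subset of a manifold is a submanifold as soon as it is linear in suitable ambient charts
(`sliceStructure`). Near a frame, real n-dimensional subspaces are parametrized by blocks (A, β, γ,
δ). Here β encodes a complex linear map α from ℂᵏ to ℂ^{r+s}, and the subspace is the image of the
vectors (w, u + iAu, γw + δu) under the unipotent isometry attached to α. Hence α drops out of the
form (`mdlForm_vecE`), and 𝒪 becomes linear: A is skew, γ is complex skew, δ vanishes. The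
codimension is then a count of skew matrices (`finrank_igrModel_eq`). The map p sends V to V ∩ iV;
in these coordinates it is the linear map to (α, γ), hence a submersion (`orbProj_submersion`). In a
fibre only A remains. The group SO(r+s, ℂ) acts on it through the middle factor, the stabilizer of
ℝ^{r+s} is SO(r, s), and in Cayley charts the derivative of the orbit map is twice the imaginary
part, which covers all skew A (`fibreEquiv_submersion`).

For the transversal, X in 𝔤 is sent to the antilinear part of the induced map from W to ℂⁿ/W^⊥.
Since b makes this quotient the dual of W, the antilinear part is a sesquilinear form on W; it is
Hermitian because X is skew for Im b (`Frame.antiMatrix_conjTranspose`), and every Hermitian form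
occurs. It vanishes on 𝔥, whose elements are complex linear, and on 𝔭, because V is contained in
W^⊥. Conversely, if it vanishes, X can be corrected by an element of 𝔥 so as to preserve V
(`Frame.exists_correction`). The stabilizer acts on W and on ℂⁿ/W^⊥ by dual representations, which
yields M ↦ ρMρ*. Block diagonal isometries show that ρ is onto; they lie in the identity component
because GL(k, ℂ) is connected (`Frame.levi_mem_groupG`). -/

theorem mem_contDiffGroupoid_iff (e : OpenPartialHomeomorph E E) :
    e ∈ contDiffGroupoid ∞ 𝓘(ℝ, E) ↔
      ContDiffOn ℝ ∞ e e.source ∧ ContDiffOn ℝ ∞ e.symm e.target := by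
  rw [contDiffGroupoid, mem_groupoid_of_pregroupoid]
  simp [contDiffPregroupoid]

/-- Transition maps to the charts of the atlas only acquire a factor `D` or its inverse. Every
nonlinear change of coordinates on the Grassmannians enters through this. -/
theorem trans_mem_maximalAtlas {M : Type*} [TopologicalSpace M] [ChartedSpace E M]
    {Ψ : OpenPartialHomeomorph M E} (hΨ : Ψ ∈ IsManifold.maximalAtlas 𝓘(ℝ, E) ∞ M)
    {D : OpenPartialHomeomorph E E} (hD : D ∈ contDiffGroupoid ∞ 𝓘(ℝ, E)) :
    Ψ ≫ₕ D ∈ IsManifold.maximalAtlas 𝓘(ℝ, E) ∞ M := by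
  rw [IsManifold.mem_maximalAtlas_iff, mem_maximalAtlas_iff] at *
  intro e he
  obtain ⟨h1, h2⟩ := hΨ e he
  constructor
  · rw [OpenPartialHomeomorph.trans_symm_eq_symm_trans_symm, OpenPartialHomeomorph.trans_assoc]
    exact StructureGroupoid.trans _ (StructureGroupoid.symm _ hD) h1
  · rw [← OpenPartialHomeomorph.trans_assoc]
    exact StructureGroupoid.trans _ h2 hD

end Groupoid

/-! ### Maps with surjective derivative as projections in charts -/

section Submersion

variable {E F : Type*} [NormedAddCommGroup E] [NormedSpace ℝ E] [FiniteDimensional ℝ E]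
  [NormedAddCommGroup F] [NormedSpace ℝ F] [FiniteDimensional ℝ F]

/-- `G` is paired with a projection `P` onto its kernel; the pair is injective because `P` is the
identity on the kernel. The space `K` is any space of the right dimension, so that the model of the
complement can be prescribed. -/
theorem exists_linearEquiv_prod_of_surjective {K : Type*} [AddCommGroup K] [Module ℝ K]
    [FiniteDimensional ℝ K] (G : E →ₗ[ℝ] F) (hG : Function.Surjective G)
    (hK : Module.finrank ℝ E = Module.finrank ℝ F + Module.finrank ℝ K) :
    ∃ e : E ≃ₗ[ℝ] F × K, ∀ x, (e x).1 = G x := by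
  have hker : Module.finrank ℝ (LinearMap.ker G) = Module.finrank ℝ K := by
    have h1 := LinearMap.finrank_range_add_finrank_ker G
    rw [LinearMap.range_eq_top.2 hG, finrank_top] at h1
    omega
  obtain ⟨P, hP⟩ := LinearMap.exists_leftInverse_of_injective (LinearMap.ker G).subtype
    (Submodule.ker_subtype _)
  let e0 : LinearMap.ker G ≃ₗ[ℝ] K := LinearEquiv.ofFinrankEq _ _ hker
  let Q : E →ₗ[ℝ] F × K := G.prod (e0.toLinearMap ∘ₗ P)
  have hinj : Function.Injective Q := by
    rw [injective_iff_map_eq_zero]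
    intro x hx
    have h1 : G x = 0 := congrArg Prod.fst hx
    have h2 : e0 (P x) = 0 := congrArg Prod.snd hx
    have h3 : P x = ⟨x, h1⟩ := congrArg (fun L => L ⟨x, h1⟩) hP
    rw [h3, map_eq_zero_iff _ e0.injective] at h2
    exact congrArg Subtype.val h2
  exact ⟨LinearEquiv.ofInjectiveOfFinrankEq Q hinj (by simpa using hK), fun x => rfl⟩

/-- A smooth map with surjective derivative at a point is a projection in suitable coordinates. -/
theorem exists_straightening {K : Type*} [NormedAddCommGroup K] [NormedSpace ℝ K]
    [FiniteDimensional ℝ K] (eqv : E ≃L[ℝ] F × K) {G : E → F} {Ω : Set E} (hΩ : IsOpen Ω)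
    (hG : ContDiffOn ℝ ∞ G Ω) {x : E} (hx : x ∈ Ω) {G' : E →L[ℝ] F} (hG' : HasFDerivAt G G' x)
    (hsurj : Function.Surjective G') :
    ∃ Φ : OpenPartialHomeomorph E E, Φ ∈ contDiffGroupoid ∞ 𝓘(ℝ, E) ∧ x ∈ Φ.source ∧
      Φ.source ⊆ Ω ∧ ∀ y ∈ Φ.source, (eqv (Φ y)).1 = G y := by
  have : CompleteSpace E := FiniteDimensional.complete ℝ E
  obtain ⟨e, he⟩ := exists_linearEquiv_prod_of_surjective (K := K) G'.toLinearMap hsurj (by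
    simpa using eqv.toLinearEquiv.finrank_eq)
  let eL : E ≃L[ℝ] F × K := e.toContinuousLinearEquiv
  let P : E →L[ℝ] K := ContinuousLinearMap.snd ℝ F K ∘L eL.toContinuousLinearMap
  -- `G` is completed by linear coordinates along the kernel of its derivative, which makes the
  -- derivative of `f` at `x` invertible.
  let f : E → E := fun y => eqv.symm (G y, P y)
  have hf : ContDiffOn ℝ ∞ f Ω :=
    eqv.symm.contDiff.comp_contDiffOn (hG.prodMk P.contDiff.contDiffOn)
  let f' : E ≃L[ℝ] E := eL.trans eqv.symm
  have hf' : HasFDerivAt f (f' : E →L[ℝ] E) x := by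
    have h1 := eqv.symm.hasFDerivAt.comp x (hG'.prodMk (P.hasFDerivAt (x := x)))
    refine h1.congr_fderiv ?_
    ext y
    change eqv.symm (G' y, P y) = eqv.symm (eL y)
    congr 1
    exact Prod.ext (he y).symm rfl
  have hfx : ContDiffAt ℝ ∞ f x := hf.contDiffAt (hΩ.mem_nhds hx)
  let Φ₀ := hfx.toOpenPartialHomeomorph f hf' (by simp)
  -- The inverse is smooth only where the derivative of `f` is invertible, and the groupoid asks for
  -- smoothness on the whole target. The source is therefore cut down to this open set.
  let U : Set E := Ω ∩ (fderiv ℝ f) ⁻¹' (range ((↑) : (E ≃L[ℝ] E) → E →L[ℝ] E))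
  have hU : IsOpen U :=
    (hf.continuousOn_fderiv_of_isOpen hΩ (by simp)).isOpen_inter_preimage hΩ
      ContinuousLinearEquiv.isOpen
  have hxU : x ∈ U := ⟨hx, f', hf'.fderiv.symm⟩
  let Φ := Φ₀.restrOpen U hU
  have hsrc : Φ.source = Φ₀.source ∩ U := rfl
  refine ⟨Φ, (mem_contDiffGroupoid_iff Φ).2 ⟨?_, ?_⟩, ?_, ?_, ?_⟩
  · exact hf.mono fun y hy => hy.2.1
  · intro z hz
    refine ContDiffAt.contDiffWithinAt ?_
    have hz' : Φ.symm z ∈ Φ.source := Φ.map_target hz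
    obtain ⟨f₁, hf₁⟩ := hz'.2.2
    have hd : ContDiffAt ℝ ∞ f (Φ.symm z) := hf.contDiffAt (hΩ.mem_nhds hz'.2.1)
    refine Φ.contDiffAt_symm (f₀' := f₁) hz ?_ hd
    change HasFDerivAt f _ _
    rw [hf₁]
    exact (hd.differentiableAt (by simp)).hasFDerivAt
  · exact ⟨hfx.mem_toOpenPartialHomeomorph_source hf' (by simp), hxU⟩
  · exact fun y hy => hy.2.1
  · intro y hy
    change (eqv (eqv.symm (G y, P y))).1 = G y
    simp

/-- A map between manifolds which has surjective derivative in charts is a submersion. -/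
theorem isSubmersion_of_charts {q m : ℕ} {S S' : Type*} [TopologicalSpace S]
    [ChartedSpace (EuclideanSpace ℝ (Fin q)) S]
    [IsManifold 𝓘(ℝ, EuclideanSpace ℝ (Fin q)) ∞ S]
    [TopologicalSpace S'] [ChartedSpace (EuclideanSpace ℝ (Fin m)) S']
    [IsManifold 𝓘(ℝ, EuclideanSpace ℝ (Fin m)) ∞ S'] (f : S → S')
    (h : ∀ x, ∃ c ∈ IsManifold.maximalAtlas 𝓘(ℝ, EuclideanSpace ℝ (Fin q)) ∞ S,
      ∃ c' ∈ IsManifold.maximalAtlas 𝓘(ℝ, EuclideanSpace ℝ (Fin m)) ∞ S',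
      ∃ (G : EuclideanSpace ℝ (Fin q) → EuclideanSpace ℝ (Fin m)) (Ω : Set (EuclideanSpace ℝ (Fin q)))
        (G' : EuclideanSpace ℝ (Fin q) →L[ℝ] EuclideanSpace ℝ (Fin m)),
        x ∈ c.source ∧ IsOpen Ω ∧ c x ∈ Ω ∧ ContDiffOn ℝ ∞ G Ω ∧ HasFDerivAt G G' (c x) ∧
        Function.Surjective G' ∧
        ∀ y ∈ c.source, c y ∈ Ω → f y ∈ c'.source ∧ c' (f y) = G (c y)) :
    IsSubmersion 𝓘(ℝ, EuclideanSpace ℝ (Fin q)) 𝓘(ℝ, EuclideanSpace ℝ (Fin m)) ∞ f := by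
  refine ⟨EuclideanSpace ℝ (Fin (q - m)), inferInstance, inferInstance, fun x => ?_⟩
  obtain ⟨c, hc, c', hc', G, Ω, G', hx, hΩ, hxΩ, hG, hG', hs, hf⟩ := h x
  have hqm : m ≤ q := by
    have := LinearMap.finrank_range_add_finrank_ker G'.toLinearMap
    rw [LinearMap.range_eq_top.2 hs, finrank_top] at this
    simp at this
    omega
  let eqv : EuclideanSpace ℝ (Fin q) ≃L[ℝ]
      EuclideanSpace ℝ (Fin m) × EuclideanSpace ℝ (Fin (q - m)) :=
    (LinearEquiv.ofFinrankEq _ _ (by simp; omega)).toContinuousLinearEquiv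
  obtain ⟨Φ, hΦ, hxΦ, hΦΩ, hΦG⟩ := exists_straightening eqv hΩ hG hxΩ hG' hs
  refine IsSubmersionAtOfComplement.mk_of_charts eqv (c ≫ₕ Φ) c' ⟨hx, hxΦ⟩ (hf x hx hxΩ).1
    (trans_mem_maximalAtlas hc hΦ) hc' ?_ ?_
  · intro y hy
    exact (hf y hy.1 (hΦΩ hy.2)).1
  · intro z hz
    have hz' : z ∈ (c ≫ₕ Φ).target := by simpa using hz
    have hy := (c ≫ₕ Φ).map_target hz'
    have h1 := hf _ hy.1 (hΦΩ hy.2)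
    have h2 : (eqv (Φ (c ((c ≫ₕ Φ).symm z)))).1 = G (c ((c ≫ₕ Φ).symm z)) := hΦG _ hy.2
    have h3 : Φ (c ((c ≫ₕ Φ).symm z)) = z := (c ≫ₕ Φ).right_inv hz'
    rw [h3] at h2
    simp only [OpenPartialHomeomorph.extend_coe, OpenPartialHomeomorph.extend_coe_symm,
      Function.comp_apply, modelWithCornersSelf_coe, modelWithCornersSelf_coe_symm, id]
    rw [h1.2, h2]

end Submersion

/-! ### Slice charts and the submanifolds they define -/

section Slices

variable {B M S : Type*} [NormedAddCommGroup B] [NormedSpace ℝ B] [FiniteDimensional ℝ B]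

section Incl

variable (L : Submodule ℝ B)

/-- A linear parametrization of a subspace. -/
def sliceIncl : EuclideanSpace ℝ (Fin (Module.finrank ℝ L)) →L[ℝ] B :=
  LinearMap.toContinuousLinearMap (L.subtype ∘ₗ (LinearEquiv.ofFinrankEq
    (EuclideanSpace ℝ (Fin (Module.finrank ℝ L))) L finrank_euclideanSpace_fin).toLinearMap)

theorem sliceIncl_injective : Function.Injective (sliceIncl L) :=
  Subtype.val_injective.comp (LinearEquiv.injective _)

theorem range_sliceIncl (y : B) : y ∈ L ↔ ∃ v, sliceIncl L v = y := by
  constructor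
  · intro hy
    obtain ⟨v, hv⟩ := (LinearEquiv.ofFinrankEq
      (EuclideanSpace ℝ (Fin (Module.finrank ℝ L))) L finrank_euclideanSpace_fin).surjective ⟨y, hy⟩
    exact ⟨v, congrArg Subtype.val hv⟩
  · rintro ⟨v, rfl⟩
    exact Subtype.property _

theorem exists_sliceRetr : ∃ ℓ : B →L[ℝ] EuclideanSpace ℝ (Fin (Module.finrank ℝ L)),
    ∀ v, ℓ (sliceIncl L v) = v := by
  obtain ⟨P, hP⟩ := LinearMap.exists_leftInverse_of_injective (sliceIncl L).toLinearMap
    (LinearMap.ker_eq_bot.2 (sliceIncl_injective L))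
  exact ⟨LinearMap.toContinuousLinearMap P, fun v => congrArg (fun Q => Q v) hP⟩

/-- A linear retraction onto a subspace, in coordinates. -/
def sliceRetr : B →L[ℝ] EuclideanSpace ℝ (Fin (Module.finrank ℝ L)) :=
  (exists_sliceRetr L).choose

theorem sliceRetr_incl (v) : sliceRetr L (sliceIncl L v) = v := (exists_sliceRetr L).choose_spec v

theorem sliceIncl_retr {y : B} (hy : y ∈ L) : sliceIncl L (sliceRetr L y) = y := by
  obtain ⟨v, rfl⟩ := (range_sliceIncl L y).1 hy
  rw [sliceRetr_incl]

end Incl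

variable [TopologicalSpace M] [ChartedSpace B M] [TopologicalSpace S]

/-- A chart in which the image of `ι` is the linear subspace `L`. -/
structure IsSliceChart (ι : S → M) (L : Submodule ℝ B) (Ψ : OpenPartialHomeomorph M B) :
    Prop where
  mem_atlas : Ψ ∈ IsManifold.maximalAtlas 𝓘(ℝ, B) ∞ M
  mem_iff : ∀ y ∈ Ψ.source, y ∈ range ι ↔ Ψ y ∈ L

variable {ι : S → M} {L : Submodule ℝ B}

/-- The chart of a submanifold induced by a slice chart. -/
def sliceChart (hι : Topology.IsEmbedding ι) {Ψ : OpenPartialHomeomorph M B} (h : IsSliceChart ι L Ψ)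
    [Nonempty S] : OpenPartialHomeomorph S (EuclideanSpace ℝ (Fin (Module.finrank ℝ L))) where
  toFun s := sliceRetr L (Ψ (ι s))
  invFun v := Function.invFun ι (Ψ.symm (sliceIncl L v))
  source := ι ⁻¹' Ψ.source
  target := sliceIncl L ⁻¹' Ψ.target
  map_source' s hs := by
    change sliceIncl L _ ∈ Ψ.target
    rw [sliceIncl_retr L ((h.mem_iff _ hs).1 (mem_range_self s))]
    exact Ψ.map_source hs
  map_target' v hv := by
    have h1 := Ψ.map_target hv
    have h2 : Ψ.symm (sliceIncl L v) ∈ range ι := by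
      rw [h.mem_iff _ h1, Ψ.right_inv hv]
      exact (range_sliceIncl L _).2 ⟨v, rfl⟩
    change ι _ ∈ Ψ.source
    rw [Function.invFun_eq h2]
    exact h1
  left_inv' s hs := by
    rw [sliceIncl_retr L ((h.mem_iff _ hs).1 (mem_range_self s)), Ψ.left_inv hs]
    exact Function.leftInverse_invFun hι.injective s
  right_inv' v hv := by
    have h1 := Ψ.map_target hv
    have h2 : Ψ.symm (sliceIncl L v) ∈ range ι := by
      rw [h.mem_iff _ h1, Ψ.right_inv hv]
      exact (range_sliceIncl L _).2 ⟨v, rfl⟩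
    rw [Function.invFun_eq h2, Ψ.right_inv hv, sliceRetr_incl]
  open_source := Ψ.open_source.preimage hι.continuous
  open_target := Ψ.open_target.preimage (sliceIncl L).continuous
  continuousOn_toFun := (sliceRetr L).continuous.comp_continuousOn
    (Ψ.continuousOn.comp hι.continuous.continuousOn fun _ hs => hs)
  continuousOn_invFun := by
    rw [hι.continuousOn_iff]
    refine (Ψ.continuousOn_symm.comp (sliceIncl L).continuous.continuousOn
      fun _ hv => hv).congr fun v hv => ?_
    have h1 := Ψ.map_target hv
    refine Function.invFun_eq (f := ι) ?_
    change _ ∈ range ι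
    rw [h.mem_iff _ h1, Ψ.right_inv hv]
    exact (range_sliceIncl L _).2 ⟨v, rfl⟩

theorem incl_sliceChart (hι : Topology.IsEmbedding ι) {Ψ : OpenPartialHomeomorph M B}
    (h : IsSliceChart ι L Ψ) [Nonempty S] {s : S} (hs : ι s ∈ Ψ.source) :
    sliceIncl L (sliceChart hι h s) = Ψ (ι s) :=
  sliceIncl_retr L ((h.mem_iff _ hs).1 (mem_range_self s))

theorem sliceChart_symm (hι : Topology.IsEmbedding ι) {Ψ : OpenPartialHomeomorph M B}
    (h : IsSliceChart ι L Ψ) [Nonempty S] {v} (hv : sliceIncl L v ∈ Ψ.target) :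
    ι ((sliceChart hι h).symm v) = Ψ.symm (sliceIncl L v) := by
  have h1 := Ψ.map_target hv
  refine Function.invFun_eq (f := ι) ?_
  change _ ∈ range ι
  rw [h.mem_iff _ h1, Ψ.right_inv hv]
  exact (range_sliceIncl L _).2 ⟨v, rfl⟩

/-- In slice coordinates the transition is the ambient one, preceded by the inclusion of `L` and
followed by a linear retraction onto it. -/
theorem contDiffOn_sliceChart_trans (hι : Topology.IsEmbedding ι) {Ψ Ψ' : OpenPartialHomeomorph M B}
    (h : IsSliceChart ι L Ψ) (h' : IsSliceChart ι L Ψ') [Nonempty S] :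
    ContDiffOn ℝ ∞ ((sliceChart hι h).symm ≫ₕ sliceChart hι h')
      ((sliceChart hι h).symm ≫ₕ sliceChart hι h').source := by
  have hg := ((mem_contDiffGroupoid_iff _).1
    (StructureGroupoid.compatible_of_mem_maximalAtlas h.mem_atlas h'.mem_atlas)).1
  have hsrc : ∀ v ∈ ((sliceChart hι h).symm ≫ₕ sliceChart hι h').source,
      sliceIncl L v ∈ Ψ.target ∧ Ψ.symm (sliceIncl L v) ∈ Ψ'.source := by
    intro v hv
    rw [OpenPartialHomeomorph.trans_source] at hv
    have h1 : sliceIncl L v ∈ Ψ.target := hv.1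
    have h2 : ι ((sliceChart hι h).symm v) ∈ Ψ'.source := hv.2
    rw [sliceChart_symm hι h h1] at h2
    exact ⟨h1, h2⟩
  refine ContDiffOn.congr (f := fun v => sliceRetr L ((Ψ.symm ≫ₕ Ψ') (sliceIncl L v))) ?_ ?_
  · refine (sliceRetr L).contDiff.comp_contDiffOn
      (hg.comp (sliceIncl L).contDiff.contDiffOn fun v hv => ?_)
    rw [OpenPartialHomeomorph.trans_source]
    exact hsrc v hv
  · intro v hv
    change sliceRetr L (Ψ' (ι ((sliceChart hι h).symm v))) = _
    rw [sliceChart_symm hι h (hsrc v hv).1]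
    rfl

/-- The atlas of all charts induced by slice charts. -/
@[reducible] def sliceCharts (hι : Topology.IsEmbedding ι)
    (h : ∀ x, ∃ Ψ : OpenPartialHomeomorph M B, IsSliceChart ι L Ψ ∧ ι x ∈ Ψ.source) :
    ChartedSpace (EuclideanSpace ℝ (Fin (Module.finrank ℝ L))) S where
  atlas := {c | ∃ (_ : Nonempty S) (Ψ : OpenPartialHomeomorph M B) (hΨ : IsSliceChart ι L Ψ),
    c = sliceChart hι hΨ}
  chartAt x := haveI : Nonempty S := ⟨x⟩; sliceChart hι (h x).choose_spec.1
  mem_chart_source x := (h x).choose_spec.2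
  chart_mem_atlas x := ⟨⟨x⟩, _, (h x).choose_spec.1, rfl⟩

/-- A topological embedding whose image is locally a linear subspace in charts of the target
is the inclusion of an embedded submanifold. -/
def sliceStructure (hι : Topology.IsEmbedding ι)
    (h : ∀ x, ∃ Ψ : OpenPartialHomeomorph M B, IsSliceChart ι L Ψ ∧ ι x ∈ Ψ.source) :
    SmoothStructure B ι (Module.finrank ℝ L) :=
  letI := sliceCharts hι h
  haveI hM : IsManifold 𝓘(ℝ, EuclideanSpace ℝ (Fin (Module.finrank ℝ L))) ∞ S := by
    apply isManifold_of_contDiffOn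
    rintro _ _ ⟨_, Ψ, hΨ, rfl⟩ ⟨_, Ψ', hΨ', rfl⟩
    simpa using contDiffOn_sliceChart_trans hι hΨ hΨ'
  { charts := sliceCharts hι h
    isManifold := hM
    isSmoothEmbedding := by
      refine ⟨?_, hι⟩
      -- The kernel of the retraction is a complement of `L`, and in the chosen charts `ι` becomes
      -- `v ↦ (v, 0)`, the normal form of an immersion.
      let K := LinearMap.ker (sliceRetr L).toLinearMap
      let Q : (EuclideanSpace ℝ (Fin (Module.finrank ℝ L))) × K →ₗ[ℝ] B :=
        (sliceIncl L).toLinearMap.coprod K.subtype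
      have hbij : Function.Bijective Q := by
        constructor
        · rw [injective_iff_map_eq_zero]
          rintro ⟨v, w, hw⟩ h0
          have h1 : sliceIncl L v + w = 0 := h0
          have h2 := congrArg (sliceRetr L) h1
          have hw' : sliceRetr L w = 0 := hw
          rw [map_add, sliceRetr_incl, hw', add_zero, map_zero] at h2
          rw [h2, map_zero, zero_add] at h1
          exact Prod.ext h2 (Subtype.ext h1)
        · intro y
          refine ⟨(sliceRetr L y, ⟨y - sliceIncl L (sliceRetr L y), ?_⟩), ?_⟩
          · change sliceRetr L _ = 0
            rw [map_sub, sliceRetr_incl, sub_self]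
          · exact add_sub_cancel _ _
      let eqv := (LinearEquiv.ofBijective Q hbij).toContinuousLinearEquiv
      refine IsImmersionOfComplement.isImmersion (F := K) fun x => ?_
      have : Nonempty S := ⟨x⟩
      obtain ⟨Ψ, hΨ, hx⟩ := h x
      refine IsImmersionAtOfComplement.mk_of_charts eqv (sliceChart hι hΨ) Ψ hx hx
        (StructureGroupoid.subset_maximalAtlas _ ⟨⟨x⟩, Ψ, hΨ, rfl⟩) hΨ.mem_atlas
        (fun y hy => hy) ?_
      intro v hv
      have hv' : sliceIncl L v ∈ Ψ.target := by
        have : v ∈ (sliceChart hι hΨ).target := by simpa using hv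
        exact this
      simp only [OpenPartialHomeomorph.extend_coe, OpenPartialHomeomorph.extend_coe_symm,
        Function.comp_apply, modelWithCornersSelf_coe, modelWithCornersSelf_coe_symm, id]
      rw [sliceChart_symm hι hΨ hv', Ψ.right_inv hv']
      change _ = sliceIncl L v + ((0 : K) : B)
      simp }

theorem sliceChart_mem_maximalAtlas (hι : Topology.IsEmbedding ι)
    (h : ∀ x, ∃ Ψ : OpenPartialHomeomorph M B, IsSliceChart ι L Ψ ∧ ι x ∈ Ψ.source)
    [Nonempty S] {Ψ : OpenPartialHomeomorph M B} (hΨ : IsSliceChart ι L Ψ) :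
    letI := (sliceStructure hι h).charts
    sliceChart hι hΨ ∈ IsManifold.maximalAtlas
      𝓘(ℝ, EuclideanSpace ℝ (Fin (Module.finrank ℝ L))) ∞ S := by
  let := (sliceStructure hι h).charts
  have := (sliceStructure hι h).isManifold
  exact StructureGroupoid.subset_maximalAtlas _ ⟨inferInstance, Ψ, hΨ, rfl⟩

/-- Submersions between submanifolds given by slice charts. -/
theorem sliceStructure_submersion {B' M' S' : Type*} [NormedAddCommGroup B'] [NormedSpace ℝ B']
    [FiniteDimensional ℝ B'] [TopologicalSpace M'] [ChartedSpace B' M'] [TopologicalSpace S']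
    {ι' : S' → M'} {L' : Submodule ℝ B'} (hι : Topology.IsEmbedding ι)
    (h : ∀ x, ∃ Ψ : OpenPartialHomeomorph M B, IsSliceChart ι L Ψ ∧ ι x ∈ Ψ.source)
    (hι' : Topology.IsEmbedding ι')
    (h' : ∀ x, ∃ Ψ : OpenPartialHomeomorph M' B', IsSliceChart ι' L' Ψ ∧ ι' x ∈ Ψ.source)
    (f : S → S')
    (hf : ∀ x, ∃ (Ψ : OpenPartialHomeomorph M B) (Ψ' : OpenPartialHomeomorph M' B')
      (F : B → B') (Ω : Set B) (F' : B →L[ℝ] B'),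
      IsSliceChart ι L Ψ ∧ IsSliceChart ι' L' Ψ' ∧ ι x ∈ Ψ.source ∧ IsOpen Ω ∧ Ψ (ι x) ∈ Ω ∧
      ContDiffOn ℝ ∞ F Ω ∧ HasFDerivAt F F' (Ψ (ι x)) ∧ (∀ l' ∈ L', ∃ l ∈ L, F' l = l') ∧
      ∀ s, ι s ∈ Ψ.source → Ψ (ι s) ∈ Ω → ι' (f s) ∈ Ψ'.source ∧ Ψ' (ι' (f s)) = F (Ψ (ι s))) :
    (sliceStructure hι h).Submersion (sliceStructure hι' h') f := by
  let := (sliceStructure hι h).charts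
  let := (sliceStructure hι' h').charts
  have := (sliceStructure hι h).isManifold
  have := (sliceStructure hι' h').isManifold
  refine isSubmersion_of_charts f fun x => ?_
  have : Nonempty S := ⟨x⟩
  have : Nonempty S' := ⟨f x⟩
  -- `F` is an ambient expression of `f`. Only its restriction to the slices counts, so the
  -- derivative has to be onto from `L` to `L'`, not from `B` to `B'`.
  obtain ⟨Ψ, Ψ', F, Ω, F', hΨ, hΨ', hx, hΩ, hxΩ, hF, hF', hs, hc⟩ := hf x
  refine ⟨sliceChart hι hΨ, sliceChart_mem_maximalAtlas hι h hΨ, sliceChart hι' hΨ',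
    sliceChart_mem_maximalAtlas hι' h' hΨ', fun v => sliceRetr L' (F (sliceIncl L v)),
    sliceIncl L ⁻¹' Ω, sliceRetr L' ∘L F' ∘L sliceIncl L, hx,
    hΩ.preimage (sliceIncl L).continuous, ?_, ?_, ?_, ?_, ?_⟩
  · change sliceIncl L _ ∈ Ω
    rwa [incl_sliceChart hι hΨ hx]
  · exact (sliceRetr L').contDiff.comp_contDiffOn
      (hF.comp (sliceIncl L).contDiff.contDiffOn fun v hv => hv)
  · have h1 : HasFDerivAt F F' (sliceIncl L (sliceChart hι hΨ x)) := by
      rwa [incl_sliceChart hι hΨ hx]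
    exact (sliceRetr L').hasFDerivAt.comp _ (h1.comp _ (sliceIncl L).hasFDerivAt)
  · intro v'
    obtain ⟨l, hl, hl'⟩ := hs (sliceIncl L' v') ((range_sliceIncl L' _).2 ⟨v', rfl⟩)
    obtain ⟨v, rfl⟩ := (range_sliceIncl L l).1 hl
    refine ⟨v, ?_⟩
    change sliceRetr L' (F' (sliceIncl L v)) = v'
    rw [hl', sliceRetr_incl]
  · intro s hs hsΩ
    have hsΩ' : Ψ (ι s) ∈ Ω := by
      have : sliceIncl L (sliceChart hι hΨ s) ∈ Ω := hsΩ
      rwa [incl_sliceChart hι hΨ hs] at this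
    obtain ⟨h1, h2⟩ := hc s hs hsΩ'
    refine ⟨h1, ?_⟩
    change sliceRetr L' (Ψ' (ι' (f s))) = sliceRetr L' (F (sliceIncl L (sliceChart hι hΨ s)))
    rw [h2, incl_sliceChart hι hΨ hs]

end Slices

/-! ### Graph charts as members of the maximal atlas -/

section GrCharts

variable {d c : ℕ} {E : Type*} [AddCommGroup E] [Module ℝ E] [FiniteDimensional ℝ E]

/-- The graph chart of a splitting as a chart of the manifold structure. -/
def grChart (e : ((Fin d → ℝ) × (Fin c → ℝ)) ≃ₗ[ℝ] E) :
    OpenPartialHomeomorph (Gr d c E) (GrModel d c) :=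
  (grCore d c E).openPartialHomeomorph (graphChart e) (mem_range_self e)

theorem grChart_mem_maximalAtlas (e : ((Fin d → ℝ) × (Fin c → ℝ)) ≃ₗ[ℝ] E) :
    grChart e ∈ IsManifold.maximalAtlas 𝓘(ℝ, GrModel d c) ∞ (Gr d c E) := by
  refine StructureGroupoid.subset_maximalAtlas _ ?_
  change _ ∈ ⋃ (e : PartialEquiv (Gr d c E) (GrModel d c)) (he : e ∈ (grCore d c E).atlas),
      {(grCore d c E).openPartialHomeomorph e he}
  simp only [mem_iUnion, mem_singleton_iff]
  exact ⟨graphChart e, mem_range_self e, rfl⟩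

theorem grChart_graphPoint (e : ((Fin d → ℝ) × (Fin c → ℝ)) ≃ₗ[ℝ] E) (φ : GrModel d c) :
    grChart e (graphPoint e φ) = φ := graphChart_graphPoint e φ

theorem mem_grChart_source (e : ((Fin d → ℝ) × (Fin c → ℝ)) ≃ₗ[ℝ] E) (V : Gr d c E) :
    V ∈ (grChart e).source ↔ ∃ φ, graphPoint e φ = V := Iff.rfl

theorem graphPoint_eq_of_le (e : ((Fin d → ℝ) × (Fin c → ℝ)) ≃ₗ[ℝ] E) (φ : GrModel d c)
    (V : Gr d c E) (h : ∀ x, e (x, φ x) ∈ V.toSubmodule) : graphPoint e φ = V := by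
  refine Gr.ext (Submodule.eq_of_le_of_finrank_eq ?_
    ((graphPoint e φ).finrank_eq.trans V.finrank_eq.symm))
  intro v hv
  obtain ⟨x, rfl⟩ := (mem_graphIn e φ v).1 hv
  exact h x

end GrCharts

/-- Two subspaces in a Grassmannian agree as soon as one is contained in the other. -/
theorem Gr.eq_of_le {d c : ℕ} {E : Type*} [AddCommGroup E] [Module ℝ E] [FiniteDimensional ℝ E]
    {V V' : Gr d c E} (h : V.toSubmodule ≤ V'.toSubmodule) : V = V' :=
  Gr.ext (Submodule.eq_of_le_of_finrank_eq h (V.finrank_eq.trans V'.finrank_eq.symm))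

/-! ### Isotropic families, and the normal form of the complex bilinear form -/

section Dual

variable {K V : Type*} [Field K] [AddCommGroup V] [Module K V] [FiniteDimensional K V]

/-- A linearly independent isotropic family has a dual isotropic family; it can be chosen
orthogonal to a given further family. -/
theorem exists_dual_isotropic [NeZero (2 : K)] (B : LinearMap.BilinForm K V) (hsymm : B.IsSymm)
    (hnd : B.Nondegenerate) {ι κ : Type*} [Fintype ι] [DecidableEq ι] [Fintype κ]
    (w : ι → V) (u : κ → V) (hli : LinearIndependent K (Sum.elim w u))
    (hww : ∀ i j, B (w i) (w j) = 0) (hwu : ∀ i j, B (w i) (u j) = 0) :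
    ∃ w' : ι → V, (∀ i j, B (w i) (w' j) = if i = j then 1 else 0) ∧
      (∀ i j, B (u i) (w' j) = 0) ∧ ∀ i j, B (w' i) (w' j) = 0 := by
  classical
  have hs (x y : V) : B x y = B y x := hsymm.eq x y
  -- `P` reads off coordinates with respect to the family. Its components at `ι` are represented
  -- through `B` by the vectors `c i`, which are therefore dual to `w` and orthogonal to `u`.
  obtain ⟨P, hP⟩ := LinearMap.exists_leftInverse_of_injective
    (Fintype.linearCombination K (Sum.elim w u))
    (LinearMap.ker_eq_bot.2 (hli.fintypeLinearCombination_injective))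
  have hP' (i : ι ⊕ κ) : P (Sum.elim w u i) = Pi.single i 1 := by
    have h := congrArg (fun L => L (Pi.single i 1)) hP
    simpa [Fintype.linearCombination_apply_single] using h
  let c (i : ι) : V := (B.toDual hnd).symm (LinearMap.proj (Sum.inl i) ∘ₗ P)
  have hc (i : ι) (x : V) : B (c i) x = P x (Sum.inl i) := by
    rw [← LinearMap.BilinForm.toDual_def hnd, LinearEquiv.apply_symm_apply]
    rfl
  have hcw (i j : ι) : B (c i) (w j) = if j = i then 1 else 0 := by
    rw [hc]
    have := congrFun (hP' (Sum.inl j)) (Sum.inl i)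
    simpa [Pi.single_apply, eq_comm] using this
  have hcu (i : ι) (j : κ) : B (c i) (u j) = 0 := by
    rw [hc]
    have := congrFun (hP' (Sum.inr j)) (Sum.inl i)
    simpa [Pi.single_apply] using this
  -- Subtracting half of the mutual products of the `c i` makes them isotropic. The correction lies
  -- in the span of `w`, so the pairings with `w` and `u` stay the same.
  refine ⟨fun i => c i - (2 : K)⁻¹ • ∑ j, B (c i) (c j) • w j, fun i j => ?_, fun i j => ?_,
    fun i j => ?_⟩
  · simp only [map_sub, map_smul, map_sum, hww, smul_zero, Finset.sum_const_zero, sub_zero]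
    rw [hs, hcw]
  · have hs' (j : ι) : B (u i) (w j) = 0 := by rw [hs, hwu]
    simp only [map_sub, map_smul, map_sum, hs', smul_zero, Finset.sum_const_zero, sub_zero]
    rw [hs, hcu]
  · have hcw' (i j : ι) : B (w i) (c j) = if i = j then 1 else 0 := by rw [hs, hcw]
    simp only [map_sub, map_smul, map_sum, LinearMap.sub_apply, LinearMap.smul_apply,
      LinearMap.sum_apply, hww, hcw, hcw', smul_eq_mul, mul_ite, mul_one, mul_zero, sub_zero,
      Finset.sum_ite_eq', Finset.mem_univ, if_true, Finset.sum_const_zero]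
    rw [hs (c j) (c i)]
    have : (2 : K) ≠ 0 := NeZero.ne _
    field_simp
    ring

end Dual

/-- Nondegenerate symmetric complex bilinear forms of the same rank are isometric. -/
theorem exists_isometry {M₁ M₂ : Type*} [AddCommGroup M₁] [Module ℂ M₁] [FiniteDimensional ℂ M₁]
    [AddCommGroup M₂] [Module ℂ M₂] [FiniteDimensional ℂ M₂] (B₁ : LinearMap.BilinForm ℂ M₁)
    (B₂ : LinearMap.BilinForm ℂ M₂) (h₁ : B₁.IsSymm) (h₂ : B₂.IsSymm) (hn₁ : B₁.Nondegenerate)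
    (hn₂ : B₂.Nondegenerate) (hrank : Module.finrank ℂ M₁ = Module.finrank ℂ M₂) :
    ∃ e : M₁ ≃ₗ[ℂ] M₂, ∀ x y, B₂ (e x) (e y) = B₁ x y := by
  let e₀ : M₁ ≃ₗ[ℂ] M₂ := LinearEquiv.ofFinrankEq _ _ hrank
  let B₃ : LinearMap.BilinForm ℂ M₁ := LinearMap.BilinForm.congr e₀.symm B₂
  have hB₃ (x y : M₁) : B₃ x y = B₂ (e₀ x) (e₀ y) := rfl
  have h₃ : B₃.IsSymm := ⟨fun x y => h₂.eq (e₀ x) (e₀ y)⟩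
  have hn₃ : B₃.Nondegenerate := hn₂.congr e₀.symm
  have hQ₁ : (QuadraticMap.associated (R := ℂ) B₁.toQuadraticMap).SeparatingLeft := by
    rw [QuadraticMap.associated_left_inverse ℂ h₁.eq]
    exact hn₁.1
  have hQ₃ : (QuadraticMap.associated (R := ℂ) B₃.toQuadraticMap).SeparatingLeft := by
    rw [QuadraticMap.associated_left_inverse ℂ h₃.eq]
    exact hn₃.1
  -- Over ℂ the rank is the only invariant of a nondegenerate quadratic form; the bilinear statement
  -- follows by polarization.
  obtain ⟨f⟩ := QuadraticForm.equivalent_of_isAlgClosed _ _ hQ₁ hQ₃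
  refine ⟨f.toLinearEquiv.trans e₀, fun x y => ?_⟩
  have hf (z : M₁) : B₃ (f z) (f z) = B₁ z z := f.map_app z
  have key := hf (x + y)
  rw [map_add] at key
  simp only [map_add, LinearMap.add_apply, hf] at key
  have e1 : B₁ y x = B₁ x y := h₁.eq y x
  have e3 : B₃ (f y) (f x) = B₃ (f x) (f y) := h₃.eq (f y) (f x)
  rw [e1, e3] at key
  change B₃ (f x) (f y) = _
  linear_combination key / 2

/-! ### The model form: a hyperbolic part and a diagonal part -/

section Model

variable {k r s : ℕ}

/-- The model space `ℂᵏ × ℂ^{r+s} × ℂᵏ`. -/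
abbrev Mdl (k r s : ℕ) : Type := (Fin k → ℂ) × (Fin r ⊕ Fin s → ℂ) × (Fin k → ℂ)

/-- The signs `1, …, 1, -1, …, -1`. -/
def sgn : Fin r ⊕ Fin s → ℝ := Sum.elim (fun _ => 1) (fun _ => -1)

theorem sgn_mul_self (j : Fin r ⊕ Fin s) : sgn j * sgn j = 1 := by
  rcases j with j | j <;> simp [sgn]

theorem sgn_ne_zero (j : Fin r ⊕ Fin s) : sgn j ≠ 0 := by
  rcases j with j | j <;> simp [sgn]

/-- The complex bilinear form `diag(1, …, 1, -1, …, -1)`. -/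
def qE (r s : ℕ) : LinearMap.BilinForm ℂ (Fin r ⊕ Fin s → ℂ) :=
  LinearMap.mk₂ ℂ (fun x y => ∑ j, (sgn j : ℂ) * (x j * y j))
    (fun x x' y => by simp [add_mul, mul_add, Finset.sum_add_distrib])
    (fun t x y => by
      simp only [Pi.smul_apply, smul_eq_mul, Finset.mul_sum]
      exact Finset.sum_congr rfl fun j _ => by ring)
    (fun x x' y => by simp [mul_add, Finset.sum_add_distrib])
    (fun t x y => by
      simp only [Pi.smul_apply, smul_eq_mul, Finset.mul_sum]
      exact Finset.sum_congr rfl fun j _ => by ring)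

theorem qE_apply (x y : Fin r ⊕ Fin s → ℂ) : qE r s x y = ∑ j, (sgn j : ℂ) * (x j * y j) := rfl

theorem qE_comm (x y : Fin r ⊕ Fin s → ℂ) : qE r s x y = qE r s y x := by
  simp only [qE_apply, mul_comm (x _)]

theorem qE_single (x : Fin r ⊕ Fin s → ℂ) (j : Fin r ⊕ Fin s) (t : ℂ) :
    qE r s x (Pi.single j t) = sgn j * (x j * t) := by
  rw [qE_apply, Finset.sum_eq_single j]
  · simp
  · intro i _ hi
    simp [Pi.single_eq_of_ne hi]
  · simp

theorem qE_isSymm : (qE r s).IsSymm := ⟨fun x y => qE_comm x y⟩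

theorem qE_separating {x : Fin r ⊕ Fin s → ℂ} (h : ∀ y, qE r s x y = 0) : x = 0 := by
  ext j
  have := h (Pi.single j 1)
  rw [qE_single] at this
  have hs : (sgn j : ℂ) ≠ 0 := by exact_mod_cast sgn_ne_zero j
  simpa [hs] using this

theorem qE_nondegenerate : (qE r s).Nondegenerate :=
  ⟨fun _ h => qE_separating h, fun _ h => qE_separating fun y => (qE_comm _ _).trans (h y)⟩

/-- The bilinear form of the model space. -/
def mdlForm (k r s : ℕ) : LinearMap.BilinForm ℂ (Mdl k r s) :=
  LinearMap.mk₂ ℂ (fun z w => z.1 ⬝ᵥ w.2.2 + z.2.2 ⬝ᵥ w.1 + qE r s z.2.1 w.2.1)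
    (fun x x' y => by simp [add_dotProduct]; ring)
    (fun t x y => by simp [smul_dotProduct]; ring)
    (fun x x' y => by simp [dotProduct_add]; ring)
    (fun t x y => by simp [dotProduct_smul]; ring)

theorem mdlForm_apply (z w : Mdl k r s) :
    mdlForm k r s z w = z.1 ⬝ᵥ w.2.2 + z.2.2 ⬝ᵥ w.1 + qE r s z.2.1 w.2.1 := rfl

theorem mdlForm_comm (z w : Mdl k r s) : mdlForm k r s z w = mdlForm k r s w z := by
  rw [mdlForm_apply, mdlForm_apply, qE_comm, dotProduct_comm, dotProduct_comm z.2.2]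
  ring

theorem mdlForm_separating {z : Mdl k r s} (h : ∀ w, mdlForm k r s z w = 0) : z = 0 := by
  obtain ⟨a, x, c⟩ := z
  have h1 : a = 0 := by
    ext i
    simpa [mdlForm_apply] using h (0, 0, Pi.single i 1)
  have h2 : c = 0 := by
    ext i
    simpa [mdlForm_apply] using h (Pi.single i 1, 0, 0)
  have h3 : x = 0 := qE_separating fun y => by simpa [mdlForm_apply] using h (0, y, 0)
  rw [h1, h2, h3]
  rfl

theorem mdlForm_nondegenerate : (mdlForm k r s).Nondegenerate :=
  ⟨fun _ h => mdlForm_separating h,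
    fun _ h => mdlForm_separating fun y => (mdlForm_comm _ _).trans (h y)⟩

theorem mdlForm_isSymm : (mdlForm k r s).IsSymm := ⟨fun x y => mdlForm_comm x y⟩

theorem finrank_mdl : Module.finrank ℂ (Mdl k r s) = r + s + 2 * k := by
  simp
  ring

end Model

variable {n k r s : ℕ} {b : LinearMap.BilinForm ℂ (CVec n)}

theorem finrank_cVec : Module.finrank ℂ (CVec n) = n := by
  have : Module.finrank ℂ (Fin n → ℂ) = n := by simp
  exact this

theorem finrank_real_cVec : Module.finrank ℝ (CVec n) = n + n := by
  have h := finrank_real_of_complex (CVec n)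
  rw [finrank_cVec] at h
  omega

/-- A linear isometry from the model space. -/
structure Frame (b : LinearMap.BilinForm ℂ (CVec n)) (k r s : ℕ) where
  toEquiv : Mdl k r s ≃ₗ[ℂ] CVec n
  map_form : ∀ z w, b (toEquiv z) (toEquiv w) = mdlForm k r s z w

theorem exists_frame (hn : r + s + 2 * k = n) (hsymm : b.IsSymm) (hnd : b.Nondegenerate) :
    Nonempty (Frame b k r s) := by
  obtain ⟨e, he⟩ := exists_isometry (mdlForm k r s) b mdlForm_isSymm hsymm mdlForm_nondegenerate
    hnd (by rw [finrank_mdl, finrank_cVec, hn])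
  exact ⟨⟨e, he⟩⟩

/-- A linear map out of the model space which preserves the forms is a frame. -/
def frameOfMap (hn : r + s + 2 * k = n) (T : Mdl k r s →ₗ[ℂ] CVec n)
    (hT : ∀ z w, b (T z) (T w) = mdlForm k r s z w) : Frame b k r s where
  toEquiv := LinearEquiv.ofInjectiveOfFinrankEq T
    ((injective_iff_map_eq_zero T).2 fun z hz => mdlForm_separating fun w => by
      rw [← hT, hz, map_zero, LinearMap.zero_apply])
    (by rw [finrank_mdl, finrank_cVec, hn])
  map_form := hT

theorem linearCombination_form {V : Type*} [AddCommGroup V] [Module ℂ V]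
    (B : LinearMap.BilinForm ℂ V) {ι κ : Type*} [Fintype ι] [Fintype κ] (v : ι → V) (w : κ → V)
    (x : ι → ℂ) (y : κ → ℂ) :
    B (Fintype.linearCombination ℂ v x) (Fintype.linearCombination ℂ w y) =
      ∑ i, ∑ j, x i * (y j * B (v i) (w j)) := by
  simp only [Fintype.linearCombination_apply, map_sum, LinearMap.sum_apply, map_smul,
    LinearMap.smul_apply, smul_eq_mul, Finset.mul_sum]
  rw [Finset.sum_comm]
  exact Finset.sum_congr rfl fun i _ => Finset.sum_congr rfl fun j _ => by ring

/-- An isotropic family together with an orthogonal family of the right signature extends to a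
frame. -/
theorem exists_frame_of_families (hn : r + s + 2 * k = n) (hsymm : b.IsSymm)
    (hnd : b.Nondegenerate) (w : Fin k → CVec n) (u : Fin r ⊕ Fin s → CVec n)
    (hli : LinearIndependent ℂ w) (hww : ∀ i j, b (w i) (w j) = 0)
    (hwu : ∀ i j, b (w i) (u j) = 0)
    (huu : ∀ i j, b (u i) (u j) = if i = j then (sgn i : ℂ) else 0) :
    ∃ T : Frame b k r s, ∀ a x, T.toEquiv (a, x, 0) = ∑ i, a i • w i + ∑ j, x j • u j := by
  have hs (x y : CVec n) : b x y = b y x := hsymm.eq x y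
  have hli' : LinearIndependent ℂ (Sum.elim w u) := by
    rw [Fintype.linearIndependent_iff] at hli ⊢
    intro g hg
    rw [Fintype.sum_sum_type] at hg
    simp only [Sum.elim_inl, Sum.elim_inr] at hg
    -- Pairing a relation with `u j` kills the isotropic vectors and isolates one coefficient.
    have h1 (j : Fin r ⊕ Fin s) : g (Sum.inr j) = 0 := by
      have h2 := congrArg (fun v => b v (u j)) hg
      simp only [map_add, map_sum, map_smul, LinearMap.add_apply, LinearMap.sum_apply,
        LinearMap.smul_apply, hwu, huu, smul_eq_mul, mul_zero, Finset.sum_const_zero, zero_add,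
        mul_ite, Finset.sum_ite_eq', Finset.mem_univ, if_true, map_zero,
        LinearMap.zero_apply] at h2
      have hs : (sgn j : ℂ) ≠ 0 := by exact_mod_cast sgn_ne_zero j
      simpa [hs] using h2
    simp only [h1, zero_smul, Finset.sum_const_zero, add_zero] at hg
    rintro (i | j)
    · exact hli _ hg i
    · exact h1 j
  obtain ⟨w', hww', huw', hw'w'⟩ := exists_dual_isotropic b hsymm hnd w u hli' hww hwu
  let T : Mdl k r s →ₗ[ℂ] CVec n := (Fintype.linearCombination ℂ w).coprod
    ((Fintype.linearCombination ℂ u).coprod (Fintype.linearCombination ℂ w'))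
  have hT (z w : Mdl k r s) : b (T z) (T w) = mdlForm k r s z w := by
    obtain ⟨a, x, c⟩ := z
    obtain ⟨a', x', c'⟩ := w
    have hw'w (i j) : b (w' i) (w j) = if i = j then 1 else 0 := by
      rw [hs, hww']
      simp only [eq_comm]
    have huw (i j) : b (u i) (w j) = 0 := by rw [hs, hwu]
    have hw'u (i j) : b (w' i) (u j) = 0 := by rw [hs, huw']
    simp only [T, LinearMap.coprod_apply, map_add, LinearMap.add_apply, linearCombination_form,
      hww, hwu, huu, huw, hww', huw', hw'w', hw'w, hw'u, mul_zero, Finset.sum_const_zero,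
      mul_ite, mul_one, Finset.sum_ite_eq, Finset.mem_univ, if_true, zero_add, add_zero]
    rw [mdlForm_apply, qE_apply, dotProduct, dotProduct]
    have : ∀ j, x j * (x' j * (sgn j : ℂ)) = (sgn j : ℂ) * (x j * x' j) := fun j => by ring
    simp only [this]
    ring
  refine ⟨frameOfMap hn T hT, fun a x => ?_⟩
  change T _ = _
  simp [T, Fintype.linearCombination_apply]

/-- An isotropic family extends to a frame. -/
theorem exists_frame_of_isotropic (hn : r + s + 2 * k = n) (hsymm : b.IsSymm)
    (hnd : b.Nondegenerate) (w : Fin k → CVec n) (hli : LinearIndependent ℂ w)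
    (hww : ∀ i j, b (w i) (w j) = 0) :
    ∃ T : Frame b k r s, ∀ a, T.toEquiv (a, 0, 0) = ∑ i, a i • w i := by
  have hs (x y : CVec n) : b x y = b y x := hsymm.eq x y
  obtain ⟨w', hww', -, hw'w'⟩ := exists_dual_isotropic b hsymm hnd w (fun i : Fin 0 => 0)
    (by
      rw [Fintype.linearIndependent_iff] at hli ⊢
      intro g hg
      rw [Fintype.sum_sum_type] at hg
      simp only [Sum.elim_inl, Finset.univ_eq_empty, Finset.sum_empty, add_zero] at hg
      rintro (i | j)
      · exact hli _ hg i
      · exact j.elim0) hww (fun i j => by simp)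
  have hw'w (i j) : b (w' i) (w j) = if i = j then 1 else 0 := by
    rw [hs, hww']
    simp only [eq_comm]
  -- The orthocomplement of the hyperbolic part spanned by `w` and `w'`. It is nondegenerate of
  -- dimension `r + s`, hence isometric to `qE r s` for any `r` and `s` with this sum: over ℂ the
  -- signs carry no information.
  let F : Submodule ℂ (CVec n) :=
    { carrier := {z | ∀ i, b (w i) z = 0 ∧ b (w' i) z = 0}
      zero_mem' := fun i => by simp
      add_mem' := fun {x y} hx hy i => by simp [hx i, hy i]
      smul_mem' := fun t x hx i => by simp [hx i] }
  let P : (Fin k → ℂ) × F × (Fin k → ℂ) →ₗ[ℂ] CVec n := (Fintype.linearCombination ℂ w).coprod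
    (F.subtype.coprod (Fintype.linearCombination ℂ w'))
  have hbw (i : Fin k) (z) : b (w i) (P z) = z.2.2 i := by
    obtain ⟨a, f, c⟩ := z
    simp [P, Fintype.linearCombination_apply, hww, hww', (f.2 i).1]
  have hbw' (i : Fin k) (z) : b (w' i) (P z) = z.1 i := by
    obtain ⟨a, f, c⟩ := z
    simp [P, Fintype.linearCombination_apply, hw'w', hw'w, (f.2 i).2]
  have hP : Function.Bijective P := by
    constructor
    · rw [injective_iff_map_eq_zero]
      intro z hz
      have h1 : z.1 = 0 := by
        ext i
        rw [← hbw', hz, map_zero]; rfl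
      have h2 : z.2.2 = 0 := by
        ext i
        rw [← hbw, hz, map_zero]; rfl
      obtain ⟨a, f, c⟩ := z
      simp only at h1 h2
      subst h1 h2
      have : (f : CVec n) = 0 := by simpa [P] using hz
      simp [Submodule.coe_eq_zero.1 this]
    · intro z
      refine ⟨(fun i => b (w' i) z, ⟨z - ∑ i, b (w' i) z • w i - ∑ i, b (w i) z • w' i,
        fun i => ?_⟩, fun i => b (w i) z), ?_⟩
      · simp [hww, hww', hw'w, hw'w']
      · simp only [P, LinearMap.coprod_apply, Fintype.linearCombination_apply,
          Submodule.subtype_apply]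
        abel
  have hrank := (LinearEquiv.ofBijective P hP).finrank_eq
  rw [finrank_cVec, Module.finrank_prod, Module.finrank_prod] at hrank
  simp only [Module.finrank_fintype_fun_eq_card, Fintype.card_fin] at hrank
  have hFnd : (b.restrict F).Nondegenerate := by
    have key (f : F) (hf : ∀ g : F, b f g = 0) : f = 0 := by
      have h0 : (f : CVec n) = 0 := hnd.1 _ fun z => by
        obtain ⟨⟨a, g, c⟩, rfl⟩ := hP.2 z
        have h1 (i) : b f (w i) = 0 := by rw [hs]; exact (f.2 i).1
        have h2 (i) : b f (w' i) = 0 := by rw [hs]; exact (f.2 i).2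
        simp [P, Fintype.linearCombination_apply, h1, h2, hf g]
      exact Subtype.ext h0
    exact ⟨fun f hf => key f hf, fun f hf => key f fun g => (hs _ _).trans (hf g)⟩
  obtain ⟨e, he⟩ := exists_isometry (qE r s) (b.restrict F) qE_isSymm (hsymm.restrict F)
    qE_nondegenerate hFnd (by simp; omega)
  let u (j : Fin r ⊕ Fin s) : CVec n := e (Pi.single j 1)
  obtain ⟨T, hT⟩ := exists_frame_of_families hn hsymm hnd w u hli hww
    (fun i j => ((e (Pi.single j 1)).2 i).1) (fun i j => by
      have := he (Pi.single i 1) (Pi.single j 1)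
      rw [qE_single] at this
      refine this.trans ?_
      by_cases hij : i = j
      · subst hij; simp
      · simp [hij])
  exact ⟨T, fun a => by simpa using hT a 0⟩

/-! ### Coordinates near a frame -/

section Coordinates

variable {k r s : ℕ}

/-- The inclusion `ℝ^{r+s} → ℂ^{r+s}`. -/
def realE (r s : ℕ) : (Fin r ⊕ Fin s → ℝ) →L[ℝ] (Fin r ⊕ Fin s → ℂ) :=
  LinearMap.toContinuousLinearMap
    { toFun := fun x j => (x j : ℂ)
      map_add' := fun x y => by ext j; simp
      map_smul' := fun t x => by ext j; simp }

@[simp] theorem realE_apply (x : Fin r ⊕ Fin s → ℝ) (j) : realE r s x j = x j := rfl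

/-- Multiplication by `i`. -/
def mulI (ι : Type*) [Fintype ι] : (ι → ℂ) →L[ℝ] (ι → ℂ) :=
  LinearMap.toContinuousLinearMap
    { toFun := fun x => Complex.I • x
      map_add' := smul_add _
      map_smul' := fun _ _ => smul_comm _ _ _ }

@[simp] theorem mulI_apply {ι : Type*} [Fintype ι] (x : ι → ℂ) : mulI ι x = Complex.I • x := rfl

/-- The complex linear map `ℂᵏ → ℂ^{r+s}` with imaginary part `β`. -/
def cxE (k r s : ℕ) : ((Fin k → ℂ) →L[ℝ] (Fin r ⊕ Fin s → ℝ)) →L[ℝ]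
    ((Fin k → ℂ) →L[ℝ] (Fin r ⊕ Fin s → ℂ)) :=
  LinearMap.toContinuousLinearMap
    { toFun := fun β => realE r s ∘L β ∘L mulI (Fin k) + mulI _ ∘L realE r s ∘L β
      map_add' := fun β β' => by ext; simp; ring
      map_smul' := fun t β => by ext; simp }

theorem cxE_apply (β : (Fin k → ℂ) →L[ℝ] (Fin r ⊕ Fin s → ℝ)) (w : Fin k → ℂ) :
    cxE k r s β w = realE r s (β (Complex.I • w)) + Complex.I • realE r s (β w) := rfl

/-- A complex linear map is determined by its imaginary part `β`, and `β` can be any real linear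
map. This is what makes `β` a free parameter. -/
theorem cxE_I (β : (Fin k → ℂ) →L[ℝ] (Fin r ⊕ Fin s → ℝ)) (w : Fin k → ℂ) :
    cxE k r s β (Complex.I • w) = Complex.I • cxE k r s β w := by
  ext j
  simp only [cxE_apply, smul_smul, Complex.I_mul_I, neg_smul, one_smul, map_neg, Pi.add_apply,
    Pi.neg_apply, Pi.smul_apply, smul_eq_mul, realE_apply, mul_add, ← mul_assoc]
  ring

/-- The adjoint of a map `ℂᵏ → ℂ^{r+s}`. -/
def adjE (k r s : ℕ) : ((Fin k → ℂ) →L[ℝ] (Fin r ⊕ Fin s → ℂ)) →L[ℝ]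
    ((Fin r ⊕ Fin s → ℂ) →L[ℝ] (Fin k → ℂ)) :=
  LinearMap.toContinuousLinearMap
    { toFun := fun α => LinearMap.toContinuousLinearMap
        { toFun := fun e j => qE r s e (α (Pi.single j 1))
          map_add' := fun e e' => by ext; simp
          map_smul' := fun t e => by
            ext
            simp only [← Complex.coe_smul, map_smul, LinearMap.smul_apply, Pi.smul_apply,
              RingHom.id_apply] }
      map_add' := fun α α' => by ext; simp
      map_smul' := fun t α => by
        ext
        simp only [← Complex.coe_smul, map_smul, Pi.smul_apply,
              RingHom.id_apply, LinearMap.coe_toContinuousLinearMap', LinearMap.coe_mk,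
              AddHom.coe_mk, smul_apply] }

theorem adjE_apply (α : (Fin k → ℂ) →L[ℝ] (Fin r ⊕ Fin s → ℂ)) (e : Fin r ⊕ Fin s → ℂ)
    (j : Fin k) : adjE k r s α e j = qE r s e (α (Pi.single j 1)) := rfl

/-- A real linear map which commutes with `i` is complex linear. -/
theorem map_smul_of_map_I {V V' : Type*} [AddCommGroup V] [Module ℂ V] [AddCommGroup V']
    [Module ℂ V'] (α : V →ₗ[ℝ] V') (hα : ∀ v, α (Complex.I • v) = Complex.I • α v) (c : ℂ)
    (v : V) : α (c • v) = c • α v := by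
  have h1 : c • v = c.re • v + c.im • Complex.I • v := by
    conv_lhs => rw [← Complex.re_add_im c]
    rw [add_smul, mul_smul, Complex.coe_smul, Complex.coe_smul]
  have h2 : c • α v = c.re • α v + c.im • Complex.I • α v := by
    conv_lhs => rw [← Complex.re_add_im c]
    rw [add_smul, mul_smul, Complex.coe_smul, Complex.coe_smul]
  rw [h1, h2, map_add, map_smul, map_smul, hα]

/-- `α w` is expanded in the standard basis, which needs complex linearity. The adjoint itself is
defined for all real linear maps, because the ambient charts of the complex isotropic Grassmannian
have to cover all nearby real subspaces. -/
theorem adjE_dotProduct (α : (Fin k → ℂ) →L[ℝ] (Fin r ⊕ Fin s → ℂ))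
    (hα : ∀ w, α (Complex.I • w) = Complex.I • α w) (e : Fin r ⊕ Fin s → ℂ) (w : Fin k → ℂ) :
    adjE k r s α e ⬝ᵥ w = qE r s e (α w) := by
  have h1 : w = ∑ j, w j • (Pi.single j (1 : ℂ) : Fin k → ℂ) := by
    ext i
    simp [Finset.sum_apply, Pi.single_apply]
  have h2 : α w = ∑ j, w j • α (Pi.single j 1) := by
    conv_lhs => rw [h1]
    rw [map_sum]
    exact Finset.sum_congr rfl fun j _ => map_smul_of_map_I α.toLinearMap hα _ _
  rw [h2, map_sum, dotProduct]
  exact Finset.sum_congr rfl fun j _ => by rw [map_smul, adjE_apply, smul_eq_mul, mul_comm]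

theorem adjE_I (α : (Fin k → ℂ) →L[ℝ] (Fin r ⊕ Fin s → ℂ)) (e : Fin r ⊕ Fin s → ℂ) :
    adjE k r s α (Complex.I • e) = Complex.I • adjE k r s α e := by
  ext j
  simp [adjE_apply]

/-- The graph `x ↦ x + i A x`. -/
def graphE (r s : ℕ) (A : (Fin r ⊕ Fin s → ℝ) →L[ℝ] (Fin r ⊕ Fin s → ℝ)) :
    (Fin r ⊕ Fin s → ℝ) →L[ℝ] (Fin r ⊕ Fin s → ℂ) :=
  realE r s + mulI _ ∘L realE r s ∘L A

theorem graphE_apply (A : (Fin r ⊕ Fin s → ℝ) →L[ℝ] (Fin r ⊕ Fin s → ℝ)) (x) :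
    graphE r s A x = realE r s x + Complex.I • realE r s (A x) := rfl

/-- The coordinate space: maps `ℂᵏ × ℝ^{r+s} → ℝ^{r+s} × ℂᵏ` in blocks. -/
abbrev Coord (k r s : ℕ) : Type :=
  ((Fin r ⊕ Fin s → ℝ) →L[ℝ] (Fin r ⊕ Fin s → ℝ)) × ((Fin k → ℂ) →L[ℝ] (Fin r ⊕ Fin s → ℝ)) ×
    ((Fin k → ℂ) →L[ℝ] (Fin k → ℂ)) × ((Fin r ⊕ Fin s → ℝ) →L[ℝ] (Fin k → ℂ))

/-- The block coordinates of a graph in terms of the parameters. -/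
def unstraighten (q : Coord k r s) : Coord k r s :=
  -- The middle coordinate of a vector of `vecE` has real part `y = u + β(iw)`. Substituting `u = y
  -- - β(iw)` displays the subspace as a graph over `(w, y)`, with these blocks.
  (q.1, q.2.1 - q.1 ∘L q.2.1 ∘L mulI (Fin k),
    q.2.2.1 - (2⁻¹ : ℝ) • adjE k r s (cxE k r s q.2.1) ∘L cxE k r s q.2.1 -
      (q.2.2.2 - adjE k r s (cxE k r s q.2.1) ∘L graphE r s q.1) ∘L q.2.1 ∘L mulI (Fin k),
    q.2.2.2 - adjE k r s (cxE k r s q.2.1) ∘L graphE r s q.1)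

/-- The real part of the complex linear map whose graph over `ℂᵏ` is contained in a graph. -/
def solveE (A : (Fin r ⊕ Fin s → ℝ) →L[ℝ] (Fin r ⊕ Fin s → ℝ))
    (β : (Fin k → ℂ) →L[ℝ] (Fin r ⊕ Fin s → ℝ)) : (Fin k → ℂ) →L[ℝ] (Fin r ⊕ Fin s → ℝ) :=
  -- If `β' = β - A β i` is the block of the graph, then `β' i - A β' = (1 + A²) β i`, so `β i` is
  -- recovered by inverting `1 + A²`.
  Ring.inverse (1 + A * A) ∘L (β ∘L mulI (Fin k) - A ∘L β)

/-- The parameters in terms of the block coordinates of a graph. -/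
def straighten (q : Coord k r s) : Coord k r s :=
  (q.1, q.2.1 + q.1 ∘L solveE q.1 q.2.1,
    q.2.2.1 + q.2.2.2 ∘L solveE q.1 q.2.1 +
      (2⁻¹ : ℝ) • adjE k r s (cxE k r s (q.2.1 + q.1 ∘L solveE q.1 q.2.1)) ∘L
        cxE k r s (q.2.1 + q.1 ∘L solveE q.1 q.2.1),
    q.2.2.2 + adjE k r s (cxE k r s (q.2.1 + q.1 ∘L solveE q.1 q.2.1)) ∘L graphE r s q.1)

theorem solveE_of_unstraighten {A : (Fin r ⊕ Fin s → ℝ) →L[ℝ] (Fin r ⊕ Fin s → ℝ)}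
    (hA : IsUnit (1 + A * A)) (β : (Fin k → ℂ) →L[ℝ] (Fin r ⊕ Fin s → ℝ)) :
    solveE A (β - A ∘L β ∘L mulI (Fin k)) = β ∘L mulI (Fin k) := by
  have h1 : (β - A ∘L β ∘L mulI (Fin k)) ∘L mulI (Fin k) - A ∘L (β - A ∘L β ∘L mulI (Fin k)) =
      (1 + A * A) ∘L (β ∘L mulI (Fin k)) := by
    ext w j
    simp [smul_smul]
    ring
  have h2 : Ring.inverse (1 + A * A) * (1 + A * A) = 1 := Ring.inverse_mul_cancel _ hA
  rw [solveE, h1, ← ContinuousLinearMap.comp_assoc]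
  change (Ring.inverse (1 + A * A) * (1 + A * A)) ∘L _ = _
  rw [h2]
  rfl

theorem unit_injective {A : (Fin r ⊕ Fin s → ℝ) →L[ℝ] (Fin r ⊕ Fin s → ℝ)}
    (hA : IsUnit A) {x y} (h : A x = A y) : x = y := by
  have h2 : Ring.inverse A * A = 1 := Ring.inverse_mul_cancel _ hA
  have h3 := congrArg (fun z => (Ring.inverse A) z) h
  have h4 (z) : Ring.inverse A (A z) = z := congrArg (fun L => L z) h2
  simpa only [h4] using h3

/-- After multiplication by `1 + A²`, which commutes with `A`, both sides become `β(iw) - A β(w)`,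
by the defining equation of `solveE` at `iw` and at `w`. -/
theorem solveE_mulI {A : (Fin r ⊕ Fin s → ℝ) →L[ℝ] (Fin r ⊕ Fin s → ℝ)}
    (hA : IsUnit (1 + A * A)) (β : (Fin k → ℂ) →L[ℝ] (Fin r ⊕ Fin s → ℝ)) :
    (β + A ∘L solveE A β) ∘L mulI (Fin k) = solveE A β := by
  have h2 : (1 + A * A) * Ring.inverse (1 + A * A) = 1 := Ring.mul_inverse_cancel _ hA
  have key (w) : (1 + A * A) (solveE A β w) = β (Complex.I • w) - A (β w) :=
    congrArg (fun L => L (β (Complex.I • w) - A (β w))) h2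
  ext1 w
  apply unit_injective hA
  have h3 : (1 + A * A) (A (solveE A β (Complex.I • w))) =
      A ((1 + A * A) (solveE A β (Complex.I • w))) := by simp
  have h4 : (β + A ∘L solveE A β) (mulI (Fin k) w) =
    β (Complex.I • w) + A (solveE A β (Complex.I • w)) := rfl
  change (1 + A * A) ((β + A ∘L solveE A β) (mulI (Fin k) w)) = _
  rw [key, h4, map_add, h3, key]
  simp [smul_smul]
  rw [sub_eq_add_neg]

theorem straighten_unstraighten {q : Coord k r s} (hq : IsUnit (1 + q.1 * q.1)) :
    straighten (unstraighten q) = q := by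
  obtain ⟨A, β, γ, δ⟩ := q
  have h1 := solveE_of_unstraighten (k := k) hq β
  have h2 : β - A ∘L β ∘L mulI (Fin k) + A ∘L β ∘L mulI (Fin k) = β := sub_add_cancel _ _
  simp only [straighten, unstraighten, h1, h2]
  refine Prod.ext rfl (Prod.ext rfl (Prod.ext ?_ (sub_add_cancel _ _)))
  change _ - _ - _ + _ + _ = γ
  rw [sub_add_cancel, sub_add_cancel]

theorem unstraighten_straighten {q : Coord k r s} (hq : IsUnit (1 + q.1 * q.1)) :
    unstraighten (straighten q) = q := by
  obtain ⟨A, β, γ, δ⟩ := q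
  have h1 := solveE_mulI (k := k) hq β
  simp only [straighten, unstraighten, h1]
  refine Prod.ext rfl (Prod.ext (add_sub_cancel_right _ _) (Prod.ext ?_ (add_sub_cancel_right _ _)))
  simp only [add_sub_cancel_right]

/-- The real form `diag(1, …, 1, -1, …, -1)`. -/
def qR (x y : Fin r ⊕ Fin s → ℝ) : ℝ := ∑ j, sgn j * (x j * y j)

/-- The neighbourhood of `0` in which the graph of a skew map has signature `(r, s)`. -/
def smallBall (r s : ℕ) : Set ((Fin r ⊕ Fin s → ℝ) →L[ℝ] (Fin r ⊕ Fin s → ℝ)) :=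
  -- The norm is the maximum norm, so the cardinality compares it with the sum of squares. The
  -- summand `1` forces `‖A‖ < 1`, which makes `1 + A²` invertible.
  {A | (Fintype.card (Fin r ⊕ Fin s) + 1 : ℝ) * ‖A‖ ^ 2 < 1}

theorem isOpen_smallBall : IsOpen (smallBall r s) :=
  isOpen_lt (by fun_prop) continuous_const

theorem zero_mem_smallBall : (0 : (Fin r ⊕ Fin s → ℝ) →L[ℝ] (Fin r ⊕ Fin s → ℝ)) ∈
    smallBall r s := by
  simp [smallBall]

theorem isUnit_of_mem_smallBall {A : (Fin r ⊕ Fin s → ℝ) →L[ℝ] (Fin r ⊕ Fin s → ℝ)}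
    (hA : A ∈ smallBall r s) : IsUnit (1 + A * A) := by
  have h1 : ‖A‖ ^ 2 < 1 := by
    have h2 : (Fintype.card (Fin r ⊕ Fin s) + 1 : ℝ) * ‖A‖ ^ 2 < 1 := hA
    have h3 : (0 : ℝ) ≤ (Fintype.card (Fin r ⊕ Fin s) : ℝ) * ‖A‖ ^ 2 := by positivity
    linarith
  have h2 : ‖-(A * A)‖ < 1 := by
    rw [norm_neg]
    exact (norm_mul_le A A).trans_lt (by rwa [← sq])
  have := isUnit_one_sub_of_norm_lt_one h2
  rwa [sub_neg_eq_add] at this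

theorem contDiff_unstraighten : ContDiff ℝ ∞ (unstraighten : Coord k r s → Coord k r s) := by
  have hA : ContDiff ℝ ∞ (fun q : Coord k r s => q.1) := contDiff_fst
  have hβ : ContDiff ℝ ∞ (fun q : Coord k r s => q.2.1) := contDiff_fst.comp contDiff_snd
  have hγ : ContDiff ℝ ∞ (fun q : Coord k r s => q.2.2.1) :=
    contDiff_fst.comp (contDiff_snd.comp contDiff_snd)
  have hδ : ContDiff ℝ ∞ (fun q : Coord k r s => q.2.2.2) :=
    contDiff_snd.comp (contDiff_snd.comp contDiff_snd)
  have hα : ContDiff ℝ ∞ (fun q : Coord k r s => cxE k r s q.2.1) := (cxE k r s).contDiff.comp hβ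
  have hadj : ContDiff ℝ ∞ (fun q : Coord k r s => adjE k r s (cxE k r s q.2.1)) :=
    (adjE k r s).contDiff.comp hα
  have hg : ContDiff ℝ ∞ (fun q : Coord k r s => graphE r s q.1) :=
    contDiff_const.add (contDiff_const.clm_comp (contDiff_const.clm_comp hA))
  have hβJ : ContDiff ℝ ∞ (fun q : Coord k r s => q.2.1 ∘L mulI (Fin k)) :=
    hβ.clm_comp contDiff_const
  have hδ' := hδ.sub (hadj.clm_comp hg)
  exact hA.prodMk ((hβ.sub (hA.clm_comp hβJ)).prodMk
    (((hγ.sub ((hadj.clm_comp hα).const_smul _)).sub (hδ'.clm_comp hβJ)).prodMk hδ'))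

theorem contDiffOn_straighten : ContDiffOn ℝ ∞ (straighten : Coord k r s → Coord k r s)
    {q | q.1 ∈ smallBall r s} := by
  set S : Set (Coord k r s) := {q | q.1 ∈ smallBall r s}
  have hA : ContDiffOn ℝ ∞ (fun q : Coord k r s => q.1) S := contDiff_fst.contDiffOn
  have hβ : ContDiffOn ℝ ∞ (fun q : Coord k r s => q.2.1) S :=
    (contDiff_fst.comp contDiff_snd).contDiffOn
  have hγ : ContDiffOn ℝ ∞ (fun q : Coord k r s => q.2.2.1) S :=
    (contDiff_fst.comp (contDiff_snd.comp contDiff_snd)).contDiffOn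
  have hδ : ContDiffOn ℝ ∞ (fun q : Coord k r s => q.2.2.2) S :=
    (contDiff_snd.comp (contDiff_snd.comp contDiff_snd)).contDiffOn
  -- This inverse is the only ingredient of `straighten` that is not polynomial in the blocks.
  have hinv : ContDiffOn ℝ ∞ (fun q : Coord k r s => Ring.inverse (1 + q.1 * q.1)) S := by
    intro q hq
    obtain ⟨u, hu⟩ := isUnit_of_mem_smallBall (show q.1 ∈ smallBall r s from hq)
    have h1 : ContDiffAt ℝ ∞ Ring.inverse (1 + q.1 * q.1) := by
      rw [← hu]
      exact contDiffAt_ringInverse ℝ u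
    have h2 : ContDiff ℝ ∞ (fun q : Coord k r s => 1 + q.1 * q.1) :=
      contDiff_const.add (contDiff_fst.clm_comp contDiff_fst)
    exact (h1.comp q h2.contDiffAt).contDiffWithinAt
  have hx : ContDiffOn ℝ ∞ (fun q : Coord k r s => solveE q.1 q.2.1) S :=
    hinv.clm_comp ((hβ.clm_comp contDiffOn_const).sub (hA.clm_comp hβ))
  have hβ' : ContDiffOn ℝ ∞ (fun q : Coord k r s => q.2.1 + q.1 ∘L solveE q.1 q.2.1) S :=
    hβ.add (hA.clm_comp hx)
  have hα := (cxE k r s).contDiff.comp_contDiffOn hβ'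
  have hadj := (adjE k r s).contDiff.comp_contDiffOn hα
  have hg : ContDiffOn ℝ ∞ (fun q : Coord k r s => graphE r s q.1) S :=
    contDiffOn_const.add (contDiffOn_const.clm_comp (contDiffOn_const.clm_comp hA))
  exact hA.prodMk (hβ'.prodMk (((hγ.add (hδ.clm_comp hx)).add
    ((hadj.clm_comp hα).const_smul _)).prodMk (hδ.add (hadj.clm_comp hg))))

/-- The straightening of the coordinates as a local homeomorphism. -/
def straightenHomeo (k r s : ℕ) : OpenPartialHomeomorph (Coord k r s) (Coord k r s) where
  toFun := straighten
  invFun := unstraighten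
  source := {q | q.1 ∈ smallBall r s}
  target := {q | q.1 ∈ smallBall r s}
  map_source' _ hq := hq
  map_target' _ hq := hq
  left_inv' _ hq := unstraighten_straighten (isUnit_of_mem_smallBall hq)
  right_inv' _ hq := straighten_unstraighten (isUnit_of_mem_smallBall hq)
  open_source := isOpen_smallBall.preimage continuous_fst
  open_target := isOpen_smallBall.preimage continuous_fst
  continuousOn_toFun := contDiffOn_straighten.continuousOn
  continuousOn_invFun := contDiff_unstraighten.continuous.continuousOn

/-- Transport of a local diffeomorphism along a linear isomorphism. -/
theorem conj_mem_contDiffGroupoid {E F : Type*} [NormedAddCommGroup E] [NormedSpace ℝ E]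
    [NormedAddCommGroup F] [NormedSpace ℝ F] (κ : E ≃L[ℝ] F) (D : OpenPartialHomeomorph F F)
    (h1 : ContDiffOn ℝ ∞ D D.source) (h2 : ContDiffOn ℝ ∞ D.symm D.target) :
    (κ.toHomeomorph.toOpenPartialHomeomorph ≫ₕ D ≫ₕ
      κ.symm.toHomeomorph.toOpenPartialHomeomorph) ∈ contDiffGroupoid ∞ 𝓘(ℝ, E) := by
  rw [mem_contDiffGroupoid_iff]
  constructor
  · refine (κ.symm.contDiff.comp_contDiffOn (h1.comp κ.contDiff.contDiffOn
      (s := κ ⁻¹' D.source) fun q hq => hq)).mono fun q hq => ?_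
    simpa using hq
  · refine (κ.symm.contDiff.comp_contDiffOn (h2.comp κ.contDiff.contDiffOn
      (s := κ ⁻¹' D.target) fun q hq => hq)).mono fun q hq => ?_
    simpa using hq

end Coordinates

/-! ### Charts of the Grassmannian centred at the standard point of a frame -/

section FrameCharts

variable {n k r s : ℕ} {b : LinearMap.BilinForm ℂ (CVec n)}

/-- A real linear coordinate system on `ℂᵏ × ℝ^{r+s}`. -/
def srcE (hn : r + s + 2 * k = n) : (Fin n → ℝ) ≃ₗ[ℝ] (Fin k → ℂ) × (Fin r ⊕ Fin s → ℝ) :=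
  LinearEquiv.ofFinrankEq _ _ (by
    simp [Module.finrank_pi_fintype, Complex.finrank_real_complex]
    omega)

/-- Block coordinates on the linear maps between the two halves of the model space. -/
def blockE (hn : r + s + 2 * k = n) : GrModel n n ≃L[ℝ] Coord k r s :=
  LinearEquiv.toContinuousLinearEquiv
    { toFun := fun φ =>
        let S := (srcE hn).toContinuousLinearEquiv
        let ψ := S.toContinuousLinearMap ∘L φ ∘L S.symm.toContinuousLinearMap
        (ContinuousLinearMap.snd ℝ _ _ ∘L ψ ∘L ContinuousLinearMap.inr ℝ _ _,
          ContinuousLinearMap.snd ℝ _ _ ∘L ψ ∘L ContinuousLinearMap.inl ℝ _ _,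
          ContinuousLinearMap.fst ℝ _ _ ∘L ψ ∘L ContinuousLinearMap.inl ℝ _ _,
          ContinuousLinearMap.fst ℝ _ _ ∘L ψ ∘L ContinuousLinearMap.inr ℝ _ _)
      invFun := fun q =>
        let S := (srcE hn).toContinuousLinearEquiv
        S.symm.toContinuousLinearMap ∘L
          ((q.2.2.1.coprod q.2.2.2).prod (q.2.1.coprod q.1)) ∘L S.toContinuousLinearMap
      map_add' := fun φ φ' => by
        refine Prod.ext ?_ (Prod.ext ?_ (Prod.ext ?_ ?_)) <;> ext <;> simp
      map_smul' := fun t φ => by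
        refine Prod.ext ?_ (Prod.ext ?_ (Prod.ext ?_ ?_)) <;> ext <;> simp
      left_inv := fun φ => by
        ext1 x
        apply (srcE hn).injective
        have h1 (p : (Fin k → ℂ) × (Fin r ⊕ Fin s → ℝ)) (L : _ →ₗ[ℝ] _) :
            (L (p.1, 0) + L (0, p.2) : (Fin k → ℂ) × (Fin r ⊕ Fin s → ℝ)) = L p := by
          rw [← map_add]
          simp
        have h2 := h1 (srcE hn x)
          ((srcE hn).toLinearMap ∘ₗ φ.toLinearMap ∘ₗ (srcE hn).symm.toLinearMap)
        simp only [LinearMap.comp_apply, LinearEquiv.coe_coe, LinearEquiv.symm_apply_apply] at h2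
        change srcE hn ((srcE hn).symm _) = _
        rw [LinearEquiv.apply_symm_apply]
        exact h2
      right_inv := fun q => by
        refine Prod.ext ?_ (Prod.ext ?_ (Prod.ext ?_ ?_)) <;> ext <;> simp }

theorem blockE_symm_apply (hn : r + s + 2 * k = n) (q : Coord k r s) (x : Fin n → ℝ) :
    (blockE hn).symm q x = (srcE hn).symm
      (q.2.2.1 (srcE hn x).1 + q.2.2.2 (srcE hn x).2, q.2.1 (srcE hn x).1 + q.1 (srcE hn x).2) :=
  rfl

/-- The decomposition of the model space into the standard point and a complement. -/
def asmE (k r s : ℕ) : (((Fin k → ℂ) × (Fin r ⊕ Fin s → ℝ)) × ((Fin k → ℂ) ×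
    (Fin r ⊕ Fin s → ℝ))) ≃ₗ[ℝ] Mdl k r s where
  toFun p := (p.1.1, realE r s p.1.2 + Complex.I • realE r s p.2.2, p.2.1)
  invFun z := ((z.1, fun j => (z.2.1 j).re), (z.2.2, fun j => (z.2.1 j).im))
  map_add' p p' := by
    refine Prod.ext rfl (Prod.ext ?_ rfl)
    simp
    abel
  map_smul' t p := by
    refine Prod.ext rfl (Prod.ext ?_ rfl)
    ext j
    simp
    ring
  left_inv p := by
    refine Prod.ext (Prod.ext rfl ?_) (Prod.ext rfl ?_) <;> ext j <;> simp
  right_inv z := by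
    refine Prod.ext rfl (Prod.ext ?_ rfl)
    ext j
    simp [mul_comm Complex.I]

theorem asmE_apply (w : Fin k → ℂ) (x : Fin r ⊕ Fin s → ℝ) (c : Fin k → ℂ)
    (y : Fin r ⊕ Fin s → ℝ) :
    asmE k r s ((w, x), (c, y)) = (w, realE r s x + Complex.I • realE r s y, c) := rfl

/-- The splitting of `ℂⁿ` attached to a frame. -/
def Frame.split (T : Frame b k r s) (hn : r + s + 2 * k = n) :
    ((Fin n → ℝ) × (Fin n → ℝ)) ≃ₗ[ℝ] CVec n :=
  ((srcE hn).prodCongr (srcE hn)).trans ((asmE k r s).trans (T.toEquiv.restrictScalars ℝ))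

theorem Frame.split_apply (T : Frame b k r s) (hn : r + s + 2 * k = n) (x y : Fin n → ℝ) :
    T.split hn (x, y) = T.toEquiv (asmE k r s (srcE hn x, srcE hn y)) := rfl

/-- The vectors of the subspace with parameters `q`, in the model space. -/
def vecE (q : Coord k r s) (w : Fin k → ℂ) (u : Fin r ⊕ Fin s → ℝ) : Mdl k r s :=
  (w, cxE k r s q.2.1 w + graphE r s q.1 u,
    q.2.2.1 w - (2⁻¹ : ℝ) • adjE k r s (cxE k r s q.2.1) (cxE k r s q.2.1 w) +
      (q.2.2.2 u - adjE k r s (cxE k r s q.2.1) (graphE r s q.1 u)))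

theorem vecE_add (q : Coord k r s) (w w' : Fin k → ℂ) (u u' : Fin r ⊕ Fin s → ℝ) :
    vecE q (w + w') (u + u') = vecE q w u + vecE q w' u' := by
  refine Prod.ext rfl (Prod.ext ?_ ?_) <;> simp [vecE] <;> abel

theorem vecE_smul (q : Coord k r s) (t : ℝ) (w : Fin k → ℂ) (u : Fin r ⊕ Fin s → ℝ) :
    vecE q (t • w) (t • u) = t • vecE q w u := by
  refine Prod.ext rfl (Prod.ext ?_ ?_)
  · simp [vecE]
  · simp [vecE, smul_sub, smul_comm t (2⁻¹ : ℝ)]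

/-- The subspace with parameters `q` relative to a frame. -/
def Frame.point (T : Frame b k r s) (hn : r + s + 2 * k = n) (q : Coord k r s) :
    Gr n n (CVec n) :=
  graphPoint (T.split hn) ((blockE hn).symm (unstraighten q))

theorem split_unstraighten (T : Frame b k r s) (hn : r + s + 2 * k = n) (q : Coord k r s)
    (x : Fin n → ℝ) :
    T.split hn (x, (blockE hn).symm (unstraighten q) x) = T.toEquiv (vecE q (srcE hn x).1
      ((srcE hn x).2 - q.2.1 (Complex.I • (srcE hn x).1))) := by
  rw [T.split_apply, blockE_symm_apply, LinearEquiv.apply_symm_apply]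
  obtain ⟨A, β, γ, δ⟩ := q
  generalize srcE hn x = p
  obtain ⟨w, y⟩ := p
  rw [asmE_apply]
  refine congrArg _ (Prod.ext rfl (Prod.ext ?_ ?_))
  · ext j
    simp [vecE, unstraighten, cxE_apply, graphE_apply]
    ring
  · ext j
    simp [vecE, unstraighten]
    ring

theorem Frame.mem_point (T : Frame b k r s) (hn : r + s + 2 * k = n) (q : Coord k r s)
    (v : CVec n) : v ∈ (T.point hn q).toSubmodule ↔ ∃ w u, T.toEquiv (vecE q w u) = v := by
  refine (mem_graphIn _ _ v).trans ⟨?_, ?_⟩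
  · rintro ⟨x, rfl⟩
    exact ⟨_, _, (split_unstraighten T hn q x).symm⟩
  · rintro ⟨w, u, rfl⟩
    refine ⟨(srcE hn).symm (w, u + q.2.1 (Complex.I • w)), ?_⟩
    rw [split_unstraighten, LinearEquiv.apply_symm_apply]
    simp

/-- The chart attached to a frame. -/
def Frame.chart (T : Frame b k r s) (hn : r + s + 2 * k = n) :
    OpenPartialHomeomorph (Gr n n (CVec n)) (GrModel n n) :=
  grChart (T.split hn) ≫ₕ ((blockE hn).toHomeomorph.toOpenPartialHomeomorph ≫ₕ
    straightenHomeo k r s ≫ₕ (blockE hn).symm.toHomeomorph.toOpenPartialHomeomorph)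

theorem Frame.chart_mem_maximalAtlas (T : Frame b k r s) (hn : r + s + 2 * k = n) :
    T.chart hn ∈ IsManifold.maximalAtlas 𝓘(ℝ, GrModel n n) ∞ (Gr n n (CVec n)) :=
  trans_mem_maximalAtlas (grChart_mem_maximalAtlas _) (conj_mem_contDiffGroupoid (blockE hn)
    (straightenHomeo k r s) contDiffOn_straighten contDiff_unstraighten.contDiffOn)

theorem Frame.mem_chart_source (T : Frame b k r s) (hn : r + s + 2 * k = n)
    (V : Gr n n (CVec n)) :
    V ∈ (T.chart hn).source ↔ ∃ q, q.1 ∈ smallBall r s ∧ T.point hn q = V := by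
  have h : V ∈ (T.chart hn).source ↔ V ∈ (grChart (T.split hn)).source ∧
      (blockE hn (grChart (T.split hn) V)).1 ∈ smallBall r s := by
    simp [Frame.chart, straightenHomeo]
  rw [h, mem_grChart_source]
  constructor
  · rintro ⟨⟨φ, rfl⟩, h2⟩
    rw [grChart_graphPoint] at h2
    refine ⟨straighten (blockE hn φ), h2, ?_⟩
    rw [Frame.point, unstraighten_straighten (isUnit_of_mem_smallBall h2)]
    simp
  · rintro ⟨q, hq, rfl⟩
    refine ⟨⟨_, rfl⟩, ?_⟩
    rw [Frame.point, grChart_graphPoint, ContinuousLinearEquiv.apply_symm_apply]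
    exact hq

theorem Frame.chart_point (T : Frame b k r s) (hn : r + s + 2 * k = n) {q : Coord k r s}
    (hq : q.1 ∈ smallBall r s) : T.chart hn (T.point hn q) = (blockE hn).symm q := by
  have h : T.chart hn (T.point hn q) =
      (blockE hn).symm (straighten (blockE hn (grChart (T.split hn) (T.point hn q)))) := rfl
  rw [h, Frame.point, grChart_graphPoint, ContinuousLinearEquiv.apply_symm_apply,
    straighten_unstraighten (isUnit_of_mem_smallBall hq)]

end FrameCharts

/-! ### The subspaces of `𝒪_(r,s)` near a frame -/

section Signature

variable {k r s : ℕ}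

/-- The imaginary part vanishes for all `u` and `u'` exactly if `A` is skew; the real part is then a
small perturbation of the standard form of signature `(r, s)`. -/
theorem qE_graphE (A : (Fin r ⊕ Fin s → ℝ) →L[ℝ] (Fin r ⊕ Fin s → ℝ))
    (u u' : Fin r ⊕ Fin s → ℝ) :
    qE r s (graphE r s A u) (graphE r s A u') =
      ((qR u u' - qR (A u) (A u') : ℝ) : ℂ) + ((qR (A u) u' + qR u (A u') : ℝ) : ℂ) *
        Complex.I := by
  simp only [qE_apply, qR, graphE_apply, Pi.add_apply, Pi.smul_apply, realE_apply, smul_eq_mul]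
  push_cast
  rw [← Finset.sum_sub_distrib, ← Finset.sum_add_distrib, Finset.sum_mul,
    ← Finset.sum_add_distrib]
  refine Finset.sum_congr rfl fun j _ => ?_
  linear_combination (sgn j : ℂ) * (A u j) * (A u' j) * Complex.I_mul_I

/-- The vectors of `vecE` are the images of `(w, u + iAu, γw + δu)` under the unipotent isometry
determined by the complex linear map `cxE β`, so `β` drops out of the form. This is the purpose of
the quadratic terms in the coordinates. -/
theorem mdlForm_vecE (q : Coord k r s) (w w' : Fin k → ℂ) (u u' : Fin r ⊕ Fin s → ℝ) :
    mdlForm k r s (vecE q w u) (vecE q w' u') =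
      w ⬝ᵥ q.2.2.1 w' + q.2.2.1 w ⬝ᵥ w' + (w ⬝ᵥ q.2.2.2 u' + q.2.2.2 u ⬝ᵥ w') +
        qE r s (graphE r s q.1 u) (graphE r s q.1 u') := by
  obtain ⟨A, β, γ, δ⟩ := q
  have hα := cxE_I (k := k) β
  rw [mdlForm_apply]
  simp only [vecE, dotProduct_add, dotProduct_sub, add_dotProduct, sub_dotProduct,
    dotProduct_smul, smul_dotProduct, map_add, LinearMap.add_apply,
    dotProduct_comm w (adjE k r s _ _), adjE_dotProduct _ hα]
  have h2 (z : ℂ) : (2⁻¹ : ℝ) • z = z / 2 := by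
    rw [Complex.real_smul]; push_cast; ring
  rw [h2, h2, qE_comm (cxE k r s β w') (cxE k r s β w),
    qE_comm (cxE k r s β w) (graphE r s A u')]
  ring

/-- Maximum norm and sum of squares differ at most by the number of coordinates, the factor in
`smallBall`. So the perturbation by `A` cannot destroy definiteness on the positive or on the
negative coordinate subspace. -/
theorem sum_sq_gt {A : (Fin r ⊕ Fin s → ℝ) →L[ℝ] (Fin r ⊕ Fin s → ℝ)} (hA : A ∈ smallBall r s)
    {u : Fin r ⊕ Fin s → ℝ} (hu : u ≠ 0) : |qR (A u) (A u)| < ∑ j, u j * u j := by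
  have hu' : 0 < ‖u‖ := norm_pos_iff.2 hu
  have hne : Nonempty (Fin r ⊕ Fin s) := by
    by_contra h
    rw [not_nonempty_iff] at h
    exact hu (Subsingleton.elim _ _)
  have h1 : ‖u‖ ^ 2 ≤ ∑ j, u j * u j := by
    have h0 : 0 ≤ ∑ j, u j * u j := Finset.sum_nonneg fun j _ => mul_self_nonneg _
    rw [← Real.le_sqrt (norm_nonneg u) h0, pi_norm_le_iff_of_nonneg (Real.sqrt_nonneg _)]
    intro j
    rw [Real.le_sqrt (norm_nonneg _) h0, Real.norm_eq_abs, sq_abs, sq]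
    exact Finset.single_le_sum (f := fun j => u j * u j) (fun i _ => mul_self_nonneg _)
      (Finset.mem_univ j)
  have h2 : |qR (A u) (A u)| ≤ Fintype.card (Fin r ⊕ Fin s) * (‖A‖ * ‖u‖) ^ 2 := by
    refine (Finset.abs_sum_le_sum_abs _ _).trans ?_
    rw [← nsmul_eq_mul, ← Finset.card_univ, ← Finset.sum_const]
    refine Finset.sum_le_sum fun j _ => ?_
    have h3 : |A u j| ≤ ‖A‖ * ‖u‖ := (norm_le_pi_norm (A u) j).trans (A.le_opNorm u)
    have h4 : |sgn j| = 1 := by rcases j with j | j <;> simp [sgn]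
    rw [abs_mul, h4, one_mul, abs_mul, sq]
    exact mul_le_mul h3 h3 (abs_nonneg _) ((abs_nonneg _).trans h3)
  have h5 : (Fintype.card (Fin r ⊕ Fin s) + 1 : ℝ) * ‖A‖ ^ 2 < 1 := hA
  have h6 : (Fintype.card (Fin r ⊕ Fin s) : ℝ) * (‖A‖ * ‖u‖) ^ 2 < ‖u‖ ^ 2 := by
    have h7 : (Fintype.card (Fin r ⊕ Fin s) : ℝ) * ‖A‖ ^ 2 < 1 := by nlinarith [sq_nonneg ‖A‖]
    have h8 : (0 : ℝ) < ‖u‖ ^ 2 := by positivity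
    calc _ = (Fintype.card (Fin r ⊕ Fin s) : ℝ) * ‖A‖ ^ 2 * ‖u‖ ^ 2 := by ring
      _ < 1 * ‖u‖ ^ 2 := mul_lt_mul_of_pos_right h7 h8
      _ = _ := one_mul _
  linarith

theorem qR_pos {A : (Fin r ⊕ Fin s → ℝ) →L[ℝ] (Fin r ⊕ Fin s → ℝ)} (hA : A ∈ smallBall r s)
    {x : Fin r → ℝ} (hx : x ≠ 0) :
    0 < qR (Sum.elim x (0 : Fin s → ℝ)) (Sum.elim x 0) -
      qR (A (Sum.elim x 0)) (A (Sum.elim x 0)) := by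
  have h0 : Sum.elim x (0 : Fin s → ℝ) ≠ 0 := fun h => hx (by
    ext i
    exact congrFun h (Sum.inl i))
  have h1 := sum_sq_gt hA h0
  have h2 : qR (Sum.elim x (0 : Fin s → ℝ)) (Sum.elim x 0) =
      ∑ j, Sum.elim x (0 : Fin s → ℝ) j * Sum.elim x (0 : Fin s → ℝ) j := by
    simp [qR, sgn]
  rw [h2]
  linarith [le_abs_self (qR (A (Sum.elim x 0)) (A (Sum.elim x 0)))]

theorem qR_neg {A : (Fin r ⊕ Fin s → ℝ) →L[ℝ] (Fin r ⊕ Fin s → ℝ)} (hA : A ∈ smallBall r s)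
    {x : Fin s → ℝ} (hx : x ≠ 0) :
    qR (Sum.elim (0 : Fin r → ℝ) x) (Sum.elim 0 x) -
      qR (A (Sum.elim 0 x)) (A (Sum.elim 0 x)) < 0 := by
  have h0 : Sum.elim (0 : Fin r → ℝ) x ≠ 0 := fun h => hx (by
    ext i
    exact congrFun h (Sum.inr i))
  have h1 := sum_sq_gt hA h0
  have h2 : qR (Sum.elim (0 : Fin r → ℝ) x) (Sum.elim 0 x) =
      -∑ j, Sum.elim (0 : Fin r → ℝ) x j * Sum.elim (0 : Fin r → ℝ) x j := by
    simp [qR, sgn]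
  rw [h2]
  linarith [neg_abs_le (qR (A (Sum.elim 0 x)) (A (Sum.elim 0 x)))]

/-- Positivity along `f` already makes `f` injective, so the signature can be bounded below by
parametrized subspaces. -/
theorem le_sigPos {M N : Type*} [AddCommGroup M] [Module ℝ M] [FiniteDimensional ℝ M]
    [AddCommGroup N] [Module ℝ N] (Q : QuadraticForm ℝ M) (f : N →ₗ[ℝ] M)
    (hf : ∀ x, x ≠ 0 → 0 < Q (f x)) : Module.finrank ℝ N ≤ sigPos Q := by
  have hinj : Function.Injective f := (injective_iff_map_eq_zero f).2 fun x hx => by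
    by_contra h
    have := hf x h
    rw [hx, map_zero] at this
    exact lt_irrefl _ this
  rw [← LinearMap.finrank_range_of_inj hinj]
  apply le_sigPos_of_posDef
  rintro ⟨_, x, rfl⟩ hx
  refine hf x fun h => hx ?_
  subst h
  exact Subtype.ext (map_zero f)

theorem le_sigNeg {M N : Type*} [AddCommGroup M] [Module ℝ M] [FiniteDimensional ℝ M]
    [AddCommGroup N] [Module ℝ N] (Q : QuadraticForm ℝ M) (f : N →ₗ[ℝ] M)
    (hf : ∀ x, x ≠ 0 → Q (f x) < 0) : Module.finrank ℝ N ≤ sigNeg Q := by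
  rw [← sigPos_neg]
  exact le_sigPos (-Q) f fun x hx => neg_pos.2 (hf x hx)

end Signature

/-! ### The linear conditions that cut out the orbit -/

section OrbitCharts

variable {n k r s : ℕ} {b : LinearMap.BilinForm ℂ (CVec n)}

theorem imForm_apply (v w : CVec n) : imForm b v w = (b v w).im := rfl

/-- The dot product is complex bilinear, and comparing the hypothesis at `w` and at `iw` against
standard basis vectors shows that complex linearity comes for free. -/
theorem map_I_of_skew {γ : (Fin k → ℂ) →L[ℝ] (Fin k → ℂ)}
    (h : ∀ w w', w ⬝ᵥ γ w' + γ w ⬝ᵥ w' = 0) (w : Fin k → ℂ) :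
    γ (Complex.I • w) = Complex.I • γ w := by
  ext j
  have h1 := h (Complex.I • w) (Pi.single j 1)
  have h2 := h w (Pi.single j 1)
  simp only [smul_dotProduct, dotProduct_single, mul_one, smul_eq_mul] at h1 h2
  simp only [Pi.smul_apply, smul_eq_mul]
  linear_combination h1 - Complex.I * h2

/-- The parameters of the points of `𝒪_(r,s)`. -/
def orbModel (k r s : ℕ) : Submodule ℝ (Coord k r s) where
  carrier := {q | (∀ u u', qR (q.1 u) u' + qR u (q.1 u') = 0) ∧
    (∀ w w', w ⬝ᵥ q.2.2.1 w' + q.2.2.1 w ⬝ᵥ w' = 0) ∧ q.2.2.2 = 0}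
  zero_mem' := by simp [qR]
  add_mem' := by
    rintro q q' ⟨h1, h2, h3⟩ ⟨h1', h2', h3'⟩
    refine ⟨fun u u' => ?_, fun w w' => ?_, ?_⟩
    · have e1 (x x' y : Fin r ⊕ Fin s → ℝ) : qR (x + x') y = qR x y + qR x' y := by
        simp [qR, add_mul, mul_add, Finset.sum_add_distrib]
      have e2 (x y y' : Fin r ⊕ Fin s → ℝ) : qR x (y + y') = qR x y + qR x y' := by
        simp [qR, mul_add, Finset.sum_add_distrib]
      simp only [Prod.fst_add, add_apply, e1, e2]
      linear_combination h1 u u' + h1' u u'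
    · simp only [Prod.snd_add, Prod.fst_add, add_apply, dotProduct_add, add_dotProduct]
      linear_combination h2 w w' + h2' w w'
    · simp [h3, h3']
  smul_mem' := by
    rintro t q ⟨h1, h2, h3⟩
    refine ⟨fun u u' => ?_, fun w w' => ?_, ?_⟩
    · have e1 (x y : Fin r ⊕ Fin s → ℝ) : qR (t • x) y = t * qR x y := by
        simp only [qR, Pi.smul_apply, smul_eq_mul, Finset.mul_sum]
        exact Finset.sum_congr rfl fun j _ => by ring
      have e2 (x y : Fin r ⊕ Fin s → ℝ) : qR x (t • y) = t * qR x y := by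
        simp only [qR, Pi.smul_apply, smul_eq_mul, Finset.mul_sum]
        exact Finset.sum_congr rfl fun j _ => by ring
      simp only [Prod.smul_fst, smul_apply, e1, e2]
      linear_combination t * h1 u u'
    · simp only [Prod.smul_snd, Prod.smul_fst, smul_apply, dotProduct_smul, smul_dotProduct]
      rw [← smul_add, h2, smul_zero]
    · simp [h3]

theorem mem_orbModel {q : Coord k r s} : q ∈ orbModel k r s ↔
    (∀ u u', qR (q.1 u) u' + qR u (q.1 u') = 0) ∧
    (∀ w w', w ⬝ᵥ q.2.2.1 w' + q.2.2.1 w ⬝ᵥ w' = 0) ∧ q.2.2.2 = 0 := Iff.rfl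

/-- The linear parametrization of a point. -/
def Frame.param (T : Frame b k r s) (hn : r + s + 2 * k = n) (q : Coord k r s) :
    (Fin k → ℂ) × (Fin r ⊕ Fin s → ℝ) →ₗ[ℝ] (T.point hn q).toSubmodule where
  toFun p := ⟨T.toEquiv (vecE q p.1 p.2), (T.mem_point hn q _).2 ⟨p.1, p.2, rfl⟩⟩
  map_add' p p' := Subtype.ext (by
    change T.toEquiv (vecE q (p.1 + p'.1) (p.2 + p'.2)) = _ + _
    rw [vecE_add, map_add])
  map_smul' t p := Subtype.ext (by
    change T.toEquiv (vecE q (t • p.1) (t • p.2)) = t • T.toEquiv (vecE q p.1 p.2)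
    rw [vecE_smul]
    exact (T.toEquiv.restrictScalars ℝ).map_smul t _)

theorem Frame.quadratic_param (T : Frame b k r s) (hn : r + s + 2 * k = n) (q : Coord k r s)
    (hδ : q.2.2.2 = 0) (p) :
    (reForm b).toQuadraticMap.restrict (T.point hn q).toSubmodule (T.param hn q p) =
      (p.1 ⬝ᵥ q.2.2.1 p.1 + q.2.2.1 p.1 ⬝ᵥ p.1).re + (qR p.2 p.2 - qR (q.1 p.2) (q.1 p.2)) := by
  change (b (T.toEquiv (vecE q p.1 p.2)) (T.toEquiv (vecE q p.1 p.2))).re = _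
  rw [T.map_form, mdlForm_vecE, hδ, qE_graphE]
  simp

/-- Three lower bounds suffice: `r` and `s` for the definite parts, and `2k` for the radical, which
contains the image of ℂᵏ. They add up to `n`, so by Sylvester's law they are equalities. -/
theorem Frame.point_mem_orb (T : Frame b k r s) (hn : r + s + 2 * k = n) {q : Coord k r s}
    (hq : q ∈ orbModel k r s) (hA : q.1 ∈ smallBall r s) : T.point hn q ∈ orb b r s := by
  obtain ⟨h1, h2, h3⟩ := hq
  have hform (w w' u u') : b (T.toEquiv (vecE q w u)) (T.toEquiv (vecE q w' u')) =
      ((qR u u' - qR (q.1 u) (q.1 u') : ℝ) : ℂ) := by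
    rw [T.map_form, mdlForm_vecE, h3, h2, qE_graphE, h1]
    simp
  set Q := (reForm b).toQuadraticMap.restrict (T.point hn q).toSubmodule with hQ
  have hpos : r ≤ sigPos Q := by
    have := le_sigPos Q (T.param hn q ∘ₗ LinearMap.inr ℝ _ _ ∘ₗ
      { toFun := fun x : Fin r → ℝ => Sum.elim x (0 : Fin s → ℝ)
        map_add' := fun x y => by ext (j | j) <;> simp
        map_smul' := fun t x => by ext (j | j) <;> simp }) (fun x hx => by
          rw [LinearMap.comp_apply, T.quadratic_param hn q h3]
          simpa using qR_pos hA hx)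
    simpa using this
  have hneg : s ≤ sigNeg Q := by
    have := le_sigNeg Q (T.param hn q ∘ₗ LinearMap.inr ℝ _ _ ∘ₗ
      { toFun := fun x : Fin s → ℝ => Sum.elim (0 : Fin r → ℝ) x
        map_add' := fun x y => by ext (j | j) <;> simp
        map_smul' := fun t x => by ext (j | j) <;> simp }) (fun x hx => by
          rw [LinearMap.comp_apply, T.quadratic_param hn q h3]
          simpa using qR_neg hA hx)
    simpa using this
  have hrad : 2 * k ≤ Module.finrank ℝ Q.radical := by
    let f : (Fin k → ℂ) →ₗ[ℝ] Q.radical :=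
      LinearMap.codRestrict _ (T.param hn q ∘ₗ LinearMap.inl ℝ _ _) (fun w => by
        rw [QuadraticMap.mem_radical_iff']
        refine ⟨?_, ?_⟩
        · rw [LinearMap.comp_apply, T.quadratic_param hn q h3]
          simp [h2, qR]
        · rintro ⟨v, hv⟩
          obtain ⟨w', u', rfl⟩ := (T.mem_point hn q v).1 hv
          have h5 (p) : Q p = (b p.1 p.1).re := rfl
          rw [h5, h5]
          change (b (T.toEquiv (vecE q w 0) + _) (T.toEquiv (vecE q w 0) + _)).re = _
          simp only [map_add, LinearMap.add_apply, hform]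
          simp [qR])
    have hf : Function.Injective f := by
      intro w w' h
      have h5 : T.toEquiv (vecE q w 0) = T.toEquiv (vecE q w' 0) :=
        congrArg (fun z : Q.radical => ((z : (T.point hn q).toSubmodule) : CVec n)) h
      exact congrArg Prod.fst (T.toEquiv.injective h5)
    have := LinearMap.finrank_le_finrank_of_injective hf
    simp [Module.finrank_pi_fintype, Complex.finrank_real_complex] at this
    omega
  have hsum := QuadraticForm.sigPos_add_sigNeg_add_radical (Q := Q)
  rw [(T.point hn q).finrank_eq] at hsum
  have hp : sigPos Q = r := by omega
  have hs : sigNeg Q = s := by omega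
  refine ⟨?_, hp, hs⟩
  intro v hv v' hv'
  obtain ⟨w, u, rfl⟩ := (T.mem_point hn q v).1 hv
  obtain ⟨w', u', rfl⟩ := (T.mem_point hn q v').1 hv'
  rw [imForm_apply, hform, Complex.ofReal_im]

/-- Isotropy for Im b makes `A` skew, kills `δ`, and gives the imaginary half of the condition on
`γ`. The real half is forced by the signature: a vector `w` at which the quadratic form of `γ` has
nonzero real part would enlarge a definite subspace of dimension `r` or `s` by one. -/
theorem Frame.mem_orbModel_of_point_mem (T : Frame b k r s) (hn : r + s + 2 * k = n)
    {q : Coord k r s} (hq : T.point hn q ∈ orb b r s) (hA : q.1 ∈ smallBall r s) :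
    q ∈ orbModel k r s := by
  obtain ⟨hiso, hpos, hneg⟩ := hq
  have him (w w' u u') : (w ⬝ᵥ q.2.2.1 w' + q.2.2.1 w ⬝ᵥ w' +
      (w ⬝ᵥ q.2.2.2 u' + q.2.2.2 u ⬝ᵥ w')).im + (qR (q.1 u) u' + qR u (q.1 u')) = 0 := by
    have := hiso _ ((T.mem_point hn q _).2 ⟨w, u, rfl⟩) _ ((T.mem_point hn q _).2 ⟨w', u', rfl⟩)
    rw [imForm_apply, T.map_form, mdlForm_vecE, qE_graphE, Complex.add_im] at this
    simpa using this
  have h1 (u u') : qR (q.1 u) u' + qR u (q.1 u') = 0 := by simpa using him 0 0 u u'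
  have h3 : q.2.2.2 = 0 := by
    ext u j
    have e1 := him (Pi.single j 1) 0 0 u
    have e2 := him (Pi.single j Complex.I) 0 0 u
    simp [qR] at e1 e2
    exact Complex.ext e2 e1
  have h4 (w) : (w ⬝ᵥ q.2.2.1 w + q.2.2.1 w ⬝ᵥ w).re = 0 := by
    rcases lt_trichotomy (w ⬝ᵥ q.2.2.1 w + q.2.2.1 w ⬝ᵥ w).re 0 with h | h | h
    · exfalso
      have := le_sigNeg ((reForm b).toQuadraticMap.restrict (T.point hn q).toSubmodule)
        (T.param hn q ∘ₗ LinearMap.prodMap (LinearMap.toSpanSingleton ℝ _ w)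
          { toFun := fun x : Fin s → ℝ => Sum.elim (0 : Fin r → ℝ) x
            map_add' := fun x y => by ext (j | j) <;> simp
            map_smul' := fun t x => by ext (j | j) <;> simp }) (fun x hx => by
          rw [LinearMap.comp_apply, T.quadratic_param hn q h3]
          obtain ⟨t, x⟩ := x
          simp only [LinearMap.prodMap_apply, LinearMap.toSpanSingleton_apply, LinearMap.coe_mk,
            AddHom.coe_mk, map_smul, dotProduct_smul, smul_dotProduct, smul_smul, ← smul_add]
          rw [Complex.real_smul, Complex.re_ofReal_mul]
          by_cases hx0 : x = 0
          · have ht : t ≠ 0 := fun h => hx (by rw [h, hx0]; rfl)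
            have ht' : 0 < t * t := mul_self_pos.2 ht
            have h0 : Sum.elim (0 : Fin r → ℝ) (0 : Fin s → ℝ) = 0 := by ext (j | j) <;> rfl
            rw [hx0, h0]
            simp only [map_zero, qR, Pi.zero_apply, mul_zero, Finset.sum_const_zero, sub_zero,
              add_zero]
            nlinarith
          · have h6 := qR_neg hA hx0
            nlinarith [mul_self_nonneg t])
      rw [hneg] at this
      simp at this
    · exact h
    · exfalso
      have := le_sigPos ((reForm b).toQuadraticMap.restrict (T.point hn q).toSubmodule)
        (T.param hn q ∘ₗ LinearMap.prodMap (LinearMap.toSpanSingleton ℝ _ w)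
          { toFun := fun x : Fin r → ℝ => Sum.elim x (0 : Fin s → ℝ)
            map_add' := fun x y => by ext (j | j) <;> simp
            map_smul' := fun t x => by ext (j | j) <;> simp }) (fun x hx => by
          rw [LinearMap.comp_apply, T.quadratic_param hn q h3]
          obtain ⟨t, x⟩ := x
          simp only [LinearMap.prodMap_apply, LinearMap.toSpanSingleton_apply, LinearMap.coe_mk,
            AddHom.coe_mk, map_smul, dotProduct_smul, smul_dotProduct, smul_smul, ← smul_add]
          rw [Complex.real_smul, Complex.re_ofReal_mul]
          by_cases hx0 : x = 0
          · have ht : t ≠ 0 := fun h => hx (by rw [h, hx0]; rfl)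
            have ht' : 0 < t * t := mul_self_pos.2 ht
            have h0 : Sum.elim (0 : Fin r → ℝ) (0 : Fin s → ℝ) = 0 := by ext (j | j) <;> rfl
            rw [hx0, h0]
            simp only [map_zero, qR, Pi.zero_apply, mul_zero, Finset.sum_const_zero, sub_zero,
              add_zero]
            nlinarith
          · have h6 := qR_pos hA hx0
            nlinarith [mul_self_nonneg t])
      rw [hpos] at this
      simp at this
  -- The real part follows from `h4` by polarization, the imaginary part from isotropy.
  refine ⟨h1, fun w w' => Complex.ext ?_ ?_, h3⟩
  · have e := h4 (w + w')
    have e1 := h4 w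
    have e2 := h4 w'
    simp only [map_add, dotProduct_add, add_dotProduct, dotProduct_comm (q.2.2.1 w'),
      dotProduct_comm (q.2.2.1 w)] at e e1 e2 ⊢
    simp only [Complex.add_re, Complex.zero_re] at e e1 e2 ⊢
    linarith
  · have := him w w' 0 0
    simpa [qR] using this

/-- The complex part `V ∩ iV` of a point of `𝒪_(r,s)` in coordinates. -/
theorem Frame.complexPart_point (T : Frame b k r s) (hn : r + s + 2 * k = n) {q : Coord k r s}
    (hq : q ∈ orbModel k r s) (hA : q.1 ∈ smallBall r s) (v : CVec n) :
    (v ∈ (T.point hn q).toSubmodule ∧ Complex.I • v ∈ (T.point hn q).toSubmodule) ↔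
      ∃ w, T.toEquiv (vecE q w 0) = v := by
  obtain ⟨h1, h2, h3⟩ := hq
  constructor
  · rintro ⟨hv, hv'⟩
    obtain ⟨w, u, rfl⟩ := (T.mem_point hn q v).1 hv
    obtain ⟨w', u', h⟩ := (T.mem_point hn q _).1 hv'
    rw [← map_smul] at h
    have h4 := T.toEquiv.injective h
    have hw : w' = Complex.I • w := congrArg Prod.fst h4
    have h5 : cxE k r s q.2.1 w' + graphE r s q.1 u' =
        Complex.I • (cxE k r s q.2.1 w + graphE r s q.1 u) := congrArg (fun z => z.2.1) h4
    rw [hw, cxE_I, smul_add, add_left_cancel_iff] at h5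
    -- Multiplication by `i` has to map `u + iAu` to another point of the same graph. This forces `u
    -- = -A²u`, hence `u = 0`, as `1 + A²` is invertible.
    have h6 : u' = -q.1 u ∧ q.1 u' = u := by
      constructor <;> ext j
      · simpa [graphE_apply] using congrArg Complex.re (congrFun h5 j)
      · simpa [graphE_apply] using congrArg Complex.im (congrFun h5 j)
    have h7 : u = 0 := by
      apply unit_injective (isUnit_of_mem_smallBall hA)
      rw [map_zero]
      change u + q.1 (q.1 u) = 0
      have h8 := h6.2
      rw [h6.1, map_neg] at h8
      rw [add_eq_zero_iff_eq_neg, h8]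
    exact ⟨w, by rw [h7]⟩
  · rintro ⟨w, rfl⟩
    refine ⟨(T.mem_point hn q _).2 ⟨w, 0, rfl⟩, (T.mem_point hn q _).2 ⟨Complex.I • w, 0, ?_⟩⟩
    rw [← map_smul]
    congr 1
    refine Prod.ext rfl (Prod.ext ?_ ?_)
    · simp [vecE, cxE_I]
    · simp only [vecE, map_zero, sub_zero, add_zero, Prod.smul_snd]
      rw [map_I_of_skew h2, cxE_I, adjE_I, smul_sub, smul_comm (2⁻¹ : ℝ) Complex.I]

end OrbitCharts

/-! ### The complex isotropic Grassmannian near a frame -/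

section ComplexIsotropic

variable {n k r s : ℕ} {b : LinearMap.BilinForm ℂ (CVec n)}

/-- The parameters of real `2k`-dimensional subspaces near a frame. -/
abbrev CCoord (k r s : ℕ) : Type :=
  ((Fin k → ℂ) →L[ℝ] (Fin r ⊕ Fin s → ℂ)) × ((Fin k → ℂ) →L[ℝ] (Fin k → ℂ))

/-- The quadratic change of coordinates which makes the isotropy condition linear. -/
def quadC (t : ℝ) (q : CCoord k r s) : CCoord k r s :=
  (q.1, q.2 + t • adjE k r s q.1 ∘L q.1)

theorem quadC_quadC (t t' : ℝ) (ht : t + t' = 0) (q : CCoord k r s) :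
    quadC t (quadC t' q) = q := by
  obtain rfl : t' = -t := by linarith
  refine Prod.ext rfl ?_
  ext w j
  simp [quadC]

theorem contDiff_quadC (t : ℝ) : ContDiff ℝ ∞ (quadC t : CCoord k r s → CCoord k r s) :=
  contDiff_fst.prodMk (contDiff_snd.add
    ((((adjE k r s).contDiff.comp contDiff_fst).clm_comp contDiff_fst).const_smul _))

/-- The quadratic change of coordinates as a homeomorphism. -/
def quadHomeo (k r s : ℕ) : OpenPartialHomeomorph (CCoord k r s) (CCoord k r s) :=
  Homeomorph.toOpenPartialHomeomorph
    { toFun := quadC 2⁻¹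
      invFun := quadC (-2⁻¹)
      left_inv := quadC_quadC _ _ (neg_add_cancel _)
      right_inv := quadC_quadC _ _ (add_neg_cancel _)
      continuous_toFun := (contDiff_quadC _).continuous
      continuous_invFun := (contDiff_quadC _).continuous }

/-- A real linear coordinate system on `ℂᵏ`. -/
def srcC (k : ℕ) : (Fin (2 * k) → ℝ) ≃ₗ[ℝ] (Fin k → ℂ) :=
  LinearEquiv.ofFinrankEq _ _ (by
    simp [Module.finrank_pi_fintype, Complex.finrank_real_complex, mul_comm])

/-- A real linear coordinate system on `ℂ^{r+s} × ℂᵏ`. -/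
def tgtC (hn : r + s + 2 * k = n) :
    (Fin (2 * (n - k)) → ℝ) ≃ₗ[ℝ] (Fin r ⊕ Fin s → ℂ) × (Fin k → ℂ) :=
  LinearEquiv.ofFinrankEq _ _ (by
    simp [Module.finrank_pi_fintype, Complex.finrank_real_complex]
    omega)

/-- Block coordinates on the model space of the Grassmannian of real `2k`-dimensional
subspaces. -/
def blockC (hn : r + s + 2 * k = n) : GrModel (2 * k) (2 * (n - k)) ≃L[ℝ] CCoord k r s :=
  LinearEquiv.toContinuousLinearEquiv
    { toFun := fun φ =>
        let ψ := (tgtC hn).toContinuousLinearEquiv.toContinuousLinearMap ∘L φ ∘L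
          (srcC k).toContinuousLinearEquiv.symm.toContinuousLinearMap
        (ContinuousLinearMap.fst ℝ _ _ ∘L ψ, ContinuousLinearMap.snd ℝ _ _ ∘L ψ)
      invFun := fun q => (tgtC hn).toContinuousLinearEquiv.symm.toContinuousLinearMap ∘L
        (q.1.prod q.2) ∘L (srcC k).toContinuousLinearEquiv.toContinuousLinearMap
      map_add' := fun φ φ' => by refine Prod.ext ?_ ?_ <;> ext <;> simp
      map_smul' := fun t φ => by refine Prod.ext ?_ ?_ <;> ext <;> simp
      left_inv := fun φ => by
        ext1 x
        apply (tgtC hn).injective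
        change tgtC hn ((tgtC hn).symm (tgtC hn (φ ((srcC k).symm (srcC k x))))) = _
        simp
      right_inv := fun q => by refine Prod.ext ?_ ?_ <;> ext <;> simp }

theorem blockC_symm_apply (hn : r + s + 2 * k = n) (q : CCoord k r s) (x : Fin (2 * k) → ℝ) :
    (blockC hn).symm q x = (tgtC hn).symm (q.1 (srcC k x), q.2 (srcC k x)) := rfl

/-- The splitting of `ℂⁿ` into an isotropic subspace and a complement. -/
def Frame.splitC (T : Frame b k r s) (hn : r + s + 2 * k = n) :
    ((Fin (2 * k) → ℝ) × (Fin (2 * (n - k)) → ℝ)) ≃ₗ[ℝ] CVec n :=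
  ((srcC k).prodCongr (tgtC hn)).trans (T.toEquiv.restrictScalars ℝ)

theorem Frame.splitC_apply (T : Frame b k r s) (hn : r + s + 2 * k = n) (x y) :
    T.splitC hn (x, y) = T.toEquiv (srcC k x, tgtC hn y) := rfl

/-- The vectors of the subspace with parameters `q`, in the model space. -/
def vecC (q : CCoord k r s) (w : Fin k → ℂ) : Mdl k r s :=
  (w, q.1 w, q.2 w - (2⁻¹ : ℝ) • adjE k r s q.1 (q.1 w))

/-- The complex part of a point consists of the vectors with `u = 0`. This identity therefore makes
`V ↦ V ∩ iV` linear in the two coordinate systems. -/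
theorem vecE_zero_right (q : Coord k r s) (w : Fin k → ℂ) :
    vecE q w 0 = vecC (cxE k r s q.2.1, q.2.2.1) w := by
  simp [vecE, vecC]

/-- The real `2k`-dimensional subspace with parameters `q` relative to a frame. -/
def Frame.pointC (T : Frame b k r s) (hn : r + s + 2 * k = n) (q : CCoord k r s) :
    Gr (2 * k) (2 * (n - k)) (CVec n) :=
  graphPoint (T.splitC hn) ((blockC hn).symm (quadC (-2⁻¹) q))

theorem splitC_quadC (T : Frame b k r s) (hn : r + s + 2 * k = n) (q : CCoord k r s)
    (x : Fin (2 * k) → ℝ) :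
    T.splitC hn (x, (blockC hn).symm (quadC (-2⁻¹) q) x) = T.toEquiv (vecC q (srcC k x)) := by
  rw [T.splitC_apply, blockC_symm_apply, LinearEquiv.apply_symm_apply]
  refine congrArg _ (Prod.ext rfl (Prod.ext rfl ?_))
  simp [vecC, quadC, sub_eq_add_neg]

theorem Frame.mem_pointC (T : Frame b k r s) (hn : r + s + 2 * k = n) (q : CCoord k r s)
    (v : CVec n) : v ∈ (T.pointC hn q).toSubmodule ↔ ∃ w, T.toEquiv (vecC q w) = v := by
  refine (mem_graphIn _ _ v).trans ⟨?_, ?_⟩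
  · rintro ⟨x, rfl⟩
    exact ⟨_, (splitC_quadC T hn q x).symm⟩
  · rintro ⟨w, rfl⟩
    refine ⟨(srcC k).symm w, ?_⟩
    rw [splitC_quadC, LinearEquiv.apply_symm_apply]

/-- The chart of the Grassmannian of real `2k`-dimensional subspaces attached to a frame. -/
def Frame.chartC (T : Frame b k r s) (hn : r + s + 2 * k = n) :
    OpenPartialHomeomorph (Gr (2 * k) (2 * (n - k)) (CVec n)) (GrModel (2 * k) (2 * (n - k))) :=
  grChart (T.splitC hn) ≫ₕ ((blockC hn).toHomeomorph.toOpenPartialHomeomorph ≫ₕ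
    quadHomeo k r s ≫ₕ (blockC hn).symm.toHomeomorph.toOpenPartialHomeomorph)

theorem Frame.chartC_mem_maximalAtlas (T : Frame b k r s) (hn : r + s + 2 * k = n) :
    T.chartC hn ∈ IsManifold.maximalAtlas 𝓘(ℝ, GrModel (2 * k) (2 * (n - k))) ∞
      (Gr (2 * k) (2 * (n - k)) (CVec n)) :=
  trans_mem_maximalAtlas (grChart_mem_maximalAtlas _) (conj_mem_contDiffGroupoid (blockC hn)
    (quadHomeo k r s) (contDiff_quadC _).contDiffOn (contDiff_quadC _).contDiffOn)

theorem Frame.mem_chartC_source (T : Frame b k r s) (hn : r + s + 2 * k = n)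
    (V : Gr (2 * k) (2 * (n - k)) (CVec n)) :
    V ∈ (T.chartC hn).source ↔ ∃ q, T.pointC hn q = V := by
  have h : V ∈ (T.chartC hn).source ↔ V ∈ (grChart (T.splitC hn)).source := by
    simp [Frame.chartC, quadHomeo]
  rw [h, mem_grChart_source]
  constructor
  · rintro ⟨φ, rfl⟩
    refine ⟨quadC 2⁻¹ (blockC hn φ), ?_⟩
    rw [Frame.pointC, quadC_quadC _ _ (neg_add_cancel _)]
    simp
  · rintro ⟨q, rfl⟩
    exact ⟨_, rfl⟩

theorem Frame.chartC_point (T : Frame b k r s) (hn : r + s + 2 * k = n) (q : CCoord k r s) :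
    T.chartC hn (T.pointC hn q) = (blockC hn).symm q := by
  have h : T.chartC hn (T.pointC hn q) =
      (blockC hn).symm (quadC 2⁻¹ (blockC hn (grChart (T.splitC hn) (T.pointC hn q)))) := rfl
  rw [h, Frame.pointC, grChart_graphPoint, ContinuousLinearEquiv.apply_symm_apply,
    quadC_quadC _ _ (add_neg_cancel _)]

/-- The parameters of the complex isotropic subspaces. -/
def isoModel (k r s : ℕ) : Submodule ℝ (CCoord k r s) where
  carrier := {q | (∀ w, q.1 (Complex.I • w) = Complex.I • q.1 w) ∧
    ∀ w w', w ⬝ᵥ q.2 w' + q.2 w ⬝ᵥ w' = 0}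
  zero_mem' := by simp
  add_mem' := by
    rintro q q' ⟨h1, h2⟩ ⟨h1', h2'⟩
    refine ⟨fun w => ?_, fun w w' => ?_⟩
    · simp only [Prod.fst_add, add_apply, h1, h1', smul_add]
    · simp only [Prod.snd_add, add_apply, dotProduct_add, add_dotProduct]
      linear_combination h2 w w' + h2' w w'
  smul_mem' := by
    rintro t q ⟨h1, h2⟩
    refine ⟨fun w => ?_, fun w w' => ?_⟩
    · simp only [Prod.smul_fst, smul_apply, h1]
      rw [smul_comm]
    · simp only [Prod.smul_snd, smul_apply, dotProduct_smul, smul_dotProduct]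
      rw [← smul_add, h2, smul_zero]

theorem mdlForm_vecC {q : CCoord k r s} (hq : ∀ w, q.1 (Complex.I • w) = Complex.I • q.1 w)
    (w w' : Fin k → ℂ) :
    mdlForm k r s (vecC q w) (vecC q w') = w ⬝ᵥ q.2 w' + q.2 w ⬝ᵥ w' := by
  rw [mdlForm_apply]
  simp only [vecC, dotProduct_sub, sub_dotProduct,
    dotProduct_smul, smul_dotProduct, 
    dotProduct_comm w (adjE k r s _ _), adjE_dotProduct _ hq]
  have h2 (z : ℂ) : (2⁻¹ : ℝ) • z = z / 2 := by
    rw [Complex.real_smul]; push_cast; ring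
  rw [h2, h2, qE_comm (q.1 w') (q.1 w)]
  ring

theorem vecC_I {q : CCoord k r s} (hq : q ∈ isoModel k r s) (w : Fin k → ℂ) :
    vecC q (Complex.I • w) = Complex.I • vecC q w := by
  refine Prod.ext rfl (Prod.ext (hq.1 w) ?_)
  simp only [vecC, Prod.smul_snd]
  rw [map_I_of_skew hq.2, hq.1, adjE_I, smul_sub, smul_comm (2⁻¹ : ℝ) Complex.I]

/-- Closure under `i` says that the first block is complex linear. Then the quadratic terms cancel
in the form, and isotropy says that the second block is skew, which includes its complex linearity.
-/
theorem Frame.pointC_mem_cIgr (T : Frame b k r s) (hn : r + s + 2 * k = n) {q : CCoord k r s} :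
    T.pointC hn q ∈ cIgr b k ↔ q ∈ isoModel k r s := by
  constructor
  · rintro ⟨W, hW, -, hiso⟩
    have hmem (v) : v ∈ W ↔ ∃ w, T.toEquiv (vecC q w) = v := by
      rw [← T.mem_pointC hn, ← hW]; rfl
    have h1 (w) : q.1 (Complex.I • w) = Complex.I • q.1 w := by
      obtain ⟨w', h⟩ := (hmem _).1 (W.smul_mem Complex.I ((hmem _).2 ⟨w, rfl⟩))
      rw [← map_smul] at h
      have h2 := T.toEquiv.injective h
      have h3 : w' = Complex.I • w := congrArg Prod.fst h2
      have h4 : q.1 w' = Complex.I • q.1 w := congrArg (fun z => z.2.1) h2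
      rw [← h3, h4]
    refine ⟨h1, fun w w' => ?_⟩
    rw [← mdlForm_vecC h1, ← T.map_form]
    exact hiso _ ((hmem _).2 ⟨w, rfl⟩) _ ((hmem _).2 ⟨w', rfl⟩)
  · intro hq
    let W : Submodule ℂ (CVec n) :=
      { toAddSubmonoid := (T.pointC hn q).toSubmodule.toAddSubmonoid
        smul_mem' := by
          intro c v hv
          obtain ⟨w, rfl⟩ := (T.mem_pointC hn q v).1 hv
          refine (T.mem_pointC hn q _).2 ⟨c • w, ?_⟩
          rw [← map_smul]
          let L : (Fin k → ℂ) →ₗ[ℝ] Mdl k r s :=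
            { toFun := vecC q
              map_add' := fun w w' => by
                refine Prod.ext rfl (Prod.ext (map_add _ _ _) ?_)
                simp [vecC]
                abel
              map_smul' := fun t w => by
                refine Prod.ext rfl (Prod.ext (map_smul _ _ _) ?_)
                simp [vecC, smul_sub, smul_comm t (2⁻¹ : ℝ)] }
          exact congrArg _ (map_smul_of_map_I L (fun w => vecC_I hq w) c w) }
    refine ⟨W, rfl, ?_, ?_⟩
    · have h1 := finrank_real_of_complex W
      have h2 : Module.finrank ℝ W = 2 * k := (T.pointC hn q).finrank_eq
      omega
    · intro v hv v' hv'
      obtain ⟨w, rfl⟩ := (T.mem_pointC hn q v).1 hv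
      obtain ⟨w', rfl⟩ := (T.mem_pointC hn q v').1 hv'
      rw [T.map_form, mdlForm_vecC hq.1, hq.2]

theorem Frame.isSliceChart_cIgr (T : Frame b k r s) (hn : r + s + 2 * k = n) :
    IsSliceChart (Subtype.val : cIgr b k → _)
      ((isoModel k r s).comap (blockC hn).toLinearEquiv.toLinearMap) (T.chartC hn) where
  mem_atlas := T.chartC_mem_maximalAtlas hn
  mem_iff := by
    intro V hV
    obtain ⟨q, rfl⟩ := (T.mem_chartC_source hn V).1 hV
    rw [Subtype.range_coe, T.pointC_mem_cIgr, T.chartC_point, Submodule.mem_comap]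
    simp

theorem Frame.isSliceChart_orb (T : Frame b k r s) (hn : r + s + 2 * k = n) :
    IsSliceChart (Subtype.val : orb b r s → _)
      ((orbModel k r s).comap (blockE hn).toLinearEquiv.toLinearMap) (T.chart hn) where
  mem_atlas := T.chart_mem_maximalAtlas hn
  mem_iff := by
    intro V hV
    obtain ⟨q, hq, rfl⟩ := (T.mem_chart_source hn V).1 hV
    rw [Subtype.range_coe, T.chart_point hn hq, Submodule.mem_comap]
    have h : T.point hn q ∈ orb b r s ↔ q ∈ orbModel k r s :=
      ⟨fun h => T.mem_orbModel_of_point_mem hn h hq, fun h => T.point_mem_orb hn h hq⟩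
    simpa using h

/-- The standard point of a frame. -/
theorem Frame.mem_point_zero (T : Frame b k r s) (hn : r + s + 2 * k = n) (v : CVec n) :
    v ∈ (T.point hn 0).toSubmodule ↔ ∃ w u, T.toEquiv (w, realE r s u, 0) = v := by
  rw [T.mem_point]
  have h (w u) : vecE (0 : Coord k r s) w u = (w, realE r s u, 0) := by
    refine Prod.ext rfl (Prod.ext ?_ ?_) <;> simp [vecE, graphE]
  simp only [h]

theorem Frame.mem_pointC_zero (T : Frame b k r s) (hn : r + s + 2 * k = n) (v : CVec n) :
    v ∈ (T.pointC hn 0).toSubmodule ↔ ∃ w, T.toEquiv (w, 0, 0) = v := by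
  rw [T.mem_pointC]
  have h (w) : vecC (0 : CCoord k r s) w = (w, 0, 0) := by
    refine Prod.ext rfl (Prod.ext ?_ ?_) <;> simp [vecC]
  simp only [h]

theorem zero_mem_orbModel : (0 : Coord k r s) ∈ orbModel k r s := Submodule.zero_mem _

theorem Frame.point_zero_mem_orb (T : Frame b k r s) (hn : r + s + 2 * k = n) :
    T.point hn 0 ∈ orb b r s := T.point_mem_orb hn zero_mem_orbModel zero_mem_smallBall

end ComplexIsotropic

/-! ### Frames adapted to the points of the orbits -/

section AdaptedFrames

variable {n k r s : ℕ} {b : LinearMap.BilinForm ℂ (CVec n)}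

theorem re_form_eq (v w : CVec n) : (b v w).re = imForm b v (Complex.I • w) := by
  simp [imForm_apply]

theorem re_form_eq' (v w : CVec n) : (b v w).re = imForm b (Complex.I • v) w := by
  simp [imForm_apply]

theorem imForm_separating (hnd : b.Nondegenerate) {v : CVec n} (h : ∀ w, imForm b v w = 0) :
    v = 0 :=
  hnd.1 v fun w => Complex.ext ((re_form_eq v w).trans (h _)) (h w)

theorem imForm_comm (hsymm : b.IsSymm) (v w : CVec n) : imForm b v w = imForm b w v := by
  rw [imForm_apply, imForm_apply, hsymm.eq v w]

theorem imForm_isSymm (hsymm : b.IsSymm) : (imForm b).IsSymm := ⟨imForm_comm hsymm⟩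

theorem imForm_nondegenerate (hsymm : b.IsSymm) (hnd : b.Nondegenerate) :
    (imForm b).Nondegenerate :=
  ⟨fun _ h => imForm_separating hnd h,
    fun _ h => imForm_separating hnd fun w => (imForm_comm hsymm _ _).trans (h w)⟩

/-- A maximal isotropic subspace is its own orthogonal. -/
theorem mem_of_forall_imForm_eq_zero (hsymm : b.IsSymm) (hnd : b.Nondegenerate)
    {V : Gr n n (CVec n)} (hV : ∀ v ∈ V.toSubmodule, ∀ w ∈ V.toSubmodule, imForm b v w = 0)
    {v : CVec n} (hv : ∀ w ∈ V.toSubmodule, imForm b w v = 0) : v ∈ V.toSubmodule := by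
  have h1 := LinearMap.BilinForm.finrank_orthogonal (imForm_nondegenerate hsymm hnd)
    V.toSubmodule
  rw [finrank_real_cVec, V.finrank_eq, Nat.add_sub_cancel] at h1
  have h2 : V.toSubmodule ≤ (imForm b).orthogonal V.toSubmodule := fun w hw x hx => hV x hx w hw
  rw [Submodule.eq_of_le_of_finrank_eq h2 (V.finrank_eq.trans h1.symm)]
  exact hv

/-- The largest complex subspace `V ∩ iV` of a real subspace. -/
def complexPart (V : Submodule ℝ (CVec n)) : Submodule ℂ (CVec n) where
  carrier := {v | v ∈ V ∧ Complex.I • v ∈ V}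
  zero_mem' := by simp
  add_mem' := by
    rintro v w ⟨h1, h2⟩ ⟨h3, h4⟩
    exact ⟨V.add_mem h1 h3, by rw [smul_add]; exact V.add_mem h2 h4⟩
  smul_mem' := by
    rintro c v ⟨h1, h2⟩
    have h (c : ℂ) : c • v = c.re • v + c.im • Complex.I • v := by
      conv_lhs => rw [← Complex.re_add_im c]
      rw [add_smul, mul_smul, Complex.coe_smul, Complex.coe_smul]
    have h' (c : ℂ) : c • v ∈ V := by
      rw [h]
      exact V.add_mem (V.smul_mem _ h1) (V.smul_mem _ h2)
    refine ⟨h' c, ?_⟩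
    rw [smul_smul]
    exact h' _

theorem mem_complexPart {V : Submodule ℝ (CVec n)} {v : CVec n} :
    v ∈ complexPart V ↔ v ∈ V ∧ Complex.I • v ∈ V := Iff.rfl

theorem form_complexPart {V : Submodule ℝ (CVec n)} (hV : ∀ v ∈ V, ∀ w ∈ V, imForm b v w = 0)
    {v w : CVec n} (hv : v ∈ complexPart V) (hw : w ∈ V) : b v w = 0 :=
  Complex.ext ((re_form_eq' v w).trans (hV _ hv.2 w hw)) (hV v hv.1 w hw)

/-- The complex part is the radical of Re b on `V`. Indeed Re b(w, v) = Im b(w, iv), so for `v` in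
the radical `iv` is orthogonal to `V` for Im b and hence lies in `V`. The radical has real dimension
`n - r - s = 2k`. -/
theorem finrank_complexPart (hn : r + s + 2 * k = n) (hsymm : b.IsSymm) (hnd : b.Nondegenerate)
    {V : Gr n n (CVec n)} (hV : V ∈ orb b r s) :
    Module.finrank ℂ (complexPart V.toSubmodule) = k := by
  obtain ⟨hiso, hpos, hneg⟩ := hV
  set Q := (reForm b).toQuadraticMap.restrict V.toSubmodule with hQ
  have hQa (v) : Q v = (b v.1 v.1).re := rfl
  have h1 : Q.radical.map V.toSubmodule.subtype =
      (complexPart V.toSubmodule).restrictScalars ℝ := by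
    ext v
    simp only [Submodule.mem_map, Submodule.subtype_apply, Subtype.exists,
      Submodule.restrictScalars_mem]
    constructor
    · rintro ⟨v, hv, h, rfl⟩
      refine ⟨hv, mem_of_forall_imForm_eq_zero hsymm hnd hiso fun w hw => ?_⟩
      obtain ⟨h2, h3⟩ := QuadraticMap.mem_radical_iff'.1 h
      have h4 := h3 ⟨w, hw⟩
      rw [hQa] at h2
      rw [hQa, hQa] at h4
      simp only [Submodule.coe_add, map_add, LinearMap.add_apply, Complex.add_re] at h4
      rw [hsymm.eq w v] at h4
      rw [← re_form_eq, hsymm.eq w v]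
      simp only at h2
      linarith
    · intro h
      refine ⟨v, h.1, QuadraticMap.mem_radical_iff'.2 ⟨?_, ?_⟩, rfl⟩
      · rw [hQa, form_complexPart hiso h h.1, Complex.zero_re]
      · rintro ⟨w, hw⟩
        rw [hQa, hQa]
        simp only [Submodule.coe_add, map_add, LinearMap.add_apply, hsymm.eq w v,
          form_complexPart hiso h h.1, form_complexPart hiso h hw]
        simp
  have h2 := QuadraticForm.sigPos_add_sigNeg_add_radical (Q := Q)
  rw [V.finrank_eq, hpos, hneg, ← Submodule.finrank_map_subtype_eq, h1] at h2
  have h3 := finrank_real_of_complex (complexPart V.toSubmodule)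
  have h4 : Module.finrank ℝ ((complexPart V.toSubmodule).restrictScalars ℝ) =
    Module.finrank ℝ (complexPart V.toSubmodule) := rfl
  omega

/-- Every point of `𝒪_(r,s)` has an orthogonal family of type `(r, s)`. -/
theorem exists_orthogonal_family (hsymm : b.IsSymm) {V : Gr n n (CVec n)}
    (hV : V ∈ orb b r s) : ∃ u : Fin r ⊕ Fin s → CVec n, (∀ j, u j ∈ V.toSubmodule) ∧
      ∀ i j, b (u i) (u j) = if i = j then (sgn i : ℂ) else 0 := by
  obtain ⟨hiso, hpos, hneg⟩ := hV
  set Q := (reForm b).toQuadraticMap.restrict V.toSubmodule with hQ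
  -- Sylvester's law with weights `1, 0, -1`: the signature counts the positive and the negative
  -- weights, and `φ` enumerates both.
  obtain ⟨wt, hwt, hE⟩ := QuadraticForm.equivalent_one_zero_neg_one_weighted_sum_squared Q
  rw [QuadraticForm.sigPos_of_equiv_weightedSumSquares hE] at hpos
  rw [QuadraticForm.sigNeg_of_equiv_weightedSumSquares hE] at hneg
  obtain ⟨e⟩ := hE
  let ep : Fin r ≃ {i | 0 < wt i} := Fintype.equivOfCardEq (by
    rw [Fintype.card_fin, ← hpos, Set.ncard_eq_toFinset_card', Set.toFinset_card])
  let en : Fin s ≃ {i | wt i < 0} := Fintype.equivOfCardEq (by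
    rw [Fintype.card_fin, ← hneg, Set.ncard_eq_toFinset_card', Set.toFinset_card])
  let φ : Fin r ⊕ Fin s → Fin (Module.finrank ℝ V.toSubmodule) :=
    Sum.elim (fun i => (ep i).1) (fun i => (en i).1)
  have hφ : Function.Injective φ := by
    rintro (i | i) (j | j) h
    · exact congrArg _ (ep.injective (Subtype.ext h))
    · have h1 : 0 < wt (ep i) := (ep i).2
      have h2 : wt (en j) < 0 := (en j).2
      have h3 : (ep i).1 = (en j).1 := h
      rw [h3] at h1
      exact absurd h1 h2.not_gt
    · have h1 : 0 < wt (ep j) := (ep j).2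
      have h2 : wt (en i) < 0 := (en i).2
      have h3 : (en i).1 = (ep j).1 := h
      rw [← h3] at h1
      exact absurd h1 h2.not_gt
    · exact congrArg _ (en.injective (Subtype.ext h))
  have hwφ (j) : wt (φ j) = sgn j := by
    rcases j with j | j
    · have h1 : 0 < wt (ep j) := (ep j).2
      rcases hwt (ep j) with h | h | h <;> first | exact h | linarith
    · have h1 : wt (en j) < 0 := (en j).2
      rcases hwt (en j) with h | h | h <;> first | exact h | linarith
  have hre (x y) : (b (e.symm x) (e.symm y)).re = ∑ i, wt i * (x i * y i) := by
    have h1 (x) : (b (e.symm x) (e.symm x)).re = ∑ i, wt i * (x i * x i) := by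
      have := e.symm.map_app x
      rw [QuadraticMap.weightedSumSquares_apply] at this
      exact this
    have h2 := h1 (x + y)
    have e1 : (e.symm (x + y)) = e.symm x + e.symm y := map_add e.symm.toLinearEquiv x y
    rw [e1] at h2
    simp only [Submodule.coe_add, map_add, LinearMap.add_apply, Complex.add_re, h1,
      hsymm.eq (e.symm y : CVec n) (e.symm x)] at h2
    have h3 : ∑ i, wt i * ((x + y) i * (x + y) i) = ∑ i, wt i * (x i * x i) +
        ∑ i, wt i * (y i * y i) + 2 * ∑ i, wt i * (x i * y i) := by
      rw [Finset.mul_sum, ← Finset.sum_add_distrib, ← Finset.sum_add_distrib]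
      exact Finset.sum_congr rfl fun i _ => by simp only [Pi.add_apply]; ring
    rw [h3] at h2
    linarith
  refine ⟨fun j => e.symm (Pi.single (φ j) 1), fun j => (e.symm (Pi.single (φ j) 1)).2,
    fun i j => Complex.ext ?_ ?_⟩
  · rw [hre]
    by_cases hij : i = j
    · subst hij
      simp [Pi.single_apply, hwφ]
    · have hij' : φ i ≠ φ j := fun h => hij (hφ h)
      rw [if_neg hij]
      refine Finset.sum_eq_zero fun l _ => ?_
      by_cases hl : l = φ i
      · subst hl
        simp [hij']
      · simp [Pi.single_apply, hl]
  -- Isotropy for Im b makes all products on `V` real, so a family that diagonalizes Re b also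
  -- diagonalizes `b`.
  · have h1 : (b (e.symm (Pi.single (φ i) 1)) (e.symm (Pi.single (φ j) 1))).im = 0 :=
      hiso _ (e.symm _).2 _ (e.symm _).2
    rw [h1]
    split_ifs <;> simp

/-- Every point of `𝒪_(r,s)` is the standard point of a frame; the frame can be chosen to be
adapted to a given basis of the complex part. -/
theorem exists_frame_of_mem_orb_of_basis (hn : r + s + 2 * k = n) (hsymm : b.IsSymm)
    (hnd : b.Nondegenerate) {V : Gr n n (CVec n)} (hV : V ∈ orb b r s)
    (w : Module.Basis (Fin k) ℂ (complexPart V.toSubmodule)) :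
    ∃ T : Frame b k r s, T.point hn 0 = V ∧ ∀ a, T.toEquiv (a, 0, 0) = ∑ i, a i • (w i).1 := by
  obtain ⟨u, hu, huu⟩ := exists_orthogonal_family hsymm hV
  have hli : LinearIndependent ℂ (fun i => (w i).1) :=
    w.linearIndependent.map' (complexPart V.toSubmodule).subtype (Submodule.ker_subtype _)
  obtain ⟨T, hT⟩ := exists_frame_of_families hn hsymm hnd (fun i => (w i).1) u hli
    (fun i j => form_complexPart hV.1 (w i).2 (w j).2.1)
    (fun i j => form_complexPart hV.1 (w i).2 (hu j)) huu
  refine ⟨T, Gr.eq_of_le ?_, fun a => by simpa using hT a 0⟩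
  intro v hv
  obtain ⟨a, x, rfl⟩ := (T.mem_point_zero hn v).1 hv
  rw [hT]
  refine V.toSubmodule.add_mem ?_ (V.toSubmodule.sum_mem fun j _ => ?_)
  · exact ((complexPart V.toSubmodule).sum_mem fun i _ =>
      (complexPart V.toSubmodule).smul_mem (a i) (w i).2).1
  · rw [realE_apply, Complex.coe_smul]
    exact V.toSubmodule.smul_mem _ (hu j)

theorem exists_frame_of_mem_orb (hn : r + s + 2 * k = n) (hsymm : b.IsSymm)
    (hnd : b.Nondegenerate) {V : Gr n n (CVec n)} (hV : V ∈ orb b r s) :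
    ∃ T : Frame b k r s, T.point hn 0 = V := by
  let w := Module.finBasisOfFinrankEq ℂ _ (finrank_complexPart hn hsymm hnd hV)
  obtain ⟨T, hT, -⟩ := exists_frame_of_mem_orb_of_basis hn hsymm hnd hV w
  exact ⟨T, hT⟩

theorem exists_frame_of_mem_cIgr (hn : r + s + 2 * k = n) (hsymm : b.IsSymm)
    (hnd : b.Nondegenerate) {U : Gr (2 * k) (2 * (n - k)) (CVec n)} (hU : U ∈ cIgr b k) :
    ∃ T : Frame b k r s, T.pointC hn 0 = U := by
  obtain ⟨W, hW, hfin, hiso⟩ := hU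
  let w := Module.finBasisOfFinrankEq ℂ W hfin
  have hli : LinearIndependent ℂ (fun i => (w i).1) :=
    w.linearIndependent.map' W.subtype (Submodule.ker_subtype _)
  obtain ⟨T, hT⟩ := exists_frame_of_isotropic (r := r) (s := s) hn hsymm hnd
    (fun i => (w i).1) hli (fun i j => hiso _ (w i).2 _ (w j).2)
  refine ⟨T, Gr.eq_of_le ?_⟩
  intro v hv
  obtain ⟨a, rfl⟩ := (T.mem_pointC_zero hn v).1 hv
  rw [hT, ← hW]
  exact W.sum_mem fun i _ => W.smul_mem (a i) (w i).2

theorem orb_nonempty (hn : r + s + 2 * k = n) (hsymm : b.IsSymm) (hnd : b.Nondegenerate) :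
    (orb b r s).Nonempty := by
  obtain ⟨T⟩ := exists_frame hn hsymm hnd
  exact ⟨_, T.point_zero_mem_orb hn⟩

/-! ### The action of `SO(n, ℂ)` -/

/-- The composition of a frame with an isometry. -/
def Frame.comp (T : Frame b k r s) (A : CVec n ≃ₗ[ℂ] CVec n)
    (hA : ∀ z w, b (A z) (A w) = b z w) : Frame b k r s where
  toEquiv := T.toEquiv.trans A
  map_form z w := (hA _ _).trans (T.map_form z w)

theorem exists_equiv_of_mem_groupH {u : GLR n} (hu : u ∈ groupH b) :
    ∃ A : CVec n ≃ₗ[ℂ] CVec n, (∀ z, A z = u.1 z) ∧ (∀ z w, b (A z) (A w) = b z w) ∧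
      LinearMap.det A.toLinearMap = 1 := by
  obtain ⟨A, hA, hb, hd⟩ := hu
  exact ⟨LinearMap.equivOfDetNeZero A (by rw [hd]; exact one_ne_zero), hA, hb, hd⟩

/-- The element of `H` given by a complex linear isometry of determinant `1`. -/
def unitOfEquiv (A : CVec n ≃ₗ[ℂ] CVec n) : GLR n :=
  ContinuousLinearEquiv.toUnit (A.restrictScalars ℝ).toContinuousLinearEquiv

theorem unitOfEquiv_apply (A : CVec n ≃ₗ[ℂ] CVec n) (z : CVec n) : (unitOfEquiv A).1 z = A z :=
  rfl

theorem unitOfEquiv_mem_groupH {A : CVec n ≃ₗ[ℂ] CVec n} (hA : ∀ z w, b (A z) (A w) = b z w)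
    (hd : LinearMap.det A.toLinearMap = 1) : unitOfEquiv A ∈ groupH b :=
  ⟨A.toLinearMap, fun _ => rfl, hA, hd⟩

theorem smul_point_zero (hn : r + s + 2 * k = n) (T T' : Frame b k r s) (u : GLR n)
    (h : ∀ z, T'.toEquiv z = u.1 (T.toEquiv z)) : u • T.point hn 0 = T'.point hn 0 := by
  refine Gr.eq_of_le fun v hv => ?_
  obtain ⟨v', hv', rfl⟩ := (mem_smul_iff _ _ _).1 hv
  obtain ⟨w, x, rfl⟩ := (T.mem_point_zero hn _).1 hv'
  exact (T'.mem_point_zero hn _).2 ⟨w, x, h _⟩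

theorem smul_mem_orb (hn : r + s + 2 * k = n) (hsymm : b.IsSymm) (hnd : b.Nondegenerate)
    {u : GLR n} (hu : u ∈ groupH b) {V : Gr n n (CVec n)} (hV : V ∈ orb b r s) :
    u • V ∈ orb b r s := by
  obtain ⟨T, rfl⟩ := exists_frame_of_mem_orb hn hsymm hnd hV
  obtain ⟨A, hA, hb, -⟩ := exists_equiv_of_mem_groupH hu
  rw [smul_point_zero hn T (T.comp A hb) u fun z => hA _]
  exact Frame.point_zero_mem_orb _ hn

theorem det_isometry (hnd : b.Nondegenerate) {A : CVec n →ₗ[ℂ] CVec n}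
    (hA : ∀ z w, b (A z) (A w) = b z w) : LinearMap.det A = 1 ∨ LinearMap.det A = -1 := by
  let B : Module.Basis (Fin n) ℂ (CVec n) := Pi.basisFun ℂ (Fin n)
  have hG : (LinearMap.BilinForm.toMatrix B b).det ≠ 0 :=
    (LinearMap.BilinForm.nondegenerate_iff_det_ne_zero B).1 hnd
  have h1 : (LinearMap.toMatrix B B A).transpose * LinearMap.BilinForm.toMatrix B b *
      LinearMap.toMatrix B B A = LinearMap.BilinForm.toMatrix B b := by
    rw [← LinearMap.BilinForm.toMatrix_comp]
    congr 1
    ext z w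
    exact hA _ _
  have h2 := congrArg Matrix.det h1
  rw [Matrix.det_mul, Matrix.det_mul, Matrix.det_transpose, LinearMap.det_toMatrix] at h2
  have h3 : LinearMap.det A * LinearMap.det A = 1 := by
    apply mul_right_cancel₀ hG
    rw [one_mul]
    linear_combination h2
  exact mul_self_eq_one_iff.1 h3

/-- Away from `r = s = 0` there is a reflection which preserves the standard point. -/
theorem exists_reflection (hrs : 0 < r + s) : ∃ R : Mdl k r s ≃ₗ[ℂ] Mdl k r s,
    (∀ z w, mdlForm k r s (R z) (R w) = mdlForm k r s z w) ∧
    LinearMap.det R.toLinearMap = -1 ∧ ∀ w x, ∃ x', R (w, realE r s x, 0) = (w, realE r s x', 0) := by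
  obtain ⟨j₀⟩ : Nonempty (Fin r ⊕ Fin s) := by
    rw [← Fintype.card_pos_iff]
    simpa using hrs
  -- A sign change in a single middle coordinate is real, so it preserves ℝ^{r+s}, and its
  -- determinant is `-1`.
  let d : Fin r ⊕ Fin s → ℂ := fun j => if j = j₀ then -1 else 1
  have hd (j) : d j * d j = 1 := by simp only [d]; split_ifs <;> simp
  let D : (Fin r ⊕ Fin s → ℂ) →ₗ[ℂ] (Fin r ⊕ Fin s → ℂ) := Matrix.toLin' (Matrix.diagonal d)
  have hD (x j) : D x j = d j * x j := by simp [D, Matrix.mulVec_diagonal]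
  have hDD (x) : D (D x) = x := by
    ext j
    rw [hD, hD, ← mul_assoc, hd, one_mul]
  let R₀ : Mdl k r s →ₗ[ℂ] Mdl k r s :=
    LinearMap.prodMap LinearMap.id (LinearMap.prodMap D LinearMap.id)
  have hR₀ (z) : R₀ (R₀ z) = z := by
    obtain ⟨a, x, c⟩ := z
    simp [R₀, hDD]
  have hdet : LinearMap.det R₀ = -1 := by
    rw [LinearMap.det_prodMap, LinearMap.det_prodMap, LinearMap.det_id,
      one_mul, mul_one, LinearMap.det_toLin', Matrix.det_diagonal]
    simp [d, Finset.prod_ite_eq']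
  refine ⟨LinearEquiv.ofLinearMap R₀ R₀ (LinearMap.ext hR₀) (LinearMap.ext hR₀), ?_, hdet, ?_⟩
  · rintro ⟨a, x, c⟩ ⟨a', x', c'⟩
    change mdlForm k r s (a, D x, c) (a', D x', c') = _
    rw [mdlForm_apply, mdlForm_apply, qE_apply, qE_apply]
    congr 1
    refine Finset.sum_congr rfl fun j _ => ?_
    simp only [hD]
    linear_combination (sgn j : ℂ) * x j * x' j * hd j
  · intro w x
    refine ⟨fun j => if j = j₀ then -x j else x j, Prod.ext rfl (Prod.ext ?_ rfl)⟩
    change D _ = _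
    ext j
    rw [hD]
    simp only [d, realE_apply]
    split_ifs <;> simp

/-- Frames with standard points `V` and `V'` differ by an isometry of `b`, whose determinant is `1`
or `-1`. In the second case one frame is precomposed with a reflection that keeps its standard
point; only this step needs `r + s > 0`. -/
theorem orbit_eq_orb (hn : r + s + 2 * k = n) (hsymm : b.IsSymm) (hnd : b.Nondegenerate)
    (hrs : 0 < r + s) {V : Gr n n (CVec n)} (hV : V ∈ orb b r s) :
    MulAction.orbit (groupH b) V = orb b r s := by
  apply Set.Subset.antisymm
  · rintro _ ⟨u, rfl⟩
    exact smul_mem_orb hn hsymm hnd u.2 hV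
  · intro V' hV'
    obtain ⟨T, rfl⟩ := exists_frame_of_mem_orb hn hsymm hnd hV
    obtain ⟨T', rfl⟩ := exists_frame_of_mem_orb hn hsymm hnd hV'
    have key (T' : Frame b k r s)
        (hdet : LinearMap.det (T.toEquiv.symm.trans T'.toEquiv).toLinearMap = 1) :
        T'.point hn 0 ∈ MulAction.orbit (groupH b) (T.point hn 0) := by
      have hb (z w) : b (T.toEquiv.symm.trans T'.toEquiv z) (T.toEquiv.symm.trans T'.toEquiv w) =
          b z w := by
        rw [LinearEquiv.trans_apply, LinearEquiv.trans_apply, T'.map_form, ← T.map_form]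
        simp
      refine ⟨⟨unitOfEquiv (T.toEquiv.symm.trans T'.toEquiv), unitOfEquiv_mem_groupH hb hdet⟩, ?_⟩
      exact smul_point_zero hn T T' _ fun z => by simp [unitOfEquiv_apply]
    have hb (z w) : b (T.toEquiv.symm.trans T'.toEquiv z) (T.toEquiv.symm.trans T'.toEquiv w) =
          b z w := by
        rw [LinearEquiv.trans_apply, LinearEquiv.trans_apply, T'.map_form, ← T.map_form]
        simp
    rcases det_isometry hnd (A := (T.toEquiv.symm.trans T'.toEquiv).toLinearMap) hb with h | h
    · exact key T' h
    · obtain ⟨R, hR, hRd, hRp⟩ := exists_reflection (k := k) hrs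
      let T'' : Frame b k r s := ⟨R.trans T'.toEquiv, fun z w => by
        rw [LinearEquiv.trans_apply, LinearEquiv.trans_apply, T'.map_form, hR]⟩
      have hp : T''.point hn 0 = T'.point hn 0 := by
        refine Gr.eq_of_le fun v hv => ?_
        obtain ⟨w, x, rfl⟩ := (T''.mem_point_zero hn v).1 hv
        obtain ⟨x', hx'⟩ := hRp w x
        exact (T'.mem_point_zero hn _).2 ⟨w, x', congrArg T'.toEquiv hx'.symm⟩
      rw [← hp]
      apply key
      have h1 : (T.toEquiv.symm.trans T''.toEquiv).toLinearMap =
          (T'.toEquiv.toLinearMap ∘ₗ R.toLinearMap ∘ₗ T'.toEquiv.symm.toLinearMap) ∘ₗ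
            (T.toEquiv.symm.trans T'.toEquiv).toLinearMap := by
        ext z
        simp [T'']
      rw [h1, LinearMap.det_comp, h, LinearMap.det_conj, hRd]
      norm_num

/-! ### The projection to the complex isotropic Grassmannian -/

theorem Frame.pointC_eq_complexPart (T : Frame b k r s) (hn : r + s + 2 * k = n)
    {q : Coord k r s} (hq : q ∈ orbModel k r s) (hA : q.1 ∈ smallBall r s) :
    (T.pointC hn (cxE k r s q.2.1, q.2.2.1)).toSubmodule =
      (complexPart (T.point hn q).toSubmodule).restrictScalars ℝ := by
  ext v
  rw [T.mem_pointC, Submodule.restrictScalars_mem, mem_complexPart,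
    T.complexPart_point hn hq hA]
  simp only [vecE_zero_right]

theorem cxE_mem_isoModel {q : Coord k r s} (hq : q ∈ orbModel k r s) :
    ((cxE k r s q.2.1, q.2.2.1) : CCoord k r s) ∈ isoModel k r s := ⟨cxE_I _, hq.2.1⟩

theorem exists_complexPart (hn : r + s + 2 * k = n) (hsymm : b.IsSymm) (hnd : b.Nondegenerate)
    (V : orb b r s) :
    ∃ U : cIgr b k, U.1.toSubmodule = (complexPart V.1.toSubmodule).restrictScalars ℝ := by
  obtain ⟨V, hV⟩ := V
  obtain ⟨T, rfl⟩ := exists_frame_of_mem_orb hn hsymm hnd hV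
  exact ⟨⟨_, (T.pointC_mem_cIgr hn).2 (cxE_mem_isoModel zero_mem_orbModel)⟩,
    T.pointC_eq_complexPart hn zero_mem_orbModel zero_mem_smallBall⟩

/-- The map `V ↦ V ∩ iV`. -/
def orbProj (hn : r + s + 2 * k = n) (hsymm : b.IsSymm) (hnd : b.Nondegenerate)
    (V : orb b r s) : cIgr b k := (exists_complexPart hn hsymm hnd V).choose

theorem orbProj_toSubmodule (hn : r + s + 2 * k = n) (hsymm : b.IsSymm) (hnd : b.Nondegenerate)
    (V : orb b r s) : (orbProj hn hsymm hnd V).1.toSubmodule =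
      (complexPart V.1.toSubmodule).restrictScalars ℝ :=
  (exists_complexPart hn hsymm hnd V).choose_spec

theorem orbProj_point (hn : r + s + 2 * k = n) (hsymm : b.IsSymm) (hnd : b.Nondegenerate)
    (T : Frame b k r s) {q : Coord k r s} (hq : q ∈ orbModel k r s) (hA : q.1 ∈ smallBall r s)
    (V : orb b r s) (hV : V.1 = T.point hn q) :
    (orbProj hn hsymm hnd V).1 = T.pointC hn (cxE k r s q.2.1, q.2.2.1) := by
  refine Gr.ext ?_
  rw [orbProj_toSubmodule, T.pointC_eq_complexPart hn hq hA, hV]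

theorem mem_orbProj (hn : r + s + 2 * k = n) (hsymm : b.IsSymm) (hnd : b.Nondegenerate)
    (V : orb b r s) (v : CVec n) : v ∈ (orbProj hn hsymm hnd V).1.toSubmodule ↔
      v ∈ V.1.toSubmodule ∧ Complex.I • v ∈ V.1.toSubmodule := by
  rw [orbProj_toSubmodule]
  rfl

/-- Elements of `H` are complex linear, so they map `V ∩ iV` into `uV ∩ i(uV)`; equality follows
from the dimensions. -/
theorem orbProj_smul (hn : r + s + 2 * k = n) (hsymm : b.IsSymm) (hnd : b.Nondegenerate)
    {u : GLR n} (hu : u ∈ groupH b) (V : orb b r s) (hV : u • V.1 ∈ orb b r s) :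
    (orbProj hn hsymm hnd ⟨u • V.1, hV⟩).1 = u • (orbProj hn hsymm hnd V).1 := by
  symm
  obtain ⟨A, hA, -, -⟩ := hu
  refine Gr.eq_of_le fun v hv => ?_
  obtain ⟨w, hw, rfl⟩ := (mem_smul_iff _ _ _).1 hv
  rw [mem_orbProj] at hw ⊢
  refine ⟨(mem_smul_iff _ _ _).2 ⟨w, hw.1, rfl⟩, (mem_smul_iff _ _ _).2 ⟨_, hw.2, ?_⟩⟩
  rw [← hA, map_smul, hA]

/-- A frame adapted to the isotropic subspace has its standard point in `𝒪`, above that subspace. -/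
theorem orbProj_surjective (hn : r + s + 2 * k = n) (hsymm : b.IsSymm) (hnd : b.Nondegenerate) :
    Function.Surjective (orbProj (r := r) (s := s) hn hsymm hnd) := by
  rintro ⟨U, hU⟩
  obtain ⟨T, rfl⟩ := exists_frame_of_mem_cIgr (r := r) (s := s) hn hsymm hnd hU
  refine ⟨⟨T.point hn 0, T.point_zero_mem_orb hn⟩, Subtype.ext ?_⟩
  have h0 : ((cxE k r s (0 : Coord k r s).2.1, (0 : Coord k r s).2.2.1) : CCoord k r s) = 0 := by
    simp
  rw [orbProj_point hn hsymm hnd T zero_mem_orbModel zero_mem_smallBall _ rfl, h0]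

theorem exists_sliceChart_orb (hn : r + s + 2 * k = n) (hsymm : b.IsSymm)
    (hnd : b.Nondegenerate) (V : orb b r s) :
    ∃ Ψ, IsSliceChart (Subtype.val : orb b r s → _)
      ((orbModel k r s).comap (blockE hn).toLinearEquiv.toLinearMap) Ψ ∧ V.1 ∈ Ψ.source := by
  obtain ⟨T, hT⟩ := exists_frame_of_mem_orb hn hsymm hnd V.2
  exact ⟨T.chart hn, T.isSliceChart_orb hn,
    (T.mem_chart_source hn _).2 ⟨0, zero_mem_smallBall, hT⟩⟩

theorem exists_sliceChart_cIgr (hn : r + s + 2 * k = n) (hsymm : b.IsSymm)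
    (hnd : b.Nondegenerate) (U : cIgr b k) :
    ∃ Ψ, IsSliceChart (Subtype.val : cIgr b k → _)
      ((isoModel k r s).comap (blockC hn).toLinearEquiv.toLinearMap) Ψ ∧ U.1 ∈ Ψ.source := by
  obtain ⟨T, hT⟩ := exists_frame_of_mem_cIgr (r := r) (s := s) hn hsymm hnd U.2
  exact ⟨T.chartC hn, T.isSliceChart_cIgr hn, (T.mem_chartC_source hn _).2 ⟨0, hT⟩⟩

/-- `𝒪_(r,s)` as an embedded submanifold. -/
def orbManifold (hn : r + s + 2 * k = n) (hsymm : b.IsSymm) (hnd : b.Nondegenerate) :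
    EmbeddedSubmanifold (GrModel n n) (orb b r s) (Module.finrank ℝ
      ((orbModel k r s).comap (blockE hn).toLinearEquiv.toLinearMap)) :=
  sliceStructure Topology.IsEmbedding.subtypeVal (exists_sliceChart_orb hn hsymm hnd)

/-- The complex isotropic Grassmannian as an embedded submanifold. -/
def cIgrManifold (hn : r + s + 2 * k = n) (hsymm : b.IsSymm) (hnd : b.Nondegenerate) :
    EmbeddedSubmanifold (GrModel (2 * k) (2 * (n - k))) (cIgr b k) (Module.finrank ℝ
      ((isoModel k r s).comap (blockC hn).toLinearEquiv.toLinearMap)) :=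
  sliceStructure Topology.IsEmbedding.subtypeVal
    (exists_sliceChart_cIgr (r := r) (s := s) hn hsymm hnd)

/-- The projection in parameters. -/
def projModel (k r s : ℕ) : Coord k r s →L[ℝ] CCoord k r s :=
  (cxE k r s ∘L ContinuousLinearMap.fst ℝ _ _ ∘L ContinuousLinearMap.snd ℝ _ _).prod
    (ContinuousLinearMap.fst ℝ _ _ ∘L ContinuousLinearMap.snd ℝ _ _ ∘L
      ContinuousLinearMap.snd ℝ _ _)

theorem projModel_apply (q : Coord k r s) : projModel k r s q = (cxE k r s q.2.1, q.2.2.1) := rfl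

/-- A preimage is obtained with `A = 0` and with the imaginary part of the given complex linear map
as `β`. -/
theorem projModel_surjOn {q : CCoord k r s} (hq : q ∈ isoModel k r s) :
    ∃ q' ∈ orbModel k r s, projModel k r s q' = q := by
  let β : (Fin k → ℂ) →L[ℝ] (Fin r ⊕ Fin s → ℝ) :=
    ContinuousLinearMap.pi fun j => Complex.imCLM ∘L ContinuousLinearMap.proj j ∘L q.1
  have hβ (w j) : β w j = (q.1 w j).im := rfl
  refine ⟨(0, β, q.2, 0), ⟨fun u u' => by simp [qR], hq.2, rfl⟩, ?_⟩
  rw [projModel_apply]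
  refine Prod.ext ?_ rfl
  ext w j
  rw [cxE_apply]
  simp only [Pi.add_apply, Pi.smul_apply, realE_apply, hβ, hq.1, smul_eq_mul]
  apply Complex.ext <;> simp

/-- If the charts on both sides come from the same frame, the projection is the restriction of the
linear map `projModel`, which maps one model onto the other. -/
theorem orbProj_submersion (hn : r + s + 2 * k = n) (hsymm : b.IsSymm) (hnd : b.Nondegenerate) :
    (orbManifold hn hsymm hnd).Submersion (cIgrManifold (r := r) (s := s) hn hsymm hnd)
      (orbProj hn hsymm hnd) := by
  refine sliceStructure_submersion _ _ _ _ _ fun V => ?_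
  obtain ⟨T, hT⟩ := exists_frame_of_mem_orb hn hsymm hnd V.2
  let F : GrModel n n →L[ℝ] GrModel (2 * k) (2 * (n - k)) :=
    (blockC hn).symm.toContinuousLinearMap ∘L projModel k r s ∘L (blockE hn).toContinuousLinearMap
  refine ⟨T.chart hn, T.chartC hn, F, univ, F, T.isSliceChart_orb hn, T.isSliceChart_cIgr hn,
    (T.mem_chart_source hn _).2 ⟨0, zero_mem_smallBall, hT⟩, isOpen_univ, mem_univ _,
    F.contDiff.contDiffOn, F.hasFDerivAt, ?_, ?_⟩
  · intro l' hl'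
    obtain ⟨q, hq, hq'⟩ := projModel_surjOn (q := blockC hn l') hl'
    refine ⟨(blockE hn).symm q, ?_, ?_⟩
    · rw [Submodule.mem_comap]
      simpa using hq
    · change (blockC hn).symm (projModel k r s (blockE hn ((blockE hn).symm q))) = _
      rw [ContinuousLinearEquiv.apply_symm_apply, hq', ContinuousLinearEquiv.symm_apply_apply]
  · intro V' hV' _
    obtain ⟨q, hA, hq⟩ := (T.mem_chart_source hn _).1 hV'
    have hmem : q ∈ orbModel k r s :=
      T.mem_orbModel_of_point_mem hn (by rw [hq]; exact V'.2) hA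
    rw [orbProj_point hn hsymm hnd T hmem hA V' hq.symm]
    refine ⟨(T.mem_chartC_source hn _).2 ⟨_, rfl⟩, ?_⟩
    rw [T.chartC_point, ← hq, T.chart_point hn hA]
    change _ = (blockC hn).symm (projModel k r s (blockE hn ((blockE hn).symm q)))
    rw [ContinuousLinearEquiv.apply_symm_apply, projModel_apply]

end AdaptedFrames

/-! ### The complex orthogonal group as a manifold -/

section Cayley

variable {𝒜 : Type*} [NormedRing 𝒜]

/-- The inverse Cayley transform `K ↦ (1 + K) (1 - K)⁻¹`. -/
def cayleyInv (K : 𝒜) : 𝒜 := (1 + K) * Ring.inverse (1 - K)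

/-- The Cayley transform `z ↦ (z - 1) (z + 1)⁻¹`. -/
def cayley (z : 𝒜) : 𝒜 := (z - 1) * Ring.inverse (z + 1)

theorem cayley_mul {z : 𝒜} (hz : IsUnit (z + 1)) : cayley z * (z + 1) = z - 1 := by
  rw [cayley, mul_assoc, Ring.inverse_mul_cancel _ hz, mul_one]

theorem cayleyInv_mul {K : 𝒜} (hK : IsUnit (1 - K)) : cayleyInv K * (1 - K) = 1 + K := by
  rw [cayleyInv, mul_assoc, Ring.inverse_mul_cancel _ hK, mul_one]

/-- As `2` is invertible, this identity and its counterpart `cayleyInv_add_one_mul` show that the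
Cayley transform exchanges invertibility of `z + 1` with invertibility of `1 - K`. -/
theorem one_sub_cayley_mul {z : 𝒜} (hz : IsUnit (z + 1)) : (1 - cayley z) * (z + 1) = 2 := by
  rw [sub_mul, cayley_mul hz, one_mul, ← one_add_one_eq_two]
  abel

theorem isUnit_of_mul_eq {a c d : 𝒜} (hc : IsUnit c) (hd : IsUnit d) (h : a * c = d) :
    IsUnit a := by
  obtain ⟨c, rfl⟩ := hc
  rw [← Units.eq_mul_inv_iff_mul_eq] at h
  rw [h]
  exact hd.mul (c⁻¹).isUnit

theorem cayleyInv_add_one_mul {K : 𝒜} (hK : IsUnit (1 - K)) :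
    (cayleyInv K + 1) * (1 - K) = 2 := by
  rw [add_mul, cayleyInv_mul hK, one_mul, ← one_add_one_eq_two]
  abel

variable [NormedAlgebra ℝ 𝒜]

theorem isUnit_two : IsUnit (2 : 𝒜) := by
  have h : IsUnit (algebraMap ℝ 𝒜 2) := (isUnit_iff_ne_zero.2 two_ne_zero).map _
  rwa [map_ofNat] at h

theorem isUnit_one_sub_cayley {z : 𝒜} (hz : IsUnit (z + 1)) : IsUnit (1 - cayley z) :=
  isUnit_of_mul_eq hz isUnit_two (one_sub_cayley_mul hz)

theorem isUnit_cayleyInv_add_one {K : 𝒜} (hK : IsUnit (1 - K)) : IsUnit (cayleyInv K + 1) :=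
  isUnit_of_mul_eq hK isUnit_two (cayleyInv_add_one_mul hK)

theorem cayleyInv_cayley {z : 𝒜} (hz : IsUnit (z + 1)) : cayleyInv (cayley z) = z := by
  have h1 := isUnit_one_sub_cayley hz
  apply h1.mul_right_cancel
  rw [cayleyInv_mul h1]
  apply hz.mul_right_cancel
  rw [mul_assoc, one_sub_cayley_mul hz, add_mul, cayley_mul hz, one_mul, mul_two]
  abel

theorem cayley_cayleyInv {K : 𝒜} (hK : IsUnit (1 - K)) : cayley (cayleyInv K) = K := by
  have h1 := isUnit_cayleyInv_add_one hK
  apply h1.mul_right_cancel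
  rw [cayley_mul h1]
  apply hK.mul_right_cancel
  rw [mul_assoc, cayleyInv_add_one_mul hK, sub_mul, cayleyInv_mul hK, one_mul, mul_two]
  abel

variable [CompleteSpace 𝒜]

theorem contDiffOn_inverse_comp {E : Type*} [NormedAddCommGroup E] [NormedSpace ℝ E] {f : E → 𝒜}
    {s : Set E} (hf : ContDiffOn ℝ ∞ f s) (h : ∀ x ∈ s, IsUnit (f x)) :
    ContDiffOn ℝ ∞ (fun x => Ring.inverse (f x)) s := by
  intro x hx
  obtain ⟨u, hu⟩ := h x hx
  have h1 : ContDiffAt ℝ ∞ Ring.inverse (f x) := by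
    rw [← hu]
    exact contDiffAt_ringInverse ℝ u
  exact h1.comp_contDiffWithinAt x (hf x hx)

theorem contDiffOn_cayleyInv : ContDiffOn ℝ ∞ (cayleyInv : 𝒜 → 𝒜) {K | IsUnit (1 - K)} :=
  (contDiffOn_const.add contDiffOn_id).mul
    (contDiffOn_inverse_comp (contDiffOn_const.sub contDiffOn_id) fun _ h => h)

theorem contDiffOn_cayley : ContDiffOn ℝ ∞ (cayley : 𝒜 → 𝒜) {z | IsUnit (z + 1)} :=
  (contDiffOn_id.sub contDiffOn_const).mul
    (contDiffOn_inverse_comp (contDiffOn_id.add contDiffOn_const) fun _ h => h)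

/-- The Cayley chart centered at `a`. -/
def cayleyHomeo (a : 𝒜ˣ) : OpenPartialHomeomorph 𝒜 𝒜 where
  toFun y := cayley ((a⁻¹ : 𝒜ˣ) * y)
  invFun K := a * cayleyInv K
  source := {y | IsUnit (((a⁻¹ : 𝒜ˣ) : 𝒜) * y + 1)}
  target := {K | IsUnit (1 - K)}
  map_source' _ h := isUnit_one_sub_cayley h
  map_target' K h := by
    change IsUnit (_ + 1)
    rw [Units.inv_mul_cancel_left]
    exact isUnit_cayleyInv_add_one h
  left_inv' y h := by
    rw [cayleyInv_cayley h, Units.mul_inv_cancel_left]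
  right_inv' K h := by
    rw [Units.inv_mul_cancel_left, cayley_cayleyInv h]
  open_source := Units.isOpen.preimage (by fun_prop)
  open_target := Units.isOpen.preimage (by fun_prop)
  continuousOn_toFun := by
    refine (contDiffOn_cayley.comp (contDiff_const.mul contDiff_id).contDiffOn
      (s := {y | IsUnit (((a⁻¹ : 𝒜ˣ) : 𝒜) * y + 1)}) fun _ h => h).continuousOn
  continuousOn_invFun := (contDiffOn_const.mul contDiffOn_cayleyInv).continuousOn

theorem contDiffOn_cayleyHomeo (a : 𝒜ˣ) :
    ContDiffOn ℝ ∞ (cayleyHomeo a) (cayleyHomeo a).source :=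
  contDiffOn_cayley.comp (contDiff_const.mul contDiff_id).contDiffOn
      (s := {y | IsUnit (((a⁻¹ : 𝒜ˣ) : 𝒜) * y + 1)}) fun _ h => h

theorem contDiffOn_cayleyHomeo_symm (a : 𝒜ˣ) :
    ContDiffOn ℝ ∞ (cayleyHomeo a).symm (cayleyHomeo a).target :=
  contDiffOn_const.mul contDiffOn_cayleyInv

/-- Both factors of the Cayley transform, `1 + K` and the inverse of `1 - K`, contribute `K` to
first order. -/
theorem hasFDerivAt_cayleyInv :
    HasFDerivAt (cayleyInv : 𝒜 → 𝒜) ((2 : ℝ) • ContinuousLinearMap.id ℝ 𝒜) 0 := by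
  have h1 : HasFDerivAt (fun K : 𝒜 => 1 + K) (ContinuousLinearMap.id ℝ 𝒜) 0 :=
    (hasFDerivAt_id _).const_add _
  have h2 : HasFDerivAt (fun K : 𝒜 => 1 - K) (-ContinuousLinearMap.id ℝ 𝒜) 0 :=
    (hasFDerivAt_id _).const_sub _
  have h3 := hasFDerivAt_ringInverse (𝕜 := ℝ) (1 : 𝒜ˣ)
  have h3' : HasFDerivAt (Ring.inverse : 𝒜 → 𝒜)
      (-ContinuousLinearMap.mulLeftRight ℝ 𝒜 ((1 : 𝒜ˣ)⁻¹ : 𝒜ˣ) ((1 : 𝒜ˣ)⁻¹ : 𝒜ˣ)) (1 - 0) := by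
    rw [sub_zero]
    exact h3
  have h4 := h1.mul' (h3'.comp (0 : 𝒜) h2)
  refine h4.congr_fderiv ?_
  ext K
  simp [two_smul]

end Cayley

/-! ### Cayley charts of the complex orthogonal group -/

section ComplexOrthogonal

variable {r s : ℕ}

/-- The matrix `diag(1, …, 1, -1, …, -1)`. -/
abbrev indefD (r s : ℕ) : Matrix (Fin r ⊕ Fin s) (Fin r ⊕ Fin s) ℂ :=
  LieAlgebra.Orthogonal.indefiniteDiagonal (Fin r) (Fin s) ℂ

theorem indefD_eq : indefD r s = Matrix.diagonal fun j => (sgn j : ℂ) := by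
  ext i j
  rw [indefD, LieAlgebra.Orthogonal.indefiniteDiagonal]
  congr 2
  ext (j | j) <;> simp [sgn]

theorem indefD_mul_self : indefD r s * indefD r s = 1 := by
  rw [indefD_eq, Matrix.diagonal_mul_diagonal, ← Matrix.diagonal_one]
  congr 1
  ext j
  exact_mod_cast sgn_mul_self j

theorem qE_eq_dotProduct (x y : Fin r ⊕ Fin s → ℂ) : qE r s x y = x ⬝ᵥ (indefD r s).mulVec y := by
  rw [qE_apply, indefD_eq, dotProduct]
  refine Finset.sum_congr rfl fun j _ => ?_
  rw [Matrix.mulVec_diagonal]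
  ring

theorem qE_mulVec (M N : Matrix (Fin r ⊕ Fin s) (Fin r ⊕ Fin s) ℂ) (x y : Fin r ⊕ Fin s → ℂ) :
    qE r s (M.mulVec x) (N.mulVec y) =
      x ⬝ᵥ (M.transpose * indefD r s * N).mulVec y := by
  rw [qE_eq_dotProduct, Matrix.dotProduct_mulVec, ← Matrix.vecMul_transpose, Matrix.vecMul_vecMul,
    Matrix.dotProduct_mulVec, Matrix.vecMul_vecMul, ← Matrix.dotProduct_mulVec]

theorem transpose_mul_eq_iff (M : Matrix (Fin r ⊕ Fin s) (Fin r ⊕ Fin s) ℂ) :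
    M.transpose * indefD r s * M = indefD r s ↔
      ∀ x y, qE r s (M.mulVec x) (M.mulVec y) = qE r s x y := by
  constructor
  · intro h x y
    rw [qE_mulVec, h, qE_eq_dotProduct]
  · intro h
    ext i j
    have := h (Pi.single i 1) (Pi.single j 1)
    rw [qE_mulVec, qE_eq_dotProduct] at this
    simpa using this

/-- The topology of the general linear group is induced by the entries of a matrix and of its
inverse. On the orthogonal group the inverse is `D Aᵀ D`, a polynomial in the entries, so the
entries alone suffice. -/
theorem isEmbedding_complexSOEntries (r s : ℕ) :
    Topology.IsEmbedding (complexSOEntries r s) := by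
  have h1 : Topology.IsEmbedding (fun A : complexSO r s => Units.embedProduct _ A.1) :=
    Units.isEmbedding_embedProduct.comp Topology.IsEmbedding.subtypeVal
  have hc : Continuous (complexSOEntries r s) :=
    (Units.continuous_val (M := Matrix (Fin r ⊕ Fin s) (Fin r ⊕ Fin s) ℂ)).comp
      continuous_subtype_val
  let g : (Fin r ⊕ Fin s → Fin r ⊕ Fin s → ℂ) → Matrix (Fin r ⊕ Fin s) (Fin r ⊕ Fin s) ℂ ×
      (Matrix (Fin r ⊕ Fin s) (Fin r ⊕ Fin s) ℂ)ᵐᵒᵖ := fun M =>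
    (Matrix.of M, MulOpposite.op (indefD r s * (Matrix.of M).transpose * indefD r s))
  have hg : Continuous g := by
    have h0 : Continuous (fun M : Fin r ⊕ Fin s → Fin r ⊕ Fin s → ℂ => (Matrix.of M)) :=
      continuous_id
    exact h0.prodMk (MulOpposite.continuous_op.comp
      ((continuous_const.matrix_mul h0.matrix_transpose).matrix_mul continuous_const))
  refine Topology.IsEmbedding.of_comp hc hg ?_
  convert h1 using 1
  funext A
  refine Prod.ext rfl (congrArg MulOpposite.op ?_)
  change indefD r s * A.1.1.transpose * indefD r s = A.1⁻¹.1
  have h2 : A.1.1.transpose * indefD r s * A.1.1 = indefD r s := A.2.1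
  have h3 : indefD r s * A.1.1.transpose * indefD r s * A.1.1 = 1 := by
    rw [Matrix.mul_assoc, Matrix.mul_assoc, ← Matrix.mul_assoc A.1.1.transpose, h2,
      indefD_mul_self]
  exact (Units.mul_eq_one_iff_eq_inv (u := A.1)).1 h3

/-- An isometry of determinant `1` as an element of `complexSO`. -/
def complexSOMk (M : Matrix (Fin r ⊕ Fin s) (Fin r ⊕ Fin s) ℂ)
    (h : M.transpose * indefD r s * M = indefD r s) (hd : M.det = 1) : complexSO r s :=
  ⟨Matrix.GeneralLinearGroup.mkOfDetNeZero M (by rw [hd]; exact one_ne_zero), h, hd⟩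

theorem complexSOMk_val (M : Matrix (Fin r ⊕ Fin s) (Fin r ⊕ Fin s) ℂ)
    (h : M.transpose * indefD r s * M = indefD r s) (hd : M.det = 1) :
    (complexSOMk M h hd).1.1 = M := rfl

/-- The Lie algebra of `SO(r + s, ℂ)`. -/
def skewModel (r s : ℕ) : Submodule ℝ (Fin r ⊕ Fin s → Fin r ⊕ Fin s → ℂ) where
  carrier := {K | (Matrix.of K).transpose * indefD r s + indefD r s * Matrix.of K = 0}
  zero_mem' := by
    change (0 : Matrix (Fin r ⊕ Fin s) (Fin r ⊕ Fin s) ℂ).transpose * indefD r s +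
      indefD r s * (0 : Matrix (Fin r ⊕ Fin s) (Fin r ⊕ Fin s) ℂ) = 0
    simp
  add_mem' := by
    intro K K' h h'
    change (Matrix.of K + Matrix.of K').transpose * indefD r s +
      indefD r s * (Matrix.of K + Matrix.of K') = 0
    rw [Matrix.transpose_add, add_mul, mul_add, add_add_add_comm]
    exact (congrArg₂ (· + ·) h h').trans (add_zero 0)
  smul_mem' := by
    intro t K h
    change (t • Matrix.of K).transpose * indefD r s + indefD r s * (t • Matrix.of K) = 0
    rw [Matrix.transpose_smul, Matrix.smul_mul, Matrix.mul_smul, ← smul_add]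
    exact (congrArg (t • ·) h).trans (smul_zero t)

open scoped Matrix.Norms.Operator

/-- The identification of the ambient space with the matrix algebra. -/
def matE (r s : ℕ) : (Fin r ⊕ Fin s → Fin r ⊕ Fin s → ℂ) ≃L[ℝ]
    Matrix (Fin r ⊕ Fin s) (Fin r ⊕ Fin s) ℂ :=
  LinearEquiv.toContinuousLinearEquiv (Matrix.ofLinearEquiv ℝ)

/-- The Cayley chart of `SO(r + s, ℂ)`. -/
def complexSOChart (a : complexSO r s) : OpenPartialHomeomorph
    (Fin r ⊕ Fin s → Fin r ⊕ Fin s → ℂ) (Fin r ⊕ Fin s → Fin r ⊕ Fin s → ℂ) :=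
  (matE r s).toHomeomorph.toOpenPartialHomeomorph ≫ₕ cayleyHomeo a.1 ≫ₕ
    (matE r s).symm.toHomeomorph.toOpenPartialHomeomorph

theorem mem_complexSOChart_source (a : complexSO r s) (y) : y ∈ (complexSOChart a).source ↔
    IsUnit ((a.1⁻¹).1 * matE r s y + 1) :=
  ⟨fun h => h.2.1, fun h => ⟨trivial, h, trivial⟩⟩

theorem complexSOChart_apply (a : complexSO r s) (y) : complexSOChart a y =
    (matE r s).symm (cayley ((a.1⁻¹).1 * matE r s y)) := rfl

theorem matE_entries (a : complexSO r s) : matE r s (complexSOEntries r s a) = a.1.1 := rfl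

theorem transpose_mul_of_inv_mul (a : complexSO r s)
    (y : Matrix (Fin r ⊕ Fin s) (Fin r ⊕ Fin s) ℂ) :
    ((a.1⁻¹).1 * y).transpose * indefD r s * ((a.1⁻¹).1 * y) = y.transpose * indefD r s * y := by
  have h : (a.1⁻¹).1.transpose * indefD r s * (a.1⁻¹).1 = indefD r s := (a⁻¹).2.1
  rw [Matrix.transpose_mul]
  calc _ = y.transpose * ((a.1⁻¹).1.transpose * indefD r s * (a.1⁻¹).1) * y := by
        simp only [Matrix.mul_assoc]
    _ = _ := by rw [h]

/-- Multiplication by `(z + 1)ᵀ` and `z + 1` turns the linear equation for `cayley z` into twice the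
quadratic equation for `z`, and both factors are invertible. Thus the Cayley chart linearizes the
group. -/
theorem cayley_mem_iff {z : Matrix (Fin r ⊕ Fin s) (Fin r ⊕ Fin s) ℂ} (hz : IsUnit (z + 1)) :
    (cayley z).transpose * indefD r s + indefD r s * cayley z = 0 ↔
      z.transpose * indefD r s * z = indefD r s := by
  have h1 : (z + 1).transpose * ((cayley z).transpose * indefD r s + indefD r s * cayley z) *
      (z + 1) = (2 : ℂ) • (z.transpose * indefD r s * z - indefD r s) := by
    have h2 : (z + 1).transpose * (cayley z).transpose = (z - 1).transpose := by
      rw [← Matrix.transpose_mul, cayley_mul hz]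
    calc _ = ((z + 1).transpose * (cayley z).transpose) * indefD r s * (z + 1) +
          (z + 1).transpose * indefD r s * (cayley z * (z + 1)) := by noncomm_ring
      _ = _ := by
        rw [h2, cayley_mul hz, Matrix.transpose_add, Matrix.transpose_sub, Matrix.transpose_one]
        rw [two_smul]
        noncomm_ring
  constructor
  · intro h
    rw [h, mul_zero, zero_mul] at h1
    exact sub_eq_zero.1 ((smul_eq_zero.1 h1.symm).resolve_left two_ne_zero)
  · intro h
    rw [h, sub_self, smul_zero] at h1
    have hz' : IsUnit (z + 1).transpose := (Matrix.isUnit_transpose _).2 hz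
    have h3 := hz.mul_right_cancel (h1.trans (zero_mul _).symm)
    exact hz'.mul_left_cancel (h3.trans (mul_zero _).symm)

/-- For skew `K` one has `(1 - K)ᵀ D = D (1 + K)`, so `1 - K` and `1 + K` have the same determinant.
Isometries of determinant `-1` thus never meet the Cayley chart, and the slice condition needs no
equation for the determinant. -/
theorem det_eq_one_of_cayley {z : Matrix (Fin r ⊕ Fin s) (Fin r ⊕ Fin s) ℂ}
    (hz : IsUnit (z + 1))
    (h : (cayley z).transpose * indefD r s + indefD r s * cayley z = 0) : z.det = 1 := by
  have hu := isUnit_one_sub_cayley hz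
  have h1 := cayleyInv_mul hu
  rw [cayleyInv_cayley hz] at h1
  have h2 : (1 - cayley z).transpose * indefD r s = indefD r s * (1 + cayley z) := by
    rw [Matrix.transpose_sub, Matrix.transpose_one, sub_mul, one_mul, mul_add, mul_one,
      eq_neg_of_add_eq_zero_left h, sub_neg_eq_add]
  have hD : (indefD r s).det ≠ 0 := by
    have := congrArg Matrix.det (indefD_mul_self (r := r) (s := s))
    rw [Matrix.det_mul, Matrix.det_one] at this
    exact left_ne_zero_of_mul_eq_one this
  have h3 := congrArg Matrix.det h2
  have h4 := congrArg Matrix.det h1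
  rw [Matrix.det_mul, Matrix.det_mul, Matrix.det_transpose, mul_comm] at h3
  rw [Matrix.det_mul, ← mul_left_cancel₀ hD h3] at h4
  have h5 : (1 - cayley z).det ≠ 0 := ((Matrix.isUnit_iff_isUnit_det _).1 hu).ne_zero
  exact mul_right_cancel₀ h5 (h4.trans (one_mul _).symm)

theorem isSliceChart_complexSO (a : complexSO r s) :
    IsSliceChart (complexSOEntries r s) (skewModel r s) (complexSOChart a) where
  mem_atlas := StructureGroupoid.mem_maximalAtlas_of_mem_groupoid _
    (conj_mem_contDiffGroupoid (matE r s) (cayleyHomeo a.1) (contDiffOn_cayleyHomeo a.1)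
      (contDiffOn_cayleyHomeo_symm a.1))
  mem_iff := by
    intro y hy
    rw [mem_complexSOChart_source] at hy
    have h1 : complexSOChart a y ∈ skewModel r s ↔
        (cayley ((a.1⁻¹).1 * matE r s y)).transpose * indefD r s +
          indefD r s * cayley ((a.1⁻¹).1 * matE r s y) = 0 := Iff.rfl
    rw [h1]
    constructor
    · rintro ⟨A, rfl⟩
      rw [cayley_mem_iff hy, transpose_mul_of_inv_mul]
      exact A.2.1
    · intro h
      have hd := det_eq_one_of_cayley hy h
      have hi := (cayley_mem_iff hy).1 h
      rw [transpose_mul_of_inv_mul] at hi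
      have ha : ((a.1⁻¹).1 : Matrix (Fin r ⊕ Fin s) (Fin r ⊕ Fin s) ℂ).det = 1 := (a⁻¹).2.2
      rw [Matrix.det_mul, ha, one_mul] at hd
      exact ⟨complexSOMk _ hi hd, rfl⟩

theorem complexSO_mem_source (a : complexSO r s) :
    complexSOEntries r s a ∈ (complexSOChart a).source := by
  rw [mem_complexSOChart_source, matE_entries, Units.inv_mul, one_add_one_eq_two]
  exact isUnit_two

/-- The smooth structure of `SO(r + s, ℂ)`. -/
def complexSOManifold (r s : ℕ) :
    SmoothStructure (Fin r ⊕ Fin s → Fin r ⊕ Fin s → ℂ) (complexSOEntries r s)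
      (Module.finrank ℝ (skewModel r s)) :=
  sliceStructure (isEmbedding_complexSOEntries r s)
    fun a => ⟨complexSOChart a, isSliceChart_complexSO a, complexSO_mem_source a⟩

end ComplexOrthogonal

/-! ### The isometries of the model space which preserve the isotropic summand -/

section BlockIsometries

variable {k r s : ℕ}

/-- The matrix is block triangular in a basis adapted to the product. -/
theorem det_of_map_inl {V V' : Type*} [AddCommGroup V] [Module ℂ V] [FiniteDimensional ℂ V]
    [AddCommGroup V'] [Module ℂ V'] [FiniteDimensional ℂ V'] (L : V × V' →ₗ[ℂ] V × V')
    (hL : ∀ x, (L (x, 0)).2 = 0) :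
    LinearMap.det L = LinearMap.det (LinearMap.fst ℂ V V' ∘ₗ L ∘ₗ LinearMap.inl ℂ V V') *
      LinearMap.det (LinearMap.snd ℂ V V' ∘ₗ L ∘ₗ LinearMap.inr ℂ V V') := by
  let v := Module.finBasis ℂ V
  let v' := Module.finBasis ℂ V'
  rw [← LinearMap.det_toMatrix (v.prod v'), ← LinearMap.det_toMatrix v,
    ← LinearMap.det_toMatrix v', ← Matrix.det_fromBlocks_zero₂₁ _
      (LinearMap.toMatrix v' v (LinearMap.fst ℂ V V' ∘ₗ L ∘ₗ LinearMap.inr ℂ V V'))]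
  congr 1
  ext (i | i) (j | j) <;> simp [LinearMap.toMatrix_apply, hL]

variable {L : Mdl k r s →ₗ[ℂ] Mdl k r s}

/-- The component of an isometry on `ℂ^{r+s}`. -/
def eMat (L : Mdl k r s →ₗ[ℂ] Mdl k r s) : Matrix (Fin r ⊕ Fin s) (Fin r ⊕ Fin s) ℂ :=
  LinearMap.toMatrix' (LinearMap.fst ℂ _ _ ∘ₗ LinearMap.snd ℂ _ _ ∘ₗ L ∘ₗ
    LinearMap.inr ℂ _ _ ∘ₗ LinearMap.inl ℂ _ _)

theorem eMat_mulVec (L : Mdl k r s →ₗ[ℂ] Mdl k r s) (x : Fin r ⊕ Fin s → ℂ) :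
    (eMat L).mulVec x = (L (0, x, 0)).2.1 := by
  rw [eMat, ← Matrix.toLin'_apply, Matrix.toLin'_toMatrix']
  rfl

/-- `L` is an isometry which maps the summand `ℂᵏ` to itself. -/
structure IsBlockIsometry (L : Mdl k r s →ₗ[ℂ] Mdl k r s) : Prop where
  map_form : ∀ z w, mdlForm k r s (L z) (L w) = mdlForm k r s z w
  map_inl : ∀ a, (L (a, 0, 0)).2 = 0

namespace IsBlockIsometry

variable (h : IsBlockIsometry L)
include h

theorem map_inl_eq (a : Fin k → ℂ) : L (a, 0, 0) = ((L (a, 0, 0)).1, 0, 0) :=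
  Prod.ext rfl (h.map_inl a)

theorem injective : Function.Injective L :=
  (injective_iff_map_eq_zero L).2 fun z hz => mdlForm_separating fun w => by
    rw [← h.map_form, hz, map_zero, LinearMap.zero_apply]

theorem surjective_inl (a : Fin k → ℂ) : ∃ a', L (a', 0, 0) = (a, 0, 0) := by
  let C : (Fin k → ℂ) →ₗ[ℂ] (Fin k → ℂ) :=
    LinearMap.fst ℂ _ _ ∘ₗ L ∘ₗ LinearMap.inl ℂ _ _
  have hC : Function.Injective C := by
    intro a a' haa
    have h1 : L (a, 0, 0) = L (a', 0, 0) := by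
      rw [h.map_inl_eq a, h.map_inl_eq a']
      exact congrArg (fun x => (x, 0, 0)) haa
    exact congrArg Prod.fst (h.injective h1)
  obtain ⟨a', ha'⟩ := LinearMap.injective_iff_surjective.1 hC a
  refine ⟨a', ?_⟩
  rw [h.map_inl_eq]
  exact congrArg (fun x => (x, 0, 0)) ha'

/-- The image of a middle vector is orthogonal to the image of ℂᵏ, which is all of ℂᵏ, and the
orthocomplement of that summand is given by the vanishing of the last coordinate. -/
theorem map_inr_inl (x : Fin r ⊕ Fin s → ℂ) : (L (0, x, 0)).2.2 = 0 := by
  ext i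
  obtain ⟨a, ha⟩ := h.surjective_inl (Pi.single i 1)
  have h1 := h.map_form (a, 0, 0) (0, x, 0)
  rw [ha, mdlForm_apply, mdlForm_apply] at h1
  simpa using h1

theorem eMat_form (x y : Fin r ⊕ Fin s → ℂ) :
    qE r s ((eMat L).mulVec x) ((eMat L).mulVec y) = qE r s x y := by
  have h1 := h.map_form (0, x, 0) (0, y, 0)
  rw [mdlForm_apply, mdlForm_apply, h.map_inr_inl, h.map_inr_inl] at h1
  rw [eMat_mulVec, eMat_mulVec]
  simpa using h1

theorem eMat_transpose : (eMat L).transpose * indefD r s * eMat L = indefD r s :=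
  (transpose_mul_eq_iff _).2 h.eMat_form

/-- The map is block triangular with diagonal blocks `C`, `eMat L`, `D`. Since the pairing of the
outer summands is preserved, `Cᵀ D = 1`, so only the middle block contributes. -/
theorem det_eq : LinearMap.det L = (eMat L).det := by
  have h1 := det_of_map_inl L h.map_inl
  have h2 := det_of_map_inl (LinearMap.snd ℂ _ _ ∘ₗ L ∘ₗ LinearMap.inr ℂ (Fin k → ℂ)
    ((Fin r ⊕ Fin s → ℂ) × (Fin k → ℂ))) fun x => h.map_inr_inl x
  rw [h1, h2]
  set C : (Fin k → ℂ) →ₗ[ℂ] (Fin k → ℂ) :=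
    LinearMap.fst ℂ _ _ ∘ₗ L ∘ₗ LinearMap.inl ℂ _ _ with hC
  set D : (Fin k → ℂ) →ₗ[ℂ] (Fin k → ℂ) := LinearMap.snd ℂ _ _ ∘ₗ
    (LinearMap.snd ℂ _ _ ∘ₗ L ∘ₗ LinearMap.inr ℂ (Fin k → ℂ)
      ((Fin r ⊕ Fin s → ℂ) × (Fin k → ℂ))) ∘ₗ LinearMap.inr ℂ _ _ with hD
  have hE : LinearMap.det (LinearMap.fst ℂ _ _ ∘ₗ
      (LinearMap.snd ℂ _ _ ∘ₗ L ∘ₗ LinearMap.inr ℂ (Fin k → ℂ)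
      ((Fin r ⊕ Fin s → ℂ) × (Fin k → ℂ))) ∘ₗ LinearMap.inl ℂ _ _) = (eMat L).det :=
    (LinearMap.det_toMatrix' _).symm
  rw [hE]
  have hCD (a c : Fin k → ℂ) : C a ⬝ᵥ D c = a ⬝ᵥ c := by
    have h3 := h.map_form (a, 0, 0) (0, 0, c)
    rw [h.map_inl_eq a, mdlForm_apply, mdlForm_apply] at h3
    simp only [map_zero, LinearMap.zero_apply, add_zero, zero_dotProduct] at h3
    exact h3
  have h4 : (LinearMap.toMatrix' C).transpose * LinearMap.toMatrix' D = 1 := by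
    ext i j
    have h5 := hCD (Pi.single i 1) (Pi.single j 1)
    rw [dotProduct_single, mul_one, Pi.single_apply] at h5
    rw [Matrix.mul_apply, Matrix.one_apply]
    simp only [Matrix.transpose_apply, LinearMap.toMatrix'_apply, eq_comm (a := i)]
    exact h5
  have h5 := congrArg Matrix.det h4
  rw [Matrix.det_mul, Matrix.det_transpose, LinearMap.det_toMatrix', LinearMap.det_toMatrix',
    Matrix.det_one] at h5
  linear_combination (eMat L).det * h5

end IsBlockIsometry

/-- The part of `L' (0, x, 0)` in the first summand stays there under `L`, so it is invisible in the
middle block. -/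
theorem eMat_comp {L' : Mdl k r s →ₗ[ℂ] Mdl k r s} (h : IsBlockIsometry L)
    (h' : IsBlockIsometry L') : eMat (L ∘ₗ L') = eMat L * eMat L' := by
  apply Matrix.mulVec_injective
  funext x
  rw [← Matrix.mulVec_mulVec, eMat_mulVec, eMat_mulVec, eMat_mulVec, LinearMap.comp_apply]
  have h1 : L' (0, x, 0) = ((L' (0, x, 0)).1, 0, 0) + (0, (L' (0, x, 0)).2.1, 0) := by
    refine Prod.ext ?_ (Prod.ext ?_ ?_)
    · simp
    · simp
    · simpa using h'.map_inr_inl x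
  conv_lhs => rw [h1, map_add, h.map_inl_eq]
  simp

/-- The isometry of the model space given by an isometry of `ℂ^{r+s}`. -/
def rotMap (k : ℕ) (A : Matrix (Fin r ⊕ Fin s) (Fin r ⊕ Fin s) ℂ) :
    Mdl k r s →ₗ[ℂ] Mdl k r s :=
  LinearMap.prodMap LinearMap.id (LinearMap.prodMap (Matrix.toLin' A) LinearMap.id)

theorem rotMap_apply (A : Matrix (Fin r ⊕ Fin s) (Fin r ⊕ Fin s) ℂ) (z : Mdl k r s) :
    rotMap k A z = (z.1, A.mulVec z.2.1, z.2.2) := rfl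

theorem rotMap_form {A : Matrix (Fin r ⊕ Fin s) (Fin r ⊕ Fin s) ℂ}
    (hA : A.transpose * indefD r s * A = indefD r s) (z w : Mdl k r s) :
    mdlForm k r s (rotMap k A z) (rotMap k A w) = mdlForm k r s z w := by
  rw [mdlForm_apply, mdlForm_apply, rotMap_apply, rotMap_apply]
  simp only [(transpose_mul_eq_iff A).1 hA]

theorem isBlockIsometry_rotMap {A : Matrix (Fin r ⊕ Fin s) (Fin r ⊕ Fin s) ℂ}
    (hA : A.transpose * indefD r s * A = indefD r s) : IsBlockIsometry (rotMap k A) :=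
  ⟨rotMap_form hA, fun a => by simp [rotMap_apply]⟩

theorem eMat_rotMap (A : Matrix (Fin r ⊕ Fin s) (Fin r ⊕ Fin s) ℂ) : eMat (rotMap k A) = A := by
  apply Matrix.mulVec_injective
  funext x
  rw [eMat_mulVec, rotMap_apply]

end BlockIsometries

/-! ### The fibres of the projection -/

section Fibres

variable {n k r s : ℕ} {b : LinearMap.BilinForm ℂ (CVec n)}

theorem mem_realSO_iff (A : complexSO r s) : A ∈ realSO r s ↔ ∀ i j, (A.1.1 i j).im = 0 := by
  have h1 : A ∈ realSO r s ↔
      Matrix.GeneralLinearGroup.map (n := Fin r ⊕ Fin s) (starRingEnd ℂ) A.1 = A.1 := Iff.rfl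
  rw [h1]
  constructor
  · intro h i j
    have h2 := congrArg (fun M : GL (Fin r ⊕ Fin s) ℂ => M.1 i j) h
    exact Complex.conj_eq_iff_im.1 h2
  · intro h
    refine Units.ext ?_
    ext i j
    exact Complex.conj_eq_iff_im.2 (h i j)

/-- The real part of a matrix. -/
def reM (r s : ℕ) : Matrix (Fin r ⊕ Fin s) (Fin r ⊕ Fin s) ℂ →ₗ[ℝ]
    Matrix (Fin r ⊕ Fin s) (Fin r ⊕ Fin s) ℝ where
  toFun M := M.map Complex.re
  map_add' M N := by ext; simp
  map_smul' t M := by ext; simp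

/-- The imaginary part of a matrix. -/
def imM (r s : ℕ) : Matrix (Fin r ⊕ Fin s) (Fin r ⊕ Fin s) ℂ →ₗ[ℝ]
    Matrix (Fin r ⊕ Fin s) (Fin r ⊕ Fin s) ℝ where
  toFun M := M.map Complex.im
  map_add' M N := by ext; simp
  map_smul' t M := by ext; simp

theorem mulVec_realE (M : Matrix (Fin r ⊕ Fin s) (Fin r ⊕ Fin s) ℂ) (x : Fin r ⊕ Fin s → ℝ) :
    M.mulVec (realE r s x) =
      realE r s ((reM r s M).mulVec x) + Complex.I • realE r s ((imM r s M).mulVec x) := by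
  ext i
  simp only [Matrix.mulVec, dotProduct, reM, imM, LinearMap.coe_mk, AddHom.coe_mk, realE_apply,
    Pi.add_apply, Pi.smul_apply, Matrix.map_apply, smul_eq_mul]
  push_cast
  rw [Finset.mul_sum, ← Finset.sum_add_distrib]
  refine Finset.sum_congr rfl fun j _ => ?_
  conv_lhs => rw [← Complex.re_add_im (M i j)]
  ring

theorem mulVec_realE_of_mem {A : complexSO r s} (hA : A ∈ realSO r s) (x : Fin r ⊕ Fin s → ℝ) :
    A.1.1.mulVec (realE r s x) = realE r s ((reM r s A.1.1).mulVec x) := by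
  have h : imM r s A.1.1 = 0 := by
    ext i j
    exact (mem_realSO_iff A).1 hA i j
  rw [mulVec_realE, h]
  simp

/-- The frame obtained by applying an isometry of `ℂ^{r+s}`. -/
def Frame.rot (T : Frame b k r s) (hn : r + s + 2 * k = n) (A : complexSO r s) : Frame b k r s :=
  frameOfMap hn (T.toEquiv.toLinearMap ∘ₗ rotMap k A.1.1)
    fun z w => (T.map_form _ _).trans (rotMap_form A.2.1 z w)

theorem Frame.rot_apply (T : Frame b k r s) (hn : r + s + 2 * k = n) (A : complexSO r s)
    (z : Mdl k r s) : (T.rot hn A).toEquiv z = T.toEquiv (z.1, A.1.1.mulVec z.2.1, z.2.2) := rfl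

theorem Frame.rot_pointC (T : Frame b k r s) (hn : r + s + 2 * k = n) (A : complexSO r s) :
    (T.rot hn A).pointC hn 0 = T.pointC hn 0 := by
  refine Gr.eq_of_le fun v hv => ?_
  obtain ⟨w, rfl⟩ := (Frame.mem_pointC_zero _ hn v).1 hv
  refine (T.mem_pointC_zero hn _).2 ⟨w, ?_⟩
  rw [T.rot_apply]
  simp

theorem Frame.mem_rot_point (T : Frame b k r s) (hn : r + s + 2 * k = n) (A : complexSO r s)
    (v : CVec n) : v ∈ ((T.rot hn A).point hn 0).toSubmodule ↔
      ∃ w x, T.toEquiv (w, A.1.1.mulVec (realE r s x), 0) = v :=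
  Frame.mem_point_zero _ hn v

theorem complexSO_mulVec_inv_mul (A B : complexSO r s) (x : Fin r ⊕ Fin s → ℂ) :
    A.1.1.mulVec ((A⁻¹ * B).1.1.mulVec x) = B.1.1.mulVec x := by
  have h : A.1.1 * (A⁻¹ * B).1.1 = B.1.1 :=
    congrArg (fun M : complexSO r s => M.1.1) (mul_inv_cancel_left A B)
  rw [Matrix.mulVec_mulVec, h]

theorem complexSO_mulVec_injective (A : complexSO r s) : Function.Injective A.1.1.mulVec :=
  Matrix.mulVec_injective_of_isUnit A.1.isUnit

/-- Comparison of the middle coordinates shows that the points agree if and only if `A⁻¹ B` maps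
real vectors to real vectors. So the orbit map descends to the quotient and is injective there. -/
theorem Frame.rot_point_eq_iff (T : Frame b k r s) (hn : r + s + 2 * k = n) (A B : complexSO r s) :
    (T.rot hn A).point hn 0 = (T.rot hn B).point hn 0 ↔ A⁻¹ * B ∈ realSO r s := by
  constructor
  · intro h
    rw [mem_realSO_iff]
    intro i j
    have h1 : T.toEquiv (0, B.1.1.mulVec (realE r s (Pi.single j 1)), 0) ∈
        ((T.rot hn A).point hn 0).toSubmodule := by
      rw [h]
      exact (T.mem_rot_point hn B _).2 ⟨0, _, rfl⟩
    obtain ⟨w, x, hx⟩ := (T.mem_rot_point hn A _).1 h1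
    have h2 : A.1.1.mulVec (realE r s x) = B.1.1.mulVec (realE r s (Pi.single j 1)) :=
      congrArg (fun z => z.2.1) (T.toEquiv.injective hx)
    rw [← complexSO_mulVec_inv_mul A B] at h2
    have h3 := congrFun (complexSO_mulVec_injective A h2) i
    have h4 : realE r s (Pi.single j 1) = Pi.single j 1 := by
      ext l
      rw [realE_apply, Pi.single_apply, Pi.single_apply]
      split_ifs <;> simp
    rw [h4, Matrix.mulVec_single_one, realE_apply] at h3
    have h5 : (A⁻¹ * B).1.1 i j = x i := h3.symm
    rw [h5, Complex.ofReal_im]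
  · intro h
    symm
    refine Gr.eq_of_le fun v hv => ?_
    obtain ⟨w, x, rfl⟩ := (T.mem_rot_point hn B _).1 hv
    refine (T.mem_rot_point hn A _).2 ⟨w, (reM r s (A⁻¹ * B).1.1).mulVec x, ?_⟩
    rw [← mulVec_realE_of_mem h, complexSO_mulVec_inv_mul]

theorem exists_sign (hrs : Nonempty (Fin r ⊕ Fin s)) :
    ∃ d : Fin r ⊕ Fin s → ℝ, (∀ j, d j * d j = 1) ∧ ∏ j, d j = -1 := by
  obtain ⟨j₀⟩ := hrs
  refine ⟨fun j => if j = j₀ then -1 else 1, fun j => ?_, ?_⟩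
  · dsimp only
    split_ifs <;> simp
  · simp [Finset.prod_ite_eq']

/-- Every isometry of `ℂ^{r+s}` agrees with one of determinant `1` up to a real reflection. -/
theorem exists_complexSO {M : Matrix (Fin r ⊕ Fin s) (Fin r ⊕ Fin s) ℂ}
    (hM : M.transpose * indefD r s * M = indefD r s) :
    ∃ A : complexSO r s, ∀ x, ∃ y, A.1.1.mulVec (realE r s x) = M.mulVec (realE r s y) := by
  have hD : (indefD r s).det ≠ 0 := by
    have := congrArg Matrix.det (indefD_mul_self (r := r) (s := s))
    rw [Matrix.det_mul, Matrix.det_one] at this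
    exact left_ne_zero_of_mul_eq_one this
  have h1 := congrArg Matrix.det hM
  rw [Matrix.det_mul, Matrix.det_mul, Matrix.det_transpose] at h1
  have h2 : M.det * M.det = 1 := by
    apply mul_right_cancel₀ hD
    linear_combination h1
  rcases mul_self_eq_one_iff.1 h2 with h | h
  · exact ⟨complexSOMk M hM h, fun x => ⟨x, rfl⟩⟩
  -- The determinant of the empty matrix is `1`, so determinant `-1` guarantees a coordinate in
  -- which to reflect.
  · have hne : Nonempty (Fin r ⊕ Fin s) := by
      by_contra hne
      rw [not_nonempty_iff] at hne
      rw [Matrix.det_isEmpty] at h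
      norm_num at h
    obtain ⟨d, hd, hd'⟩ := exists_sign hne
    let R : Matrix (Fin r ⊕ Fin s) (Fin r ⊕ Fin s) ℂ := Matrix.diagonal fun j => (d j : ℂ)
    have hR : R.transpose * indefD r s * R = indefD r s := by
      rw [indefD_eq, Matrix.diagonal_transpose, Matrix.diagonal_mul_diagonal,
        Matrix.diagonal_mul_diagonal]
      congr 1
      ext j
      have : (d j : ℂ) * d j = 1 := by exact_mod_cast hd j
      linear_combination (sgn j : ℂ) * this
    refine ⟨complexSOMk (M * R) ?_ ?_, fun x => ⟨fun j => d j * x j, ?_⟩⟩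
    · rw [Matrix.transpose_mul]
      calc _ = R.transpose * (M.transpose * indefD r s * M) * R := by
            simp only [Matrix.mul_assoc]
        _ = _ := by rw [hM, hR]
    · rw [Matrix.det_mul, h, Matrix.det_diagonal, ← Complex.ofReal_prod, hd']
      simp
    · rw [complexSOMk_val, ← Matrix.mulVec_mulVec]
      congr 1
      ext j
      simp [R, Matrix.mulVec_diagonal]

variable (hn : r + s + 2 * k = n) (hsymm : b.IsSymm) (hnd : b.Nondegenerate)

/-- The fibre of the projection. -/
abbrev fibre (W : cIgr b k) : Set (Gr n n (CVec n)) :=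
  {V | ∃ hV : V ∈ orb b r s, orbProj hn hsymm hnd ⟨V, hV⟩ = W}

/-- The parameters of the points of a fibre. -/
def fibModel (k r s : ℕ) : Submodule ℝ (Coord k r s) :=
  orbModel k r s ⊓ LinearMap.ker (projModel k r s).toLinearMap

theorem orbProj_eq_of_frame (T : Frame b k r s) (V : orb b r s) (hV : T.point hn 0 = V.1) :
    (orbProj hn hsymm hnd V).1 = T.pointC hn 0 := by
  have h0 : ((cxE k r s (0 : Coord k r s).2.1, (0 : Coord k r s).2.2.1) : CCoord k r s) = 0 := by
    simp
  rw [orbProj_point hn hsymm hnd T zero_mem_orbModel zero_mem_smallBall V hV.symm, h0]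

/-- The subspace `W` has parameters `0` and the projection is linear in the parameters, so the fibre
is the kernel of `projModel` inside the model of the orbit. -/
theorem point_mem_fibre_iff {W : cIgr b k} (T : Frame b k r s) (hT : T.pointC hn 0 = W.1)
    {q : Coord k r s} (hq : q.1 ∈ smallBall r s) :
    T.point hn q ∈ fibre hn hsymm hnd W ↔ q ∈ fibModel k r s := by
  have key (hq' : q ∈ orbModel k r s) (hV : T.point hn q ∈ orb b r s) :
      orbProj hn hsymm hnd ⟨_, hV⟩ = W ↔ projModel k r s q = 0 := by
    rw [← Subtype.coe_inj, orbProj_point hn hsymm hnd T hq' hq _ rfl, ← hT, ← projModel_apply]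
    constructor
    · intro h
      have h1 := congrArg (T.chartC hn) h
      rw [T.chartC_point, T.chartC_point] at h1
      exact (blockC hn).symm.injective h1
    · intro h
      rw [h]
  constructor
  · rintro ⟨hV, h⟩
    have hq' := T.mem_orbModel_of_point_mem hn hV hq
    exact ⟨hq', (key hq' hV).1 h⟩
  · rintro ⟨hq', h⟩
    have hV := T.point_mem_orb hn hq' hq
    exact ⟨hV, (key hq' hV).2 h⟩

theorem isSliceChart_fibre {W : cIgr b k} (T : Frame b k r s) (hT : T.pointC hn 0 = W.1) :
    IsSliceChart (Subtype.val : fibre hn hsymm hnd W → _)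
      ((fibModel k r s).comap (blockE hn).toLinearEquiv.toLinearMap) (T.chart hn) where
  mem_atlas := T.chart_mem_maximalAtlas hn
  mem_iff := by
    intro V hV
    obtain ⟨q, hq, rfl⟩ := (T.mem_chart_source hn V).1 hV
    rw [Subtype.range_coe, T.chart_point hn hq, Submodule.mem_comap]
    simpa using point_mem_fibre_iff hn hsymm hnd T hT hq

theorem exists_sliceChart_fibre (W : cIgr b k) (V : fibre hn hsymm hnd W) :
    ∃ Ψ, IsSliceChart (Subtype.val : fibre hn hsymm hnd W → _)
      ((fibModel k r s).comap (blockE hn).toLinearEquiv.toLinearMap) Ψ ∧ V.1 ∈ Ψ.source := by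
  obtain ⟨V, hV, hVW⟩ := V
  obtain ⟨T, hT⟩ := exists_frame_of_mem_orb hn hsymm hnd hV
  have hTW : T.pointC hn 0 = W.1 := by
    rw [← hVW, orbProj_eq_of_frame hn hsymm hnd T ⟨V, hV⟩ hT]
  exact ⟨T.chart hn, isSliceChart_fibre hn hsymm hnd T hTW,
    (T.mem_chart_source hn _).2 ⟨0, zero_mem_smallBall, hT⟩⟩

/-- The fibre as an embedded submanifold. -/
def fibreManifold (W : cIgr b k) : EmbeddedSubmanifold (GrModel n n) (fibre hn hsymm hnd W)
    (Module.finrank ℝ ((fibModel k r s).comap (blockE hn).toLinearEquiv.toLinearMap)) :=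
  sliceStructure Topology.IsEmbedding.subtypeVal (exists_sliceChart_fibre hn hsymm hnd W)

variable {W : cIgr b k} (T : Frame b k r s) (hT : T.pointC hn 0 = W.1)

/-- The orbit map of the fibre. -/
def rotPoint (A : complexSO r s) : fibre hn hsymm hnd W :=
  ⟨(T.rot hn A).point hn 0, Frame.point_zero_mem_orb _ hn, Subtype.ext (by
    rw [orbProj_eq_of_frame hn hsymm hnd (T.rot hn A) _ rfl, T.rot_pointC, hT])⟩

theorem isBlockIsometry_of_pointC (T' : Frame b k r s)
    (h : ∀ a, T'.toEquiv (a, 0, 0) ∈ (T.pointC hn 0).toSubmodule) :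
    IsBlockIsometry (T.toEquiv.symm.toLinearMap ∘ₗ T'.toEquiv.toLinearMap) where
  map_form z w := by
    rw [← T.map_form]
    simp [T'.map_form]
  map_inl a := by
    obtain ⟨a', ha'⟩ := (T.mem_pointC_zero hn _).1 (h a)
    simp [← ha']

include hT in
-- Both `T` and a frame adapted to `V` parametrize the same complex part, so the second can be
-- chosen to agree with `T` on ℂᵏ. The transition is then a block isometry. Its middle block, made
-- of determinant `1` by a real reflection if necessary, rotates the standard point of `T` to `V`;
-- the part in ℂᵏ only moves vectors within `W`.
theorem rotPoint_surjective : Function.Surjective (rotPoint hn hsymm hnd T hT) := by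
  rintro ⟨V, hV, hVW⟩
  have hmem (v) : v ∈ complexPart V.toSubmodule ↔ ∃ a, T.toEquiv (a, 0, 0) = v := by
    rw [← T.mem_pointC_zero hn, hT, ← hVW, orbProj_toSubmodule]
    rfl
  let e : (Fin k → ℂ) ≃ₗ[ℂ] complexPart V.toSubmodule :=
    LinearEquiv.ofBijective (LinearMap.codRestrict _
      (T.toEquiv.toLinearMap ∘ₗ LinearMap.inl ℂ _ _) fun a => (hmem _).2 ⟨a, rfl⟩)
      ⟨fun a a' h => by
        have h1 : T.toEquiv (a, 0, 0) = T.toEquiv (a', 0, 0) := congrArg Subtype.val h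
        exact congrArg Prod.fst (T.toEquiv.injective h1),
      fun ⟨v, hv⟩ => by
        obtain ⟨a, rfl⟩ := (hmem v).1 hv
        exact ⟨a, rfl⟩⟩
  obtain ⟨T', hT', hT'a⟩ := exists_frame_of_mem_orb_of_basis hn hsymm hnd hV
    (Module.Basis.ofEquivFun e.symm)
  have hTT (a) : T'.toEquiv (a, 0, 0) = T.toEquiv (a, 0, 0) := by
    rw [hT'a]
    have h1 : e a = ∑ i, a i • (Module.Basis.ofEquivFun e.symm i) := by
      conv_lhs => rw [← (Module.Basis.ofEquivFun e.symm).sum_equivFun (e a)]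
      simp
    have h2 : (e a).1 = T.toEquiv (a, 0, 0) := rfl
    rw [← h2, h1]
    simp
  have hL := isBlockIsometry_of_pointC hn T T' fun a => (T.mem_pointC_zero hn _).2 ⟨a, (hTT a).symm⟩
  set L := T.toEquiv.symm.toLinearMap ∘ₗ T'.toEquiv.toLinearMap with hLdef
  obtain ⟨A, hA⟩ := exists_complexSO hL.eMat_transpose
  refine ⟨A, Subtype.ext (Gr.eq_of_le fun v hv => ?_)⟩
  change v ∈ V.toSubmodule
  obtain ⟨w, x, rfl⟩ := (T.mem_rot_point hn A v).1 hv
  obtain ⟨y, hy⟩ := hA x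
  have h1 : L (0, realE r s y, 0) = ((L (0, realE r s y, 0)).1, (eMat L).mulVec (realE r s y), 0) := by
    refine Prod.ext rfl (Prod.ext (eMat_mulVec _ _).symm (hL.map_inr_inl _))
  have h2 : T'.toEquiv (0, realE r s y, 0) = T.toEquiv (L (0, realE r s y, 0)) := by
    simp [hLdef]
  rw [← hT', hy]
  refine (T'.mem_point_zero hn _).2 ⟨w - (L (0, realE r s y, 0)).1, y, ?_⟩
  have h3 : ((w - (L (0, realE r s y, 0)).1, realE r s y, 0) : Mdl k r s) =
      (w - (L (0, realE r s y, 0)).1, 0, 0) + (0, realE r s y, 0) := by simp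
  rw [h3, map_add, hTT, h2, ← map_add, h1]
  simp

/-- The identification of the homogeneous space with the fibre. -/
def fibreEquiv : (complexSO r s ⧸ realSO r s) ≃ fibre hn hsymm hnd W :=
  Equiv.ofBijective
    (Quotient.lift (rotPoint hn hsymm hnd T hT) fun A B h =>
      Subtype.ext ((T.rot_point_eq_iff hn A B).2 (QuotientGroup.leftRel_apply.1 h)))
    ⟨fun x y => Quotient.inductionOn₂ x y fun A B h => Quotient.sound
        (QuotientGroup.leftRel_apply.2 ((T.rot_point_eq_iff hn A B).1 (congrArg Subtype.val h))),
      fun V => (rotPoint_surjective hn hsymm hnd T hT V).imp' (fun A => QuotientGroup.mk A)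
        fun _ h => h⟩

/-! ### The action of the stabilizer on a fibre -/

/-- The action of an element of `H` in a frame. -/
def frameMap (u : groupH b) : Mdl k r s →ₗ[ℂ] Mdl k r s :=
  T.toEquiv.symm.toLinearMap ∘ₗ (exists_equiv_of_mem_groupH u.2).choose.toLinearMap ∘ₗ
    T.toEquiv.toLinearMap

theorem toEquiv_frameMap (u : groupH b) (z : Mdl k r s) :
    T.toEquiv (frameMap T u z) = u.1.1 (T.toEquiv z) := by
  rw [frameMap]
  simp [(exists_equiv_of_mem_groupH u.2).choose_spec.1]

theorem det_frameMap (u : groupH b) : LinearMap.det (frameMap T u) = 1 := by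
  have h := (exists_equiv_of_mem_groupH u.2).choose_spec.2.2
  have h1 := LinearMap.det_conj (exists_equiv_of_mem_groupH u.2).choose.toLinearMap T.toEquiv.symm
  rw [h] at h1
  exact h1

theorem frameMap_mul (u u' : groupH b) :
    frameMap T (u * u') = frameMap T u ∘ₗ frameMap T u' := by
  refine LinearMap.ext fun z => ?_
  apply T.toEquiv.injective
  rw [LinearMap.comp_apply, toEquiv_frameMap, toEquiv_frameMap, toEquiv_frameMap]
  rfl

include hT in
theorem isBlockIsometry_frameMap (u : groupH b)
    (hu : u.1 ∈ MulAction.stabilizer (GLR n) W.1) : IsBlockIsometry (frameMap T u) where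
  map_form z w := by
    rw [← T.map_form, ← T.map_form, toEquiv_frameMap, toEquiv_frameMap]
    obtain ⟨A, hA, hb, -⟩ := u.2
    rw [← hA, ← hA, hb]
  map_inl a := by
    have h1 : u.1.1 (T.toEquiv (a, 0, 0)) ∈ (T.pointC hn 0).toSubmodule := by
      have h2 : u.1 • W.1 = W.1 := hu
      rw [hT, ← h2]
      exact (mem_smul_iff _ _ _).2 ⟨_, by rw [← hT]; exact (T.mem_pointC_zero hn _).2 ⟨a, rfl⟩, rfl⟩
    obtain ⟨a', ha'⟩ := (T.mem_pointC_zero hn _).1 h1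
    rw [← toEquiv_frameMap] at ha'
    rw [← T.toEquiv.injective ha']
    rfl

/-- The homomorphism from the stabilizer of an isotropic subspace to `SO(r + s, ℂ)`. -/
def stabHom : ↥(groupH b ⊓ MulAction.stabilizer (GLR n) W.1) →* complexSO r s :=
  MonoidHom.mk' (fun u => complexSOMk (eMat (frameMap T ⟨u.1, u.2.1⟩))
      (isBlockIsometry_frameMap hn T hT ⟨u.1, u.2.1⟩ u.2.2).eMat_transpose
      (by rw [← (isBlockIsometry_frameMap hn T hT ⟨u.1, u.2.1⟩ u.2.2).det_eq, det_frameMap]))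
    fun u u' => by
      refine Subtype.ext (Units.ext ?_)
      change eMat (frameMap T (⟨u.1, u.2.1⟩ * ⟨u'.1, u'.2.1⟩)) = eMat _ * eMat _
      rw [frameMap_mul, eMat_comp (isBlockIsometry_frameMap hn T hT ⟨u.1, u.2.1⟩ u.2.2)
        (isBlockIsometry_frameMap hn T hT ⟨u'.1, u'.2.1⟩ u'.2.2)]

theorem stabHom_val (u : ↥(groupH b ⊓ MulAction.stabilizer (GLR n) W.1)) :
    (stabHom hn T hT u).1.1 = eMat (frameMap T ⟨u.1, u.2.1⟩) := rfl

/-- A rotation of the middle summand fixes `W` pointwise, and its determinant is that of the middle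
block. -/
theorem stabHom_surjective : Function.Surjective (stabHom hn T hT) := by
  intro A
  let E : CVec n ≃ₗ[ℂ] CVec n := T.toEquiv.symm.trans (T.rot hn A).toEquiv
  have hE (z) : E (T.toEquiv z) = T.toEquiv (rotMap k A.1.1 z) := by
    change (T.rot hn A).toEquiv (T.toEquiv.symm (T.toEquiv z)) = _
    rw [LinearEquiv.symm_apply_apply]
    rfl
  have hb (z w) : b (E z) (E w) = b z w := by
    change b ((T.rot hn A).toEquiv _) ((T.rot hn A).toEquiv _) = _
    rw [Frame.map_form, ← T.map_form]
    simp
  have hd : LinearMap.det E.toLinearMap = 1 := by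
    have h1 : E.toLinearMap =
        T.toEquiv.toLinearMap ∘ₗ rotMap k A.1.1 ∘ₗ T.toEquiv.symm.toLinearMap := rfl
    rw [h1, LinearMap.det_conj, (isBlockIsometry_rotMap A.2.1).det_eq, eMat_rotMap]
    exact A.2.2
  have hs : unitOfEquiv E • W.1 = W.1 := by
    rw [← hT]
    refine Gr.eq_of_le fun v hv => ?_
    obtain ⟨v', hv', rfl⟩ := (mem_smul_iff _ _ _).1 hv
    obtain ⟨a, rfl⟩ := (T.mem_pointC_zero hn _).1 hv'
    refine (T.mem_pointC_zero hn _).2 ⟨a, ?_⟩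
    rw [unitOfEquiv_apply, hE, rotMap_apply]
    simp
  refine ⟨⟨unitOfEquiv E, unitOfEquiv_mem_groupH hb hd, hs⟩, Subtype.ext (Units.ext ?_)⟩
  rw [stabHom_val, ← eMat_rotMap (k := k) A.1.1]
  congr 1
  refine LinearMap.ext fun z => ?_
  apply T.toEquiv.injective
  rw [toEquiv_frameMap, ← hE]
  rfl

/-- In the frame an element of the stabilizer is block triangular; what it adds in the first summand
lies in `W`, which every point of the fibre contains. So only the middle block acts. -/
theorem fibreEquiv_smul (u : ↥(groupH b ⊓ MulAction.stabilizer (GLR n) W.1))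
    (x : complexSO r s ⧸ realSO r s) :
    (fibreEquiv hn hsymm hnd T hT (stabHom hn T hT u • x)).1 =
      u.1 • (fibreEquiv hn hsymm hnd T hT x).1 := by
  induction x using QuotientGroup.induction_on with
  | H A =>
    have hL := isBlockIsometry_frameMap hn T hT ⟨u.1, u.2.1⟩ u.2.2
    symm
    refine Gr.eq_of_le fun v hv => ?_
    obtain ⟨v', hv', rfl⟩ := (mem_smul_iff _ _ _).1 hv
    obtain ⟨w, x, rfl⟩ := (T.mem_rot_point hn A _).1 hv'
    have h1 := toEquiv_frameMap T ⟨u.1, u.2.1⟩ (w, A.1.1.mulVec (realE r s x), 0)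
    set L := frameMap T ⟨u.1, u.2.1⟩ with hLd
    have h2 : L (w, A.1.1.mulVec (realE r s x), 0) =
        ((L (w, 0, 0)).1 + (L (0, A.1.1.mulVec (realE r s x), 0)).1,
          (eMat L).mulVec (A.1.1.mulVec (realE r s x)), 0) := by
      have h3 : ((w, A.1.1.mulVec (realE r s x), 0) : Mdl k r s) =
        (w, 0, 0) + (0, A.1.1.mulVec (realE r s x), 0) := by simp
      rw [h3, map_add, eMat_mulVec]
      refine Prod.ext rfl (Prod.ext ?_ ?_)
      · simp [hL.map_inl]
      · simp [hL.map_inl, hL.map_inr_inl]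
    rw [h2, Matrix.mulVec_mulVec] at h1
    exact (T.mem_rot_point hn (stabHom hn T hT u * A) _).2 ⟨_, x, h1⟩

/-! ### The orbit map is a submersion -/

open scoped Matrix.Norms.Operator

/-- The real and imaginary parts as continuous maps. -/
def reML (r s : ℕ) : Matrix (Fin r ⊕ Fin s) (Fin r ⊕ Fin s) ℂ →L[ℝ]
    Matrix (Fin r ⊕ Fin s) (Fin r ⊕ Fin s) ℝ := LinearMap.toContinuousLinearMap (reM r s)

/-- The imaginary part as a continuous map. -/
def imML (r s : ℕ) : Matrix (Fin r ⊕ Fin s) (Fin r ⊕ Fin s) ℂ →L[ℝ]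
    Matrix (Fin r ⊕ Fin s) (Fin r ⊕ Fin s) ℝ := LinearMap.toContinuousLinearMap (imM r s)

theorem reML_one : reML r s 1 = 1 := by
  ext i j
  change (Complex.re ((1 : Matrix (Fin r ⊕ Fin s) (Fin r ⊕ Fin s) ℂ) i j)) = _
  rw [Matrix.one_apply, Matrix.one_apply]
  split_ifs <;> simp

theorem imML_one : imML r s 1 = 0 := by
  ext i j
  change (Complex.im ((1 : Matrix (Fin r ⊕ Fin s) (Fin r ⊕ Fin s) ℂ) i j)) = _
  rw [Matrix.one_apply]
  split_ifs <;> simp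

/-- A real matrix as an operator. -/
def opE (r s : ℕ) : Matrix (Fin r ⊕ Fin s) (Fin r ⊕ Fin s) ℝ →L[ℝ]
    ((Fin r ⊕ Fin s → ℝ) →L[ℝ] (Fin r ⊕ Fin s → ℝ)) :=
  LinearMap.toContinuousLinearMap
    (LinearMap.toContinuousLinearMap.toLinearMap ∘ₗ Matrix.toLin'.toLinearMap)

/-- The real matrix whose graph is the image of the real vectors under `z`. -/
def slope (z : Matrix (Fin r ⊕ Fin s) (Fin r ⊕ Fin s) ℂ) :
    Matrix (Fin r ⊕ Fin s) (Fin r ⊕ Fin s) ℝ :=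
  imML r s z * Ring.inverse (reML r s z)

theorem contDiffOn_slope : ContDiffOn ℝ ∞ (slope : _ → Matrix (Fin r ⊕ Fin s) (Fin r ⊕ Fin s) ℝ)
    {z | IsUnit (reML r s z)} :=
  (imML r s).contDiff.contDiffOn.mul
    (contDiffOn_inverse_comp (reML r s).contDiff.contDiffOn fun _ h => h)

/-- At `1` the imaginary part is zero, so the derivative of the inverse does not contribute. -/
theorem hasFDerivAt_slope :
    HasFDerivAt (slope : _ → Matrix (Fin r ⊕ Fin s) (Fin r ⊕ Fin s) ℝ) (imML r s) 1 := by
  have h1 := (imML r s).hasFDerivAt (x := 1)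
  have h2 := hasFDerivAt_ringInverse (𝕜 := ℝ) (1 : (Matrix (Fin r ⊕ Fin s) (Fin r ⊕ Fin s) ℝ)ˣ)
  have h3 : HasFDerivAt (Ring.inverse : Matrix (Fin r ⊕ Fin s) (Fin r ⊕ Fin s) ℝ → _)
      (-ContinuousLinearMap.mulLeftRight ℝ (Matrix (Fin r ⊕ Fin s) (Fin r ⊕ Fin s) ℝ)
        ((1 : (Matrix (Fin r ⊕ Fin s) (Fin r ⊕ Fin s) ℝ)ˣ)⁻¹ : _ˣ)
        ((1 : (Matrix (Fin r ⊕ Fin s) (Fin r ⊕ Fin s) ℝ)ˣ)⁻¹ : _ˣ)) (reML r s 1) := by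
    rw [reML_one]
    exact h2
  have h4 := h1.mul' (h3.comp (1 : Matrix (Fin r ⊕ Fin s) (Fin r ⊕ Fin s) ℂ)
    (reML r s).hasFDerivAt)
  refine h4.congr_fderiv ?_
  ext1 K
  simp [imML_one, reML_one]
  exact mul_one _

/-- The domain of the orbit map in the charts. -/
def orbitDomain (r s : ℕ) : Set (Matrix (Fin r ⊕ Fin s) (Fin r ⊕ Fin s) ℂ) :=
  ({K | IsUnit (1 - K)} ∩ cayleyInv ⁻¹' {z | IsUnit (reML r s z)}) ∩
    (fun K => opE r s (slope (cayleyInv K))) ⁻¹' smallBall r s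

theorem contDiffOn_orbitMap : ContDiffOn ℝ ∞ (fun K => opE r s (slope (cayleyInv K)))
    ({K | IsUnit (1 - K)} ∩ cayleyInv ⁻¹' {z | IsUnit (reML r s z)}) :=
  (opE r s).contDiff.comp_contDiffOn
    (contDiffOn_slope.comp (contDiffOn_cayleyInv.mono inter_subset_left) fun _ h => h.2)

theorem isOpen_orbitDomain : IsOpen (orbitDomain r s) := by
  have h1 : IsOpen {K : Matrix (Fin r ⊕ Fin s) (Fin r ⊕ Fin s) ℂ | IsUnit (1 - K)} :=
    Units.isOpen.preimage (by fun_prop)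
  have h2 : IsOpen {z | IsUnit (reML r s z)} := Units.isOpen.preimage (reML r s).continuous
  have h3 := contDiffOn_cayleyInv.continuousOn.isOpen_inter_preimage h1 h2
  exact contDiffOn_orbitMap.continuousOn.isOpen_inter_preimage h3 isOpen_smallBall

theorem cayleyInv_zero : cayleyInv (0 : Matrix (Fin r ⊕ Fin s) (Fin r ⊕ Fin s) ℂ) = 1 := by
  simp [cayleyInv]

theorem zero_mem_orbitDomain : (0 : Matrix (Fin r ⊕ Fin s) (Fin r ⊕ Fin s) ℂ) ∈ orbitDomain r s := by
  refine ⟨⟨by simp, ?_⟩, ?_⟩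
  · change IsUnit (reML r s (cayleyInv 0))
    rw [cayleyInv_zero, reML_one]
    exact isUnit_one
  · change opE r s (slope (cayleyInv 0)) ∈ smallBall r s
    rw [cayleyInv_zero, slope, imML_one, zero_mul, map_zero]
    exact zero_mem_smallBall

theorem hasFDerivAt_orbitMap : HasFDerivAt (fun K => opE r s (slope (cayleyInv K)))
    (opE r s ∘L imML r s ∘L ((2 : ℝ) • ContinuousLinearMap.id ℝ _)) 0 := by
  have h1 : HasFDerivAt (slope : _ → Matrix (Fin r ⊕ Fin s) (Fin r ⊕ Fin s) ℝ) (imML r s)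
      (cayleyInv 0) := by
    rw [cayleyInv_zero]
    exact hasFDerivAt_slope
  exact (opE r s).hasFDerivAt.comp _ (h1.comp _ hasFDerivAt_cayleyInv)

/-- Write `A₀⁻¹ A = X + iY`. If `X` is invertible, the substitution `x = X⁻¹ u` shows that this
matrix maps ℝ^{r+s} onto the graph of `Y X⁻¹`. -/
theorem rot_point_eq_point (A₀ A : complexSO r s)
    (hu : IsUnit (reML r s ((A₀.1⁻¹).1 * A.1.1))) :
    (T.rot hn A).point hn 0 =
      (T.rot hn A₀).point hn (opE r s (slope ((A₀.1⁻¹).1 * A.1.1)), 0, 0, 0) := by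
  symm
  refine Gr.eq_of_le fun v hv => ?_
  obtain ⟨w, u, rfl⟩ := (Frame.mem_point _ hn _ v).1 hv
  set z := (A₀.1⁻¹).1 * A.1.1 with hz
  refine (T.mem_rot_point hn A _).2 ⟨w, (Ring.inverse (reML r s z)).mulVec u, ?_⟩
  rw [T.rot_apply]
  refine congrArg T.toEquiv (Prod.ext rfl (Prod.ext ?_ ?_))
  · have h1 : A.1.1 = A₀.1.1 * z := by rw [hz, Units.mul_inv_cancel_left]
    rw [h1, ← Matrix.mulVec_mulVec]
    change _ = A₀.1.1.mulVec _
    rw [mulVec_realE]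
    have h2 : (reM r s z).mulVec ((Ring.inverse (reML r s z)).mulVec u) = u := by
      change (reML r s z).mulVec _ = _
      rw [Matrix.mulVec_mulVec, Ring.mul_inverse_cancel _ hu, Matrix.one_mulVec]
    have h3 : (imM r s z).mulVec ((Ring.inverse (reML r s z)).mulVec u) =
        opE r s (slope z) u := by
      rw [Matrix.mulVec_mulVec]
      rfl
    rw [h2, h3]
    simp [vecE, graphE_apply]
  · simp [vecE]

/-- This is the surjectivity of the derivative of the orbit map. If `M` is the matrix of the
remaining block, then `K = (i/2) M` works: the `1/2` absorbs the factor from the Cayley transform,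
and the skewness of `M` passes to `K`. -/
theorem exists_skew_of_mem_fibModel {q : Coord k r s} (hq : q ∈ fibModel k r s) :
    ∃ K ∈ skewModel r s, q = (opE r s (imML r s ((2 : ℝ) • matE r s K)), 0, 0, 0) := by
  obtain ⟨⟨h1, -, h3⟩, h4⟩ := hq
  have h5 : projModel k r s q = 0 := h4
  have h6 : cxE k r s q.2.1 = 0 := congrArg Prod.fst h5
  have h7 : q.2.2.1 = 0 := congrArg Prod.snd h5
  have h8 : q.2.1 = 0 := by
    ext w j
    have := congrArg (fun L => (L w j).im) h6
    simpa [cxE_apply] using this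
  let M : Matrix (Fin r ⊕ Fin s) (Fin r ⊕ Fin s) ℝ := LinearMap.toMatrix' q.1.toLinearMap
  have hM (i j) : M i j = q.1 (Pi.single j 1) i := by simp [M, LinearMap.toMatrix'_apply]
  have hskew (i j) : sgn i * M i j + sgn j * M j i = 0 := by
    have := h1 (Pi.single j 1) (Pi.single i 1)
    simp only [qR, Pi.single_apply, mul_ite, mul_one, mul_zero, ite_mul, one_mul, zero_mul,
      Finset.sum_ite_eq', Finset.mem_univ, if_true] at this
    rw [hM, hM]
    exact this
  refine ⟨fun i j => Complex.I * ((2⁻¹ * M i j : ℝ) : ℂ), ?_, Prod.ext ?_ (Prod.ext h8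
    (Prod.ext h7 h3))⟩
  · change (Matrix.of _).transpose * indefD r s + indefD r s * Matrix.of _ = 0
    ext i j
    rw [indefD_eq, Matrix.add_apply, Matrix.mul_diagonal, Matrix.diagonal_mul]
    simp only [Matrix.transpose_apply, Matrix.of_apply, Matrix.zero_apply]
    have := congrArg (fun x : ℝ => (x : ℂ)) (hskew i j)
    push_cast at this ⊢
    linear_combination Complex.I * 2⁻¹ * this
  · have h9 : imML r s ((2 : ℝ) • matE r s fun i j => Complex.I * ((2⁻¹ * M i j : ℝ) : ℂ)) = M := by
      ext i j
      change Complex.im ((2 : ℝ) • (Complex.I * ((2⁻¹ * M i j : ℝ) : ℂ))) = _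
      rw [Complex.smul_im, Complex.I_mul_im, Complex.ofReal_re, smul_eq_mul]
      ring
    rw [h9]
    have h10 : Matrix.toLin' M = q.1.toLinearMap := Matrix.toLin'_toMatrix' _
    ext1 x
    exact (congrArg (fun L => L x) h10).symm

/-- The manifold structure of a quotient is characterized by the projection being a submersion, so
for the bijection `fibreEquiv` this says that it is a diffeomorphism. The point `A₀` has Cayley
coordinate `0` in its own chart, so only the derivative at `0` is needed. -/
theorem fibreEquiv_submersion : (complexSOManifold r s).Submersion (fibreManifold hn hsymm hnd W)
    (fun A => fibreEquiv hn hsymm hnd T hT (QuotientGroup.mk A)) := by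
  refine sliceStructure_submersion _ _ _ _ _ fun A₀ => ?_
  let ι₁ : ((Fin r ⊕ Fin s → ℝ) →L[ℝ] (Fin r ⊕ Fin s → ℝ)) →L[ℝ] GrModel n n :=
    (blockE hn).symm.toContinuousLinearMap ∘L ContinuousLinearMap.inl ℝ _ _
  have h0 : complexSOChart A₀ (complexSOEntries r s A₀) = 0 := by
    rw [complexSOChart_apply, matE_entries, Units.inv_mul]
    simp [cayley]
  have hT₀ : (T.rot hn A₀).pointC hn 0 = W.1 := (T.rot_pointC hn A₀).trans hT
  refine ⟨complexSOChart A₀, (T.rot hn A₀).chart hn,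
    fun K => ι₁ (opE r s (slope (cayleyInv (matE r s K)))), matE r s ⁻¹' orbitDomain r s,
    ι₁ ∘L (opE r s ∘L imML r s ∘L ((2 : ℝ) • ContinuousLinearMap.id ℝ _)) ∘L
      (matE r s).toContinuousLinearMap,
    isSliceChart_complexSO A₀, isSliceChart_fibre hn hsymm hnd _ hT₀, complexSO_mem_source A₀,
    isOpen_orbitDomain.preimage (matE r s).continuous, ?_, ?_, ?_, ?_, ?_⟩
  · rw [h0, mem_preimage, map_zero]
    exact zero_mem_orbitDomain
  · exact ι₁.contDiff.comp_contDiffOn ((contDiffOn_orbitMap.mono inter_subset_left).comp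
      (matE r s).contDiff.contDiffOn fun _ h => h)
  · rw [h0]
    have h1 : HasFDerivAt (fun K => opE r s (slope (cayleyInv K)))
        (opE r s ∘L imML r s ∘L ((2 : ℝ) • ContinuousLinearMap.id ℝ _)) (matE r s 0) := by
      rw [map_zero]
      exact hasFDerivAt_orbitMap
    exact ι₁.hasFDerivAt.comp _ (h1.comp _ (matE r s).hasFDerivAt)
  · intro l' hl'
    obtain ⟨K, hK, hq⟩ := exists_skew_of_mem_fibModel (q := blockE hn l') hl'
    refine ⟨K, hK, ?_⟩
    apply (blockE hn).injective
    rw [hq]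
    change blockE hn ((blockE hn).symm _) = _
    rw [ContinuousLinearEquiv.apply_symm_apply]
    rfl
  · intro A hA hAΩ
    rw [mem_complexSOChart_source, matE_entries] at hA
    have hz : cayleyInv (matE r s (complexSOChart A₀ (complexSOEntries r s A))) =
        (A₀.1⁻¹).1 * A.1.1 := by
      rw [complexSOChart_apply, ContinuousLinearEquiv.apply_symm_apply, matE_entries,
        cayleyInv_cayley hA]
    obtain ⟨⟨-, h2⟩, h3⟩ := hAΩ
    rw [mem_preimage, hz] at h2 h3
    have hp := rot_point_eq_point hn T A₀ A h2
    have hp' : (fibreEquiv hn hsymm hnd T hT (QuotientGroup.mk A)).1 = _ := hp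
    let q : Coord k r s := (opE r s (slope ((A₀.1⁻¹).1 * A.1.1)), 0, 0, 0)
    have hq : q.1 ∈ smallBall r s := h3
    have h5 := (T.rot hn A₀).chart_point hn hq
    have h6 : (T.rot hn A₀).point hn q ∈ ((T.rot hn A₀).chart hn).source :=
      ((T.rot hn A₀).mem_chart_source hn _).2 ⟨q, hq, rfl⟩
    rw [hp']
    refine ⟨h6, ?_⟩
    rw [h5]
    change _ = ι₁ (opE r s (slope (cayleyInv (matE r s (complexSOChart A₀
      (complexSOEntries r s A))))))
    rw [hz]
    rfl

end Fibres

/-! ### The volume form and self-duality -/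

section VolumeForm

variable {n : ℕ} {b : LinearMap.BilinForm ℂ (CVec n)}

/-- The real coordinates of a vector. -/
def coordVec (z : CVec n) : Fin n ⊕ Fin n → ℝ :=
  Sum.elim (fun a => (z a).re) (fun a => (z a).im)

theorem volForm_eq (x : Fin n ⊕ Fin n → CVec n) : volForm b x =
    ‖(Matrix.of fun i j : Fin n => b (stdVec i) (stdVec j)).det‖ *
      (Matrix.of fun i j => coordVec (x j) i).det := by
  rw [volForm]
  congr 3

theorem coordVec_sum {ι : Type*} [Fintype ι] (c : ι → ℝ) (x : ι → CVec n) (i : Fin n ⊕ Fin n) :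
    coordVec (∑ l, c l • x l) i = ∑ l, c l * coordVec (x l) i := by
  have h (a : Fin n) : (∑ l, c l • x l : CVec n) a = ∑ l, (c l : ℂ) * x l a := by
    have h1 : (∑ l, c l • x l : CVec n) a = ∑ l, (c l • x l : CVec n) a :=
      Finset.sum_apply (M := fun _ : Fin n => ℂ) a Finset.univ fun l => c l • x l
    rw [h1]
    exact Finset.sum_congr rfl fun l _ => Complex.real_smul
  rcases i with a | a
  · change ((∑ l, c l • x l : CVec n) a).re = ∑ l, c l * (x l a).re
    rw [h, Complex.re_sum]
    exact Finset.sum_congr rfl fun l _ => Complex.re_ofReal_mul _ _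
  · change ((∑ l, c l • x l : CVec n) a).im = ∑ l, c l * (x l a).im
    rw [h, Complex.im_sum]
    exact Finset.sum_congr rfl fun l _ => Complex.im_ofReal_mul _ _

theorem volForm_combination (x : Fin n ⊕ Fin n → CVec n)
    (C : Matrix (Fin n ⊕ Fin n) (Fin n ⊕ Fin n) ℝ) :
    volForm b (fun j => ∑ l, C l j • x l) = volForm b x * C.det := by
  rw [volForm_eq, volForm_eq, mul_assoc, ← Matrix.det_mul]
  congr 3
  ext i j
  rw [Matrix.of_apply, coordVec_sum, Matrix.mul_apply]
  exact Finset.sum_congr rfl fun l _ => mul_comm _ _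

theorem volForm_perm (x : Fin n ⊕ Fin n → CVec n) (c : Fin n ⊕ Fin n → ℝ)
    (σ : Equiv.Perm (Fin n ⊕ Fin n)) :
    volForm b (fun j => c j • x (σ j)) = (∏ j, c j) * Equiv.Perm.sign σ * volForm b x := by
  have h : (fun j => c j • x (σ j)) = fun j =>
      ∑ l, (Matrix.of fun l j => c j * (1 : Matrix _ _ ℝ).submatrix id σ l j) l j • x l := by
    funext j
    rw [Finset.sum_eq_single (σ j)]
    · simp [Matrix.one_apply]
    · intro l _ hl
      simp [Matrix.one_apply, hl]
    · simp
  rw [h, volForm_combination, Matrix.det_mul_row, Matrix.det_permute', Matrix.det_one]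
  ring

theorem volForm_I_smul (z : Fin n → CVec n)
    (hz : ‖(Matrix.of fun i j => b (z i) (z j)).det‖ = 1) :
    volForm b (Sum.elim (fun j => Complex.I • z j) z) = (-1) ^ n := by
  let Z : Matrix (Fin n) (Fin n) ℂ := Matrix.of fun i j => z j i
  let X : Matrix (Fin n) (Fin n) ℝ := Matrix.of fun i j => (z j i).re
  let Y : Matrix (Fin n) (Fin n) ℝ := Matrix.of fun i j => (z j i).im
  let X' : Matrix (Fin n) (Fin n) ℂ := X.map (Complex.ofRealHom)
  let Y' : Matrix (Fin n) (Fin n) ℂ := Y.map (Complex.ofRealHom)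
  have hZ : Z = X' + Complex.I • Y' := by
    ext i j
    change z j i = ((z j i).re : ℂ) + Complex.I * ((z j i).im : ℂ)
    rw [mul_comm, Complex.re_add_im]
  have hZ' : Z.map (starRingEnd ℂ) = X' - Complex.I • Y' := by
    ext i j
    change (starRingEnd ℂ) (z j i) = ((z j i).re : ℂ) - Complex.I * ((z j i).im : ℂ)
    apply Complex.ext <;> simp
  have hM : (Matrix.of fun i j => coordVec (Sum.elim (fun j => Complex.I • z j) z j) i) =
      Matrix.fromBlocks (-Y) X X Y := by
    ext (i | i) (j | j)
    · change (Complex.I * z j i).re = -(z j i).im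
      simp
    · rfl
    · change (Complex.I * z j i).im = (z j i).re
      simp
    · rfl
  have hdet : ((Matrix.fromBlocks (-Y) X X Y).det : ℂ) = (-1) ^ n * (Z.det * (starRingEnd ℂ) Z.det) := by
    have h1 : ((Matrix.fromBlocks (-Y) X X Y).det : ℂ) = (Matrix.fromBlocks (-Y') X' X' Y').det := by
      change Complex.ofRealHom _ = _
      rw [RingHom.map_det]
      congr 1
      ext (i | i) (j | j) <;> simp [X', Y']
    -- Over ℂ, two unipotent factors make the real matrix block triangular with diagonal blocks `iZ`
    -- and `i` times the conjugate of `Z`.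
    have h2 : Matrix.fromBlocks (1 : Matrix (Fin n) (Fin n) ℂ) (Complex.I • 1) 0 1 *
        Matrix.fromBlocks (-Y') X' X' Y' *
        Matrix.fromBlocks (1 : Matrix (Fin n) (Fin n) ℂ) (Complex.I • 1) 0 1 =
        Matrix.fromBlocks (Complex.I • Z) 0 X' (Complex.I • Z.map (starRingEnd ℂ)) := by
      rw [hZ', hZ, Matrix.fromBlocks_multiply, Matrix.fromBlocks_multiply]
      congr 1 <;> ext i j <;> simp [← mul_assoc] <;> ring_nf <;> simp
    have h3 := congrArg Matrix.det h2
    rw [Matrix.det_mul, Matrix.det_mul, Matrix.det_fromBlocks_zero₂₁, Matrix.det_one, one_mul,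
      one_mul, mul_one, Matrix.det_fromBlocks_zero₁₂, Matrix.det_smul, Matrix.det_smul,
      Fintype.card_fin] at h3
    have h4 : (Z.map (starRingEnd ℂ)).det = (starRingEnd ℂ) Z.det := by
      rw [RingHom.map_det]; rfl
    rw [h1, h3, h4]
    calc _ = (Complex.I * Complex.I) ^ n * (Z.det * (starRingEnd ℂ) Z.det) := by
          rw [mul_pow]; ring
      _ = _ := by rw [Complex.I_mul_I]
  have hdet' : (Matrix.fromBlocks (-Y) X X Y).det = (-1) ^ n * ‖Z.det‖ ^ 2 := by
    have h1 : (Z.det * (starRingEnd ℂ) Z.det) = ((‖Z.det‖ ^ 2 : ℝ) : ℂ) := by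
      rw [Complex.mul_conj, Complex.normSq_eq_norm_sq]
    rw [h1] at hdet
    exact_mod_cast hdet
  -- The normalization of `volForm` enters here: it turns `|det Z|²` into the norm of the Gram
  -- determinant of `z`, which is `1`.
  have hG : (Matrix.of fun i j => b (z i) (z j)) =
      Z.transpose * (Matrix.of fun i j : Fin n => b (stdVec i) (stdVec j)) * Z := by
    have hz' (j) : z j = ∑ i, Z i j • (stdVec i : CVec n) := by
      have h1 : z j = ∑ i, (z j) i • (Pi.single i (1 : ℂ) : Fin n → ℂ) := by
        have := pi_eq_sum_univ' (R := ℂ) (z j)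
        refine this.trans ?_
        refine Finset.sum_congr rfl fun i _ => ?_
        congr 1
      exact h1
    ext i j
    rw [Matrix.of_apply]
    conv_lhs => rw [hz' i, hz' j]
    simp only [map_sum, LinearMap.sum_apply, map_smul, LinearMap.smul_apply, smul_eq_mul,
      Matrix.mul_apply, Matrix.transpose_apply, Matrix.of_apply]
    refine Finset.sum_congr rfl fun l _ => ?_
    rw [Finset.mul_sum, Finset.sum_mul]
    exact Finset.sum_congr rfl fun m _ => mul_comm _ _
  rw [hG, Matrix.det_mul, Matrix.det_mul, Matrix.det_transpose, norm_mul, norm_mul] at hz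
  rw [volForm_eq, hM, hdet']
  linear_combination (-1) ^ n * hz

/-- Families which are dual to each other with respect to the imaginary part form a basis. -/
theorem exists_basis_of_dual {c v : Fin n → CVec n}
    (hvv : ∀ i j, imForm b (v i) (v j) = 0)
    (hcv : ∀ i j, imForm b (c i) (v j) = if i = j then 1 else 0) :
    ∃ B : Module.Basis (Fin n ⊕ Fin n) ℝ (CVec n), ⇑B = Sum.elim c v := by
  have hli : LinearIndependent ℝ (Sum.elim c v) := by
    rw [Fintype.linearIndependent_iff]
    intro g hg
    rw [Fintype.sum_sum_type] at hg
    simp only [Sum.elim_inl, Sum.elim_inr] at hg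
    have h1 (j : Fin n) : g (Sum.inl j) = 0 := by
      have h2 := congrArg (fun z => imForm b z (v j)) hg
      simpa [hvv, hcv] using h2
    simp only [h1, zero_smul, Finset.sum_const_zero, zero_add] at hg
    rintro (j | j)
    · exact h1 j
    · have h2 := congrArg (fun z => imForm b (c j) z) hg
      simpa [hcv] using h2
  refine ⟨basisOfLinearIndependentOfCardEqFinrank' _ hli ?_, ?_⟩
  · rw [finrank_real_cVec]; simp
  · simp

/-- Self-duality can be tested on one pair of dual families. -/
theorem isDual_iff {V : Gr n n (CVec n)}
    (hV : ∀ v ∈ V.toSubmodule, ∀ w ∈ V.toSubmodule, imForm b v w = 0) {c v : Fin n → CVec n}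
    (hv : ∀ j, v j ∈ V.toSubmodule)
    (hcv : ∀ i j, imForm b (c i) (v j) = if i = j then 1 else 0) (ε : ℝ) :
    IsDual b ε V.toSubmodule ↔ ε * volForm b (Sum.elim c v) = 1 := by
  have hvv (i j) : imForm b (v i) (v j) = 0 := hV _ (hv i) _ (hv j)
  constructor
  · intro h
    rw [h c v hv]
    have h1 : (Matrix.of fun i j : Fin n => imForm b (c i) (v j)) = 1 := by
      ext i j
      rw [Matrix.of_apply, hcv, Matrix.one_apply]
    rw [h1, Matrix.det_one]
  -- Everything is expanded in the basis `c, v`. Since `V` is isotropic, its vectors have no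
  -- component along `c`; the coefficient matrix is block triangular, and both sides equal `det P *
  -- det R`.
  · intro h w x hx
    obtain ⟨B, hB⟩ := exists_basis_of_dual hvv hcv
    have hrepr (z : CVec n) : z = ∑ l, B.repr z (Sum.inl l) • c l + ∑ l, B.repr z (Sum.inr l) • v l := by
      conv_lhs => rw [← B.sum_repr z, Fintype.sum_sum_type]
      simp [hB]
    have hl (z : CVec n) (l) : imForm b z (v l) = B.repr z (Sum.inl l) := by
      conv_lhs => rw [hrepr z]
      simp [hvv, hcv]
    have h0 {z : CVec n} (hz : z ∈ V.toSubmodule) (l) : B.repr z (Sum.inl l) = 0 := by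
      rw [← hl, hV _ hz _ (hv l)]
    let P : Matrix (Fin n) (Fin n) ℝ := Matrix.of fun l j => B.repr (w j) (Sum.inl l)
    let Q : Matrix (Fin n) (Fin n) ℝ := Matrix.of fun l j => B.repr (w j) (Sum.inr l)
    let R : Matrix (Fin n) (Fin n) ℝ := Matrix.of fun l j => B.repr (x j) (Sum.inr l)
    have h1 : Sum.elim w x = fun j => ∑ l, (Matrix.fromBlocks P 0 Q R) l j • Sum.elim c v l := by
      funext j
      rw [Fintype.sum_sum_type]
      rcases j with j | j
      · exact hrepr (w j)
      · conv_lhs => rw [Sum.elim_inr, hrepr (x j)]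
        simp only [h0 (hx j)]
        rfl
    have h2 : (Matrix.of fun i j : Fin n => imForm b (w i) (x j)) = P.transpose * R := by
      ext i j
      rw [Matrix.of_apply]
      conv_lhs => rw [hrepr (x j)]
      simp only [h0 (hx j), zero_smul, Finset.sum_const_zero, zero_add, map_sum, map_smul, hl,
        smul_eq_mul]
      rw [Matrix.mul_apply]
      exact Finset.sum_congr rfl fun l _ => mul_comm _ _
    rw [h1, volForm_combination, Matrix.det_fromBlocks_zero₁₂, ← mul_assoc, h, one_mul, h2,
      Matrix.det_mul, Matrix.det_transpose]

end VolumeForm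

/-! ### The sign of the orbit -/

section OrbitSign

variable {n k r s : ℕ} {b : LinearMap.BilinForm ℂ (CVec n)}

/-- The cyclic permutation of blocks which compares the two bases attached to a frame. -/
def blockCycle (κ ε : Type*) : (κ ⊕ ε ⊕ κ) ⊕ (κ ⊕ ε ⊕ κ) → (κ ⊕ ε ⊕ κ) ⊕ (κ ⊕ ε ⊕ κ)
  | Sum.inl (Sum.inl i) => Sum.inl (Sum.inl i)
  | Sum.inl (Sum.inr (Sum.inl j)) => Sum.inl (Sum.inr (Sum.inl j))
  | Sum.inl (Sum.inr (Sum.inr i)) => Sum.inr (Sum.inl i)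
  | Sum.inr (Sum.inl i) => Sum.inr (Sum.inr (Sum.inr i))
  | Sum.inr (Sum.inr (Sum.inl j)) => Sum.inr (Sum.inr (Sum.inl j))
  | Sum.inr (Sum.inr (Sum.inr i)) => Sum.inl (Sum.inr (Sum.inr i))

theorem blockCycle_three {κ ε : Type*} (x) :
    blockCycle κ ε (blockCycle κ ε (blockCycle κ ε x)) = x := by
  rcases x with (i | j | i) | (i | j | i) <;> rfl

theorem exists_perm_blockCycle {κ ε : Type*} [Fintype κ] [Fintype ε]
    (e : Fin n ≃ κ ⊕ ε ⊕ κ) : ∃ σ : Equiv.Perm (Fin n ⊕ Fin n), Equiv.Perm.sign σ = 1 ∧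
      ∀ j, (e.sumCongr e) (σ j) = blockCycle κ ε (e.sumCongr e j) := by
  let f := e.sumCongr e
  let σ : Equiv.Perm (Fin n ⊕ Fin n) :=
    { toFun := fun j => f.symm (blockCycle κ ε (f j))
      invFun := fun j => f.symm (blockCycle κ ε (blockCycle κ ε (f j)))
      left_inv := fun j => by simp [blockCycle_three]
      right_inv := fun j => by simp [blockCycle_three] }
  have hσ (j) : f (σ j) = blockCycle κ ε (f j) := f.apply_symm_apply _
  refine ⟨σ, ?_, hσ⟩
  -- A permutation whose cube is trivial is even, whatever the sizes of the blocks.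
  have h3 : σ * σ * σ = 1 := by
    ext1 j
    apply f.injective
    change f (σ (σ (σ j))) = f j
    rw [hσ, hσ, hσ, blockCycle_three]
  have h4 := congrArg Equiv.Perm.sign h3
  rw [map_mul, map_mul, map_one, Int.units_mul_self, one_mul] at h4
  exact h4

/-- The complex basis attached to a frame. -/
def Frame.zfam (T : Frame b k r s) : Fin k ⊕ (Fin r ⊕ Fin s) ⊕ Fin k → CVec n
  | Sum.inl i => T.toEquiv (0, 0, Pi.single i 1)
  | Sum.inr (Sum.inl j) => T.toEquiv (0, Pi.single j 1, 0)
  | Sum.inr (Sum.inr i) => T.toEquiv (Pi.single i 1, 0, 0)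

/-- The signs attached to a frame. -/
def signFam (k r s : ℕ) : Fin k ⊕ (Fin r ⊕ Fin s) ⊕ Fin k → ℝ
  | Sum.inl _ => 1
  | Sum.inr (Sum.inl j) => sgn j
  | Sum.inr (Sum.inr _) => 1

theorem Frame.norm_det_gram (T : Frame b k r s)
    (e : Fin n ≃ Fin k ⊕ (Fin r ⊕ Fin s) ⊕ Fin k) :
    ‖(Matrix.of fun i j => b (T.zfam (e i)) (T.zfam (e j))).det‖ = 1 := by
  let G : Matrix (Fin k ⊕ (Fin r ⊕ Fin s) ⊕ Fin k) (Fin k ⊕ (Fin r ⊕ Fin s) ⊕ Fin k) ℂ :=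
    Matrix.of fun i j => b (T.zfam i) (T.zfam j)
  have h1 : (Matrix.of fun i j => b (T.zfam (e i)) (T.zfam (e j))) = G.submatrix e e := rfl
  rw [h1, Matrix.det_submatrix_equiv_self]
  -- The Gram matrix pairs the outer families with each other and is `±1` on the middle one, so it
  -- is an involution.
  have hGG : G * G = 1 := by
    ext i j
    have hs (j : Fin r ⊕ Fin s) : (sgn j : ℂ) * sgn j = 1 := by exact_mod_cast sgn_mul_self j
    rw [Matrix.mul_apply, Fintype.sum_sum_type, Fintype.sum_sum_type]
    rcases i with i | i | i <;> rcases j with j | j | j <;>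
      simp [G, Frame.zfam, T.map_form, mdlForm_apply, qE_single, Pi.single_apply, Matrix.one_apply,
        hs]
    all_goals simp only [eq_comm]
  have h2 := congrArg (fun M => ‖M.det‖) hGG
  simp only [Matrix.det_mul, norm_mul, Matrix.det_one, norm_one] at h2
  rcases mul_self_eq_one_iff.1 h2 with h | h
  · exact h
  · linarith [norm_nonneg G.det]

/-- The real basis of the standard point and a dual family arise from the family `(iz, z)` by a
cyclic permutation of three blocks and `s` changes of sign. The volume of `(iz, z)` is `(-1)ⁿ`, the
permutation is even, and the signs contribute `(-1)ˢ`. -/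
theorem orb_subset_igr (hn : r + s + 2 * k = n) (hsymm : b.IsSymm) (hnd : b.Nondegenerate) :
    orb b r s ⊆ igr b ((-1) ^ (n - s)) := by
  intro V hV
  refine ⟨hV.1, ?_⟩
  obtain ⟨T, rfl⟩ := exists_frame_of_mem_orb hn hsymm hnd hV
  let e : Fin n ≃ Fin k ⊕ (Fin r ⊕ Fin s) ⊕ Fin k := Fintype.equivOfCardEq (by
    simp only [Fintype.card_fin, Fintype.card_sum]
    omega)
  obtain ⟨σ, hσ, hσe⟩ := exists_perm_blockCycle e
  let y : Fin n ⊕ Fin n → CVec n :=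
    Sum.elim (fun j => Complex.I • T.zfam (e j)) fun j => T.zfam (e j)
  let Y : (Fin k ⊕ (Fin r ⊕ Fin s) ⊕ Fin k) ⊕ (Fin k ⊕ (Fin r ⊕ Fin s) ⊕ Fin k) → CVec n :=
    Sum.elim (fun j => Complex.I • T.zfam j) T.zfam
  have hy (j) : y j = Y (e.sumCongr e j) := by rcases j with j | j <;> rfl
  let sg : Fin n ⊕ Fin n → ℝ := Sum.elim (fun j => signFam k r s (e j)) 1
  let x : Fin n ⊕ Fin n → CVec n := fun j => sg j • y (σ j)
  have hx (j) : x j = sg j • Y (blockCycle _ _ (e.sumCongr e j)) := by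
    rw [← hσe, ← hy]
  have hxe : x = Sum.elim (fun j => x (Sum.inl j)) (fun j => x (Sum.inr j)) := by
    funext j
    rcases j with j | j <;> rfl
  have hvol : volForm b x = (-1) ^ (n - s) := by
    rw [volForm_perm, hσ, volForm_I_smul _ (T.norm_det_gram e)]
    have h1 : ∏ j, sg j = (-1) ^ s := by
      rw [Fintype.prod_sum_type]
      simp only [sg, Sum.elim_inl, Sum.elim_inr, Pi.one_apply, Finset.prod_const_one, mul_one]
      rw [e.prod_comp (signFam k r s), Fintype.prod_sum_type, Fintype.prod_sum_type,
        Fintype.prod_sum_type]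
      simp [signFam, sgn]
    rw [h1]
    simp only [Units.val_one, Int.cast_one, mul_one]
    have h2 : n = s + (n - s) := by omega
    conv_lhs => rw [h2]
    rw [pow_add, ← mul_assoc, ← mul_pow]
    simp
  rw [isDual_iff hV.1 (c := fun j => x (Sum.inl j)) (v := fun j => x (Sum.inr j)), ← hxe,
    hvol, ← mul_pow]
  · simp
  · intro j
    rw [hx]
    change (1 : ℝ) • Y (blockCycle _ _ (Sum.inr (e j))) ∈ _
    rw [one_smul, T.mem_point_zero]
    rcases e j with i | i | i
    · exact ⟨Pi.single i 1, 0, by simp [Y, blockCycle, Frame.zfam]⟩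
    · refine ⟨0, Pi.single i 1, ?_⟩
      have h4 : realE r s (Pi.single i 1) = Pi.single i 1 := by
        ext l
        rw [realE_apply, Pi.single_apply, Pi.single_apply]
        split_ifs <;> simp
      rw [h4]
      rfl
    · refine ⟨Complex.I • Pi.single i 1, 0, ?_⟩
      change _ = Complex.I • T.toEquiv (Pi.single i 1, 0, 0)
      rw [← map_smul]
      congr 1
      simp
  · intro i j
    have h1 : (i = j) = (e i = e j) := by rw [e.injective.eq_iff]
    rw [hx, hx]
    change imForm b (signFam k r s (e i) • Y (blockCycle _ _ (Sum.inl (e i))))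
      ((1 : ℝ) • Y (blockCycle _ _ (Sum.inr (e j)))) = _
    rw [one_smul, map_smul, LinearMap.smul_apply]
    simp only [h1]
    rcases e i with i | i | i <;> rcases e j with j | j | j <;>
      simp [Y, blockCycle, Frame.zfam, T.map_form, mdlForm_apply, imForm_apply, signFam, qE_single,
        Pi.single_apply]
    all_goals
      rcases eq_or_ne j i with rfl | h
      · simp [sgn_mul_self]
      · simp [h, h.symm]

end OrbitSign

/-! ### The maximal isotropic Grassmannians as submanifolds -/

section Skew

/-- Skew-symmetric matrices with entries in a real vector space. -/
def skewFun (ι K : Type*) [AddCommGroup K] [Module ℝ K] : Submodule ℝ (ι → ι → K) where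
  carrier := {M | ∀ i j, M i j = -M j i}
  zero_mem' := by simp
  add_mem' := by
    intro M N hM hN i j
    rw [Pi.add_apply, Pi.add_apply, hM, hN, Pi.add_apply, Pi.add_apply, neg_add]
  smul_mem' := by
    intro t M hM i j
    rw [Pi.smul_apply, Pi.smul_apply, hM, smul_neg, Pi.smul_apply, Pi.smul_apply]

variable {ι K : Type*} [AddCommGroup K] [Module ℝ K]

theorem skewFun_diag {M : ι → ι → K} (hM : M ∈ skewFun ι K) (i : ι) : M i i = 0 := by
  have h : (2 : ℝ) • M i i = 0 := by
    rw [two_smul]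
    exact add_eq_zero_iff_eq_neg.2 (hM i i)
  exact (smul_eq_zero.1 h).resolve_left two_ne_zero

/-- The entries above the diagonal are free and determine the rest. The formula is doubled and
written without subtraction to suit natural numbers. -/
theorem two_mul_finrank_skewFun [Fintype ι] [FiniteDimensional ℝ K] :
    2 * Module.finrank ℝ (skewFun ι K) + Fintype.card ι * Module.finrank ℝ K =
      Fintype.card ι ^ 2 * Module.finrank ℝ K := by
  classical
  let _ : LinearOrder ι := LinearOrder.lift' (Fintype.equivFin ι) (Fintype.equivFin ι).injective
  let P : skewFun ι K →ₗ[ℝ] ({p : ι × ι // p.1 < p.2} → K) :=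
    { toFun := fun M p => M.1 p.1.1 p.1.2
      map_add' := fun _ _ => rfl
      map_smul' := fun _ _ => rfl }
  have hP : Function.Bijective P := by
    constructor
    · rw [injective_iff_map_eq_zero]
      intro M hM
      have h1 (i j) (h : i < j) : M.1 i j = 0 := congrFun hM ⟨(i, j), h⟩
      ext i j
      rcases lt_trichotomy i j with h | rfl | h
      · exact h1 i j h
      · exact skewFun_diag M.2 i
      · rw [M.2 i j, h1 j i h]
        simp
    · intro f
      refine ⟨⟨fun i j => if h : i < j then f ⟨(i, j), h⟩ else
        if h : j < i then -f ⟨(j, i), h⟩ else 0, fun i j => ?_⟩, ?_⟩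
      · rcases lt_trichotomy i j with h | rfl | h
        · simp [h, h.not_gt]
        · simp
        · simp [h, h.not_gt]
      · funext p
        change (if h : p.1.1 < p.1.2 then f ⟨(p.1.1, p.1.2), h⟩ else _) = _
        rw [dif_pos p.2]
  rw [(LinearEquiv.ofBijective P hP).finrank_eq, Module.finrank_pi_fintype, Finset.sum_const,
    Finset.card_univ, smul_eq_mul]
  have hcard : 2 * Fintype.card {p : ι × ι // p.1 < p.2} + Fintype.card ι = Fintype.card ι ^ 2 := by
    have e : ({p : ι × ι // p.1 < p.2} ⊕ {p : ι × ι // p.1 < p.2}) ⊕ ι ≃ ι × ι :=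
      { toFun := Sum.elim (Sum.elim (fun p => p.1) fun p => p.1.swap) fun i => (i, i)
        invFun := fun p => if h : p.1 < p.2 then Sum.inl (Sum.inl ⟨p, h⟩) else
          if h : p.2 < p.1 then Sum.inl (Sum.inr ⟨p.swap, h⟩) else Sum.inr p.1
        left_inv := by
          rintro ((⟨p, h⟩ | ⟨p, h⟩) | i)
          · simp [h]
          · simp [h, h.not_gt]
          · simp
        right_inv := by
          rintro ⟨i, j⟩
          rcases lt_trichotomy i j with h | rfl | h
          · simp [h]
          · simp
          · simp [h, h.not_gt] }
    have := Fintype.card_congr e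
    simp only [Fintype.card_sum, Fintype.card_prod] at this
    nlinarith
  rw [← hcard]
  ring

end Skew

/-! ### Charts of the maximal isotropic Grassmannians -/

section Igr

variable {n : ℕ} {b : LinearMap.BilinForm ℂ (CVec n)}

/-- The model of the charts of the maximal isotropic Grassmannian. -/
def igrModel (n : ℕ) : Submodule ℝ (GrModel n n) where
  carrier := {φ | ∀ x x', φ x ⬝ᵥ x' + x ⬝ᵥ φ x' = 0}
  zero_mem' := by simp
  add_mem' := by
    intro φ ψ h h' x x'
    have h1 := h x x'
    have h2 := h' x x'
    simp only [add_apply, add_dotProduct, dotProduct_add]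
    linarith
  smul_mem' := by
    intro t φ h x x'
    have h1 := h x x'
    simp only [smul_apply, smul_dotProduct, dotProduct_smul, smul_eq_mul]
    linear_combination t * h1

/-- With an isotropic complement spanned by a dual family `c`, a graph over `V` is isotropic exactly
if its linear map is skew. Duality adds no equation: the basis of the graph differs from `v` by
multiples of `c`, a unipotent change that leaves the volume of the dual pair unchanged. -/
theorem exists_sliceChart_igr (hsymm : b.IsSymm) (hnd : b.Nondegenerate) (ε : ℝ) (V : igr b ε) :
    ∃ Ψ : OpenPartialHomeomorph (Gr n n (CVec n)) (GrModel n n),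
      IsSliceChart (Subtype.val : igr b ε → _) (igrModel n) Ψ ∧ V.1 ∈ Ψ.source := by
  obtain ⟨V, hiso, hdual⟩ := V
  let B := Module.finBasisOfFinrankEq ℝ V.toSubmodule V.finrank_eq
  let v (i : Fin n) : CVec n := B i
  have hv (i) : v i ∈ V.toSubmodule := (B i).2
  have hvv (i j) : imForm b (v i) (v j) = 0 := hiso _ (hv i) _ (hv j)
  have hli : LinearIndependent ℝ v := B.linearIndependent.map' V.toSubmodule.subtype
    (Submodule.ker_subtype _)
  obtain ⟨c, hvc, -, hcc⟩ := exists_dual_isotropic (imForm b) (imForm_isSymm hsymm)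
    (imForm_nondegenerate hsymm hnd) v (Empty.elim : Empty → CVec n) (by
      rw [← linearIndependent_equiv (Equiv.sumEmpty (Fin n) Empty).symm]
      exact hli) hvv (fun i j => j.elim)
  have hcv (i j) : imForm b (c i) (v j) = if i = j then 1 else 0 := by
    rw [imForm_comm hsymm, hvc]
    simp only [eq_comm]
  obtain ⟨C, hC⟩ := exists_basis_of_dual hcc hvc
  let e : ((Fin n → ℝ) × (Fin n → ℝ)) ≃ₗ[ℝ] CVec n :=
    (LinearEquiv.sumArrowLequivProdArrow (Fin n) (Fin n) ℝ ℝ).symm ≪≫ₗ C.equivFun.symm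
  have he (x y) : e (x, y) = ∑ i, x i • v i + ∑ i, y i • c i := by
    change C.equivFun.symm (Sum.elim x y) = _
    rw [Module.Basis.equivFun_symm_apply, Fintype.sum_sum_type, hC]
    rfl
  have hform (x y x' y') : imForm b (e (x, y)) (e (x', y')) = y ⬝ᵥ x' + x ⬝ᵥ y' := by
    rw [he, he]
    simp only [map_add, LinearMap.add_apply, map_sum, LinearMap.sum_apply, map_smul,
      LinearMap.smul_apply, hvv, hcc, hvc, hcv, smul_eq_mul, mul_zero, Finset.sum_const_zero,
      mul_ite, mul_one, Finset.sum_ite_eq', Finset.mem_univ, if_true, zero_add,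
      add_zero, dotProduct]
    simp only [mul_comm]
  have hvol : ε * volForm b (Sum.elim c v) = 1 := (isDual_iff hiso hv hcv ε).1 hdual
  refine ⟨grChart e, ⟨grChart_mem_maximalAtlas e, ?_⟩, ?_⟩
  · rintro _ ⟨φ, rfl⟩
    rw [Subtype.range_coe]
    change graphPoint e φ ∈ _ ↔ grChart e (graphPoint e φ) ∈ _
    rw [grChart_graphPoint]
    have hmem (x) : e (x, φ x) ∈ (graphPoint e φ).toSubmodule := (mem_graphIn e φ _).2 ⟨x, rfl⟩
    constructor
    · rintro ⟨h, -⟩ x x'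
      rw [← hform]
      exact h _ (hmem x) _ (hmem x')
    · intro h
      have hiso' : ∀ z ∈ (graphPoint e φ).toSubmodule, ∀ w ∈ (graphPoint e φ).toSubmodule,
          imForm b z w = 0 := by
        intro z hz w hw
        obtain ⟨x, rfl⟩ := (mem_graphIn e φ _).1 hz
        obtain ⟨x', rfl⟩ := (mem_graphIn e φ _).1 hw
        rw [hform]
        exact h x x'
      refine ⟨hiso', (isDual_iff hiso' (c := c)
        (v := fun j => e (Pi.single j 1, φ (Pi.single j 1))) (fun j => hmem _) ?_ ε).2 ?_⟩
      · intro i j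
        have hc : c i = e (0, Pi.single i 1) := by simp [he, Pi.single_apply]
        rw [hc, hform]
        simp [Pi.single_apply, eq_comm]
      · have h1 : (Sum.elim c fun j => e (Pi.single j 1, φ (Pi.single j 1))) = fun j =>
            ∑ l, (Matrix.fromBlocks 1 (Matrix.of fun l j => φ (Pi.single j 1) l) 0 1 :
              Matrix _ _ ℝ) l j • Sum.elim c v l := by
          funext j
          rw [Fintype.sum_sum_type]
          rcases j with j | j
          · simp [Matrix.one_apply]
          · simp [Matrix.one_apply, he, Pi.single_apply, add_comm]
        rw [h1, volForm_combination, Matrix.det_fromBlocks_zero₂₁, Matrix.det_one, one_mul,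
          mul_one, hvol]
  · refine ⟨0, graphPoint_eq_of_le e 0 V fun x => ?_⟩
    rw [he]
    simp only [zero_apply, Pi.zero_apply, zero_smul, Finset.sum_const_zero, add_zero]
    exact V.toSubmodule.sum_mem fun i _ => V.toSubmodule.smul_mem _ (hv i)

/-- The maximal isotropic Grassmannian of a given sign as an embedded submanifold. -/
def igrManifold (hsymm : b.IsSymm) (hnd : b.Nondegenerate) (ε : ℝ) :
    EmbeddedSubmanifold (GrModel n n) (igr b ε) (Module.finrank ℝ (igrModel n)) :=
  sliceStructure Topology.IsEmbedding.subtypeVal (exists_sliceChart_igr hsymm hnd ε)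

theorem finrank_igrModel (n : ℕ) :
    Module.finrank ℝ (igrModel n) = Module.finrank ℝ (skewFun (Fin n) ℝ) := by
  let F : (Fin n → Fin n → ℝ) ≃ₗ[ℝ] GrModel n n :=
    (Matrix.toLin' (R := ℝ) (m := Fin n) (n := Fin n)) ≪≫ₗ LinearMap.toContinuousLinearMap
  have hF (M : Fin n → Fin n → ℝ) (x i) : F M x i = ∑ j, M i j * x j := rfl
  have h : igrModel n = (skewFun (Fin n) ℝ).map F.toLinearMap := by
    ext φ
    rw [Submodule.mem_map_equiv]
    obtain ⟨M, rfl⟩ := F.surjective φ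
    rw [LinearEquiv.symm_apply_apply]
    constructor
    · intro hM i j
      have := hM (Pi.single j 1) (Pi.single i 1)
      simp [hF, Pi.single_apply] at this
      linarith
    · intro hM x x'
      simp only [dotProduct, hF, Finset.mul_sum, Finset.sum_mul]
      rw [Finset.sum_comm, ← Finset.sum_add_distrib]
      refine Finset.sum_eq_zero fun i _ => ?_
      rw [← Finset.sum_add_distrib]
      refine Finset.sum_eq_zero fun j _ => ?_
      rw [hM j i]
      ring
  rw [h, LinearEquiv.finrank_map_eq]

end Igr

/-! ### The codimension of the orbit -/

section Dimension

variable (k r s : ℕ)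

/-- The parametrization of the model of the orbit by skew matrices. -/
def orbParam : (skewFun (Fin r ⊕ Fin s) ℝ × ((Fin k → ℂ) →L[ℝ] (Fin r ⊕ Fin s → ℝ)) ×
    skewFun (Fin k) ℂ) →ₗ[ℝ] Coord k r s where
  toFun p := (LinearMap.toContinuousLinearMap
      (Matrix.mulVecLin (Matrix.of fun i j => sgn i * p.1.1 i j)), p.2.1,
    LinearMap.toContinuousLinearMap ((Matrix.mulVecLin (Matrix.of p.2.2.1)).restrictScalars ℝ), 0)
  map_add' p q := by
    refine Prod.ext ?_ (Prod.ext rfl (Prod.ext ?_ (by simp)))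
    · ext x i
      simp [Matrix.mulVec, dotProduct, mul_add, add_mul, Finset.sum_add_distrib]
    · ext x i
      simp [Matrix.mulVec, dotProduct, add_mul, Finset.sum_add_distrib]
  map_smul' t p := by
    refine Prod.ext ?_ (Prod.ext rfl (Prod.ext ?_ (by
      ext x i
      exact (smul_zero t).symm)))
    · ext x i
      simp only [RingHom.id_apply, Prod.smul_fst, Submodule.coe_smul, Pi.smul_apply, smul_eq_mul,
        LinearMap.coe_toContinuousLinearMap', Matrix.mulVecLin_apply, Matrix.mulVec, dotProduct,
        Matrix.of_apply, smul_apply, Finset.mul_sum]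
      exact Finset.sum_congr rfl fun j _ => by ring
    · ext x i
      simp [Matrix.mulVec, dotProduct, Finset.mul_sum, mul_assoc]

variable {k r s}

theorem orbParam_fst (p) (x : Fin r ⊕ Fin s → ℝ) (i) :
    (orbParam k r s p).1 x i = ∑ j, sgn i * p.1.1 i j * x j := rfl

theorem orbParam_third (p) (x : Fin k → ℂ) (i) :
    (orbParam k r s p).2.2.1 x i = ∑ j, p.2.2.1 i j * x j := rfl

theorem orbParam_injective : Function.Injective (orbParam k r s) := by
  intro p q h
  refine Prod.ext (Subtype.ext ?_) (Prod.ext (congrArg (fun z => z.2.1) h) (Subtype.ext ?_))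
  · ext i j
    have h1 := congrArg (fun z : Coord k r s => z.1 (Pi.single j 1) i) h
    simp only [orbParam_fst] at h1
    simp only [Pi.single_apply, mul_ite, mul_one, mul_zero, Finset.sum_ite_eq', Finset.mem_univ,
      if_true] at h1
    have h2 := congrArg (fun t => sgn i * t) h1
    simpa [← mul_assoc, sgn_mul_self] using h2
  · ext i j
    have h1 := congrArg (fun z : Coord k r s => z.2.2.1 (Pi.single j 1) i) h
    simp only [orbParam_third] at h1
    simpa [Pi.single_apply] using h1

/-- Multiplication by the signs turns skewness for the indefinite form into ordinary skewness. In
the third block skewness includes complex linearity, so a complex matrix determines the block. -/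
theorem range_orbParam : LinearMap.range (orbParam k r s) = orbModel k r s := by
  ext q
  rw [LinearMap.mem_range, mem_orbModel]
  constructor
  · rintro ⟨p, rfl⟩
    refine ⟨fun u u' => ?_, fun w w' => ?_, rfl⟩
    · simp only [qR, orbParam_fst, Finset.mul_sum, Finset.sum_mul]
      rw [Finset.sum_comm, ← Finset.sum_add_distrib]
      refine Finset.sum_eq_zero fun i _ => ?_
      rw [← Finset.sum_add_distrib]
      refine Finset.sum_eq_zero fun j _ => ?_
      rw [p.1.2 j i]
      linear_combination (u i * u' j * (-p.1.1 i j)) * (sgn_mul_self j) -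
        (u i * u' j * (-p.1.1 i j)) * (sgn_mul_self i)
    · simp only [dotProduct, orbParam_third, Finset.mul_sum, Finset.sum_mul]
      rw [Finset.sum_comm, ← Finset.sum_add_distrib]
      refine Finset.sum_eq_zero fun i _ => ?_
      rw [← Finset.sum_add_distrib]
      refine Finset.sum_eq_zero fun j _ => ?_
      rw [p.2.2.2 j i]
      ring
  · rintro ⟨h1, h2, h3⟩
    obtain ⟨A, β, γ, δ⟩ := q
    simp only at h1 h2 h3
    subst h3
    refine ⟨(⟨fun i j => sgn i * A (Pi.single j 1) i, fun i j => ?_⟩, β,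
      ⟨fun i j => γ (Pi.single j 1) i, fun i j => ?_⟩), ?_⟩
    · have := h1 (Pi.single j 1) (Pi.single i 1)
      simp [qR, Pi.single_apply] at this
      linarith
    · have := h2 (Pi.single j 1) (Pi.single i 1)
      simp at this
      linear_combination this
    · refine Prod.ext ?_ (Prod.ext rfl (Prod.ext ?_ rfl))
      · ext x i
        rw [orbParam_fst]
        conv_rhs => rw [pi_eq_sum_univ' x]
        simp only [map_sum, map_smul, Finset.sum_apply, Pi.smul_apply, smul_eq_mul]
        refine Finset.sum_congr rfl fun j _ => ?_
        have e1 : (fun l => if j = l then (1 : ℝ) else 0) = Pi.single j 1 := by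
          ext l; simp [Pi.single_apply, eq_comm]
        linear_combination (A (Pi.single j 1) i * x j) * sgn_mul_self i
      · ext x i
        rw [orbParam_third]
        let γ' : (Fin k → ℂ) →ₗ[ℂ] (Fin k → ℂ) :=
          { toFun := γ
            map_add' := map_add γ
            map_smul' := map_smul_of_map_I γ.toLinearMap (map_I_of_skew h2) }
        change _ = γ' x i
        conv_rhs => rw [pi_eq_sum_univ' x]
        simp only [map_sum, map_smul, Finset.sum_apply, Pi.smul_apply, smul_eq_mul]
        refine Finset.sum_congr rfl fun j _ => mul_comm _ _

theorem finrank_clm (V W : Type*) [NormedAddCommGroup V] [NormedSpace ℝ V] [FiniteDimensional ℝ V]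
    [NormedAddCommGroup W] [NormedSpace ℝ W] [FiniteDimensional ℝ W] :
    Module.finrank ℝ (V →L[ℝ] W) = Module.finrank ℝ V * Module.finrank ℝ W := by
  rw [← (LinearMap.toContinuousLinearMap (𝕜 := ℝ) (E := V) (F' := W)).finrank_eq,
    Module.finrank_linearMap]

/-- The codimension of the orbit. -/
theorem finrank_igrModel_eq {n : ℕ} (hn : r + s + 2 * k = n) :
    Module.finrank ℝ (igrModel n) = Module.finrank ℝ
      ((orbModel k r s).comap (blockE hn).toLinearEquiv.toLinearMap) + k ^ 2 := by
  have h1 : Module.finrank ℝ ((orbModel k r s).comap (blockE hn).toLinearEquiv.toLinearMap) =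
      Module.finrank ℝ (skewFun (Fin r ⊕ Fin s) ℝ) + (k * 2 * (r + s) +
        Module.finrank ℝ (skewFun (Fin k) ℂ)) := by
    rw [← range_orbParam]
    have h2 : (LinearMap.range (orbParam k r s)).comap (blockE hn).toLinearEquiv.toLinearMap =
        (LinearMap.range (orbParam k r s)).map (blockE hn).toLinearEquiv.symm.toLinearMap := by
      exact Submodule.comap_equiv_eq_map_symm _ _
    rw [h2, LinearEquiv.finrank_map_eq, LinearMap.finrank_range_of_inj orbParam_injective,
      Module.finrank_prod, Module.finrank_prod, finrank_clm]
    simp [Module.finrank_pi_fintype, Complex.finrank_real_complex]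
  -- With `m = r + s` and `n = m + 2k` the count is `n(n-1)/2 = m(m-1)/2 + 2km + k(k-1) + k²`.
  have e1 := two_mul_finrank_skewFun (ι := Fin n) (K := ℝ)
  have e2 := two_mul_finrank_skewFun (ι := Fin r ⊕ Fin s) (K := ℝ)
  have e3 := two_mul_finrank_skewFun (ι := Fin k) (K := ℂ)
  rw [finrank_igrModel, h1]
  simp only [Fintype.card_fin, Fintype.card_sum, Module.finrank_self, mul_one,
    Complex.finrank_real_complex] at e1 e2 e3
  subst hn
  nlinarith

end Dimension

/-! ### The Hermitian matrix of an infinitesimal deformation -/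

section Deformation

variable {n k r s : ℕ} {b : LinearMap.BilinForm ℂ (CVec n)} (T : Frame b k r s)

theorem star_I_smul (w : Fin k → ℂ) : star (Complex.I • w) = -(Complex.I • star w) := by
  ext j
  simp

theorem star_single_one (l : Fin k) : star (Pi.single l 1 : Fin k → ℂ) = Pi.single l 1 := by
  ext i
  by_cases h : i = l <;> simp [h]

/-- The inclusion of the isotropic complex subspace of a frame. -/
def Frame.incl : (Fin k → ℂ) →ₗ[ℂ] CVec n := T.toEquiv.toLinearMap ∘ₗ LinearMap.inl ℂ _ _

/-- The coordinates on the quotient by the orthocomplement of that subspace. -/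
def Frame.coproj : CVec n →ₗ[ℂ] (Fin k → ℂ) :=
  LinearMap.snd ℂ _ _ ∘ₗ LinearMap.snd ℂ _ _ ∘ₗ T.toEquiv.symm.toLinearMap

theorem Frame.incl_apply (w : Fin k → ℂ) : T.incl w = T.toEquiv (w, 0, 0) := rfl

theorem Frame.coproj_toEquiv (z : Mdl k r s) : T.coproj (T.toEquiv z) = z.2.2 := by
  change (T.toEquiv.symm (T.toEquiv z)).2.2 = _
  rw [LinearEquiv.symm_apply_apply]

theorem Frame.coproj_surjective : Function.Surjective T.coproj :=
  fun c => ⟨T.toEquiv (0, 0, c), T.coproj_toEquiv _⟩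

/-- The form identifies ℂⁿ/W^⊥ with the dual of `W`, and in the coordinates of a frame this duality
is the dot product. -/
theorem Frame.form_incl (w : Fin k → ℂ) (z : CVec n) : b (T.incl w) z = w ⬝ᵥ T.coproj z := by
  obtain ⟨z, rfl⟩ := T.toEquiv.surjective z
  rw [T.coproj_toEquiv, T.incl_apply, T.map_form, mdlForm_apply]
  simp

theorem Frame.form_incl' (hsymm : b.IsSymm) (w : Fin k → ℂ) (z : CVec n) :
    b z (T.incl w) = T.coproj z ⬝ᵥ w := by
  rw [dotProduct_comm, ← T.form_incl]
  exact hsymm.eq _ _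

theorem Frame.coproj_eq_zero_iff (hn : r + s + 2 * k = n) (z : CVec n) :
    T.coproj z = 0 ↔ ∀ w ∈ (T.point hn 0).toSubmodule,
      Complex.I • w ∈ (T.point hn 0).toSubmodule → b w z = 0 := by
  have hv (w : Fin k → ℂ) : vecE (0 : Coord k r s) w 0 = (w, 0, 0) := by
    refine Prod.ext rfl (Prod.ext ?_ ?_) <;> simp [vecE, graphE]
  have hc := T.complexPart_point hn zero_mem_orbModel zero_mem_smallBall
  simp only [hv] at hc
  constructor
  · intro h w hw hw'
    obtain ⟨w, rfl⟩ := (hc w).1 ⟨hw, hw'⟩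
    rw [← T.incl_apply, T.form_incl, h, dotProduct_zero]
  · intro h
    have h1 (w : Fin k → ℂ) : w ⬝ᵥ T.coproj z = 0 := by
      rw [← T.form_incl]
      obtain ⟨h2, h3⟩ := (hc (T.incl w)).2 ⟨w, rfl⟩
      exact h _ h2 h3
    ext j
    simpa using h1 (Pi.single j 1)

/-- The antilinear part of the deformation of the isotropic complex subspace. -/
def Frame.antiPart : (CVec n →L[ℝ] CVec n) →ₗ[ℝ] (Fin k → ℂ) →ₗ[ℝ] (Fin k → ℂ) :=
  -- For `f = coproj ∘ X ∘ incl` the expression `f(w) + i f(iw)` kills complex linear `f` and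
  -- doubles antilinear `f`.
  LinearMap.mk₂ ℝ (fun X w => T.coproj (X (T.incl w)) + Complex.I • T.coproj (X (T.incl (Complex.I • w))))
    (fun X Y w => by simp only [add_apply, map_add, smul_add]; abel)
    (fun t X w => by
      have h (z : CVec n) : T.coproj (t • z) = t • T.coproj z :=
        (T.coproj.restrictScalars ℝ).map_smul t z
      simp only [smul_apply, h, smul_add, smul_comm Complex.I t])
    (fun X w w' => by simp only [map_add, smul_add]; abel)
    (fun t X w => by
      have h (z : CVec n) : T.coproj (t • z) = t • T.coproj z :=
        (T.coproj.restrictScalars ℝ).map_smul t z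
      have h' (w : Fin k → ℂ) : T.incl (t • w) = t • T.incl w :=
        (T.incl.restrictScalars ℝ).map_smul t w
      simp only [smul_comm Complex.I t, h', map_smul, h, smul_add])

theorem Frame.antiPart_apply (X : CVec n →L[ℝ] CVec n) (w : Fin k → ℂ) : T.antiPart X w =
    T.coproj (X (T.incl w)) + Complex.I • T.coproj (X (T.incl (Complex.I • w))) := rfl

theorem Frame.antiPart_I (X : CVec n →L[ℝ] CVec n) (w : Fin k → ℂ) :
    T.antiPart X (Complex.I • w) = -(Complex.I • T.antiPart X w) := by
  rw [T.antiPart_apply, T.antiPart_apply, smul_smul, Complex.I_mul_I, neg_one_smul, map_neg,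
    map_neg, map_neg, smul_add, smul_smul, Complex.I_mul_I, neg_one_smul, smul_neg]
  abel

/-- The matrix of the antilinear part. -/
def Frame.antiMatrix : (CVec n →L[ℝ] CVec n) →ₗ[ℝ] Matrix (Fin k) (Fin k) ℂ where
  toFun X := Matrix.of fun j l => T.antiPart X (Pi.single l 1) j
  map_add' X Y := by
    rw [map_add]
    rfl
  map_smul' t X := by
    rw [map_smul]
    rfl

theorem Frame.antiMatrix_mulVec (X : CVec n →L[ℝ] CVec n) (w : Fin k → ℂ) :
    (T.antiMatrix X).mulVec (star w) = T.antiPart X w := by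
  let σ : (Fin k → ℂ) →ₗ[ℝ] (Fin k → ℂ) :=
    { toFun := star
      map_add' := star_add
      map_smul' := fun t w => by
        ext j
        simp }
  let α : (Fin k → ℂ) →ₗ[ℝ] (Fin k → ℂ) := T.antiPart X ∘ₗ σ
  have hα (v) : α (Complex.I • v) = Complex.I • α v := by
    change T.antiPart X (star (Complex.I • v)) = Complex.I • T.antiPart X (star v)
    rw [star_I_smul, map_neg, T.antiPart_I, neg_neg]
  let α' : (Fin k → ℂ) →ₗ[ℂ] (Fin k → ℂ) :=
    { toFun := α
      map_add' := map_add α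
      map_smul' := map_smul_of_map_I α hα }
  have h1 : T.antiMatrix X = LinearMap.toMatrix' α' := by
    ext j l
    rw [LinearMap.toMatrix'_apply]
    change T.antiPart X (Pi.single l 1) j = T.antiPart X (star (Pi.single l 1)) j
    rw [star_single_one]
  rw [h1, LinearMap.toMatrix'_mulVec]
  change T.antiPart X (star (star w)) = _
  rw [star_star]

theorem re_form_coproj (hsymm : b.IsSymm) (X : CVec n →L[ℝ] CVec n) (w w' : Fin k → ℂ) :
    T.antiPart X w ⬝ᵥ w' =
      ⟨imForm b (X (T.incl w)) (T.incl (Complex.I • w')) -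
          imForm b (X (T.incl (Complex.I • w))) (T.incl w'),
        imForm b (X (T.incl w)) (T.incl w') +
          imForm b (X (T.incl (Complex.I • w))) (T.incl (Complex.I • w'))⟩ := by
  rw [T.antiPart_apply, add_dotProduct, smul_dotProduct]
  simp only [imForm_apply, T.form_incl' hsymm, dotProduct_smul]
  apply Complex.ext <;> simp [sub_eq_add_neg]

/-- By `re_form_coproj` the entries are combinations of the values Im b(Xv, v'), which are skew in
`v` and `v'`. Exchanging `w` and `w'` therefore keeps the real part of the pairing and reverses its
imaginary part. -/
theorem Frame.antiMatrix_conjTranspose (hsymm : b.IsSymm) {X : CVec n →L[ℝ] CVec n}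
    (hX : X ∈ algG b) : (T.antiMatrix X).conjTranspose = T.antiMatrix X := by
  have hskew (v w) : imForm b (X v) w = -imForm b (X w) v := by
    have := hX v w
    rw [imForm_comm hsymm v] at this
    linarith
  have key (j l) : T.antiMatrix X j l = T.antiPart X (Pi.single l 1) ⬝ᵥ Pi.single j 1 := by
    simp [Frame.antiMatrix]
  ext j l
  rw [Matrix.conjTranspose_apply, key, key, re_form_coproj T hsymm, re_form_coproj T hsymm]
  apply Complex.ext
  · change _ = _ - _
    rw [hskew (T.incl (Pi.single l 1)), hskew (T.incl (Complex.I • Pi.single l 1))]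
    change _ - _ = _
    ring
  · change -(_ + _) = _ + _
    rw [hskew (T.incl (Pi.single l 1)), hskew (T.incl (Complex.I • Pi.single l 1))]
    ring

theorem Frame.exists_antiMatrix_eq {M : Matrix (Fin k) (Fin k) ℂ}
    (hM : M.conjTranspose = M) : ∃ X ∈ algG b, T.antiMatrix X = M := by
  let L : CVec n →ₗ[ℝ] CVec n :=
    -- The factor `1/2` compensates the doubling in `antiPart`. The map is skew for Im b because,
    -- `M` being Hermitian, the two pairings to be added are complex conjugates.
    { toFun := fun z => T.toEquiv (0, 0, (2⁻¹ : ℂ) • M.mulVec (star (T.toEquiv.symm z).1))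
      map_add' := fun z z' => by
        rw [← map_add, map_add T.toEquiv.symm, Prod.fst_add, star_add, Matrix.mulVec_add, smul_add]
        simp
      map_smul' := fun t z => by
        have h1 : T.toEquiv.symm (t • z) = t • T.toEquiv.symm z :=
          (T.toEquiv.symm.restrictScalars ℝ).map_smul t z
        have h2 : star (t • (T.toEquiv.symm z).1) = t • star (T.toEquiv.symm z).1 := by
          ext j
          simp
        have h3 (v : Mdl k r s) : T.toEquiv (t • v) = t • T.toEquiv v :=
          (T.toEquiv.restrictScalars ℝ).map_smul t v
        rw [h1, Prod.smul_fst, h2, Matrix.mulVec_smul, smul_comm (2⁻¹ : ℂ) t, RingHom.id_apply,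
          ← h3]
        simp }
  have hL (z : Mdl k r s) : L (T.toEquiv z) = T.toEquiv (0, 0, (2⁻¹ : ℂ) • M.mulVec (star z.1)) := by
    change T.toEquiv (0, 0, (2⁻¹ : ℂ) • M.mulVec (star (T.toEquiv.symm (T.toEquiv z)).1)) = _
    rw [LinearEquiv.symm_apply_apply]
  refine ⟨LinearMap.toContinuousLinearMap L, fun v w => ?_, ?_⟩
  · obtain ⟨v, rfl⟩ := T.toEquiv.surjective v
    obtain ⟨w, rfl⟩ := T.toEquiv.surjective w
    change imForm b (L _) _ + imForm b _ (L _) = 0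
    rw [hL, hL, imForm_apply, imForm_apply, T.map_form, T.map_form, mdlForm_apply, mdlForm_apply]
    simp only [zero_dotProduct, dotProduct_zero, map_zero, LinearMap.zero_apply, zero_add, add_zero,
      smul_dotProduct, dotProduct_smul, smul_eq_mul]
    have h1 : v.1 ⬝ᵥ M.mulVec (star w.1) = (starRingEnd ℂ) (M.mulVec (star v.1) ⬝ᵥ w.1) := by
      have h2 : (starRingEnd ℂ) (M.mulVec (star v.1) ⬝ᵥ w.1) =
          star w.1 ⬝ᵥ star (M.mulVec (star v.1)) := by
        rw [Matrix.star_dotProduct_star]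
        rfl
      rw [h2, Matrix.star_mulVec, star_star, hM, dotProduct_comm (star w.1),
        Matrix.dotProduct_mulVec]
    rw [h1]
    simp
  · have key (w : Fin k → ℂ) :
        T.antiPart (LinearMap.toContinuousLinearMap L) w = M.mulVec (star w) := by
      have e (w : Fin k → ℂ) : LinearMap.toContinuousLinearMap L (T.incl w) =
        T.toEquiv (0, 0, (2⁻¹ : ℂ) • M.mulVec (star w)) := hL (w, 0, 0)
      rw [T.antiPart_apply, e, e, T.coproj_toEquiv, T.coproj_toEquiv, star_I_smul,
        Matrix.mulVec_neg, Matrix.mulVec_smul]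
      ext j
      simp only [Pi.add_apply, Pi.smul_apply, Pi.neg_apply, smul_eq_mul]
      linear_combination -(2⁻¹ : ℂ) * M.mulVec (star w) j * Complex.I_mul_I
    ext j l
    change T.antiPart _ (Pi.single l 1) j = _
    rw [key, star_single_one, Matrix.mulVec_single_one, Matrix.col_apply]

end Deformation

/-! ### The infinitesimal transversal -/

section Correction

variable {n k r s : ℕ} {b : LinearMap.BilinForm ℂ (CVec n)} (T : Frame b k r s)

/-- The complex linear map of the model space given by the blocks of a skew form. -/
def correction (γ : (Fin k → ℂ) →ₗ[ℂ] (Fin k → ℂ)) (τ : Fin r ⊕ Fin s → Fin k → ℂ)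
    (a : Fin r ⊕ Fin s → Fin r ⊕ Fin s → ℝ) : Mdl k r s →ₗ[ℂ] Mdl k r s where
  toFun z := (0, fun j => (sgn j : ℂ) * (Complex.I * ∑ i, a i j * z.2.1 i - τ j ⬝ᵥ z.1),
    γ z.1 + ∑ j, z.2.1 j • τ j)
  map_add' z z' := by
    refine Prod.ext (by simp) (Prod.ext ?_ ?_)
    · ext j
      simp only [Prod.fst_add, Prod.snd_add, Pi.add_apply, dotProduct_add, mul_add,
        Finset.sum_add_distrib]
      ring
    · simp only [Prod.fst_add, Prod.snd_add, Pi.add_apply, map_add, add_smul,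
        Finset.sum_add_distrib]
      abel
  map_smul' c z := by
    refine Prod.ext (by simp) (Prod.ext ?_ ?_)
    · ext j
      simp only [Prod.smul_fst, Prod.smul_snd, Pi.smul_apply, dotProduct_smul, smul_eq_mul,
        RingHom.id_apply, mul_left_comm _ c, ← Finset.mul_sum]
      ring
    · simp only [Prod.smul_fst, Prod.smul_snd, Pi.smul_apply, map_smul, smul_add, smul_eq_mul,
        RingHom.id_apply, mul_smul, Finset.smul_sum]

theorem mdlForm_correction (γ : (Fin k → ℂ) →ₗ[ℂ] (Fin k → ℂ)) (τ : Fin r ⊕ Fin s → Fin k → ℂ)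
    (a : Fin r ⊕ Fin s → Fin r ⊕ Fin s → ℝ) (z z' : Mdl k r s) :
    mdlForm k r s (correction γ τ a z) z' = γ z.1 ⬝ᵥ z'.1 + ∑ j, z.2.1 j * (τ j ⬝ᵥ z'.1) +
      ∑ j, (Complex.I * ∑ i, a i j * z.2.1 i - τ j ⬝ᵥ z.1) * z'.2.1 j := by
  rw [mdlForm_apply, qE_apply]
  change 0 ⬝ᵥ _ + (γ z.1 + ∑ j, z.2.1 j • τ j) ⬝ᵥ z'.1 + ∑ j, (sgn j : ℂ) *
    ((sgn j : ℂ) * (Complex.I * ∑ i, a i j * z.2.1 i - τ j ⬝ᵥ z.1) * z'.2.1 j) = _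
  rw [zero_dotProduct, zero_add, add_dotProduct, sum_dotProduct]
  simp only [smul_dotProduct, smul_eq_mul]
  congr 1
  refine Finset.sum_congr rfl fun j _ => ?_
  have h : (sgn j : ℂ) * sgn j = 1 := by exact_mod_cast sgn_mul_self j
  linear_combination ((Complex.I * ∑ i, a i j * z.2.1 i - τ j ⬝ᵥ z.1) * z'.2.1 j) * h

/-- By complex bilinearity the real part at `w'` is the imaginary part at `iw'`. -/
theorem skew_of_im_skew {γ : (Fin k → ℂ) →ₗ[ℂ] (Fin k → ℂ)}
    (h : ∀ w w', (γ w ⬝ᵥ w' + γ w' ⬝ᵥ w).im = 0) (w w' : Fin k → ℂ) :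
    γ w ⬝ᵥ w' + γ w' ⬝ᵥ w = 0 := by
  refine Complex.ext ?_ (h w w')
  have h1 := h w (Complex.I • w')
  rw [map_smul, smul_dotProduct, dotProduct_smul, ← smul_add] at h1
  simpa using h1

/-- As `V` is its own orthocomplement for Im b, it suffices that `Y` has the same values Im b(Yv,
v') as `X` on `V`. On `W` these are the imaginary part of a complex bilinear skew form `γ`, because
the antilinear part vanishes; the mixed values are given by `τ`, and those on ℝ^{r+s} by a real skew
matrix `a`. The complex extension with `i a` in place of `a` lies in the Lie algebra of `H`. -/
theorem Frame.exists_correction (hn : r + s + 2 * k = n) (hsymm : b.IsSymm) (hnd : b.Nondegenerate)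
    {X : CVec n →L[ℝ] CVec n} (hX : X ∈ algG b) (h0 : T.antiMatrix X = 0) :
    ∃ Y ∈ algH b, ∀ v ∈ (T.point hn 0).toSubmodule, (X - Y) v ∈ (T.point hn 0).toSubmodule := by
  have hskew (v w) : imForm b (X v) w = -imForm b (X w) v := by
    have := hX v w
    rw [imForm_comm hsymm v] at this
    linarith
  have hI (w : Fin k → ℂ) : T.coproj (X (T.incl (Complex.I • w))) =
      Complex.I • T.coproj (X (T.incl w)) := by
    have h1 := T.antiMatrix_mulVec X w
    rw [h0, Matrix.zero_mulVec, T.antiPart_apply] at h1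
    have h2 := congrArg (fun v => Complex.I • v) h1
    simp only [smul_zero, smul_add, smul_smul, Complex.I_mul_I, neg_one_smul] at h2
    rw [← sub_eq_add_neg] at h2
    exact (sub_eq_zero.1 h2.symm).symm
  let γ₀ : (Fin k → ℂ) →ₗ[ℝ] (Fin k → ℂ) :=
    (T.coproj.restrictScalars ℝ) ∘ₗ X.toLinearMap ∘ₗ (T.incl.restrictScalars ℝ)
  let γ : (Fin k → ℂ) →ₗ[ℂ] (Fin k → ℂ) :=
    { toFun := γ₀
      map_add' := map_add γ₀
      map_smul' := map_smul_of_map_I γ₀ hI }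
  have hγ (w) : γ w = T.coproj (X (T.incl w)) := rfl
  have hγskew : ∀ w w', γ w ⬝ᵥ w' + γ w' ⬝ᵥ w = 0 := skew_of_im_skew fun w w' => by
    have h1 := hskew (T.incl w) (T.incl w')
    rw [imForm_apply, imForm_apply, T.form_incl' hsymm, T.form_incl' hsymm] at h1
    rw [Complex.add_im, hγ, hγ, h1]
    ring
  let u (j : Fin r ⊕ Fin s) : CVec n := T.toEquiv (0, Pi.single j 1, 0)
  let τ (j : Fin r ⊕ Fin s) : Fin k → ℂ := T.coproj (X (u j))
  let a (i j : Fin r ⊕ Fin s) : ℝ := imForm b (X (u i)) (u j)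
  have ha (i j) : a i j = -a j i := hskew _ _
  let Y₀ : CVec n →ₗ[ℂ] CVec n :=
    T.toEquiv.toLinearMap ∘ₗ correction γ τ a ∘ₗ T.toEquiv.symm.toLinearMap
  have hY₀ (z) : Y₀ (T.toEquiv z) = T.toEquiv (correction γ τ a z) := by
    change T.toEquiv (correction γ τ a (T.toEquiv.symm (T.toEquiv z))) = _
    rw [LinearEquiv.symm_apply_apply]
  let Y : CVec n →L[ℝ] CVec n := LinearMap.toContinuousLinearMap (Y₀.restrictScalars ℝ)
  refine ⟨Y, ⟨fun z => Y₀.map_smul _ _, fun z w => ?_⟩, fun v hv => ?_⟩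
  · obtain ⟨z, rfl⟩ := T.toEquiv.surjective z
    obtain ⟨w, rfl⟩ := T.toEquiv.surjective w
    change b (Y₀ _) _ + b _ (Y₀ _) = 0
    rw [hY₀, hY₀, T.map_form, T.map_form, mdlForm_comm z, mdlForm_correction, mdlForm_correction]
    have h1 : ∑ j, (∑ i, (a i j : ℂ) * z.2.1 i) * w.2.1 j =
        -∑ j, (∑ i, (a i j : ℂ) * w.2.1 i) * z.2.1 j := by
      simp only [Finset.sum_mul]
      rw [Finset.sum_comm, ← Finset.sum_neg_distrib]
      refine Finset.sum_congr rfl fun i _ => ?_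
      rw [← Finset.sum_neg_distrib]
      refine Finset.sum_congr rfl fun j _ => ?_
      rw [ha i j]
      push_cast
      ring
    simp only [sub_mul, Finset.sum_sub_distrib, mul_assoc, ← Finset.mul_sum, h1]
    simp only [mul_comm _ (τ _ ⬝ᵥ _)]
    linear_combination hγskew z.1 w.1
  · refine mem_of_forall_imForm_eq_zero hsymm hnd (T.point_zero_mem_orb hn).1 fun v' hv' => ?_
    obtain ⟨w, x, rfl⟩ := (T.mem_point_zero hn v).1 hv
    obtain ⟨w', x', rfl⟩ := (T.mem_point_zero hn v').1 hv'
    have hdec (w : Fin k → ℂ) (x : Fin r ⊕ Fin s → ℝ) : T.toEquiv (w, realE r s x, 0) =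
        T.incl w + ∑ j, x j • u j := by
      have h1 : ((w, realE r s x, 0) : Mdl k r s) =
          (w, 0, 0) + ∑ j, (x j : ℂ) • (0, Pi.single j 1, 0) := by
        refine Prod.ext ?_ (Prod.ext ?_ ?_)
        · simp [Prod.fst_sum]
        · ext l
          simp [Prod.fst_sum, Prod.snd_sum, Pi.single_apply, -Fintype.sum_sum_type]
        · simp [Prod.snd_sum]
      rw [h1, map_add, map_sum, T.incl_apply]
      congr 1
      refine Finset.sum_congr rfl fun j _ => ?_
      rw [map_smul, Complex.coe_smul]
    have ht (j) (w : Fin k → ℂ) : imForm b (X (u j)) (T.incl w) = (τ j ⬝ᵥ w).im := by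
      rw [imForm_apply, T.form_incl' hsymm]
    have ht' (j) (w : Fin k → ℂ) : imForm b (X (T.incl w)) (u j) = -(τ j ⬝ᵥ w).im := by
      rw [hskew, ht]
    have hγ' : imForm b (X (T.incl w)) (T.incl w') = (γ w ⬝ᵥ w').im := by
      rw [imForm_apply, T.form_incl' hsymm, hγ]
    have hu (i j) : imForm b (X (u i)) (u j) = a i j := rfl
    have e1 : imForm b (X (T.toEquiv (w, realE r s x, 0))) (T.toEquiv (w', realE r s x', 0)) =
        (γ w ⬝ᵥ w').im + ∑ j, x j * (τ j ⬝ᵥ w').im +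
          ∑ j, (∑ i, a i j * x i - (τ j ⬝ᵥ w).im) * x' j := by
      rw [hdec, hdec]
      simp only [map_add, map_sum, map_smul, LinearMap.add_apply, LinearMap.sum_apply,
        LinearMap.smul_apply, smul_eq_mul, ht, ht', hγ', hu]
      rw [add_assoc, add_assoc]
      congr 1
      congr 1
      refine Finset.sum_congr rfl fun j _ => ?_
      simp only [mul_comm (x _)]
      ring
    have e2 : imForm b (Y₀ (T.toEquiv (w, realE r s x, 0))) (T.toEquiv (w', realE r s x', 0)) =
        (γ w ⬝ᵥ w').im + ∑ j, x j * (τ j ⬝ᵥ w').im +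
          ∑ j, (∑ i, a i j * x i - (τ j ⬝ᵥ w).im) * x' j := by
      rw [hY₀, imForm_apply, T.map_form, mdlForm_correction]
      simp only [Complex.add_im, Complex.im_sum, realE_apply, Complex.im_ofReal_mul,
        Complex.im_mul_ofReal, Complex.sub_im]
      congr 2
      ext j
      congr 2
      have h1 : ∑ i, (a i j : ℂ) * (x i : ℂ) = ((∑ i, a i j * x i : ℝ) : ℂ) := by push_cast; rfl
      rw [h1]
      simp
    rw [imForm_comm hsymm]
    change imForm b (X _ - Y₀ _) _ = 0
    rw [map_sub, LinearMap.sub_apply, e1, e2, sub_self]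

end Correction

/-! ### Block diagonal isometries -/

section Levi

variable {n k r s : ℕ} {b : LinearMap.BilinForm ℂ (CVec n)} (T : Frame b k r s)

/-- The block diagonal map of a frame. -/
def Frame.blockMap (P Q : Matrix (Fin k) (Fin k) ℂ) : CVec n →ₗ[ℂ] CVec n :=
  T.toEquiv.toLinearMap ∘ₗ
    (P.transpose.mulVecLin.prodMap (LinearMap.id.prodMap Q.mulVecLin)) ∘ₗ
      T.toEquiv.symm.toLinearMap

theorem Frame.blockMap_apply (P Q : Matrix (Fin k) (Fin k) ℂ) (z : Mdl k r s) :
    T.blockMap P Q (T.toEquiv z) =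
      T.toEquiv (P.transpose.mulVec z.1, z.2.1, Q.mulVec z.2.2) := by
  change T.toEquiv (P.transpose.mulVec (T.toEquiv.symm (T.toEquiv z)).1,
    (T.toEquiv.symm (T.toEquiv z)).2.1, Q.mulVec (T.toEquiv.symm (T.toEquiv z)).2.2) = _
  rw [LinearEquiv.symm_apply_apply]

theorem Frame.blockMap_mul (P Q P' Q' : Matrix (Fin k) (Fin k) ℂ) (h : P' * P = 1)
    (h' : Q * Q' = 1) (z : CVec n) : T.blockMap P Q (T.blockMap P' Q' z) = z := by
  obtain ⟨z, rfl⟩ := T.toEquiv.surjective z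
  rw [T.blockMap_apply, T.blockMap_apply, Matrix.mulVec_mulVec, Matrix.mulVec_mulVec,
    ← Matrix.transpose_mul, h, h', Matrix.transpose_one, Matrix.one_mulVec, Matrix.one_mulVec]

theorem Frame.form_blockMap (P Q : Matrix (Fin k) (Fin k) ℂ) (h : P * Q = 1) (z w : CVec n) :
    b (T.blockMap P Q z) (T.blockMap P Q w) = b z w := by
  obtain ⟨z, rfl⟩ := T.toEquiv.surjective z
  obtain ⟨w, rfl⟩ := T.toEquiv.surjective w
  have key (x y : Fin k → ℂ) : P.transpose.mulVec x ⬝ᵥ Q.mulVec y = x ⬝ᵥ y := by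
    rw [Matrix.mulVec_transpose, ← Matrix.dotProduct_mulVec, Matrix.mulVec_mulVec, h,
      Matrix.one_mulVec]
  rw [T.blockMap_apply, T.blockMap_apply, T.map_form, T.map_form, mdlForm_apply, mdlForm_apply,
    key, dotProduct_comm (Q.mulVec _), key, dotProduct_comm w.1]

theorem Frame.continuous_blockMap {S : Type*} [TopologicalSpace S]
    {P Q : S → Matrix (Fin k) (Fin k) ℂ} (hP : Continuous P) (hQ : Continuous Q) :
    Continuous fun t => LinearMap.toContinuousLinearMap ((T.blockMap (P t) (Q t)).restrictScalars ℝ) := by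
  rw [continuous_clm_apply]
  intro z
  have hT : Continuous T.toEquiv := T.toEquiv.toLinearMap.continuous_of_finiteDimensional
  refine hT.comp ?_
  exact (hP.matrix_transpose.matrix_mulVec continuous_const).prodMk
    (continuous_const.prodMk (hQ.matrix_mulVec continuous_const))

/-- The block diagonal isometry attached to an invertible matrix. -/
def Frame.levi (C : GL (Fin k) ℂ) : GLR n where
  val := LinearMap.toContinuousLinearMap ((T.blockMap C⁻¹.1 C.1).restrictScalars ℝ)
  inv := LinearMap.toContinuousLinearMap ((T.blockMap C.1 C⁻¹.1).restrictScalars ℝ)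
  val_inv := by
    ext1 z
    exact T.blockMap_mul _ _ _ _ C.mul_inv C.mul_inv z
  inv_val := by
    ext1 z
    exact T.blockMap_mul _ _ _ _ C.inv_mul C.inv_mul z

theorem Frame.levi_apply (C : GL (Fin k) ℂ) (z : CVec n) :
    (T.levi C).1 z = T.blockMap C⁻¹.1 C.1 z := rfl

theorem Frame.levi_mem_orthIm (C : GL (Fin k) ℂ) : T.levi C ∈ orthIm b := fun v w => by
  rw [imForm_apply, imForm_apply, T.levi_apply, T.levi_apply, T.form_blockMap _ _ C.inv_mul]

theorem Frame.levi_mem_groupH (C : GL (Fin k) ℂ) : T.levi C ∈ groupH b := by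
  refine ⟨T.blockMap C⁻¹.1 C.1, fun _ => rfl, T.form_blockMap _ _ C.inv_mul, ?_⟩
  rw [Frame.blockMap, LinearMap.det_conj, LinearMap.det_prodMap, LinearMap.det_prodMap,
    LinearMap.det_id, one_mul, ← Matrix.toLin'_apply', ← Matrix.toLin'_apply',
    LinearMap.det_toLin', LinearMap.det_toLin', Matrix.det_transpose, ← Matrix.det_mul, C.inv_mul,
    Matrix.det_one]

theorem Frame.levi_smul_point (hn : r + s + 2 * k = n) (C : GL (Fin k) ℂ) :
    T.levi C • T.point hn 0 = T.point hn 0 := by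
  refine Gr.eq_of_le fun v hv => ?_
  obtain ⟨v', hv', rfl⟩ := (mem_smul_iff _ _ _).1 hv
  obtain ⟨w, x, rfl⟩ := (T.mem_point_zero hn _).1 hv'
  rw [T.levi_apply, T.blockMap_apply, T.mem_point_zero]
  exact ⟨(C⁻¹.1).transpose.mulVec w, x, by simp only [Matrix.mulVec_zero]⟩

theorem Frame.levi_one : T.levi 1 = 1 := by
  refine Units.ext ?_
  ext1 z
  rw [T.levi_apply]
  obtain ⟨z, rfl⟩ := T.toEquiv.surjective z
  rw [T.blockMap_apply]
  simp

/-- The block diagonal isometries lie in the identity component, as the general linear group is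
connected. -/
theorem Frame.levi_mem_groupG (C : GL (Fin k) ℂ) : T.levi C ∈ groupG b := by
  -- On the complex line through `1` and `C` the singular matrices are the zeros of a nonzero
  -- polynomial. Removing finitely many points from ℂ leaves a connected set, which contains `0` and
  -- `1`.
  let D (t : ℂ) : Matrix (Fin k) (Fin k) ℂ := 1 + t • (C.1 - 1)
  have hD0 : D 0 = 1 := by simp [D]
  have hD1 : D 1 = C.1 := by simp [D]
  have hDc : Continuous D := continuous_const.add (continuous_id.smul continuous_const)
  have hfin : {t | (D t).det = 0}.Finite := by
    let p : Polynomial ℂ := (1 + (Polynomial.X : Polynomial ℂ) • (C.1 - 1).map Polynomial.C).det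
    have hp (t) : p.eval t = (D t).det := by
      change Polynomial.evalRingHom t _ = _
      rw [RingHom.map_det]
      congr 1
      ext i j
      by_cases h : i = j
      · simp [D, h]
      · simpa [D, h] using mul_comm _ _
    have hp0 : p ≠ 0 := by
      intro h
      have h1 := hp 0
      rw [h, hD0, Matrix.det_one] at h1
      simp at h1
    refine (Polynomial.finite_setOfPred_isRoot hp0).subset fun t ht => ?_
    exact (hp t).trans ht
  have hconn := hfin.countable.isPathConnected_compl_of_one_lt_rank
    (by rw [Complex.rank_real_complex]; exact Nat.one_lt_ofNat)
  let S : Set ℂ := {t | (D t).det = 0}ᶜ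
  have : PreconnectedSpace S := isPreconnected_iff_preconnectedSpace.1 hconn.isConnected.isPreconnected
  have hS1 : (D 1).det ≠ 0 := by
    rw [hD1]
    exact ((Matrix.isUnit_iff_isUnit_det _).1 C.isUnit).ne_zero
  have hS0 : (D 0).det ≠ 0 := by simp [hD0]
  let c (t : S) : GL (Fin k) ℂ := Matrix.GeneralLinearGroup.mkOfDetNeZero (D t.1) t.2
  have hc1 : c ⟨1, hS1⟩ = C := Units.ext hD1
  have hc0 : c ⟨0, hS0⟩ = 1 := Units.ext hD0
  have hcc : Continuous fun t => (c t).1 := hDc.comp continuous_subtype_val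
  -- The topology of the unit group also involves the inverse, whose continuity comes from Cramer's
  -- rule.
  have hci : Continuous fun t => (c t)⁻¹.1 := by
    have h (t) : (c t)⁻¹.1 = ((D t.1).det)⁻¹ • (D t.1).adjugate := by
      rw [Matrix.coe_units_inv, Matrix.inv_def, Ring.inverse_eq_inv']
      rfl
    simp only [h]
    exact ((hDc.comp continuous_subtype_val).matrix_det.inv₀ fun t => t.2).smul
      (hDc.comp continuous_subtype_val).matrix_adjugate
  let σ (t : S) : orthIm b := ⟨T.levi (c t), T.levi_mem_orthIm _⟩
  have hσ : Continuous σ := by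
    refine Continuous.subtype_mk (Units.continuous_iff.2 ⟨?_, ?_⟩) _
    · exact T.continuous_blockMap hci hcc
    · exact T.continuous_blockMap hcc hci
  refine ⟨⟨T.levi C, T.levi_mem_orthIm _⟩, ?_, rfl⟩
  have h1 := (isPreconnected_range hσ).subset_connectedComponent (x := (1 : orthIm b))
    ⟨⟨0, hS0⟩, Subtype.ext (by
      change T.levi (c ⟨0, hS0⟩) = 1
      rw [hc0, T.levi_one])⟩
  refine h1 ⟨⟨1, hS1⟩, Subtype.ext ?_⟩
  change T.levi (c ⟨1, hS1⟩) = T.levi C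
  rw [hc1]

end Levi

/-! ### The isotropy action on `W` and on its dual -/

section Isotropy

variable {n k r s : ℕ} {b : LinearMap.BilinForm ℂ (CVec n)} (T : Frame b k r s)

/-- The matrix induced on the quotient by the orthocomplement of the isotropic subspace. -/
def Frame.quotMatrix (u : GLR n) : Matrix (Fin k) (Fin k) ℂ :=
  Matrix.of fun j l => T.coproj (u.1 (T.toEquiv (0, 0, Pi.single l 1))) j

theorem Frame.exists_incl (hn : r + s + 2 * k = n) {u : GLR n} (hu : u ∈ groupH b)
    (hs : u • T.point hn 0 = T.point hn 0) (w : Fin k → ℂ) : ∃ w', T.incl w' = u.1 (T.incl w) := by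
  have hv (w : Fin k → ℂ) : vecE (0 : Coord k r s) w 0 = (w, 0, 0) := by
    refine Prod.ext rfl (Prod.ext ?_ ?_) <;> simp [vecE, graphE]
  have hc := T.complexPart_point hn zero_mem_orbModel zero_mem_smallBall
  simp only [hv] at hc
  obtain ⟨h1, h2⟩ := (hc (T.incl w)).2 ⟨w, rfl⟩
  obtain ⟨A, hA, -, -⟩ := hu
  refine (hc _).1 ⟨?_, ?_⟩
  · rw [← hs]
    exact (mem_smul_iff _ _ _).2 ⟨_, h1, rfl⟩
  · rw [← hs]
    refine (mem_smul_iff _ _ _).2 ⟨_, h2, ?_⟩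
    rw [← hA, map_smul, hA]

/-- Both `u` and its inverse preserve `W`, hence `u` preserves the orthocomplement of `W`, which is
the kernel of `coproj`. So `u` acts on the quotient, complex linearly. -/
theorem Frame.coproj_apply (hn : r + s + 2 * k = n) {u : GLR n} (hu : u ∈ groupH b)
    (hs : u • T.point hn 0 = T.point hn 0) (z : CVec n) :
    T.coproj (u.1 z) = (T.quotMatrix u).mulVec (T.coproj z) := by
  have hui := (groupH b).inv_mem hu
  have hsi : u⁻¹ • T.point hn 0 = T.point hn 0 := by rw [inv_smul_eq_iff, hs]
  have hz (y : CVec n) (hy : T.coproj y = 0) : T.coproj (u.1 y) = 0 := by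
    have h1 (w : Fin k → ℂ) : w ⬝ᵥ T.coproj (u.1 y) = 0 := by
      obtain ⟨w', hw'⟩ := T.exists_incl hn hui hsi w
      have h2 : u.1 (T.incl w') = T.incl w := by
        rw [hw']
        exact congrArg (fun L => L (T.incl w)) u.mul_inv
      obtain ⟨A, hA, hb, -⟩ := hu
      rw [← T.form_incl, ← h2, ← hA, ← hA, hb, T.form_incl, hy, dotProduct_zero]
    ext j
    simpa using h1 (Pi.single j 1)
  obtain ⟨A, hA, -, -⟩ := id hu
  let L : (Fin k → ℂ) →ₗ[ℂ] (Fin k → ℂ) :=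
    T.coproj ∘ₗ A ∘ₗ T.toEquiv.toLinearMap ∘ₗ LinearMap.inr ℂ _ _ ∘ₗ LinearMap.inr ℂ _ _
  have hL (c) : L c = T.coproj (u.1 (T.toEquiv (0, 0, c))) := by
    change T.coproj (A _) = _
    rw [hA]
    rfl
  have hR : T.quotMatrix u = LinearMap.toMatrix' L := by
    ext j l
    rw [LinearMap.toMatrix'_apply, hL]
    rfl
  have h3 : z = T.toEquiv (0, 0, T.coproj z) + (z - T.toEquiv (0, 0, T.coproj z)) := by abel
  have h4 : T.coproj (z - T.toEquiv (0, 0, T.coproj z)) = 0 := by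
    rw [map_sub, T.coproj_toEquiv, sub_self]
  rw [hR, LinearMap.toMatrix'_mulVec, hL]
  conv_lhs => rw [h3]
  rw [map_add, map_add, hz _ h4, add_zero]

/-- `W` and the quotient are dual under `b` and `u` is an isometry, so the inverse of `u` acts on
`W` by the transpose of the action of `u` on the quotient. -/
theorem Frame.inv_incl (hn : r + s + 2 * k = n) {u : GLR n} (hu : u ∈ groupH b)
    (hs : u • T.point hn 0 = T.point hn 0) (w : Fin k → ℂ) :
    u⁻¹.1 (T.incl w) = T.incl ((T.quotMatrix u).transpose.mulVec w) := by
  have hsi : u⁻¹ • T.point hn 0 = T.point hn 0 := by rw [inv_smul_eq_iff, hs]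
  obtain ⟨w', hw'⟩ := T.exists_incl hn ((groupH b).inv_mem hu) hsi w
  rw [← hw']
  congr 1
  have h2 : u.1 (T.incl w') = T.incl w := by
    rw [hw']
    exact congrArg (fun L => L (T.incl w)) u.mul_inv
  have h3 (z : CVec n) : w' ⬝ᵥ T.coproj z = (T.quotMatrix u).transpose.mulVec w ⬝ᵥ T.coproj z := by
    rw [Matrix.mulVec_transpose, ← Matrix.dotProduct_mulVec, ← T.coproj_apply hn hu hs,
      ← T.form_incl, ← T.form_incl, ← h2]
    obtain ⟨A, hA, hb, -⟩ := hu
    rw [← hA, ← hA, hb]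
  ext j
  obtain ⟨z, hz⟩ := T.coproj_surjective (Pi.single j 1)
  simpa [hz] using h3 z

theorem Frame.quotMatrix_mul (hn : r + s + 2 * k = n) {u u' : GLR n} (hu : u ∈ groupH b)
    (hs : u • T.point hn 0 = T.point hn 0) :
    T.quotMatrix (u * u') = T.quotMatrix u * T.quotMatrix u' := by
  ext j l
  change T.coproj (u.1 (u'.1 _)) j = _
  rw [T.coproj_apply hn hu hs]
  rfl

theorem Frame.quotMatrix_one : T.quotMatrix 1 = 1 := by
  ext j l
  change T.coproj (T.toEquiv (0, 0, Pi.single l 1)) j = _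
  rw [T.coproj_toEquiv, Matrix.one_apply]
  exact Pi.single_apply l 1 j

theorem Frame.quotMatrix_levi (C : GL (Fin k) ℂ) : T.quotMatrix (T.levi C) = C.1 := by
  ext j l
  change T.coproj (T.blockMap C⁻¹.1 C.1 (T.toEquiv (0, 0, Pi.single l 1))) j = _
  rw [T.blockMap_apply, T.coproj_toEquiv, Matrix.mulVec_single_one]
  rfl

/-- Conjugation composes the map from `W` to the quotient with `quotMatrix u` on the left and with
its transpose on the right. The matrix of an antilinear map acts on conjugate vectors, so the
transpose becomes the conjugate transpose. -/
theorem Frame.antiMatrix_conjEnd (hn : r + s + 2 * k = n) {u : GLR n} (hu : u ∈ groupH b)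
    (hs : u • T.point hn 0 = T.point hn 0) (X : CVec n →L[ℝ] CVec n) :
    T.antiMatrix (conjEnd u X) =
      T.quotMatrix u * T.antiMatrix X * (T.quotMatrix u).conjTranspose := by
  have key (w : Fin k → ℂ) : (T.antiMatrix (conjEnd u X)).mulVec (star w) =
      (T.quotMatrix u * T.antiMatrix X * (T.quotMatrix u).conjTranspose).mulVec (star w) := by
    have h1 (w : Fin k → ℂ) : T.coproj (conjEnd u X (T.incl w)) = (T.quotMatrix u).mulVec
        (T.coproj (X (T.incl ((T.quotMatrix u).transpose.mulVec w)))) := by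
      change T.coproj (u.1 (X (u⁻¹.1 (T.incl w)))) = _
      rw [T.coproj_apply hn hu hs, T.inv_incl hn hu hs]
    have h2 : (T.quotMatrix u).conjTranspose.mulVec (star w) =
        star ((T.quotMatrix u).transpose.mulVec w) := by
      rw [Matrix.star_mulVec, ← Matrix.mulVec_transpose]
      congr 1
    rw [T.antiMatrix_mulVec, T.antiPart_apply, h1, h1, ← Matrix.mulVec_mulVec,
      ← Matrix.mulVec_mulVec, h2, T.antiMatrix_mulVec, T.antiPart_apply, Matrix.mulVec_add,
      Matrix.mulVec_smul, Matrix.mulVec_smul]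
  ext j l
  have h3 := congrFun (key (Pi.single l 1)) j
  rwa [star_single_one, Matrix.mulVec_single_one, Matrix.mulVec_single_one] at h3

end Isotropy

/-! ### The identification of the transversal with Hermitian matrices -/

section Transversal

variable {n k r s : ℕ} {b : LinearMap.BilinForm ℂ (CVec n)} (T : Frame b k r s)
  {V₀ : Gr n n (CVec n)} {g : GLR n}

theorem conj_mem_groupH {h : GLR n} (hh : h ∈ conjH b g) : g * h * g⁻¹ ∈ groupH b := by
  obtain ⟨u, hu, rfl⟩ := hh
  have h1 : g * (MulAut.conj g⁻¹).toMonoidHom u * g⁻¹ = u := by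
    simp [mul_assoc]
  rw [h1]
  exact hu

theorem conj_smul {h : GLR n} (hh : h ∈ groupP b V₀) : (g * h * g⁻¹) • g • V₀ = g • V₀ := by
  have h1 : h • V₀ = V₀ := hh.2
  rw [mul_smul, mul_smul, inv_smul_smul, h1]

theorem algH_le_algG : algH b ≤ algG b := by
  intro X hX v w
  have h := congrArg Complex.im (hX.2 v w)
  rwa [Complex.add_im] at h

/-- The homomorphism to the general linear group given by the action on the quotient. -/
def quotRep (hn : r + s + 2 * k = n) (hT : T.point hn 0 = g • V₀) :
    ↥(conjH b g ⊓ groupP b V₀) →* GL (Fin k) ℂ :=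
  MonoidHom.toHomUnits
    { toFun := fun h => T.quotMatrix (g * h.1 * g⁻¹)
      map_one' := by
        rw [OneMemClass.coe_one, mul_one, mul_inv_cancel, T.quotMatrix_one]
      map_mul' := fun h h' => by
        rw [← T.quotMatrix_mul hn (conj_mem_groupH h.2.1) (by rw [hT, conj_smul h.2.2])]
        congr 1
        simp [mul_assoc] }

theorem quotRep_val (hn : r + s + 2 * k = n) (hT : T.point hn 0 = g • V₀)
    (h : ↥(conjH b g ⊓ groupP b V₀)) :
    (quotRep T hn hT h).1 = T.quotMatrix (g * h.1 * g⁻¹) := rfl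

/-- The preimage is a block diagonal isometry conjugated by `g`. It lies in `P` because block
diagonal isometries belong to the identity component and fix the standard point. -/
theorem quotRep_surjective (hn : r + s + 2 * k = n) (hT : T.point hn 0 = g • V₀)
    (hg : g ∈ groupG b) : Function.Surjective (quotRep T hn hT) := by
  intro C
  have hs : (g⁻¹ * T.levi C * g) • V₀ = V₀ := by
    rw [mul_smul, mul_smul, ← hT, T.levi_smul_point, hT, inv_smul_smul]
  refine ⟨⟨g⁻¹ * T.levi C * g, ⟨T.levi C, T.levi_mem_groupH C, ?_⟩,
    (groupG b).mul_mem ((groupG b).mul_mem ((groupG b).inv_mem hg) (T.levi_mem_groupG C)) hg, hs⟩,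
    Units.ext ?_⟩
  · simp
  · rw [quotRep_val, ← T.quotMatrix_levi C]
    congr 1
    simp [mul_assoc]

/-- The Hermitian matrix of an element of the Lie algebra. -/
def hermMap (hsymm : b.IsSymm) (hg : g ∈ groupG b) :
    algG b →ₗ[ℝ] selfAdjoint (Matrix (Fin k) (Fin k) ℂ) where
  toFun X := ⟨T.antiMatrix (conjEnd g X.1),
    T.antiMatrix_conjTranspose hsymm (conjEnd_mem_algG b hg X.2)⟩
  map_add' X Y := Subtype.ext (by
    change T.antiMatrix (conjEnd g (X.1 + Y.1)) = _
    rw [map_add, map_add]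
    rfl)
  map_smul' t X := Subtype.ext (by
    change T.antiMatrix (conjEnd g (t • X.1)) = _
    rw [map_smul, map_smul]
    rfl)

theorem hermMap_apply (hsymm : b.IsSymm) (hg : g ∈ groupG b) (X : algG b) :
    (hermMap T hsymm hg X).1 = T.antiMatrix (conjEnd g X.1) := rfl

theorem hermMap_surjective (hsymm : b.IsSymm) (hg : g ∈ groupG b) :
    Function.Surjective (hermMap T hsymm hg) := by
  rintro ⟨M, hM⟩
  obtain ⟨X, hX, rfl⟩ := T.exists_antiMatrix_eq hM
  refine ⟨⟨conjEnd g⁻¹ X, conjEnd_mem_algG b ((groupG b).inv_mem hg) hX⟩, Subtype.ext ?_⟩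
  rw [hermMap_apply, ← conjEnd_mul, mul_inv_cancel, conjEnd_one]

/-- Transported by `g`, such an `X` maps `W` into `V`, and `coproj` vanishes on `V`. -/
theorem hermMap_eq_zero_of_algP (hn : r + s + 2 * k = n) (hT : T.point hn 0 = g • V₀)
    (hsymm : b.IsSymm) (hg : g ∈ groupG b) (X : algG b) (hX : X.1 ∈ algP b V₀) :
    hermMap T hsymm hg X = 0 := by
  have h1 (w : Fin k → ℂ) : T.coproj (conjEnd g X.1 (T.incl w)) = 0 := by
    have hw : T.incl w ∈ (g • V₀).toSubmodule := by
      rw [← hT, T.mem_point_zero]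
      exact ⟨w, 0, by rw [map_zero]; rfl⟩
    obtain ⟨v, hv, hvw⟩ := (mem_smul_iff _ _ _).1 hw
    have h2 : conjEnd g X.1 (T.incl w) = g.1 (X.1 v) := by
      rw [← hvw]
      change g.1 (X.1 (g⁻¹.1 (g.1 v))) = _
      congr 2
      exact congrArg (fun L => L v) g.inv_mul
    have h3 : g.1 (X.1 v) ∈ (T.point hn 0).toSubmodule := by
      rw [hT]
      exact (mem_smul_iff _ _ _).2 ⟨_, hX.2 v hv, rfl⟩
    obtain ⟨w', x, h4⟩ := (T.mem_point_zero hn _).1 h3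
    rw [h2, ← h4, T.coproj_toEquiv]
  refine Subtype.ext ?_
  ext j l
  change T.antiPart _ (Pi.single l 1) j = 0
  rw [T.antiPart_apply, h1, h1, smul_zero, add_zero]
  rfl

theorem antiMatrix_of_algH {Y : CVec n →L[ℝ] CVec n} (hY : Y ∈ algH b) : T.antiMatrix Y = 0 := by
  ext j l
  change T.antiPart _ (Pi.single l 1) j = 0
  rw [T.antiPart_apply, map_smul T.incl, hY.1, map_smul, smul_smul, Complex.I_mul_I, neg_one_smul,
    add_neg_cancel]
  rfl

theorem hermMap_eq_zero_of_algConjH (hsymm : b.IsSymm) (hg : g ∈ groupG b) (X : algG b)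
    (hX : X.1 ∈ algConjH b g) : hermMap T hsymm hg X = 0 := by
  obtain ⟨Y, hY, hXY⟩ := hX
  refine Subtype.ext ?_
  rw [hermMap_apply, ← hXY, ← conjEnd_mul, mul_inv_cancel, conjEnd_one, antiMatrix_of_algH T hY]
  rfl

/-- Together with the two vanishing statements this identifies the kernel of `hermMap` with the sum
of the Lie algebras of `H_𝒪` and `P`, that is, it gives injectivity on the transversal. -/
theorem exists_decomposition (hn : r + s + 2 * k = n) (hT : T.point hn 0 = g • V₀)
    (hsymm : b.IsSymm) (hnd : b.Nondegenerate) (hg : g ∈ groupG b) (X : algG b)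
    (hX : hermMap T hsymm hg X = 0) :
    ∃ Y Z : algG b, Y.1 ∈ algConjH b g ∧ Z.1 ∈ algP b V₀ ∧ X = Y + Z := by
  have hX' := conjEnd_mem_algG b hg X.2
  have hgi := (groupG b).inv_mem hg
  obtain ⟨Y, hY, hYV⟩ := T.exists_correction hn hsymm hnd hX' (congrArg Subtype.val hX)
  have hZ := (algG b).sub_mem hX' (algH_le_algG hY)
  refine ⟨⟨conjEnd g⁻¹ Y, conjEnd_mem_algG b hgi (algH_le_algG hY)⟩,
    ⟨conjEnd g⁻¹ (conjEnd g X.1 - Y), conjEnd_mem_algG b hgi hZ⟩, ⟨Y, hY, rfl⟩,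
    ⟨conjEnd_mem_algG b hgi hZ, fun v hv => ?_⟩, Subtype.ext ?_⟩
  · rw [hT] at hYV
    obtain ⟨v', hv', h⟩ := (mem_smul_iff _ _ _).1 (hYV _ ((mem_smul_iff _ _ _).2 ⟨v, hv, rfl⟩))
    have h1 : conjEnd g⁻¹ (conjEnd g X.1 - Y) v = v' := by
      change g⁻¹.1 ((conjEnd g X.1 - Y) (g⁻¹⁻¹.1 v)) = v'
      rw [inv_inv, ← h]
      exact congrArg (fun L => L v') g.inv_mul
    rw [h1]
    exact hv'
  · change X.1 = conjEnd g⁻¹ Y + conjEnd g⁻¹ (conjEnd g X.1 - Y)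
    rw [← map_add, add_sub_cancel, ← conjEnd_mul, inv_mul_cancel, conjEnd_one]

/-- The Hermitian matrix of an infinitesimal transversal. -/
def transversalMap (hn : r + s + 2 * k = n) (hT : T.point hn 0 = g • V₀) (hsymm : b.IsSymm)
    (hg : g ∈ groupG b) : Transversal b V₀ g →ₗ[ℝ] selfAdjoint (Matrix (Fin k) (Fin k) ℂ) :=
  Submodule.liftQ _ (Submodule.liftQ _ (hermMap T hsymm hg) fun X hX =>
    hermMap_eq_zero_of_algP T hn hT hsymm hg X hX) (by
      rintro _ ⟨X, hX, rfl⟩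
      exact hermMap_eq_zero_of_algConjH T hsymm hg X hX)

theorem transversalMap_mk (hn : r + s + 2 * k = n) (hT : T.point hn 0 = g • V₀) (hsymm : b.IsSymm)
    (hg : g ∈ groupG b) (X : algG b) :
    transversalMap T hn hT hsymm hg (Submodule.Quotient.mk (Submodule.Quotient.mk X)) =
      hermMap T hsymm hg X := rfl

theorem exists_rep_transversal (t : Transversal b V₀ g) :
    ∃ X : algG b, t = Submodule.Quotient.mk (Submodule.Quotient.mk X) := by
  obtain ⟨q, rfl⟩ := Submodule.Quotient.mk_surjective _ t
  obtain ⟨X, rfl⟩ := Submodule.Quotient.mk_surjective _ q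
  exact ⟨X, rfl⟩

theorem transversalMap_bijective (hn : r + s + 2 * k = n) (hT : T.point hn 0 = g • V₀)
    (hsymm : b.IsSymm) (hnd : b.Nondegenerate) (hg : g ∈ groupG b) :
    Function.Bijective (transversalMap T hn hT hsymm hg) := by
  constructor
  · rw [injective_iff_map_eq_zero]
    intro t ht
    obtain ⟨X, rfl⟩ := exists_rep_transversal t
    obtain ⟨Y, Z, hY, hZ, rfl⟩ := exists_decomposition T hn hT hsymm hnd hg X ht
    refine (Submodule.Quotient.mk_eq_zero _).2 ⟨Y, hY, ?_⟩
    have hZ' : (Submodule.Quotient.mk Z : QuotGP b V₀) = 0 :=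
      (Submodule.Quotient.mk_eq_zero _).2 hZ
    rw [Submodule.mkQ_apply, Submodule.Quotient.mk_add, hZ', add_zero]
  · intro M
    obtain ⟨X, rfl⟩ := hermMap_surjective T hsymm hg M
    exact ⟨_, transversalMap_mk T hn hT hsymm hg X⟩

theorem transversalMap_rep (hn : r + s + 2 * k = n) (hT : T.point hn 0 = g • V₀)
    (hsymm : b.IsSymm) (hg : g ∈ groupG b) (h : ↥(conjH b g ⊓ groupP b V₀))
    (t : Transversal b V₀ g) : transversalMap T hn hT hsymm hg (transversalRep b V₀ g h t) =
      hermRep k (quotRep T hn hT h) (transversalMap T hn hT hsymm hg t) := by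
  obtain ⟨X, rfl⟩ := exists_rep_transversal t
  change hermMap T hsymm hg (adG b h X) = hermRep k (quotRep T hn hT h) (hermMap T hsymm hg X)
  refine Subtype.ext ?_
  change T.antiMatrix (conjEnd g (conjEnd h.1 X.1)) = T.quotMatrix (g * h.1 * g⁻¹) *
    T.antiMatrix (conjEnd g X.1) * (T.quotMatrix (g * h.1 * g⁻¹)).conjTranspose
  rw [← T.antiMatrix_conjEnd hn (conj_mem_groupH h.2.1) (by rw [hT, conj_smul h.2.2]),
    ← conjEnd_mul, ← conjEnd_mul, inv_mul_cancel_right]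

theorem exists_transversal_equiv (hn : r + s + 2 * k = n) (hsymm : b.IsSymm)
    (hnd : b.Nondegenerate) (hg : g ∈ groupG b) (hV : g • V₀ ∈ orb b r s) :
    ∃ (ρ : ↥(conjH b g ⊓ groupP b V₀) →* GL (Fin k) ℂ)
      (Φ : Transversal b V₀ g ≃ₗ[ℝ] selfAdjoint (Matrix (Fin k) (Fin k) ℂ))
      (θ : CVec n →ₗ[ℂ] (Fin k → ℂ)),
      Function.Surjective ρ ∧ Function.Surjective θ ∧
      (∀ z, θ z = 0 ↔ ∀ w ∈ (g • V₀).toSubmodule,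
        Complex.I • w ∈ (g • V₀).toSubmodule → b w z = 0) ∧
      (∀ h z, θ ((g * h.1 * g⁻¹).1 z) = (ρ h).1.mulVec (θ z)) ∧
      ∀ h t, Φ (transversalRep b V₀ g h t) = hermRep k (ρ h) (Φ t) := by
  obtain ⟨T, hT⟩ := exists_frame_of_mem_orb hn hsymm hnd hV
  refine ⟨quotRep T hn hT, LinearEquiv.ofBijective _ (transversalMap_bijective T hn hT hsymm hnd hg),
    T.coproj, quotRep_surjective T hn hT hg, T.coproj_surjective, ?_, fun h z => ?_, fun h t => ?_⟩
  · rw [← hT]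
    exact T.coproj_eq_zero_iff hn
  · exact T.coproj_apply hn (conj_mem_groupH h.2.1) (by rw [hT, conj_smul h.2.2]) z
  · exact transversalMap_rep T hn hT hsymm hg h t

end Transversal

end SplitGrassmannian

end
open SplitGrassmannian in
theorem proposition4p1 (n r s k : ℕ) (hn : r + s + 2 * k = n)
    (b : LinearMap.BilinForm ℂ (CVec n)) (hsymm : b.IsSymm) (hnd : b.Nondegenerate) :
    -- `𝒪 = 𝒪_(r,s)` is non-empty, lies in `IGr^±` with sign `(-1)^(n-s)`, and is a single
    -- `H`-orbit unless `r = s = 0`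
    ((orb b r s).Nonempty ∧ orb b r s ⊆ igr b ((-1) ^ (n - s)) ∧
      (0 < r + s → ∀ V ∈ orb b r s, MulAction.orbit (groupH b) V = orb b r s)) ∧
    -- (1) codimension, and fibration over the complex isotropic Grassmannian
    (∃ (N d e q : ℕ)
        (_X : EmbeddedSubmanifold (GrModel n n) (igr b ((-1) ^ (n - s))) N)
        (O : EmbeddedSubmanifold (GrModel n n) (orb b r s) d)
        (Z : EmbeddedSubmanifold (GrModel (2 * k) (2 * (n - k))) (cIgr b k) e)
        (S : SmoothStructure (Fin r ⊕ Fin s → Fin r ⊕ Fin s → ℂ) (complexSOEntries r s) q),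
      N = d + k ^ 2 ∧
      ∃ p : orb b r s → cIgr b k,
        (∀ u ∈ groupH b, ∀ V : orb b r s, ∃ hV : u • V.1 ∈ orb b r s,
          (p ⟨u • V.1, hV⟩).1 = u • (p V).1) ∧
        Function.Surjective p ∧
        O.Submersion Z p ∧
        ∀ W : cIgr b k,
          ∃ (m : ℕ)
            (F : EmbeddedSubmanifold (GrModel n n)
              {V : Gr n n (CVec n) | ∃ hV : V ∈ orb b r s, p ⟨V, hV⟩ = W} m)
            (f : (complexSO r s ⧸ realSO r s) ≃
              {V : Gr n n (CVec n) | ∃ hV : V ∈ orb b r s, p ⟨V, hV⟩ = W})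
            (π : ↥(groupH b ⊓ MulAction.stabilizer (GLR n) W.1) →* complexSO r s),
            -- `f` is a diffeomorphism for the quotient manifold structure
            S.Submersion F (fun A => f (QuotientGroup.mk A)) ∧
            -- and it is equivariant for the stabilizer of `W` in `H`
            Function.Surjective π ∧
            ∀ u x, (f (π u • x)).1 = u.1 • (f x).1) ∧
    -- (2) the infinitesimal transversal
    (∀ (V₀ : Gr n n (CVec n)) (g : GLR n), g ∈ groupG b → g • V₀ ∈ orb b r s →
      ∃ (ρ : ↥(conjH b g ⊓ groupP b V₀) →* GL (Fin k) ℂ)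
        (Φ : Transversal b V₀ g ≃ₗ[ℝ] selfAdjoint (Matrix (Fin k) (Fin k) ℂ))
        (θ : CVec n →ₗ[ℂ] (Fin k → ℂ)),
        Function.Surjective ρ ∧
        -- naturality: with `W = V ∩ iV` for `V = g • V₀`, the map `θ` is a basis of the complex
        -- vector space `ℂⁿ / W^⊥`, and `ρ h` is the matrix of the action of `g h g⁻¹` on it
        Function.Surjective θ ∧
        (∀ z, θ z = 0 ↔ ∀ w ∈ (g • V₀).toSubmodule,
          Complex.I • w ∈ (g • V₀).toSubmodule → b w z = 0) ∧
        (∀ h z, θ ((g * h.1 * g⁻¹).1 z) = (ρ h).1.mulVec (θ z)) ∧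
        ∀ h T, Φ (transversalRep b V₀ g h T) = hermRep k (ρ h) (Φ T)) := by
  refine ⟨⟨orb_nonempty hn hsymm hnd, orb_subset_igr hn hsymm hnd, fun hrs V hV =>
    orbit_eq_orb hn hsymm hnd hrs hV⟩, ?_, ?_⟩
  · refine ⟨_, _, _, _, igrManifold hsymm hnd _, orbManifold hn hsymm hnd,
      cIgrManifold (r := r) (s := s) hn hsymm hnd, complexSOManifold r s, finrank_igrModel_eq hn,
      orbProj hn hsymm hnd, fun u hu V => ⟨smul_mem_orb hn hsymm hnd hu V.2, ?_⟩,
      orbProj_surjective hn hsymm hnd, orbProj_submersion hn hsymm hnd, fun W => ?_⟩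
    · exact orbProj_smul hn hsymm hnd hu V _
    -- A frame above `W` provides the base point of the fibre, and with it the orbit map and the
    -- homomorphism from the stabilizer.
    · obtain ⟨T, hT⟩ := exists_frame_of_mem_cIgr hn hsymm hnd W.2
      exact ⟨_, fibreManifold hn hsymm hnd W, fibreEquiv hn hsymm hnd T hT, stabHom hn T hT,
        fibreEquiv_submersion hn hsymm hnd T hT, stabHom_surjective hn T hT,
        fibreEquiv_smul hn hsymm hnd T hT⟩
  · exact fun V₀ g hg hV => exists_transversal_equiv hn hsymm hnd hg hV
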